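/- **Setting.** Let $p\ge 0$ be an integer and let $z'>p-1$, $w'>-1$ be real (if $p=0$, assume also $z'+w'\neq-1$, so that the constants $S_N$ below are defined). A signature of order $N$ is an $N$-tuple of integers $\lambda=(\lambda_1\ge\dots\ge\lambda_N)$; $\mathbb{GT}_N$ is the set of these. For $\lambda\in\mathbb{GT}_N$, $\mu\in\mathbb{GT}_{N+1}$ write $\lambda\prec\mu$ if $\mu_1\ge\lambda_1\ge\mu_2\ge\dots\ge\lambda_N\ge\mu_{N+1}$, and let $\operatorname{Dim}\lambda$ be the number of paths $\emptyset=\lambda(0)\prec\lambda(1)\prec\dots\prec\lambda(N)=\lambda$. Put $p^\downarrow(\lambda\mid\mu)=\operatorname{Dim}\lambda/\operatorname{Dim}\mu$ if $\lambda\prec\mu$, and $0$ otherwise. For $z=p$, $w=0$ let $$M_N(\lambda)=M_N^{p,0,z',w'}(\lambda)=\frac{\operatorname{Dim}^2(\lambda)}{S_N}\prod_{i=1}^N\frac{1}{\Gamma(z-\lambda_i+i)\Gamma(w+N+1+\lambda_i-i)\Gamma(z'-\lambda_i+i)\Gamma(w'+N+1+\lambda_i-i)},$$ $$S_N=\prod_{i=1}^N\frac{\Gamma(z+w+z'+w'+i)}{\Gamma(z+w+i)\Gamma(z+w'+i)\Gamma(z'+w+i)\Gamma(z'+w'+i)\Gamma(i)}.$$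 The $M_N$ form a coherent system of probability distributions: $\sum_{\mu}p^\downarrow(\lambda\mid\mu)M_{N+1}(\mu)=M_N(\lambda)$. Set $p^\uparrow(\mu\mid\lambda)=\frac{M_{N+1}(\mu)}{M_N(\lambda)}p^\downarrow(\lambda\mid\mu)$ for $M_N(\lambda)\ne0$. The up–down chain $T_N(k)$, $k=0,1,2,\dots$, is the stationary Markov chain with initial distribution $M_N$ and transition probabilities $p^{st}_N(\lambda\mid\lambda')=\sum_{\mu:\,M_{N+1}(\mu)\neq 0}p^\downarrow(\lambda\mid\mu)\,p^\uparrow(\mu\mid\lambda')$. The measure $M_N$ is supported by the $\lambda$ with $p\ge\lambda_1\ge\dots\ge\lambda_N\ge0$; for such $\lambda$ let $x_1<\dots<x_p$ be the elements of $$X(\lambda)=\{0,1,\dots,N+p-1\}\setminus\{\lambda_i-i+N:1\le i\le N\},\qquad \pi_N(X(\lambda))=\Bigl(\tfrac{x_1}{N+p-1},\dots,\tfrac{x_p}{N+p-1}\Bigr)\in[0,1]^p .$$ Define $J^N_{p,z',w'}(t)=\pi_N\bigl(X(T_N(\lfloor tN^2\rfloor))\bigr)$ for $t\ge0$. For $0<x<1$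 let $w_{p,z',w'}(x)=x^{w'}(1-x)^{z'-p}$, let $\mathrm{Jac}^n(x)=\frac{(z'-p+1)_n}{n!}\,{}_2F_1(-n,\,n+z'-p+w'+1;\,z'-p+1;\,1-x)$ be the Jacobi polynomials on $(0,1)$, and $$j^n(x)=\frac{\mathrm{Jac}^n(x)\sqrt{w_{p,z',w'}(x)}}{\bigl(\int_0^1 \mathrm{Jac}^n(u)^2w_{p,z',w'}(u)\,du\bigr)^{1/2}}.$$ Let $K(i)=i(i+w'+z'+1-p)$, $K=\sum_{i=0}^{p-1}K(i)$, and let $\rho$ be the probability density on $[0,1]^p$ equal to $\rho(X)=B\prod_{i<j}(x_i-x_j)^2\prod_{i=1}^p w_{p,z',w'}(x_i)$ for $x_1<\dots<x_p$ and to $0$ otherwise, where $B$ is the normalization constant. **Theorem.** There is a stationary Markov process $J_{p,z',w'}(t)$, $t\ge0$, on $[0,1]^p$ such that, as $N\to\infty$, all finite-dimensional distributions of $J^N_{p,z',w'}(t)$ converge weakly to the corresponding finite-dimensional distributions of $J_{p,z',w'}(t)$. The distribution of $J_{p,z',w'}(0)$ has density $\rho$ with respect to Lebesgue measure. For $t>0$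 the transition probabilities of $J_{p,z',w'}$ have the density $$\mathcal P^t(Y\mid X)=\frac{\sqrt{\rho(Y)}}{\sqrt{\rho(X)}}\;e^{tK}\;\det\bigl[\mathcal J^t(x_i,y_j)\bigr]_{i,j=1}^p,\qquad \mathcal J^t(x,y)=\sum_{i=0}^\infty e^{-tK(i)}j^i(x)j^i(y),$$ where the series converges for all $x,y\in(0,1)$; for every $X$ with $0<x_1<\dots<x_p<1$, $\mathcal P^t(\cdot\mid X)$ is integrable with integral $1$ over $[0,1]^p$, and $\mathcal P^t(Y\mid X)\ge0$ whenever $0<y_1<\dots<y_p<1$. -/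

import Mathlib

open MeasureTheory Filter Topology
open scoped NNReal Nat

noncomputable section

namespace GelfandTsetlin

/-! ### The Gelfand–Tsetlin graph -/

/-- Signatures of order `N`: `λ₁ ≥ λ₂ ≥ … ≥ λ_N` in `ℤ`; `λ_{i+1}` is `l.1 i` for `i : Fin N`. -/
def Signature (N : ℕ) : Type := {l : Fin N → ℤ // Antitone l}

/-- The set of signatures is discrete: every subset is measurable. -/
instance (N : ℕ) : MeasurableSpace (Signature N) := ⊤

/-- The edge relation `l ≺ m`, that is `m₁ ≥ l₁ ≥ m₂ ≥ … ≥ l_N ≥ m_{N+1}`. -/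
def Interlaces {N : ℕ} (l : Signature N) (m : Signature (N + 1)) : Prop :=
  ∀ i : Fin N, l.1 i ≤ m.1 i.castSucc ∧ m.1 i.succ ≤ l.1 i

/-- Paths in the graph from the (unique) signature of order `0` to a given signature. -/
inductive GTPath : (N : ℕ) → Signature N → Type
  | root (l : Signature 0) : GTPath 0 l
  | step {N : ℕ} {l : Signature N} {m : Signature (N + 1)}
      (h : Interlaces l m) (γ : GTPath N l) : GTPath (N + 1) m

/-- `Dim(l)`: the number of paths from the empty signature to `l`. -/
def Dim {N : ℕ} (l : Signature N) : ℕ := Nat.card (GTPath N l)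

open Classical in
/-- The "down" transition function `p↓(l ∣ m)`. -/
def pDown {N : ℕ} (l : Signature N) (m : Signature (N + 1)) : ℝ :=
  if Interlaces l m then (Dim l : ℝ) / (Dim m : ℝ) else 0

/-! ### Coherent systems and up-down chains -/

/-- Coherent systems of distributions: each `M N` is a probability distribution on the signatures
of order `N`, and consecutive ones are consistent with the down transition function. -/
structure IsCoherentSystem (M : (N : ℕ) → Signature N → ℝ) : Prop where
  nonneg : ∀ N l, 0 ≤ M N l
  hasSum_one : ∀ N, HasSum (M N) 1
  coherent : ∀ N (l : Signature N), HasSum (fun m => pDown l m * M (N + 1) m) (M N l)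

/-- The "up" transition function `p↑(m ∣ l)` of `M` (meaningful for `M N l ≠ 0`). -/
def pUp (M : (N : ℕ) → Signature N → ℝ) {N : ℕ} (m : Signature (N + 1)) (l : Signature N) : ℝ :=
  M (N + 1) m / M N l * pDown l m

/-- The up-down transition function `p^{st}_N(l ∣ l')`: from `l'` up to the support of `M` on
level `N + 1`, and then down to `l`. -/
def pUpDown (M : (N : ℕ) → Signature N → ℝ) {N : ℕ} (l l' : Signature N) : ℝ :=
  ∑' m : Function.support (M (N + 1)), pDown l m.1 * pUp M m.1 l'

/-- `T` is a realization of the `N`-th level up-down chain of `M`: the Markov chain with initial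
distribution `M N` and one-step transition probabilities `p^{st}_N`. -/
structure IsUpDownChain {Ω : Type*} [MeasurableSpace Ω] (P : Measure Ω)
    (M : (N : ℕ) → Signature N → ℝ) (N : ℕ) (T : ℕ → Ω → Signature N) : Prop where
  measurable : ∀ k, Measurable (T k)
  law : ∀ (n : ℕ) (l : ℕ → Signature N),
    P.real {ω | ∀ k ≤ n, T k ω = l k} =
      M N (l 0) * ∏ k ∈ Finset.range n, pUpDown M (l (k + 1)) (l k)

/-! ### The measures `M_N^{z,w,z',w'}` -/

/-- The normalization constant `S_N(z,w,z',w')`. -/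
def zwConst (z w z' w' : ℝ) (N : ℕ) : ℝ :=
  ∏ i ∈ Finset.Icc 1 N,
    Real.Gamma (z + w + z' + w' + i) /
      (Real.Gamma (z + w + i) * Real.Gamma (z + w' + i) * Real.Gamma (z' + w + i) *
        Real.Gamma (z' + w' + i) * Real.Gamma i)

/-- `M_N^{z,w,z',w'}(λ)`. The function `1/Γ` vanishes at the poles of `Γ`; this agrees with
Mathlib's value `0` of `Γ` there. The index `i` of the product is `(i : ℕ) + 1` below. -/
def zwMeasure (z w z' w' : ℝ) (N : ℕ) (l : Signature N) : ℝ :=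
  (zwConst z w z' w' N)⁻¹ * (Dim l : ℝ) ^ 2 *
    ∏ i : Fin N,
      (Real.Gamma (z - l.1 i + ((i : ℕ) + 1)) *
        Real.Gamma (w + N + 1 + l.1 i - ((i : ℕ) + 1)) *
        Real.Gamma (z' - l.1 i + ((i : ℕ) + 1)) *
        Real.Gamma (w' + N + 1 + l.1 i - ((i : ℕ) + 1)))⁻¹

/-! ### Point configurations -/

/-- `X(λ) = {0, …, N+p-1} ∖ {λ₁-1+N, …, λ_N-N+N}`. -/
def holes (p : ℕ) {N : ℕ} (l : Signature N) : Finset ℕ :=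
  (Finset.range (N + p)).filter fun x => ∀ i : Fin N, (x : ℤ) ≠ l.1 i - ((i : ℕ) + 1) + N

/-- For `p ≥ λ₁ ≥ … ≥ λ_N ≥ 0` the set `X(λ)` has exactly `p` elements. -/
theorem card_holes (p : ℕ) {N : ℕ} (l : Signature N) (h : ∀ i, 0 ≤ l.1 i ∧ l.1 i ≤ p) :
    (holes p l).card = p := by
  classical
  let f : Fin N → ℕ := fun i => (l.1 i - ((i : ℕ) + 1) + N).toNat
  have hf : ∀ i, ((f i : ℕ) : ℤ) = l.1 i - ((i : ℕ) + 1) + N := fun i => by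
    have := h i; have := i.2; simp only [f]; omega
  have hinj : Function.Injective f := by
    intro i j hij
    have h1 := hf i; have h2 := hf j
    rw [hij] at h1
    rcases le_total i j with hle | hle
    · have := l.2 hle; apply Fin.ext; have : (i : ℕ) ≤ j := hle; omega
    · have := l.2 hle; apply Fin.ext; have : (j : ℕ) ≤ i := hle; omega
  have heq : holes p l = Finset.range (N + p) \ Finset.univ.image f := by
    ext x
    simp only [holes, Finset.mem_filter, Finset.mem_sdiff, Finset.mem_image, Finset.mem_univ,
      true_and, not_exists]
    refine and_congr_right fun _ => forall_congr' fun i => ?_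
    rw [← hf i]; constructor <;> intro hx e <;> apply hx
    · exact_mod_cast e.symm
    · exact_mod_cast e.symm
  have hsub : Finset.univ.image f ⊆ Finset.range (N + p) := by
    intro x hx
    obtain ⟨i, -, rfl⟩ := Finset.mem_image.1 hx
    have := hf i; have := h i; have := i.2
    rw [Finset.mem_range]; omega
  rw [heq, Finset.card_sdiff_of_subset hsub, Finset.card_image_of_injective _ hinj]
  simp

/-- The configuration `x₁ < … < x_p` of the elements of `X(λ)` in increasing order
(`x_{i+1}` is `config p l i` for `i : Fin p`). -/
def config (p : ℕ) {N : ℕ} (l : Signature N) (i : Fin p) : ℕ :=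
  Nat.nth (fun x => x ∈ holes p l) i

theorem config_lt (p : ℕ) {N : ℕ} (l : Signature N) (i : Fin p) : config p l i < N + p := by
  unfold config
  by_cases h : Nat.nth (fun x => x ∈ holes p l) i = 0
  · have := i.2; omega
  · have h2 : Nat.nth (fun x => x ∈ holes p l) i ∈ holes p l :=
      Nat.nth_mem_of_ne_zero h
    exact Finset.mem_range.1 (Finset.mem_filter.1 h2).1

/-- The rescaled configuration `π_N(X(λ)) = (x_i / (N+p-1))_i ∈ [0,1]^p`. -/
def scaledConfig (p : ℕ) {N : ℕ} (l : Signature N) (i : Fin p) : unitInterval :=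
  ⟨(config p l i : ℝ) / ((N : ℝ) + p - 1), by
    have h := config_lt p l i
    have h1 : (config p l i : ℝ) + 1 ≤ (N : ℝ) + p := by exact_mod_cast h
    have h0 : (0 : ℝ) ≤ config p l i := Nat.cast_nonneg _
    have h2 : (config p l i : ℝ) ≤ (N : ℝ) + p - 1 := by linarith
    exact ⟨div_nonneg h0 (h0.trans h2), div_le_one_of_le₀ h2 (h0.trans h2)⟩⟩

/-- `J^N(t) = π_N(U^N(⌊t N²⌋))`, where `U^N(k) = X(T(k))`. -/
def rescaledProcess {Ω : Type*} (p N : ℕ) (T : ℕ → Ω → Signature N) (t : ℝ≥0) (ω : Ω) :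
    Fin p → unitInterval :=
  scaledConfig p (T ⌊t * (N : ℝ≥0) ^ 2⌋₊ ω)

/-! ### Jacobi polynomials and the limiting densities -/

/-- The Jacobi polynomial shifted to `(0,1)`, orthogonal for the weight `(1-x)^α x^β`. -/
def jacobiPoly (n : ℕ) (α β x : ℝ) : ℝ :=
  (ascPochhammer ℝ n).eval (α + 1) / (n ! : ℝ) *
    ordinaryHypergeometric (-(n : ℝ)) (n + α + β + 1) (α + 1) (1 - x)

/-- `w_{p,z',w'}(x) = x^{w'} (1-x)^{z'-p}`. -/
def betaWeight (p : ℕ) (z' w' x : ℝ) : ℝ := x ^ w' * (1 - x) ^ (z' - p)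

/-- The squared norm of the `k`-th Jacobi polynomial in `L²([0,1], w_{p,z',w'})`. -/
def jacobiNormSq (p : ℕ) (z' w' : ℝ) (k : ℕ) : ℝ :=
  ∫ x in (0 : ℝ)..1, jacobiPoly k (z' - p) w' x ^ 2 * betaWeight p z' w' x

/-- The orthonormalized Jacobi functions `j^k_{p,z',w'}`. -/
def jacobiFun (p : ℕ) (z' w' : ℝ) (k : ℕ) (x : ℝ) : ℝ :=
  jacobiPoly k (z' - p) w' x * √(betaWeight p z' w' x) / √(jacobiNormSq p z' w' k)

/-- `K_{p,z',w'}(i) = i (i + w' + z' + 1 - p)`. -/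
def eigK (p : ℕ) (z' w' : ℝ) (i : ℕ) : ℝ := i * (i + w' + z' + 1 - p)

/-- `K_{p,z',w'} = ∑_{i<p} K_{p,z',w'}(i)`. -/
def totalK (p : ℕ) (z' w' : ℝ) : ℝ := ∑ i ∈ Finset.range p, eigK p z' w' i

/-- The terms of the series defining `𝒥^t_{p,z',w'}(x,y)`. -/
def jacobiKernelTerm (p : ℕ) (z' w' t x y : ℝ) (i : ℕ) : ℝ :=
  Real.exp (-t * eigK p z' w' i) * jacobiFun p z' w' i x * jacobiFun p z' w' i y

/-- `𝒥^t_{p,z',w'}(x,y)`. -/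
def jacobiKernel (p : ℕ) (z' w' t x y : ℝ) : ℝ := ∑' i, jacobiKernelTerm p z' w' t x y i

open Classical in
/-- The unnormalized Jacobi ensemble on `x₁ < … < x_p`, extended by zero to `[0,1]^p`. -/
def ensembleWeight (p : ℕ) (z' w' : ℝ) (X : Fin p → unitInterval) : ℝ :=
  if StrictMono X then
    (∏ i : Fin p, ∏ j ∈ Finset.Ioi i, ((X i : ℝ) - X j) ^ 2) * ∏ i, betaWeight p z' w' (X i)
  else 0

/-- The normalization constant `B_{p,z',w'}`. -/
def ensembleConst (p : ℕ) (z' w' : ℝ) : ℝ := (∫ X, ensembleWeight p z' w' X)⁻¹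

/-- The Jacobi ensemble density `ρ_{p,z',w'}` with respect to Lebesgue measure on `[0,1]^p`. -/
def ensembleDensity (p : ℕ) (z' w' : ℝ) (X : Fin p → unitInterval) : ℝ :=
  ensembleConst p z' w' * ensembleWeight p z' w' X

/-- The transition density `𝒫^t_{p,z',w'}(Y ∣ X)`, from `X` to `Y`. -/
def transitionDensity (p : ℕ) (z' w' t : ℝ) (X Y : Fin p → unitInterval) : ℝ :=
  √(ensembleDensity p z' w' Y) / √(ensembleDensity p z' w' X) *
    Real.exp (t * totalK p z' w') *
    (Matrix.of fun i j : Fin p => jacobiKernel p z' w' t (X i) (Y j)).det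

/-- The open chamber `0 < x₁ < … < x_p < 1`. -/
def openChamber (p : ℕ) : Set (Fin p → unitInterval) :=
  {X | StrictMono X ∧ ∀ i, (X i : ℝ) ∈ Set.Ioo (0 : ℝ) 1}

/-! ### Stationary Markov processes -/

/-- Stationarity: the finite-dimensional distributions are invariant under time shifts. -/
def IsStationaryProcess {Ω E : Type*} [MeasurableSpace Ω] [MeasurableSpace E] (P : Measure Ω)
    (J : ℝ≥0 → Ω → E) : Prop :=
  ∀ (n : ℕ) (t : Fin n → ℝ≥0) (h : ℝ≥0),
    P.map (fun ω i => J (t i + h) ω) = P.map (fun ω i => J (t i) ω)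

/-- The Markov property of `J` with respect to its natural filtration, with transition
probabilities given by the density `q t x y` (from `x` to `y` in time `t`). -/
def IsMarkovWithDensity {Ω E : Type*} [MeasurableSpace Ω] [MeasureSpace E] (P : Measure Ω)
    (J : ℝ≥0 → Ω → E) (q : ℝ → E → E → ℝ) : Prop :=
  ∀ s t : ℝ≥0, s < t → ∀ A : Set E, MeasurableSet A →
    P[(J t ⁻¹' A).indicator (fun _ => (1 : ℝ)) |
        ⨆ u ∈ Set.Iic s, MeasurableSpace.comap (J u) inferInstance]
      =ᵐ[P] fun ω => ∫ y in A, q ((t : ℝ) - s) (J s ω) y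

end GelfandTsetlin

end

open GelfandTsetlin

/-!
# Up-down chains on the Gelfand–Tsetlin graph and Jacobi processes

In terms of the `p` holes `x₁ < … < x_p` of a signature, everything is determinantal. An edge of
the graph moves each hole by `0` or `1`, independently of the others as long as no two collide
(`interlaces_iff_config`), and `Dim` is the Vandermonde determinant `V(x)` divided by a product of
one-particle factors (`dim_eq`). Since colliding configurations have vanishing determinants, a step
down or up acts on functions `det[ψ_j(x_i)] / V(x)` by a first-order difference operator applied to
every `ψ_j` (`sum_pDown_slater`, `sum_up_zwMeasure`). On the Vandermonde determinant the operators
act by a scalar; this gives coherence. The measure `M_N` is the Hahn orthogonal polynomial ensemble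
(`zwMeasure_eq`), and the Andréief identity `sum_slater_mul_slater` turns the expectation of a
product of multiplicative functions `∏ᵢ ξ_k(x_i)` of the chain at several times into a ratio of
`p × p` determinants (`IsUpDownChain.integral_prod`).

The one-particle problem has an exactly solvable scaling limit. Under the linear map that sends
`X ^ j` to the normalized falling factorial of degree `j`, one step of the chain becomes a constant
of order `N²` minus the Jacobi differential operator (`stepOp_fallingMap`), the Hahn weight becomes
the Jacobi weight (`sum_hahnWt_fallingMap`), and multiplication by the rescaled position becomes
multiplication by `X` up to `O(1/N)`. After `⌊t N²⌋` steps the powers of these operators converge on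
polynomials to the semigroup `jacobiSemigroup`, which is diagonal in the Jacobi polynomials. Hence
the correlation functions of the rescaled chains converge to explicit determinants
(`tendsto_integral_rescaledProcess`, `limitCorr`).

The space of paths with values in ordered configurations is compact, so the laws of the rescaled
chains have a limit point (`exists_limit_law`). By Stone–Weierstrass, multiplicative functions span
a dense space of continuous functions; therefore the finite-dimensional distributions of the limit
are determined by `limitCorr`, and all of the following can be read off from it: convergence
(`tendsto_integral_continuous`), stationarity (`map_eval_add`), and the law at a fixed time
(`IsLimitLaw.map_eval`).

The semigroup has the kernel `heatKernel`, whose series converges because the norms of the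
normalized Jacobi polynomials of degree `k` are at most `exp (O(k log k))`, while the eigenvalues
grow quadratically. The continuous
Andréief identity computes integrals of the transition density
(`integral_transitionDensity_mul`); the determinant of kernels is nonnegative since, up to positive
factors, it is the joint density of the configurations at two times (`kernelDet_nonneg`). Symmetry
of the semigroup moves the last time step from one side of the determinantal pairing to the other,
which is the Markov property tested on multiplicative functions
(`IsLimitLaw.integral_pathProd_succ`). A further density argument and the `π`-system of cylinder
sets give the statement about conditional expectations (`IsLimitLaw.isMarkovWithDensity`).
-/

open MeasureTheory Filter Topology
open scoped NNReal Nat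
open GelfandTsetlin

noncomputable section

namespace GelfandTsetlin


/-! ### Signatures in a box and their configurations of holes -/

/-- The signature `l` has all its parts in `[0, p]`. -/
def IsBoxed (p : ℕ) {N : ℕ} (l : Signature N) : Prop := ∀ i, 0 ≤ l.1 i ∧ l.1 i ≤ p

/-- The position `λ_i - i + N` of the `i`-th particle of a signature. -/
def particle {N : ℕ} (l : Signature N) (i : Fin N) : ℤ := l.1 i - ((i : ℕ) + 1) + N

open Classical in
/-- The strictly increasing `p`-tuples of natural numbers below `M`. -/
def configs (p M : ℕ) : Finset (Fin p → ℕ) :=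
  (Fintype.piFinset fun _ => Finset.range M).filter StrictMono

lemma mem_configs {p M : ℕ} {x : Fin p → ℕ} :
    x ∈ configs p M ↔ (∀ i, x i < M) ∧ StrictMono x := by
  simp [configs]

lemma particle_strictAnti {N : ℕ} (l : Signature N) : StrictAnti (particle l) := by
  intro i j hij
  have := l.2 hij.le
  have h2 : (i : ℕ) < j := hij
  unfold particle; omega

lemma IsBoxed.particle_nonneg {p N : ℕ} {l : Signature N} (h : IsBoxed p l) (i : Fin N) :
    0 ≤ particle l i := by
  have := h i; have := i.2; unfold particle; omega

lemma IsBoxed.particle_lt {p N : ℕ} {l : Signature N} (h : IsBoxed p l) (i : Fin N) :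
    particle l i < N + p := by
  have := h i; have := i.2; unfold particle; omega

lemma mem_holes {p N : ℕ} {l : Signature N} {x : ℕ} :
    x ∈ holes p l ↔ x < N + p ∧ ∀ i, (x : ℤ) ≠ particle l i := by
  simp [holes, particle]

lemma IsBoxed.config_eq {p N : ℕ} {l : Signature N} (h : IsBoxed p l) (i : Fin p) :
    config p l i = (holes p l).orderEmbOfFin (card_holes p l h) i := by
  have hf : (Set.ofPred fun x => x ∈ holes p l).Finite := (holes p l).finite_toSet
  have ht : hf.toFinset = holes p l := by ext x; simp
  have hc := card_holes p l h
  have key : ∀ (s : Finset ℕ) (hs : s = holes p l) (hi : (i : ℕ) < s.card),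
      s.orderEmbOfFin rfl ⟨i, hi⟩ = (holes p l).orderEmbOfFin (card_holes p l h) i := by
    rintro s rfl hi
    rw [Finset.orderEmbOfFin_eq_orderEmbOfFin_iff]
  unfold config
  rw [Nat.nth_eq_orderEmbOfFin hf (by rw [ht, hc]; exact i.2)]
  exact key _ ht _

lemma IsBoxed.config_strictMono {p N : ℕ} {l : Signature N} (h : IsBoxed p l) :
    StrictMono (config p l) := by
  have : config p l = (holes p l).orderEmbOfFin (card_holes p l h) := funext h.config_eq
  rw [this]
  exact OrderEmbedding.strictMono _

lemma IsBoxed.mem_range_config {p N : ℕ} {l : Signature N} (h : IsBoxed p l) {x : ℕ} :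
    (∃ i, config p l i = x) ↔ x ∈ holes p l := by
  have := Finset.range_orderEmbOfFin (holes p l) (card_holes p l h)
  rw [← Finset.mem_coe, ← this]
  simp_rw [h.config_eq]
  rfl

lemma IsBoxed.config_mem {p N : ℕ} {l : Signature N} (h : IsBoxed p l) :
    config p l ∈ configs p (N + p) :=
  mem_configs.2 ⟨config_lt p l, h.config_strictMono⟩

/-- A downward closed predicate on `Fin k` holds exactly on an initial segment. -/
lemma iff_lt_card_of_antitone {k : ℕ} (P : Fin k → Prop) [DecidablePred P]
    (hP : ∀ i j, i ≤ j → P j → P i) (i : Fin k) :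
    P i ↔ (i : ℕ) < (Finset.univ.filter P).card := by
  constructor
  · intro hi
    have : Finset.Iic i ⊆ Finset.univ.filter P := fun j hj => by
      simpa using hP j i (Finset.mem_Iic.1 hj) hi
    have := Finset.card_le_card this
    simp at this; omega
  · intro hi
    by_contra hn
    have : Finset.univ.filter P ⊆ Finset.Iio i := fun j hj => by
      rw [Finset.mem_Iio]
      by_contra hji
      exact hn (hP i j (not_lt.1 hji) (by simpa using hj))
    have := Finset.card_le_card this
    simp at this; omega

/-- The number of particles of `l` at positions `≥ t`. -/
def countAbove {N : ℕ} (l : Signature N) (t : ℕ) : ℕ :=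
  (Finset.univ.filter fun i => (t : ℤ) ≤ particle l i).card

/-- The number of entries of the tuple `x` below `t`. -/
def countBelow {p : ℕ} (x : Fin p → ℕ) (t : ℕ) : ℕ :=
  (Finset.univ.filter fun i => x i < t).card

lemma le_particle_iff {N : ℕ} (l : Signature N) (t : ℕ) (i : Fin N) :
    (t : ℤ) ≤ particle l i ↔ (i : ℕ) < countAbove l t :=
  iff_lt_card_of_antitone (fun i => (t : ℤ) ≤ particle l i)
    (fun _ _ hij h => le_trans h ((particle_strictAnti l).antitone hij)) i

lemma lt_iff_countBelow {p : ℕ} {x : Fin p → ℕ} (hx : StrictMono x) (t : ℕ) (i : Fin p) :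
    x i < t ↔ (i : ℕ) < countBelow x t :=
  iff_lt_card_of_antitone (fun i => x i < t) (fun _ _ hij h => (hx.monotone hij).trans_lt h) i

/-- Below `t` there are `t` places, each taken either by a hole or by a particle. -/
lemma IsBoxed.countBelow_config {p N : ℕ} {l : Signature N} (h : IsBoxed p l) {t : ℕ}
    (ht : t ≤ N + p) : countBelow (config p l) t + N = t + countAbove l t := by
  classical
  have h1 : countBelow (config p l) t = ((holes p l).filter (· < t)).card := by
    unfold countBelow
    rw [← Finset.card_image_of_injective _ h.config_strictMono.injective]
    congr 1
    ext x
    simp only [Finset.mem_image, Finset.mem_filter, Finset.mem_univ, true_and]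
    rw [← h.mem_range_config]
    constructor
    · rintro ⟨i, hi, rfl⟩; exact ⟨⟨i, rfl⟩, hi⟩
    · rintro ⟨⟨i, rfl⟩, hi⟩; exact ⟨i, hi, rfl⟩
  have h2 : countAbove l t + (Finset.univ.filter fun i => particle l i < t).card = N := by
    have := Finset.card_filter_add_card_filter_not (s := (Finset.univ : Finset (Fin N)))
      (fun i => (t : ℤ) ≤ particle l i)
    simpa [countAbove] using this
  have h3 : t = ((holes p l).filter (· < t)).card +
      (Finset.univ.filter fun i => particle l i < t).card := by
    have hinj : Set.InjOn (fun i => (particle l i).toNat)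
        ((Finset.univ.filter fun i => particle l i < t : Finset (Fin N)) : Set (Fin N)) := by
      intro i _ j _ hij
      have := h.particle_nonneg i; have := h.particle_nonneg j
      exact (particle_strictAnti l).injective (by simp only at hij; omega)
    rw [← Finset.card_image_of_injOn hinj, ← Finset.card_union_of_disjoint]
    · conv_lhs => rw [← Finset.card_range t]
      congr 1
      ext x
      simp only [Finset.mem_union, Finset.mem_filter, Finset.mem_image, Finset.mem_univ, true_and,
        Finset.mem_range, mem_holes]
      constructor
      · intro hx
        by_cases hex : ∃ i, (x : ℤ) = particle l i
        · obtain ⟨i, hi⟩ := hex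
          exact Or.inr ⟨i, by omega, by omega⟩
        · push Not at hex
          exact Or.inl ⟨⟨by omega, hex⟩, hx⟩
      · rintro (⟨_, hx⟩ | ⟨i, hi, rfl⟩)
        · exact hx
        · have := h.particle_nonneg i; omega
    · rw [Finset.disjoint_left]
      intro x hx hx'
      simp only [Finset.mem_filter, Finset.mem_image, Finset.mem_univ, true_and, mem_holes]
        at hx hx'
      obtain ⟨i, _, rfl⟩ := hx'
      have := h.particle_nonneg i
      exact hx.1.2 i (by omega)
  omega

lemma interlaces_iff_particle {N : ℕ} {l : Signature N} {m : Signature (N + 1)} :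
    Interlaces l m ↔ ∀ i : Fin N, particle l i < particle m i.castSucc ∧
      particle m i.succ ≤ particle l i := by
  unfold Interlaces particle
  refine forall_congr' fun i => ?_
  simp only [Fin.val_castSucc, Fin.val_succ]
  constructor <;> rintro ⟨h1, h2⟩ <;> push_cast at * <;> constructor <;> omega

/-- In terms of holes, going up one level moves every hole by `0` or `1`. -/
lemma interlaces_iff_config {p N : ℕ} {l : Signature N} {m : Signature (N + 1)}
    (hl : IsBoxed p l) (hm : IsBoxed p m) :
    Interlaces l m ↔ ∀ j, config p l j ≤ config p m j ∧ config p m j ≤ config p l j + 1 := by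
  rw [interlaces_iff_particle]
  have hxl := lt_iff_countBelow hl.config_strictMono
  have hxm := lt_iff_countBelow hm.config_strictMono
  constructor
  · intro h j
    have hj1 := config_lt p l j
    have hj2 := config_lt p m j
    constructor
    · by_contra hlt
      push Not at hlt
      set t := config p l j with ht
      have h1 := (hxm t j).1 hlt
      have h2 := mt (hxl t j).2 (lt_irrefl t)
      have e1 := hl.countBelow_config (t := t) (by omega)
      have e2 := hm.countBelow_config (t := t) (by omega)
      have hc : countAbove m t ≤ N + 1 := by
        unfold countAbove; exact (Finset.card_le_univ _).trans (by simp)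
      have h4 : countAbove l t < N := by omega
      have h3 := (le_particle_iff m t (Fin.succ ⟨countAbove l t, h4⟩)).2 (by simp; omega)
      have h5 := (le_particle_iff l t ⟨countAbove l t, h4⟩).1 (h3.trans (h _).2)
      simp at h5
    · by_contra hlt
      push Not at hlt
      set t := config p l j + 1 with ht
      have h1 := (hxl t j).1 (by omega)
      have h2 := mt (hxm (t + 1) j).2 (by omega)
      have e1 := hl.countBelow_config (t := t) (by omega)
      have e2 := hm.countBelow_config (t := t + 1) (by omega)
      have hc : countAbove l t ≤ N := by
        unfold countAbove; exact (Finset.card_le_univ _).trans (by simp)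
      have h4 : countAbove m (t + 1) < N := by omega
      have h3 := (le_particle_iff l t ⟨countAbove m (t + 1), h4⟩).2 (by simp; omega)
      have h6 := (h ⟨countAbove m (t + 1), h4⟩).1
      have h5 := (le_particle_iff m (t + 1) (Fin.castSucc ⟨countAbove m (t + 1), h4⟩)).1
        (by push_cast; omega)
      simp at h5
  · intro h i
    have hb : ∀ t ≤ N + p, countBelow (config p m) t ≤ countBelow (config p l) t ∧
        countBelow (config p l) t ≤ countBelow (config p m) (t + 1) := by
      intro t _
      constructor <;> refine Finset.card_le_card fun j hj => ?_ <;>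
        simp only [Finset.mem_filter, Finset.mem_univ, true_and] at hj ⊢ <;>
        have := h j <;> omega
    have hn := hl.particle_nonneg i
    have hlt := hl.particle_lt i
    constructor
    · obtain ⟨t, ht⟩ := Int.eq_ofNat_of_zero_le hn
      have h1 := (le_particle_iff l t i).1 (by omega)
      have e1 := hl.countBelow_config (t := t) (by omega)
      have e2 := hm.countBelow_config (t := t + 1) (by omega)
      have := (hb t (by omega)).2
      have h2 := (le_particle_iff m (t + 1) i.castSucc).2 (by simp; omega)
      push_cast at h2; omega
    · obtain ⟨t, ht⟩ := Int.eq_ofNat_of_zero_le (hm.particle_nonneg i.succ)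
      by_contra hcon
      have hlt2 := hm.particle_lt i.succ
      have h1 := (le_particle_iff m t i.succ).1 (by omega)
      have e2 := hm.countBelow_config (t := t) (by omega)
      rw [Fin.val_succ] at h1
      by_cases htN : t ≤ N + p
      · have e1 := hl.countBelow_config (t := t) (by omega)
        have := (hb t (by omega)).1
        have h2 := (le_particle_iff l t i).2 (by omega)
        omega
      · push_cast at hlt2; omega

lemma config_injOn {p N : ℕ} {l l' : Signature N} (hl : IsBoxed p l) (hl' : IsBoxed p l')
    (h : config p l = config p l') : l = l' := by
  have key : ∀ i, particle l i = particle l' i := by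
    intro i
    have h0 := hl.particle_nonneg i
    have h1 := hl.particle_lt i
    have h0' := hl'.particle_nonneg i
    have h1' := hl'.particle_lt i
    have hc : ∀ t ≤ N + p, countAbove l t = countAbove l' t := by
      intro t ht
      have e1 := hl.countBelow_config ht
      have e2 := hl'.countBelow_config ht
      rw [h] at e1; omega
    have hi : ∀ t : ℕ, t ≤ N + p → ((t : ℤ) ≤ particle l i ↔ (t : ℤ) ≤ particle l' i) := by
      intro t ht
      rw [le_particle_iff, le_particle_iff, hc t ht]
    have a1 := hi (particle l i).toNat (by omega)
    have a2 := hi (particle l' i).toNat (by omega)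
    omega
  apply Subtype.ext
  funext i
  have := key i
  unfold particle at this; omega

lemma exists_config_eq {p N : ℕ} {x : Fin p → ℕ} (hx : x ∈ configs p (N + p)) :
    ∃ l : Signature N, IsBoxed p l ∧ config p l = x := by
  classical
  obtain ⟨hx1, hx2⟩ := mem_configs.1 hx
  set A : Finset ℕ := Finset.range (N + p) \ Finset.univ.image x with hA
  have hcard : A.card = N := by
    rw [hA, Finset.card_sdiff_of_subset, Finset.card_image_of_injective _ hx2.injective]
    · simp
    · intro y hy
      obtain ⟨i, -, rfl⟩ := Finset.mem_image.1 hy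
      exact Finset.mem_range.2 (hx1 i)
  let f := A.orderEmbOfFin hcard
  have hfm : StrictMono f := f.strictMono
  -- a strictly increasing enumeration moves by at least the distance of the indices
  have hgap : ∀ (d : ℕ) (i j : Fin N), (i : ℕ) + d = j → f i + d ≤ f j := by
    intro d
    induction d with
    | zero => intro i j hij; have : i = j := Fin.ext (by omega); subst this; simp
    | succ d ih =>
      intro i j hij
      have h1 := ih i ⟨i + d, by omega⟩ rfl
      have h2 : f ⟨i + d, by omega⟩ < f j := hfm (by rw [Fin.lt_def]; simp; omega)
      omega
  have hflt : ∀ i, f i < N + p := fun i => by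
    have := Finset.mem_sdiff.1 (A.orderEmbOfFin_mem hcard i)
    exact Finset.mem_range.1 this.1
  let l : Signature N := ⟨fun i => (f i.rev : ℤ) + (i + 1) - N, by
    intro i j hij
    have h2 : (i : ℕ) ≤ j := hij
    have := hgap (j - i) j.rev i.rev (by simp [Fin.val_rev]; omega)
    simp only; omega⟩
  have hpart : ∀ i, particle l i = f i.rev := by
    intro i; simp only [particle, l]; ring
  have hbox : IsBoxed p l := by
    intro i
    have hi := i.2
    have h1 := hgap (N - 1 - i) ⟨0, by omega⟩ i.rev (by simp [Fin.val_rev]; omega)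
    have h2 := hgap i i.rev ⟨N - 1, by omega⟩ (by simp [Fin.val_rev]; omega)
    have h3 := hflt ⟨N - 1, by omega⟩
    simp only [l]
    constructor <;> omega
  refine ⟨l, hbox, ?_⟩
  have hh : holes p l = Finset.univ.image x := by
    ext y
    rw [mem_holes]
    have hr : (∃ i, f i = y) ↔ y ∈ A := by
      have := Finset.range_orderEmbOfFin A hcard
      rw [← Finset.mem_coe, ← this]; rfl
    constructor
    · rintro ⟨hy, hy2⟩
      by_contra hyx
      obtain ⟨i, hi⟩ := hr.2 (by rw [hA, Finset.mem_sdiff]; exact ⟨Finset.mem_range.2 hy, hyx⟩)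
      exact hy2 i.rev (by rw [hpart, Fin.rev_rev, hi])
    · intro hy
      refine ⟨?_, ?_⟩
      · obtain ⟨i, -, rfl⟩ := Finset.mem_image.1 hy
        exact hx1 i
      · intro i hi
        rw [hpart] at hi
        have := hr.1 ⟨i.rev, by exact_mod_cast hi.symm⟩
        rw [hA, Finset.mem_sdiff] at this
        exact this.2 hy
  have : config p l = (holes p l).orderEmbOfFin (card_holes p l hbox) := funext hbox.config_eq
  rw [this]
  refine (Finset.orderEmbOfFin_unique _ (fun i => ?_) hx2).symm
  rw [hh]; exact Finset.mem_image_of_mem _ (Finset.mem_univ i)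

lemma finite_isBoxed (p N : ℕ) : {l : Signature N | IsBoxed p l}.Finite :=
  Set.Finite.of_finite_image
    (f := config p)
    ((configs p (N + p)).finite_toSet.subset
      (by rintro _ ⟨l, hl, rfl⟩; exact IsBoxed.config_mem hl))
    fun _ hl _ hl' h => config_injOn hl hl' h

/-- The finite set of signatures of order `N` with all parts in `[0, p]`. -/
def box (p N : ℕ) : Finset (Signature N) := (finite_isBoxed p N).toFinset

@[simp] lemma mem_box {p N : ℕ} {l : Signature N} : l ∈ box p N ↔ IsBoxed p l := by simp [box]

lemma sum_box {p N : ℕ} (F : (Fin p → ℕ) → ℝ) :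
    ∑ l ∈ box p N, F (config p l) = ∑ x ∈ configs p (N + p), F x := by
  refine Finset.sum_nbij (config p) (fun l hl => (mem_box.1 hl).config_mem) ?_ ?_ fun _ _ => rfl
  · intro l hl l' hl' h
    exact config_injOn (mem_box.1 hl) (mem_box.1 hl') h
  · intro x hx
    obtain ⟨l, hl, rfl⟩ := exists_config_eq hx
    exact ⟨l, mem_box.2 hl, rfl⟩

lemma Interlaces.isBoxed {p N : ℕ} {l : Signature N} {m : Signature (N + 1)}
    (h : Interlaces l m) (hm : IsBoxed p m) : IsBoxed p l := fun i =>
  ⟨(hm _).1.trans (h i).2, (h i).1.trans (hm _).2⟩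


/-! ### Slater determinants and one step of the chain -/

open Polynomial in
/-- The determinant of a system of polynomials of degrees at most `0, 1, …, p - 1` is the
Vandermonde determinant times the product of the top coefficients. -/
lemma det_eval_eq_prod_coeff_mul_vandermonde {p : ℕ} (P : Fin p → ℝ[X])
    (hP : ∀ j, (P j).natDegree ≤ j) (v : Fin p → ℝ) :
    (Matrix.of fun i j => (P j).eval (v i)).det =
      (∏ j, (P j).coeff j) * (Matrix.vandermonde v).det := by
  rw [Matrix.eval_matrixOfPolynomials_eq_vandermonde_mul_matrixOfPolynomials v P hP, Matrix.det_mul,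
    Matrix.det_of_isUpperTriangular (Matrix.matrixOfPolynomials_blockTriangular P hP), mul_comm]
  rfl

/-- The Slater determinant `det[ψ_j(x_i)]` of the functions `ψ_j` at the configuration `x`. -/
def slater {p : ℕ} (ψ : Fin p → ℝ → ℝ) (x : Fin p → ℕ) : ℝ :=
  (Matrix.of fun i j => ψ j (x i)).det

/-- The Vandermonde determinant of a configuration. -/
def vand {p : ℕ} (x : Fin p → ℕ) : ℝ := (Matrix.vandermonde fun i => (x i : ℝ)).det

lemma vand_pos {p : ℕ} {x : Fin p → ℕ} (hx : StrictMono x) : 0 < vand x := by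
  unfold vand
  rw [Matrix.det_vandermonde]
  refine Finset.prod_pos fun i _ => Finset.prod_pos fun j hj => ?_
  have : x i < x j := hx (Finset.mem_Ioi.1 hj)
  have : (x i : ℝ) < x j := by exact_mod_cast this
  linarith

lemma slater_descPochhammer {p : ℕ} (x : Fin p → ℕ) :
    slater (fun j u => (descPochhammer ℝ j).eval u) x = vand x := by
  unfold slater vand
  rw [det_eval_eq_prod_coeff_mul_vandermonde (fun j : Fin p => descPochhammer ℝ j)
    (fun j => (descPochhammer_natDegree ℝ (j : ℕ)).le)]
  have : ∀ j : Fin p, (descPochhammer ℝ (j : ℕ)).coeff j = 1 := fun j => by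
    have := monic_descPochhammer (R := ℝ) j
    rwa [Polynomial.Monic, Polynomial.leadingCoeff, descPochhammer_natDegree] at this
  simp [this]

lemma det_add_rows {p : ℕ} (c d : Fin p → ℝ) (u v : Fin p → Fin p → ℝ) :
    (Matrix.of fun i j => c i * u i j + d i * v i j).det =
      ∑ s : Finset (Fin p), (∏ i, if i ∈ s then c i else d i) *
        (Matrix.of fun i j => if i ∈ s then u i j else v i j).det := by
  have h := (Matrix.detRowAlternating (R := ℝ) (n := Fin p)).map_add_univ
    (fun i => c i • u i) (fun i => d i • v i)
  have e1 : (Matrix.of fun i j => c i * u i j + d i * v i j) =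
      ((fun i => c i • u i) + fun i => d i • v i : Fin p → Fin p → ℝ) := by
    ext i j; simp
  have e2 : (Matrix.of fun i j => c i * u i j + d i * v i j).det =
    Matrix.detRowAlternating ((fun i => c i • u i) + fun i => d i • v i : Fin p → Fin p → ℝ) := by
    rw [e1]; rfl
  rw [e2, h]
  refine Finset.sum_congr rfl fun s _ => ?_
  have e3 : s.piecewise (fun i => c i • u i) (fun i => d i • v i) =
      fun i => (if i ∈ s then c i else d i) • (fun j => if i ∈ s then u i j else v i j) := by
    funext i
    by_cases hi : i ∈ s <;> simp [hi]
  rw [e3, AlternatingMap.map_smul_univ]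
  rfl

/-- The one-particle operator of a step down from level `N + 1`, where `M = N + p`. -/
def downOp (M : ℝ) (ψ : ℝ → ℝ) (y : ℝ) : ℝ := y * ψ (y - 1) + (M - y) * ψ y

/-- The one-particle operator of a step up from level `N`, where `α = w' + 1`, `β = z' + N`. -/
def upOp (α β : ℝ) (χ : ℝ → ℝ) (x : ℝ) : ℝ := (x + α) * χ (x + 1) + (β - x) * χ x

open Classical in
/-- Every particle steps down by `0` or `1` independently; forbidden configurations drop out,
since their Slater determinants or their weights vanish. -/
lemma sum_down_slater {p M : ℕ} (ψ : Fin p → ℝ → ℝ) {y : Fin p → ℕ} (hy : y ∈ configs p (M + 1)) :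
    ∑ x ∈ configs p M, (if ∀ j, x j ≤ y j ∧ y j ≤ x j + 1 then
      (∏ j, if x j < y j then (y j : ℝ) else M - y j) * slater ψ x else 0) =
      slater (fun j => downOp M (ψ j)) y := by
  obtain ⟨hyM, hy2⟩ := mem_configs.1 hy
  have hR : slater (fun j => downOp M (ψ j)) y =
      ∑ s : Finset (Fin p), (∏ i, if i ∈ s then (y i : ℝ) else M - y i) *
        (Matrix.of fun i j => if i ∈ s then ψ j (y i - 1) else ψ j (y i)).det := by
    unfold slater downOp
    exact det_add_rows (fun i => (y i : ℝ)) (fun i => M - y i) (fun i j => ψ j (y i - 1))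
      (fun i j => ψ j (y i))
  rw [hR, ← Finset.sum_filter]
  refine Finset.sum_of_injOn (fun x => Finset.univ.filter fun j => x j < y j) ?_ ?_ ?_ ?_
  · intro x hx x' hx' h
    simp only [Finset.coe_filter, Set.mem_ofPred_eq] at hx hx'
    funext j
    have h1 := hx.2 j; have h2 := hx'.2 j
    have := Finset.ext_iff.1 h j
    simp only [Finset.mem_filter, Finset.mem_univ, true_and] at this
    omega
  · intro _ _; simp
  · intro s _ hs
    by_cases h0 : ∃ i ∈ s, y i = 0
    · obtain ⟨i, hi, h0⟩ := h0
      rw [Finset.prod_eq_zero (Finset.mem_univ i) (by simp [hi, h0]), zero_mul]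
    by_cases h1 : ∃ i, i ∉ s ∧ y i = M
    · obtain ⟨i, hi, h1⟩ := h1
      rw [Finset.prod_eq_zero (Finset.mem_univ i) (by simp [hi, h1]), zero_mul]
    push Not at h0 h1
    set x : Fin p → ℕ := fun i => if i ∈ s then y i - 1 else y i with hx
    have hxy : ∀ i, (i ∈ s ∧ x i + 1 = y i) ∨ (i ∉ s ∧ x i = y i) := by
      intro i
      by_cases hi : i ∈ s
      · have := h0 i hi
        exact Or.inl ⟨hi, by simp [hx, hi]; omega⟩
      · exact Or.inr ⟨hi, by simp [hx, hi]⟩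
    have hrow : ∀ i j, (if i ∈ s then ψ j (y i - 1) else ψ j (y i)) = ψ j (x i) := by
      intro i j
      rcases hxy i with ⟨hi, he⟩ | ⟨hi, he⟩
      · rw [if_pos hi, ← he]; push_cast; ring_nf
      · rw [if_neg hi, he]
    by_cases hmono : StrictMono x
    · exfalso
      apply hs
      refine ⟨x, ?_, ?_⟩
      · simp only [Finset.coe_filter, Set.mem_ofPred_eq, mem_configs]
        refine ⟨⟨fun i => ?_, hmono⟩, fun j => ?_⟩
        · have := hyM i; have := hxy i; have := h1 i; grind
        · rcases hxy j with ⟨_, he⟩ | ⟨_, he⟩ <;> omega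
      · ext i
        simp only [Finset.mem_filter, Finset.mem_univ, true_and]
        rcases hxy i with ⟨hi, he⟩ | ⟨hi, he⟩
        · simp [hi]; omega
        · simp [hi, he]
    · have : ∃ i j, i ≠ j ∧ x i = x j := by
        unfold StrictMono at hmono
        push Not at hmono
        obtain ⟨i, j, hij, hle⟩ := hmono
        refine ⟨i, j, hij.ne, ?_⟩
        have := hy2 hij; have := hxy i; have := hxy j; omega
      obtain ⟨i, j, hij, he⟩ := this
      rw [Matrix.det_zero_of_row_eq hij, mul_zero]
      funext k
      simp only [Matrix.of_apply, hrow, he]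
  · intro x hx
    simp only [Finset.mem_filter] at hx
    unfold slater
    congr 1
    · simp
    · congr 1
      ext i j
      simp only [Matrix.of_apply, Finset.mem_filter, Finset.mem_univ, true_and]
      have := hx.2 i
      split_ifs with h
      · have : y i = x i + 1 := by omega
        rw [this]; push_cast; ring_nf
      · have : y i = x i := by omega
        rw [this]

open Classical in
lemma sum_up_slater {p M : ℕ} (α β : ℝ) (χ : Fin p → ℝ → ℝ) {x : Fin p → ℕ}
    (hx : x ∈ configs p M) :
    ∑ y ∈ configs p (M + 1), (if ∀ j, x j ≤ y j ∧ y j ≤ x j + 1 then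
      (∏ j, if x j < y j then (x j + α : ℝ) else β - x j) * slater χ y else 0) =
      slater (fun j => upOp α β (χ j)) x := by
  obtain ⟨hxM, hx2⟩ := mem_configs.1 hx
  have hR : slater (fun j => upOp α β (χ j)) x =
      ∑ s : Finset (Fin p), (∏ i, if i ∈ s then (x i + α : ℝ) else β - x i) *
        (Matrix.of fun i j => if i ∈ s then χ j (x i + 1) else χ j (x i)).det := by
    unfold slater upOp
    exact det_add_rows (fun i => (x i + α : ℝ)) (fun i => β - x i) (fun i j => χ j (x i + 1))
      (fun i j => χ j (x i))
  rw [hR, ← Finset.sum_filter]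
  refine Finset.sum_of_injOn (fun y => Finset.univ.filter fun j => x j < y j) ?_ ?_ ?_ ?_
  · intro y hy y' hy' h
    simp only [Finset.coe_filter, Set.mem_ofPred_eq] at hy hy'
    funext j
    have h1 := hy.2 j; have h2 := hy'.2 j
    have := Finset.ext_iff.1 h j
    simp only [Finset.mem_filter, Finset.mem_univ, true_and] at this
    omega
  · intro _ _; simp
  · intro s _ hs
    set y : Fin p → ℕ := fun i => if i ∈ s then x i + 1 else x i with hy
    have hxy : ∀ i, (i ∈ s ∧ y i = x i + 1) ∨ (i ∉ s ∧ y i = x i) := by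
      intro i
      by_cases hi : i ∈ s
      · exact Or.inl ⟨hi, by simp [hy, hi]⟩
      · exact Or.inr ⟨hi, by simp [hy, hi]⟩
    have hrow : ∀ i j, (if i ∈ s then χ j (x i + 1) else χ j (x i)) = χ j (y i) := by
      intro i j
      rcases hxy i with ⟨hi, he⟩ | ⟨hi, he⟩
      · rw [if_pos hi, he]; push_cast; ring_nf
      · rw [if_neg hi, he]
    by_cases hmono : StrictMono y
    · exfalso
      apply hs
      refine ⟨y, ?_, ?_⟩
      · simp only [Finset.coe_filter, Set.mem_ofPred_eq, mem_configs]
        refine ⟨⟨fun i => ?_, hmono⟩, fun j => ?_⟩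
        · have := hxM i; have := hxy i; omega
        · rcases hxy j with ⟨_, he⟩ | ⟨_, he⟩ <;> omega
      · ext i
        simp only [Finset.mem_filter, Finset.mem_univ, true_and]
        rcases hxy i with ⟨hi, he⟩ | ⟨hi, he⟩
        · simp [hi]; omega
        · simp [hi, he]
    · have : ∃ i j, i ≠ j ∧ y i = y j := by
        unfold StrictMono at hmono
        push Not at hmono
        obtain ⟨i, j, hij, hle⟩ := hmono
        refine ⟨i, j, hij.ne, ?_⟩
        have := hx2 hij; have := hxy i; have := hxy j; omega
      obtain ⟨i, j, hij, he⟩ := this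
      rw [Matrix.det_zero_of_row_eq hij, mul_zero]
      funext k
      simp only [Matrix.of_apply, hrow, he]
  · intro y hy
    simp only [Finset.mem_filter] at hy
    unfold slater
    congr 1
    · simp
    · congr 1
      ext i j
      simp only [Matrix.of_apply, Finset.mem_filter, Finset.mem_univ, true_and]
      have := hy.2 i
      split_ifs with h
      · have : y i = x i + 1 := by omega
        rw [this]; push_cast; ring_nf
      · have : y i = x i := by omega
        rw [this]

/-- `x! (M-1-x)!` for a place `x < M`. -/
def placeWt (M x : ℕ) : ℝ := (x ! : ℝ) * ((M - 1 - x)! : ℝ)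

lemma placeWt_pos (M x : ℕ) : 0 < placeWt M x := by unfold placeWt; positivity

lemma placeWt_div_succ {M x : ℕ} (hx : x < M) :
    placeWt (M + 1) (x + 1) / placeWt M x = x + 1 := by
  rw [div_eq_iff (placeWt_pos M x).ne']
  unfold placeWt
  rw [show M + 1 - 1 - (x + 1) = M - 1 - x by omega, Nat.factorial_succ]
  push_cast; ring

lemma placeWt_div_self {M x : ℕ} (hx : x < M) :
    placeWt (M + 1) x / placeWt M x = M - x := by
  rw [div_eq_iff (placeWt_pos M x).ne']
  unfold placeWt
  rw [show M + 1 - 1 - x = (M - 1 - x) + 1 by omega, Nat.factorial_succ,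
    show M - 1 - x = M - (1 + x) by omega]
  push_cast [Nat.cast_sub (show 1 + x ≤ M by omega)]; ring

lemma placeWt_div {M x y : ℕ} (hx : x < M) (h : x ≤ y ∧ y ≤ x + 1) :
    placeWt (M + 1) y / placeWt M x = if x < y then (y : ℝ) else M - y := by
  split_ifs with hlt
  · obtain rfl : y = x + 1 := by omega
    rw [placeWt_div_succ hx]; push_cast; ring
  · obtain rfl : y = x := by omega
    exact placeWt_div_self hx

/-- On falling factorials the downward one-particle operator is diagonal. -/
lemma downOp_descPochhammer (M : ℝ) (j : ℕ) (y : ℝ) :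
    downOp M (fun u => (descPochhammer ℝ j).eval u) y =
      (M - j) * (descPochhammer ℝ j).eval y := by
  unfold downOp
  cases j with
  | zero => simp
  | succ j =>
    have h1 : (descPochhammer ℝ (j + 1)).eval y = y * (descPochhammer ℝ j).eval (y - 1) := by
      rw [descPochhammer_succ_left]; simp
    have h2 : (descPochhammer ℝ (j + 1)).eval (y - 1) =
        (descPochhammer ℝ j).eval (y - 1) * (y - 1 - j) := descPochhammer_succ_eval j (y - 1)
    simp only [h1, h2]; push_cast; ring

lemma upOp_descPochhammer (α β : ℝ) (j : ℕ) (x : ℝ) :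
    upOp α β (fun u => (descPochhammer ℝ j).eval u) x =
      (α + β + j) * (descPochhammer ℝ j).eval x +
        j * (α + j - 1) * (descPochhammer ℝ (j - 1)).eval x := by
  unfold upOp
  cases j with
  | zero => simp; ring
  | succ j =>
    have h1 : (descPochhammer ℝ (j + 1)).eval (x + 1) =
        (x + 1) * (descPochhammer ℝ j).eval x := by
      rw [descPochhammer_succ_left]; simp
    have h2 : (descPochhammer ℝ (j + 1)).eval x =
        (descPochhammer ℝ j).eval x * (x - j) := descPochhammer_succ_eval j x
    simp only [h1, h2, Nat.add_sub_cancel]; push_cast; ring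

lemma slater_mul {p : ℕ} (c : Fin p → ℝ) (ψ : Fin p → ℝ → ℝ) (x : Fin p → ℕ) :
    slater (fun j u => c j * ψ j u) x = (∏ j, c j) * slater ψ x := by
  unfold slater
  exact Matrix.det_mul_row c (Matrix.of fun i j => ψ j (x i))

lemma slater_downOp_descPochhammer {p : ℕ} (M : ℝ) (y : Fin p → ℕ) :
    slater (fun j => downOp M fun u => (descPochhammer ℝ j).eval u) y =
      (∏ j : Fin p, (M - (j : ℕ))) * vand y := by
  rw [← slater_descPochhammer, ← slater_mul]
  congr 1
  funext j u
  exact downOp_descPochhammer M j u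

lemma slater_upOp_descPochhammer {p : ℕ} (α β : ℝ) (x : Fin p → ℕ) :
    slater (fun j => upOp α β fun u => (descPochhammer ℝ j).eval u) x =
      (∏ j : Fin p, (α + β + (j : ℕ))) * vand x := by
  have h := det_eval_eq_prod_coeff_mul_vandermonde (p := p)
    (fun j => Polynomial.C (α + β + (j : ℕ)) * descPochhammer ℝ j +
      Polynomial.C ((j : ℕ) * (α + (j : ℕ) - 1)) * descPochhammer ℝ ((j : ℕ) - 1)) (fun j => ?_)
    (fun i => (x i : ℝ))
  · unfold slater vand
    have e : ∀ j : Fin p, (Polynomial.C (α + β + (j : ℕ)) * descPochhammer ℝ j +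
      Polynomial.C ((j : ℕ) * (α + (j : ℕ) - 1)) * descPochhammer ℝ ((j : ℕ) - 1)).coeff j =
        α + β + (j : ℕ) := fun j => by
      have h1 : (descPochhammer ℝ (j : ℕ)).coeff j = 1 := by
        have := monic_descPochhammer (R := ℝ) j
        rwa [Polynomial.Monic, Polynomial.leadingCoeff, descPochhammer_natDegree] at this
      rw [Polynomial.coeff_add, Polynomial.coeff_C_mul, Polynomial.coeff_C_mul, h1]
      rcases Nat.eq_zero_or_pos (j : ℕ) with h0 | h0
      · simp [h0]
      · rw [Polynomial.coeff_eq_zero_of_natDegree_lt (by rw [descPochhammer_natDegree]; omega)]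
        ring
    rw [← Finset.prod_congr rfl fun j _ => e j, ← h]
    congr 1
    ext i j
    simp only [Matrix.of_apply, upOp_descPochhammer]
    simp
  · refine (Polynomial.natDegree_add_le _ _).trans (max_le ?_ ?_)
    · exact (Polynomial.natDegree_C_mul_le _ _).trans (descPochhammer_natDegree ℝ _).le
    · refine (Polynomial.natDegree_C_mul_le _ _).trans ?_
      rw [descPochhammer_natDegree]
      omega


/-! ### Dimensions and the measures in terms of holes -/

/-- A path to a signature of order `N + 1` is an edge together with a path to its lower end. -/
def gtPathEquiv {N : ℕ} (m : Signature (N + 1)) :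
    GTPath (N + 1) m ≃ Σ l : {l : Signature N // Interlaces l m}, GTPath N l.1 where
  toFun
    | .step h γ => ⟨⟨_, h⟩, γ⟩
  invFun x := .step x.1.2 x.2
  left_inv := by rintro ⟨h, γ⟩; rfl
  right_inv := by rintro ⟨⟨l, h⟩, γ⟩; rfl

instance (l : Signature 0) : Unique (GTPath 0 l) where
  default := .root l
  uniq := by rintro ⟨l⟩; rfl

lemma finite_interlaces {N : ℕ} (m : Signature (N + 1)) :
    {l : Signature N | Interlaces l m}.Finite := by
  have h : (Set.Icc (fun i : Fin N => m.1 i.succ) (fun i : Fin N => m.1 i.castSucc)).Finite :=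
    Set.finite_Icc _ _
  refine Set.Finite.of_finite_image (f := Subtype.val) (h.subset ?_)
    (fun _ _ _ _ h => Subtype.ext h)
  rintro _ ⟨l, hl, rfl⟩
  exact ⟨fun i => (hl i).2, fun i => (hl i).1⟩

instance finite_gtPath : ∀ {N : ℕ} (l : Signature N), Finite (GTPath N l)
  | 0, _ => inferInstance
  | N + 1, m => by
    have := (finite_interlaces m).to_subtype
    have : ∀ l : {l : Signature N // Interlaces l m}, Finite (GTPath N l.1) :=
      fun l => finite_gtPath l.1
    have : Finite {l : Signature N // Interlaces l m} := (finite_interlaces m).to_subtype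
    exact Finite.of_equiv _ (gtPathEquiv m).symm

lemma dim_zero (l : Signature 0) : Dim l = 1 := Nat.card_unique

open Classical in
lemma dim_succ {p N : ℕ} {m : Signature (N + 1)} (hm : IsBoxed p m) :
    (Dim m : ℝ) = ∑ l ∈ box p N, if Interlaces l m then (Dim l : ℝ) else 0 := by
  have : Fintype {l : Signature N // Interlaces l m} := (finite_interlaces m).fintype
  unfold Dim
  rw [Nat.card_congr (gtPathEquiv m), Nat.card_sigma, ← Finset.sum_filter]
  push_cast
  symm
  refine Finset.sum_bij (fun l hl => ⟨l, (Finset.mem_filter.1 hl).2⟩) (fun _ _ => Finset.mem_univ _)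
    (fun _ _ _ _ h => congrArg Subtype.val h) (fun l _ => ⟨l.1, ?_, rfl⟩) (fun _ _ => rfl)
  rw [Finset.mem_filter, mem_box]
  exact ⟨l.2.isBoxed hm, l.2⟩

/-- The factor of proportionality in the formula for `Dim` in terms of holes. -/
def dimConst (p : ℕ) : ℕ → ℝ
  | 0 => (∏ j : Fin p, placeWt p j) / vand (fun j : Fin p => (j : ℕ))
  | N + 1 => dimConst p N * ∏ j : Fin p, (((N + p : ℕ) : ℝ) - (j : ℕ))

lemma prod_sub_pos (p N : ℕ) : 0 < ∏ j : Fin p, (((N + p : ℕ) : ℝ) - (j : ℕ)) := by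
  refine Finset.prod_pos fun j _ => sub_pos.2 ?_
  exact_mod_cast j.2.trans_le (Nat.le_add_left p N)

lemma dimConst_pos (p N : ℕ) : 0 < dimConst p N := by
  induction N with
  | zero =>
    exact div_pos (Finset.prod_pos fun j _ => placeWt_pos _ _) (vand_pos fun i j h => h)
  | succ N ih => exact mul_pos ih (prod_sub_pos p N)

open Classical in
lemma sum_box_interlaces {p N : ℕ} {m : Signature (N + 1)} (hm : IsBoxed p m)
    (F : (Fin p → ℕ) → ℝ) :
    ∑ l ∈ box p N, (if Interlaces l m then F (config p l) else 0) =
      ∑ x ∈ configs p (N + p),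
        (if ∀ j, x j ≤ config p m j ∧ config p m j ≤ x j + 1 then F x else 0) := by
  rw [← sum_box (fun x => if ∀ j, x j ≤ config p m j ∧ config p m j ≤ x j + 1 then F x else 0)]
  refine Finset.sum_congr rfl fun l hl => ?_
  simp only [interlaces_iff_config (mem_box.1 hl) hm]

lemma IsBoxed.config_mem' {p N : ℕ} {m : Signature (N + 1)} (hm : IsBoxed p m) :
    config p m ∈ configs p (N + p + 1) := by
  have := hm.config_mem
  rwa [show N + 1 + p = N + p + 1 by ring] at this

open Classical in
/-- One step down, for functions of the form `det[ψ_j(x_i)] / ∏ placeWt x_i`. -/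
lemma sum_interlaces_slater {p N : ℕ} {m : Signature (N + 1)} (hm : IsBoxed p m)
    (ψ : Fin p → ℝ → ℝ) :
    ∑ l ∈ box p N, (if Interlaces l m then
      slater ψ (config p l) / ∏ j, placeWt (N + p) (config p l j) else 0) =
      slater (fun j => downOp (N + p : ℕ) (ψ j)) (config p m) /
        ∏ j, placeWt (N + 1 + p) (config p m j) := by
  have hP : 0 < ∏ j, placeWt (N + 1 + p) (config p m j) :=
    Finset.prod_pos fun j _ => placeWt_pos _ _
  rw [sum_box_interlaces hm fun x => slater ψ x / ∏ j, placeWt (N + p) (x j),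
    ← sum_down_slater ψ hm.config_mem', eq_div_iff hP.ne', Finset.sum_mul]
  refine Finset.sum_congr rfl fun x hx => ?_
  split_ifs with h
  · have hx1 := (mem_configs.1 hx).1
    rw [← Finset.prod_congr rfl fun j _ => placeWt_div (hx1 j) (h j), Finset.prod_div_distrib,
      show N + 1 + p = N + p + 1 by ring]
    ring
  · simp

/-- The dimension in terms of holes. -/
lemma dim_eq {p N : ℕ} {l : Signature N} (hl : IsBoxed p l) :
    (Dim l : ℝ) = dimConst p N * (vand (config p l) / ∏ j, placeWt (N + p) (config p l j)) := by
  classical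
  induction N with
  | zero =>
    have hc : config p l = fun j : Fin p => (j : ℕ) := by
      have hid : (fun j : Fin p => (j : ℕ)) ∈ configs p (0 + p) :=
        mem_configs.2 ⟨fun j => by simp, fun i j h => h⟩
      obtain ⟨l', _, h2⟩ := exists_config_eq hid
      have : l = l' := Subtype.ext (funext fun i => i.elim0)
      rw [this, h2]
    have h1 : 0 < ∏ j : Fin p, placeWt p j := Finset.prod_pos fun j _ => placeWt_pos _ _
    have h2 : 0 < vand (fun j : Fin p => (j : ℕ)) := vand_pos fun i j h => h
    rw [dim_zero, hc]
    simp only [dimConst, Nat.zero_add]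
    field_simp
    simp
  | succ N ih =>
    rw [dim_succ hl]
    have h := sum_interlaces_slater hl (fun j u => (descPochhammer ℝ j).eval u)
    rw [slater_downOp_descPochhammer] at h
    simp only [slater_descPochhammer] at h
    have e : ∀ l' ∈ box p N, (if Interlaces l' l then (Dim l' : ℝ) else 0) = dimConst p N *
        (if Interlaces l' l then vand (config p l') / ∏ j, placeWt (N + p) (config p l' j)
          else 0) := by
      intro l' hl'
      rw [ih (mem_box.1 hl')]
      split_ifs <;> simp
    rw [Finset.sum_congr rfl e, ← Finset.mul_sum, h]
    simp only [dimConst]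
    ring

lemma pDown_nonneg {N : ℕ} (l : Signature N) (m : Signature (N + 1)) : 0 ≤ pDown l m := by
  unfold pDown; split_ifs <;> positivity

lemma pDown_eq_zero {p N : ℕ} {l : Signature N} {m : Signature (N + 1)} (hl : ¬ IsBoxed p l)
    (hm : IsBoxed p m) : pDown l m = 0 := if_neg fun h => hl (h.isBoxed hm)

/-- The down transition function acts on ratios `det[ψ_j(x_i)] / V(x)` by `downOp`. -/
lemma sum_pDown_slater {p N : ℕ} {m : Signature (N + 1)} (hm : IsBoxed p m)
    (ψ : Fin p → ℝ → ℝ) :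
    ∑ l ∈ box p N, pDown l m * (slater ψ (config p l) / vand (config p l)) =
      (∏ j : Fin p, (((N + p : ℕ) : ℝ) - (j : ℕ)))⁻¹ *
        (slater (fun j => downOp (N + p : ℕ) (ψ j)) (config p m) / vand (config p m)) := by
  classical
  have h := sum_interlaces_slater hm ψ
  have e : ∀ l ∈ box p N, pDown l m * (slater ψ (config p l) / vand (config p l)) =
      dimConst p N / Dim m * (if Interlaces l m then
        slater ψ (config p l) / ∏ j, placeWt (N + p) (config p l j) else 0) := by
    intro l hl
    unfold pDown
    split_ifs
    · rw [dim_eq (mem_box.1 hl)]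
      have := vand_pos (mem_box.1 hl).config_strictMono
      field_simp
    · simp
  have h1 := vand_pos hm.config_strictMono
  have h2 : 0 < ∏ j, placeWt (N + 1 + p) (config p m j) :=
    Finset.prod_pos fun j _ => placeWt_pos _ _
  have h3 := dimConst_pos p N
  have h4 := prod_sub_pos p N
  rw [Finset.sum_congr rfl e, ← Finset.mul_sum, h, dim_eq hm, dimConst]
  field_simp

lemma sum_pDown {p N : ℕ} {m : Signature (N + 1)} (hm : IsBoxed p m) :
    ∑ l ∈ box p N, pDown l m = 1 := by
  have h := sum_pDown_slater hm (fun j u => (descPochhammer ℝ j).eval u)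
  have h4 := prod_sub_pos p N
  have h1 := vand_pos hm.config_strictMono
  rw [slater_downOp_descPochhammer, mul_div_assoc, div_self h1.ne', mul_one,
    inv_mul_cancel₀ h4.ne'] at h
  rw [← h]
  refine Finset.sum_congr rfl fun l hl => ?_
  rw [slater_descPochhammer, div_self (vand_pos (mem_box.1 hl).config_strictMono).ne', mul_one]

/-- The product of the four Gamma functions in `zwMeasure` (for `z = p`, `w = 0`) at a place. -/
def gammaFour (p : ℕ) (z' w' : ℝ) (N x : ℕ) : ℝ :=
  Real.Gamma (p + N - x) * Real.Gamma (x + 1) * Real.Gamma (z' + N - x) * Real.Gamma (w' + x + 1)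

/-- The weight of the Hahn ensemble of holes on level `N`. -/
def hahnWt (p : ℕ) (z' w' : ℝ) (N x : ℕ) : ℝ :=
  Real.Gamma (z' + N - x) * Real.Gamma (w' + x + 1) / placeWt (N + p) x

/-- The normalization of the ensemble of holes. -/
def holeConst (p : ℕ) (z' w' : ℝ) (N : ℕ) : ℝ :=
  (zwConst p 0 z' w' N)⁻¹ * dimConst p N ^ 2 / ∏ x ∈ Finset.range (N + p), gammaFour p z' w' N x

section Positivity

variable {p : ℕ} {z' w' : ℝ}

lemma gammaFour_pos (hz : (p : ℝ) - 1 < z') (hw : -1 < w') {N x : ℕ} (hx : x < N + p) :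
    0 < gammaFour p z' w' N x := by
  have h : (x : ℝ) + 1 ≤ N + p := by exact_mod_cast hx
  have h0 : (0 : ℝ) ≤ x := Nat.cast_nonneg _
  unfold gammaFour
  refine mul_pos (mul_pos (mul_pos ?_ ?_) ?_) ?_ <;> apply Real.Gamma_pos_of_pos <;> linarith

lemma hahnWt_pos (hz : (p : ℝ) - 1 < z') (hw : -1 < w') {N x : ℕ} (hx : x < N + p) :
    0 < hahnWt p z' w' N x := by
  have h : (x : ℝ) + 1 ≤ N + p := by exact_mod_cast hx
  have h0 : (0 : ℝ) ≤ x := Nat.cast_nonneg _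
  unfold hahnWt
  refine div_pos (mul_pos ?_ ?_) (placeWt_pos _ _) <;> apply Real.Gamma_pos_of_pos <;> linarith

lemma gammaFour_div {N x : ℕ} (hx : x < N + p) :
    gammaFour p z' w' N x / placeWt (N + p) x ^ 2 = hahnWt p z' w' N x := by
  have h1 : Real.Gamma (p + N - x) = ((N + p - 1 - x)! : ℝ) := by
    rw [← Real.Gamma_nat_eq_factorial]
    congr 1
    have : ((N + p - 1 - x : ℕ) : ℝ) = N + p - 1 - x := by
      rw [show N + p - 1 - x = N + p - (1 + x) by omega,
        Nat.cast_sub (show 1 + x ≤ N + p by omega)]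
      push_cast; ring
    rw [this]; ring
  unfold gammaFour hahnWt
  rw [h1, Real.Gamma_nat_eq_factorial]
  have := placeWt_pos (N + p) x
  have e : placeWt (N + p) x = (x ! : ℝ) * ((N + p - 1 - x)! : ℝ) := rfl
  rw [div_eq_div_iff (by positivity) this.ne', e]
  ring

lemma zwConst_factor_pos (hz : (p : ℝ) - 1 < z') (hw : -1 < w')
    (hp : p = 0 → z' + w' ≠ -1) {i : ℕ} (hi : 1 ≤ i) :
    0 < Real.Gamma (p + z' + w' + i) / Real.Gamma (z' + w' + i) := by
  have hi' : (1 : ℝ) ≤ i := by exact_mod_cast hi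
  rcases Nat.eq_zero_or_pos p with rfl | h
  · have hne : Real.Gamma (z' + w' + i) ≠ 0 := by
      apply Real.Gamma_ne_zero
      intro m hm
      have := hp rfl
      have hm0 : (0 : ℝ) ≤ m := Nat.cast_nonneg _
      simp only [Nat.cast_zero] at hz
      rcases Nat.lt_or_ge i 2 with h2 | h2
      · obtain rfl : i = 1 := by omega
        rcases Nat.eq_zero_or_pos m with rfl | h3
        · apply this; push_cast at hm; linarith
        · have : (1 : ℝ) ≤ m := by exact_mod_cast h3
          push_cast at hm; linarith
      · have : (2 : ℝ) ≤ i := by exact_mod_cast h2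
        linarith
    simp [div_self hne]
  · have : (1 : ℝ) ≤ p := by exact_mod_cast h
    apply div_pos <;> apply Real.Gamma_pos_of_pos <;> linarith

lemma zwConst_succ (N : ℕ) : zwConst p 0 z' w' (N + 1) = zwConst p 0 z' w' N *
    (Real.Gamma (p + z' + w' + (N + 1 : ℕ)) / Real.Gamma (z' + w' + (N + 1 : ℕ)) /
      (Real.Gamma (p + N + 1) * Real.Gamma (p + w' + N + 1) * Real.Gamma (z' + N + 1) *
        Real.Gamma (N + 1))) := by
  unfold zwConst
  rw [Finset.prod_Icc_succ_top (by omega)]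
  congr 1
  push_cast
  simp only [add_zero, ← add_assoc]
  rw [div_div]
  congr 1
  ring

lemma zwConst_pos (hz : (p : ℝ) - 1 < z') (hw : -1 < w')
    (hp : p = 0 → z' + w' ≠ -1) (N : ℕ) : 0 < zwConst p 0 z' w' N := by
  induction N with
  | zero => simp [zwConst]
  | succ N ih =>
    rw [zwConst_succ]
    have h0 : (0 : ℝ) ≤ p := Nat.cast_nonneg _
    have h1 : (0 : ℝ) ≤ N := Nat.cast_nonneg _
    refine mul_pos ih (div_pos (zwConst_factor_pos hz hw hp (by omega)) ?_)
    refine mul_pos (mul_pos (mul_pos ?_ ?_) ?_) ?_ <;> apply Real.Gamma_pos_of_pos <;> linarith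

lemma holeConst_pos (hz : (p : ℝ) - 1 < z') (hw : -1 < w')
    (hp : p = 0 → z' + w' ≠ -1) (N : ℕ) : 0 < holeConst p z' w' N :=
  div_pos (mul_pos (inv_pos.2 (zwConst_pos hz hw hp N)) (pow_pos (dimConst_pos p N) 2))
    (Finset.prod_pos fun _ hx => gammaFour_pos hz hw (Finset.mem_range.1 hx))

lemma prod_particle_mul_prod_config {N : ℕ} {l : Signature N} (hl : IsBoxed p l) (G : ℕ → ℝ) :
    (∏ i, G (particle l i).toNat) * ∏ j, G (config p l j) = ∏ x ∈ Finset.range (N + p), G x := by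
  classical
  have hinj : Function.Injective fun i => (particle l i).toNat := by
    intro i j hij
    have := hl.particle_nonneg i; have := hl.particle_nonneg j
    exact (particle_strictAnti l).injective (by simp only at hij; omega)
  rw [← Finset.prod_image (f := G) (s := Finset.univ) (g := fun i => (particle l i).toNat)
      hinj.injOn,
    ← Finset.prod_image (f := G) (s := Finset.univ) (g := config p l)
      hl.config_strictMono.injective.injOn, ← Finset.prod_union]
  · congr 1
    ext x
    simp only [Finset.mem_union, Finset.mem_image, Finset.mem_univ, true_and, Finset.mem_range,
      hl.mem_range_config, mem_holes]
    constructor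
    · rintro (⟨i, rfl⟩ | h)
      · have := hl.particle_nonneg i; have := hl.particle_lt i; omega
      · exact h.1
    · intro hx
      by_cases hex : ∃ i, (x : ℤ) = particle l i
      · obtain ⟨i, hi⟩ := hex
        exact Or.inl ⟨i, by omega⟩
      · push Not at hex
        exact Or.inr ⟨hx, hex⟩
  · rw [Finset.disjoint_left]
    intro x hx hx'
    simp only [Finset.mem_image, Finset.mem_univ, true_and, hl.mem_range_config, mem_holes]
      at hx hx'
    obtain ⟨i, rfl⟩ := hx
    have := hl.particle_nonneg i
    exact hx'.2 i (by omega)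

/-- The measure `M_N` in terms of holes: a Hahn orthogonal polynomial ensemble. -/
lemma zwMeasure_eq (hz : (p : ℝ) - 1 < z') (hw : -1 < w') {N : ℕ} {l : Signature N}
    (hl : IsBoxed p l) : zwMeasure p 0 z' w' N l =
      holeConst p z' w' N * (vand (config p l) ^ 2 * ∏ j, hahnWt p z' w' N (config p l j)) := by
  have h1 : ∀ i : Fin N, Real.Gamma (p - l.1 i + ((i : ℕ) + 1)) *
        Real.Gamma (0 + N + 1 + l.1 i - ((i : ℕ) + 1)) *
        Real.Gamma (z' - l.1 i + ((i : ℕ) + 1)) *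
        Real.Gamma (w' + N + 1 + l.1 i - ((i : ℕ) + 1)) =
      gammaFour p z' w' N (particle l i).toNat := fun i => by
    have h : (((particle l i).toNat : ℕ) : ℝ) = l.1 i - ((i : ℕ) + 1) + N := by
      have h2 : (((particle l i).toNat : ℕ) : ℤ) = l.1 i - ((i : ℕ) + 1) + N := by
        rw [Int.toNat_of_nonneg (hl.particle_nonneg i)]; rfl
      exact_mod_cast h2
    unfold gammaFour
    rw [h]
    ring_nf
  have hG := prod_particle_mul_prod_config hl (gammaFour p z' w' N)
  have hpos1 : 0 < ∏ j, gammaFour p z' w' N (config p l j) :=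
    Finset.prod_pos fun j _ => gammaFour_pos hz hw (config_lt p l j)
  have hpos2 : 0 < ∏ i, gammaFour p z' w' N (particle l i).toNat :=
    Finset.prod_pos fun i _ => gammaFour_pos hz hw (by
      have := hl.particle_nonneg i; have := hl.particle_lt i; omega)
  have hpos3 : 0 < ∏ j, placeWt (N + p) (config p l j) :=
    Finset.prod_pos fun j _ => placeWt_pos _ _
  unfold zwMeasure holeConst
  rw [Finset.prod_congr rfl fun i _ => congrArg _ (h1 i), Finset.prod_inv_distrib, dim_eq hl,
    ← hG, ← Finset.prod_congr rfl fun j _ => gammaFour_div (z' := z') (w' := w') (config_lt p l j),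
    Finset.prod_div_distrib, Finset.prod_pow]
  field_simp

lemma zwMeasure_eq_zero {N : ℕ} {l : Signature N} (hl : ¬ IsBoxed p l) :
    zwMeasure p 0 z' w' N l = 0 := by
  unfold IsBoxed at hl
  push Not at hl
  obtain ⟨i, hi⟩ := hl
  have hanti := l.2
  unfold zwMeasure
  by_cases h0 : 0 ≤ l.1 i
  · -- the first part exceeds `p`, so that the first Gamma function has a pole
    have h1 := hi h0
    have hN : 0 < N := i.pos
    rw [Finset.prod_eq_zero (Finset.mem_univ (⟨0, hN⟩ : Fin N)), mul_zero]
    have h2 : l.1 i ≤ l.1 ⟨0, hN⟩ := hanti (by rw [Fin.le_def]; simp)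
    obtain ⟨k, hk⟩ := Int.eq_ofNat_of_zero_le (show 0 ≤ l.1 ⟨0, hN⟩ - p - 1 by omega)
    have h3 : Real.Gamma (p - l.1 ⟨0, hN⟩ + (((⟨0, hN⟩ : Fin N) : ℕ) + 1)) = 0 := by
      have e : (p : ℝ) - l.1 ⟨0, hN⟩ + (((⟨0, hN⟩ : Fin N) : ℕ) + 1) = -(k : ℕ) := by
        have : (l.1 ⟨0, hN⟩ : ℝ) - p - 1 = k := by exact_mod_cast hk
        simp only [Nat.cast_zero, ← this]; ring
      rw [e]; exact Real.Gamma_neg_nat_eq_zero k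
    rw [h3]; simp
  · have hN : 0 < N := i.pos
    set j : Fin N := ⟨N - 1, by omega⟩ with hj
    rw [Finset.prod_eq_zero (Finset.mem_univ j), mul_zero]
    have h2 : l.1 j ≤ l.1 i := hanti (by rw [Fin.le_def]; simp [hj]; omega)
    obtain ⟨k, hk⟩ := Int.eq_ofNat_of_zero_le (show 0 ≤ -l.1 j - 1 by omega)
    have h3 : Real.Gamma (0 + N + 1 + l.1 j - ((j : ℕ) + 1)) = 0 := by
      have e : (0 : ℝ) + N + 1 + l.1 j - ((j : ℕ) + 1) = -(k : ℕ) := by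
        have h4 : -(l.1 j : ℝ) - 1 = k := by exact_mod_cast hk
        have h5 : ((j : ℕ) : ℝ) = N - 1 := by
          simp only [hj]; rw [Nat.cast_sub (by omega)]; simp
        rw [← h4, h5]; ring
      rw [e]; exact Real.Gamma_neg_nat_eq_zero k
    rw [h3]; simp

lemma zwMeasure_pos (hz : (p : ℝ) - 1 < z') (hw : -1 < w')
    (hp : p = 0 → z' + w' ≠ -1) {N : ℕ} {l : Signature N} (hl : IsBoxed p l) :
    0 < zwMeasure p 0 z' w' N l := by
  rw [zwMeasure_eq hz hw hl]
  exact mul_pos (holeConst_pos hz hw hp N) (mul_pos (pow_pos (vand_pos hl.config_strictMono) 2)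
    (Finset.prod_pos fun j _ => hahnWt_pos hz hw (config_lt p l j)))

lemma gamma_add_nat_eq (x : ℝ) (k : ℕ) (h : ∀ j < k, x + j ≠ 0) :
    Real.Gamma (x + k) = (∏ j ∈ Finset.range k, (x + j)) * Real.Gamma x := by
  induction k with
  | zero => simp
  | succ k ih =>
    rw [Nat.cast_succ, ← add_assoc, Real.Gamma_add_one (h k (by omega)),
      ih fun j hj => h j (by omega), Finset.prod_range_succ]
    ring

/-- The recursion of the normalization constants, which expresses coherence. -/
lemma holeConst_succ (hz : (p : ℝ) - 1 < z') (hw : -1 < w')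
    (hp : p = 0 → z' + w' ≠ -1) (N : ℕ) :
    holeConst p z' w' (N + 1) * (∏ j : Fin p, (((N + p : ℕ) : ℝ) - (j : ℕ)))⁻¹ *
      (∏ j : Fin p, (w' + 1 + (z' + N) + (j : ℕ))) = holeConst p z' w' N := by
  have h0 : (0 : ℝ) ≤ p := Nat.cast_nonneg _
  have h1 : (0 : ℝ) ≤ N := Nat.cast_nonneg _
  have hA : ∏ j : Fin p, (((N + p : ℕ) : ℝ) - (j : ℕ)) =
      Real.Gamma (p + N + 1) / Real.Gamma (N + 1) := by
    have hpos : 0 < Real.Gamma ((N : ℝ) + 1) := Real.Gamma_pos_of_pos (by linarith)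
    rw [eq_div_iff hpos.ne', show (p : ℝ) + N + 1 = (N + 1 : ℝ) + p by ring,
      gamma_add_nat_eq _ _ fun j _ => by positivity,
      Fin.prod_univ_eq_prod_range fun j : ℕ => (((N + p : ℕ) : ℝ) - j), ← Finset.prod_range_reflect]
    congr 1
    refine Finset.prod_congr rfl fun j hj => ?_
    have hj' := Finset.mem_range.1 hj
    rw [show p - 1 - j = p - (1 + j) by omega, Nat.cast_sub (by omega)]
    push_cast; ring
  set r := Real.Gamma (p + z' + w' + (N + 1 : ℕ)) / Real.Gamma (z' + w' + (N + 1 : ℕ)) with hr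
  have hrpos : 0 < r := zwConst_factor_pos hz hw hp (by omega)
  have hB : ∏ j : Fin p, (w' + 1 + (z' + N) + (j : ℕ)) = r := by
    have hne : Real.Gamma (z' + w' + (N + 1 : ℕ)) ≠ 0 := fun h => by
      rw [hr, h, div_zero] at hrpos; exact lt_irrefl _ hrpos
    rw [hr, eq_div_iff hne,
      show (p : ℝ) + z' + w' + (N + 1 : ℕ) = (z' + w' + (N + 1 : ℕ)) + p by ring,
      gamma_add_nat_eq (z' + w' + (N + 1 : ℕ)) p,
      Fin.prod_univ_eq_prod_range fun j : ℕ => (w' + 1 + (z' + N) + (j : ℝ))]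
    · congr 1
      refine Finset.prod_congr rfl fun j _ => ?_
      push_cast; ring
    · intro j hj
      have : (1 : ℝ) ≤ p := by exact_mod_cast (show 1 ≤ p by omega)
      have : (0 : ℝ) ≤ j := Nat.cast_nonneg _
      apply ne_of_gt
      push_cast; linarith
  have hG : ∏ x ∈ Finset.range (N + 1 + p), gammaFour p z' w' (N + 1) x =
      (∏ x ∈ Finset.range (N + p), gammaFour p z' w' N x) *
        (Real.Gamma (p + N + 1) * Real.Gamma (p + N + 1) * Real.Gamma (z' + N + 1) *
          Real.Gamma (p + w' + N + 1)) := by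
    unfold gammaFour
    simp only [Finset.prod_mul_distrib]
    rw [show N + 1 + p = N + p + 1 by ring, Finset.prod_range_succ' (fun x : ℕ =>
      Real.Gamma (p + (N + 1 : ℕ) - x)), Finset.prod_range_succ' (fun x : ℕ =>
      Real.Gamma (z' + (N + 1 : ℕ) - x)), Finset.prod_range_succ, Finset.prod_range_succ]
    push_cast
    have e1 : ∀ x : ℕ, (p : ℝ) + (N + 1) - (x + 1) = p + N - x := fun x => by ring
    have e2 : ∀ x : ℕ, z' + ((N : ℝ) + 1) - (x + 1) = z' + N - x := fun x => by ring
    simp only [e1, e2]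
    ring_nf
  have g1 : 0 < Real.Gamma ((p : ℝ) + N + 1) := Real.Gamma_pos_of_pos (by linarith)
  have g2 : 0 < Real.Gamma ((p : ℝ) + w' + N + 1) := Real.Gamma_pos_of_pos (by linarith)
  have g3 : 0 < Real.Gamma (z' + N + 1) := Real.Gamma_pos_of_pos (by linarith)
  have g4 : 0 < Real.Gamma ((N : ℝ) + 1) := Real.Gamma_pos_of_pos (by linarith)
  have g5 : 0 < ∏ x ∈ Finset.range (N + p), gammaFour p z' w' N x :=
    Finset.prod_pos fun _ hx => gammaFour_pos hz hw (Finset.mem_range.1 hx)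
  have g6 := zwConst_pos hz hw hp N
  unfold holeConst
  rw [hG, zwConst_succ, dimConst, hB, hA, ← hr]
  field_simp

/-- The one-step weights up the graph are those of independent particles. -/
lemma hahnWt_mul_placeWt_div (hz : (p : ℝ) - 1 < z') (hw : -1 < w') {N x y : ℕ} (hx : x < N + p)
    (h : x ≤ y ∧ y ≤ x + 1) :
    hahnWt p z' w' (N + 1) y * (placeWt (N + 1 + p) y / placeWt (N + p) x) =
      hahnWt p z' w' N x * (if x < y then x + (w' + 1) else z' + N - x) := by
  have hx' : (x : ℝ) + 1 ≤ N + p := by exact_mod_cast hx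
  have h0 : (0 : ℝ) ≤ x := Nat.cast_nonneg _
  have h1 := placeWt_pos (N + 1 + p) y
  have h2 := placeWt_pos (N + p) x
  unfold hahnWt
  rw [div_mul_div_cancel₀ h1.ne', div_mul_eq_mul_div]
  congr 1
  split_ifs with hlt
  · obtain rfl : y = x + 1 := by omega
    have e : w' + ((x + 1 : ℕ) : ℝ) + 1 = (w' + x + 1) + 1 := by push_cast; ring
    rw [e, Real.Gamma_add_one (by linarith)]
    push_cast
    ring_nf
  · obtain rfl : y = x := by omega
    have e : z' + ((N + 1 : ℕ) : ℝ) - y = (z' + N - y) + 1 := by push_cast; ring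
    rw [e, Real.Gamma_add_one (by linarith)]
    ring

/-- Going up from `l`, ratios `det[χ_j(y_i)] / V(y)` are transformed by `upOp`. -/
lemma sum_up_zwMeasure (hz : (p : ℝ) - 1 < z') (hw : -1 < w')
    (hp : p = 0 → z' + w' ≠ -1) {N : ℕ} {l : Signature N} (hl : IsBoxed p l)
    (χ : Fin p → ℝ → ℝ) :
    ∑ m ∈ box p (N + 1), pDown l m * zwMeasure p 0 z' w' (N + 1) m *
        (slater χ (config p m) / vand (config p m)) =
      (∏ j : Fin p, (w' + 1 + (z' + N) + (j : ℕ)))⁻¹ * zwMeasure p 0 z' w' N l *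
        (slater (fun j => upOp (w' + 1) (z' + N) (χ j)) (config p l) / vand (config p l)) := by
  classical
  have hV := vand_pos hl.config_strictMono
  have hA := prod_sub_pos p N
  have hB : 0 < ∏ j : Fin p, (w' + 1 + (z' + N) + (j : ℕ)) := by
    refine Finset.prod_pos fun j _ => ?_
    have : (1 : ℝ) ≤ p := by exact_mod_cast (show 1 ≤ p from j.pos)
    have h1 : (0 : ℝ) ≤ N := Nat.cast_nonneg _
    have h2 : (0 : ℝ) ≤ (j : ℕ) := Nat.cast_nonneg _
    linarith
  have hc := dimConst_pos p N
  have hpl : 0 < ∏ j, placeWt (N + p) (config p l j) := Finset.prod_pos fun j _ => placeWt_pos _ _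
  have hWl : 0 < ∏ j, hahnWt p z' w' N (config p l j) :=
    Finset.prod_pos fun j _ => hahnWt_pos hz hw (config_lt p l j)
  have e : ∀ m ∈ box p (N + 1), pDown l m * zwMeasure p 0 z' w' (N + 1) m *
        (slater χ (config p m) / vand (config p m)) =
      holeConst p z' w' (N + 1) * (∏ j : Fin p, (((N + p : ℕ) : ℝ) - (j : ℕ)))⁻¹ *
        vand (config p l) * (∏ j, hahnWt p z' w' N (config p l j)) *
        (fun y : Fin p → ℕ => if ∀ j, config p l j ≤ y j ∧ y j ≤ config p l j + 1 then
          (∏ j, if config p l j < y j then (config p l j + (w' + 1) : ℝ)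
            else z' + N - config p l j) * slater χ y else 0) (config p m) := by
    intro m hm
    have hm' := mem_box.1 hm
    have hVm := vand_pos hm'.config_strictMono
    have hpm : 0 < ∏ j, placeWt (N + 1 + p) (config p m j) :=
      Finset.prod_pos fun j _ => placeWt_pos _ _
    unfold pDown
    simp only [interlaces_iff_config hl hm']
    split_ifs with h
    · have hw' := Finset.prod_congr (rfl : (Finset.univ : Finset (Fin p)) = Finset.univ)
        fun j _ => hahnWt_mul_placeWt_div hz hw (config_lt p l j) (h j)
      simp only [Finset.prod_mul_distrib, Finset.prod_div_distrib] at hw'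
      have hw2 := eq_div_of_mul_eq (by positivity) hw'
      rw [zwMeasure_eq hz hw hm', hw2, dim_eq hl, dim_eq hm', dimConst]
      field_simp
    · simp
  have hs := sum_box (p := p) (N := N + 1) (fun y : Fin p → ℕ =>
    if ∀ j, config p l j ≤ y j ∧ y j ≤ config p l j + 1 then
          (∏ j, if config p l j < y j then (config p l j + (w' + 1) : ℝ)
            else z' + N - config p l j) * slater χ y else 0)
  rw [Finset.sum_congr rfl e, ← Finset.mul_sum, hs, show N + 1 + p = N + p + 1 by ring,
    sum_up_slater (w' + 1) (z' + N) χ hl.config_mem, zwMeasure_eq hz hw hl,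
    ← holeConst_succ hz hw hp N]
  field_simp

end Positivity


/-! ### Coherence and the up-down transition function -/

section Coherence

variable {p : ℕ} {z' w' : ℝ}

lemma zwMeasure_nonneg (hz : (p : ℝ) - 1 < z') (hw : -1 < w')
    (hp : p = 0 → z' + w' ≠ -1) {N : ℕ} (l : Signature N) : 0 ≤ zwMeasure p 0 z' w' N l := by
  by_cases h : IsBoxed p l
  · exact (zwMeasure_pos hz hw hp h).le
  · exact (zwMeasure_eq_zero h).ge

lemma prod_up_pos (hz : (p : ℝ) - 1 < z') (hw : -1 < w') (N : ℕ) :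
    0 < ∏ j : Fin p, (w' + 1 + (z' + N) + (j : ℕ)) := by
  refine Finset.prod_pos fun j _ => ?_
  have : (1 : ℝ) ≤ p := by exact_mod_cast (show 1 ≤ p from j.pos)
  have h1 : (0 : ℝ) ≤ N := Nat.cast_nonneg _
  have h2 : (0 : ℝ) ≤ (j : ℕ) := Nat.cast_nonneg _
  linarith

lemma sum_pDown_mul_zwMeasure (hz : (p : ℝ) - 1 < z') (hw : -1 < w')
    (hp : p = 0 → z' + w' ≠ -1) {N : ℕ} {l : Signature N} (hl : IsBoxed p l) :
    ∑ m ∈ box p (N + 1), pDown l m * zwMeasure p 0 z' w' (N + 1) m = zwMeasure p 0 z' w' N l := by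
  have h := sum_up_zwMeasure hz hw hp hl (fun j u => (descPochhammer ℝ j).eval u)
  have hV := vand_pos hl.config_strictMono
  have hB := prod_up_pos hz hw N
  rw [slater_upOp_descPochhammer, mul_div_assoc, div_self hV.ne', mul_one] at h
  rw [show (∏ j : Fin p, (w' + 1 + (z' + N) + (j : ℕ)))⁻¹ * zwMeasure p 0 z' w' N l *
    (∏ j : Fin p, (w' + 1 + (z' + N) + (j : ℕ))) = zwMeasure p 0 z' w' N l by field_simp] at h
  rw [← h]
  refine Finset.sum_congr rfl fun m hm => ?_
  rw [slater_descPochhammer, div_self (vand_pos (mem_box.1 hm).config_strictMono).ne', mul_one]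

lemma sum_zwMeasure (hz : (p : ℝ) - 1 < z') (hw : -1 < w')
    (hp : p = 0 → z' + w' ≠ -1) (N : ℕ) : ∑ l ∈ box p N, zwMeasure p 0 z' w' N l = 1 := by
  induction N with
  | zero =>
    have l₀ : Signature 0 := ⟨fun i => i.elim0, fun i => i.elim0⟩
    have hs : ∀ l l' : Signature 0, l = l' := fun l l' => Subtype.ext (funext fun i => i.elim0)
    rw [Finset.sum_eq_single_of_mem l₀ (mem_box.2 fun i => i.elim0)
      fun l _ hl => absurd (hs l l₀) hl]
    simp [zwMeasure, zwConst, dim_zero]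
  | succ N ih =>
    have e : ∀ l ∈ box p N, zwMeasure p 0 z' w' N l =
        ∑ m ∈ box p (N + 1), pDown l m * zwMeasure p 0 z' w' (N + 1) m := fun l hl =>
      (sum_pDown_mul_zwMeasure hz hw hp (mem_box.1 hl)).symm
    rw [← ih, Finset.sum_congr rfl e, Finset.sum_comm]
    refine Finset.sum_congr rfl fun m hm => ?_
    rw [← Finset.sum_mul, sum_pDown (mem_box.1 hm), one_mul]

theorem isCoherentSystem_zwMeasure (hz : (p : ℝ) - 1 < z') (hw : -1 < w')
    (hp : p = 0 → z' + w' ≠ -1) : IsCoherentSystem (zwMeasure p 0 z' w') where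
  nonneg _ l := zwMeasure_nonneg hz hw hp l
  hasSum_one N := by
    rw [← sum_zwMeasure hz hw hp N]
    exact hasSum_sum_of_ne_finset_zero fun l hl =>
      zwMeasure_eq_zero fun h => hl (mem_box.2 h)
  coherent N l := by
    have h : ∀ m ∉ box p (N + 1), pDown l m * zwMeasure p 0 z' w' (N + 1) m = 0 := fun m hm => by
      rw [zwMeasure_eq_zero fun h => hm (mem_box.2 h), mul_zero]
    by_cases hl : IsBoxed p l
    · rw [← sum_pDown_mul_zwMeasure hz hw hp hl]
      exact hasSum_sum_of_ne_finset_zero h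
    · rw [zwMeasure_eq_zero hl]
      convert! hasSum_zero using 2 with m
      by_cases hm : IsBoxed p m
      · rw [pDown_eq_zero hl hm, zero_mul]
      · exact h m fun h => hm (mem_box.1 h)

/-- The transition function is reversible with respect to `M_N`: the expression on the right,
multiplied by `M_N(l')`, is symmetric. -/
lemma pUpDown_zwMeasure {N : ℕ} (l l' : Signature N) :
    pUpDown (zwMeasure p 0 z' w') l l' = (zwMeasure p 0 z' w' N l')⁻¹ *
      ∑ m ∈ box p (N + 1), pDown l m * (zwMeasure p 0 z' w' (N + 1) m * pDown l' m) := by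
  classical
  unfold pUpDown pUp
  rw [tsum_subtype (Function.support (zwMeasure p 0 z' w' (N + 1))) (fun m => pDown l m *
    (zwMeasure p 0 z' w' (N + 1) m / zwMeasure p 0 z' w' N l' * pDown l' m)),
    tsum_eq_sum (s := box p (N + 1)), Finset.mul_sum]
  · refine Finset.sum_congr rfl fun m _ => ?_
    rw [Set.indicator_apply]
    split_ifs with h
    · ring
    · rw [Function.notMem_support.1 h]; ring
  · intro m hm
    exact Set.indicator_of_notMem (Function.notMem_support.2
      (zwMeasure_eq_zero fun h' => hm (mem_box.2 h'))) _

lemma pUpDown_nonneg (hz : (p : ℝ) - 1 < z') (hw : -1 < w')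
    (hp : p = 0 → z' + w' ≠ -1) {N : ℕ} (l l' : Signature N) :
    0 ≤ pUpDown (zwMeasure p 0 z' w') l l' := by
  rw [pUpDown_zwMeasure]
  exact mul_nonneg (inv_nonneg.2 (zwMeasure_nonneg hz hw hp _)) (Finset.sum_nonneg fun m _ =>
    mul_nonneg (pDown_nonneg _ _) (mul_nonneg (zwMeasure_nonneg hz hw hp _) (pDown_nonneg _ _)))

lemma pUpDown_eq_zero {N : ℕ} {l l' : Signature N} (hl : ¬ IsBoxed p l) :
    pUpDown (zwMeasure p 0 z' w') l l' = 0 := by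
  rw [pUpDown_zwMeasure, Finset.sum_eq_zero, mul_zero]
  intro m hm
  rw [pDown_eq_zero hl (mem_box.1 hm), zero_mul]

lemma sum_pUpDown (hz : (p : ℝ) - 1 < z') (hw : -1 < w')
    (hp : p = 0 → z' + w' ≠ -1) {N : ℕ} {l' : Signature N} (hl' : IsBoxed p l') :
    ∑ l ∈ box p N, pUpDown (zwMeasure p 0 z' w') l l' = 1 := by
  simp_rw [pUpDown_zwMeasure]
  rw [← Finset.mul_sum, Finset.sum_comm, inv_mul_eq_one₀ (zwMeasure_pos hz hw hp hl').ne',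
    ← sum_pDown_mul_zwMeasure hz hw hp hl']
  refine Finset.sum_congr rfl fun m hm => ?_
  rw [← Finset.sum_mul, sum_pDown (mem_box.1 hm)]
  ring

/-- The one-particle operator of one step of the up-down chain. -/
def stepOp (p : ℕ) (z' w' : ℝ) (N : ℕ) (ψ : ℝ → ℝ) : ℝ → ℝ :=
  upOp (w' + 1) (z' + N) (downOp (N + p : ℕ) ψ)

/-- The eigenvalue of the product of the one-particle operators on the Vandermonde determinant. -/
def stepNorm (p : ℕ) (z' w' : ℝ) (N : ℕ) : ℝ :=
  ∏ j : Fin p, ((((N + p : ℕ) : ℝ) - (j : ℕ)) * (w' + 1 + (z' + N) + (j : ℕ)))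

/-- One step of the up-down chain acts on densities `det[ψ_j(x_i)] / V(x)` by `stepOp`. -/
lemma sum_pUpDown_slater (hz : (p : ℝ) - 1 < z') (hw : -1 < w')
    (hp : p = 0 → z' + w' ≠ -1) {N : ℕ} {l : Signature N} (hl : IsBoxed p l)
    (ψ : Fin p → ℝ → ℝ) :
    ∑ l' ∈ box p N, pUpDown (zwMeasure p 0 z' w') l l' *
        (zwMeasure p 0 z' w' N l' * (slater ψ (config p l') / vand (config p l'))) =
      (stepNorm p z' w' N)⁻¹ * (zwMeasure p 0 z' w' N l *
        (slater (fun j => stepOp p z' w' N (ψ j)) (config p l) / vand (config p l))) := by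
  have e : ∀ l' ∈ box p N, pUpDown (zwMeasure p 0 z' w') l l' *
        (zwMeasure p 0 z' w' N l' * (slater ψ (config p l') / vand (config p l'))) =
      ∑ m ∈ box p (N + 1), pDown l m * zwMeasure p 0 z' w' (N + 1) m * (pDown l' m *
        (slater ψ (config p l') / vand (config p l'))) := by
    intro l' hl'
    have := zwMeasure_pos hz hw hp (mem_box.1 hl')
    rw [pUpDown_zwMeasure, Finset.mul_sum, Finset.sum_mul]
    refine Finset.sum_congr rfl fun m _ => ?_
    field_simp
  rw [Finset.sum_congr rfl e, Finset.sum_comm]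
  have e2 : ∀ m ∈ box p (N + 1), ∑ l' ∈ box p N, pDown l m * zwMeasure p 0 z' w' (N + 1) m *
      (pDown l' m * (slater ψ (config p l') / vand (config p l'))) =
      (∏ j : Fin p, (((N + p : ℕ) : ℝ) - (j : ℕ)))⁻¹ * (pDown l m *
        zwMeasure p 0 z' w' (N + 1) m *
        (slater (fun j => downOp (N + p : ℕ) (ψ j)) (config p m) / vand (config p m))) := by
    intro m hm
    rw [← Finset.mul_sum, sum_pDown_slater (mem_box.1 hm)]
    ring
  rw [Finset.sum_congr rfl e2, ← Finset.mul_sum, sum_up_zwMeasure hz hw hp hl]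
  unfold stepNorm stepOp
  rw [Finset.prod_mul_distrib, mul_inv]
  ring

lemma sum_pUpDown_mul_zwMeasure (hz : (p : ℝ) - 1 < z') (hw : -1 < w')
    (hp : p = 0 → z' + w' ≠ -1) {N : ℕ} {l : Signature N} (hl : IsBoxed p l) :
    ∑ l' ∈ box p N, pUpDown (zwMeasure p 0 z' w') l l' * zwMeasure p 0 z' w' N l' =
      zwMeasure p 0 z' w' N l := by
  have e : ∀ l' ∈ box p N, pUpDown (zwMeasure p 0 z' w') l l' * zwMeasure p 0 z' w' N l' =
      ∑ m ∈ box p (N + 1), pDown l m * zwMeasure p 0 z' w' (N + 1) m * pDown l' m := by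
    intro l' hl'
    have := zwMeasure_pos hz hw hp (mem_box.1 hl')
    rw [pUpDown_zwMeasure, Finset.mul_sum, Finset.sum_mul]
    refine Finset.sum_congr rfl fun m _ => ?_
    field_simp
  rw [Finset.sum_congr rfl e, Finset.sum_comm, ← sum_pDown_mul_zwMeasure hz hw hp hl]
  refine Finset.sum_congr rfl fun m hm => ?_
  rw [← Finset.mul_sum, sum_pDown (mem_box.1 hm), mul_one]

end Coherence

/-! ### Existence of the chains -/

instance (N : ℕ) : DiscreteMeasurableSpace (Signature N) := ⟨fun _ => trivial⟩

instance (N : ℕ) : Countable (Signature N) :=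
  inferInstanceAs (Countable {l : Fin N → ℤ // Antitone l})

/-- The discrete measure with weights `f` on the finite set `B`. -/
def discreteMeasure {S : Type*} [MeasurableSpace S] (B : Finset S) (f : S → ℝ) : Measure S :=
  ∑ x ∈ B, ENNReal.ofReal (f x) • Measure.dirac x

lemma discreteMeasure_singleton {S : Type*} [MeasurableSpace S] [DiscreteMeasurableSpace S]
    {B : Finset S} {f : S → ℝ} (h0 : ∀ x ∉ B, f x = 0) (x : S) :
    discreteMeasure B f {x} = ENNReal.ofReal (f x) := by
  classical
  unfold discreteMeasure
  simp only [Measure.coe_finsetSum, Finset.sum_apply, Measure.smul_apply, smul_eq_mul,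
    Measure.dirac_apply, Set.indicator_apply, Set.mem_singleton_iff, Pi.one_apply, mul_ite,
    mul_one, mul_zero]
  rw [Finset.sum_ite_eq']
  split_ifs with h
  · rfl
  · rw [h0 x h, ENNReal.ofReal_zero]

lemma isProbabilityMeasure_discreteMeasure {S : Type*} [MeasurableSpace S] {B : Finset S}
    {f : S → ℝ} (hf : ∀ x ∈ B, 0 ≤ f x) (h1 : ∑ x ∈ B, f x = 1) :
    IsProbabilityMeasure (discreteMeasure B f) := by
  constructor
  unfold discreteMeasure
  simp only [Measure.coe_finsetSum, Finset.sum_apply, Measure.smul_apply, smul_eq_mul,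
    measure_univ, mul_one]
  rw [← ENNReal.ofReal_sum_of_nonneg hf, h1, ENNReal.ofReal_one]

/-- The chain driven by a family of independent random jumps `ω (some (k, x))`, the jump made at
time `k` from the state `x`; `ω none` is the initial state. -/
def jumpChain {S : Type*} : ℕ → (Option (ℕ × S) → S) → S
  | 0, ω => ω none
  | k + 1, ω => ω (some (k, jumpChain k ω))

lemma measurable_jumpChain {S : Type*} [MeasurableSpace S] [DiscreteMeasurableSpace S]
    [Countable S] (k : ℕ) : Measurable (jumpChain (S := S) k) := by
  induction k with
  | zero => exact measurable_pi_apply _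
  | succ k ih =>
    refine measurable_to_countable' fun x => ?_
    have : (jumpChain (S := S) (k + 1)) ⁻¹' {x} =
        ⋃ y, (jumpChain k ⁻¹' {y} ∩ (fun ω : Option (ℕ × S) → S => ω (some (k, y))) ⁻¹' {x}) := by
      ext ω; simp [jumpChain]
    rw [this]
    exact MeasurableSet.iUnion fun y => (ih (measurableSet_singleton y)).inter
      (measurable_pi_apply _ (measurableSet_singleton x))

lemma forall_jumpChain_eq_iff {S : Type*} (n : ℕ) (l : ℕ → S) (ω : Option (ℕ × S) → S) :
    (∀ k ≤ n, jumpChain k ω = l k) ↔ ω none = l 0 ∧ ∀ k < n, ω (some (k, l k)) = l (k + 1) := by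
  induction n with
  | zero => simp [jumpChain]
  | succ n ih =>
    have h1 : (∀ k ≤ n + 1, jumpChain k ω = l k) ↔
        (∀ k ≤ n, jumpChain k ω = l k) ∧ jumpChain (n + 1) ω = l (n + 1) := by
      constructor
      · exact fun h => ⟨fun k hk => h k (by omega), h _ le_rfl⟩
      · rintro ⟨h, h'⟩ k hk
        rcases Nat.lt_or_ge n k with hlt | hge
        · obtain rfl : k = n + 1 := by omega
          exact h'
        · exact h k hge
    rw [h1]
    constructor
    · rintro ⟨h, h'⟩
      refine ⟨(ih.1 h).1, fun k hk => ?_⟩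
      rcases Nat.lt_or_ge k n with hlt | hge
      · exact (ih.1 h).2 k hlt
      · obtain rfl : k = n := by omega
        rw [← h', jumpChain, h k le_rfl]
    · rintro ⟨h, h'⟩
      have h2 := ih.2 ⟨h, fun k hk => h' k (by omega)⟩
      exact ⟨h2, by rw [jumpChain, h2 n le_rfl, h' n (by omega)]⟩

theorem exists_isUpDownChain {p : ℕ} {z' w' : ℝ} (hz : (p : ℝ) - 1 < z') (hw : -1 < w')
    (hp : p = 0 → z' + w' ≠ -1) (N : ℕ) :
    ∃ (Ω : Type) (_ : MeasurableSpace Ω) (P : Measure Ω) (_ : IsProbabilityMeasure P)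
      (T : ℕ → Ω → Signature N), IsUpDownChain P (zwMeasure p 0 z' w') N T := by
  classical
  set M := zwMeasure p 0 z' w' with hM
  let μ : Option (ℕ × Signature N) → Measure (Signature N) := fun i => i.elim
    (discreteMeasure (box p N) (M N)) fun kx => if IsBoxed p kx.2 then
      discreteMeasure (box p N) (fun l => pUpDown M l kx.2) else Measure.dirac kx.2
  have hμ : ∀ i, IsProbabilityMeasure (μ i) := by
    rintro (_ | ⟨k, x⟩)
    · exact isProbabilityMeasure_discreteMeasure (fun l _ => zwMeasure_nonneg hz hw hp l)
        (sum_zwMeasure hz hw hp N)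
    · simp only [μ, Option.elim]
      split_ifs with h
      · exact isProbabilityMeasure_discreteMeasure (fun l _ => pUpDown_nonneg hz hw hp l x)
          (sum_pUpDown hz hw hp h)
      · infer_instance
  refine ⟨_, inferInstance, Measure.infinitePi μ, inferInstance, jumpChain,
    fun k => measurable_jumpChain k, fun n l => ?_⟩
  have hset : {ω : Option (ℕ × Signature N) → Signature N | ∀ k ≤ n, jumpChain k ω = l k} =
      Set.pi ((insert none ((Finset.range n).image fun k => some (k, l k)) :
        Finset (Option (ℕ × Signature N))) : Set (Option (ℕ × Signature N)))
        (fun i => {i.elim (l 0) fun kx => l (kx.1 + 1)}) := by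
    ext ω
    simp only [Set.mem_ofPred_eq, forall_jumpChain_eq_iff]
    simp [Set.mem_pi]
  rw [Measure.real, hset, Measure.infinitePi_pi μ fun i _ => measurableSet_singleton _,
    Finset.prod_insert (by simp), Finset.prod_image (fun i _ j _ h =>
      (Prod.mk.inj (Option.some.inj h)).1), ENNReal.toReal_mul,
    ENNReal.toReal_prod]
  have h0 : (μ none {l 0}).toReal = M N (l 0) := by
    change (discreteMeasure (box p N) (M N) {l 0}).toReal = _
    rw [discreteMeasure_singleton fun x hx => zwMeasure_eq_zero fun h => hx (mem_box.2 h),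
      ENNReal.toReal_ofReal (zwMeasure_nonneg hz hw hp _)]
  have hstep : ∀ k x y, IsBoxed p x → (μ (some (k, x)) {y}).toReal = pUpDown M y x := by
    intro k x y hx
    simp only [μ, Option.elim, if_pos hx]
    rw [discreteMeasure_singleton fun y hy => pUpDown_eq_zero fun h => hy (mem_box.2 h),
      ENNReal.toReal_ofReal (pUpDown_nonneg hz hw hp _ _)]
  -- off the box the jumps are irrelevant: such states are never reached
  suffices h : (μ none {l 0}).toReal * ∏ k ∈ Finset.range n, (μ (some (k, l k)) {l (k + 1)}).toReal
      = M N (l 0) * ∏ k ∈ Finset.range n, pUpDown M (l (k + 1)) (l k) ∧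
      (¬ IsBoxed p (l n) → M N (l 0) * ∏ k ∈ Finset.range n, pUpDown M (l (k + 1)) (l k) = 0) from
    h.1
  clear hset
  induction n with
  | zero =>
    simp only [Finset.range_zero, Finset.prod_empty, mul_one]
    exact ⟨h0, fun h => zwMeasure_eq_zero h⟩
  | succ n ih =>
    rw [Finset.prod_range_succ, Finset.prod_range_succ, ← mul_assoc, ← mul_assoc, ih.1]
    by_cases hb : IsBoxed p (l n)
    · rw [hstep _ _ _ hb]
      exact ⟨rfl, fun h => by rw [pUpDown_eq_zero h, mul_zero]⟩
    · rw [ih.2 hb]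
      simp


/-! ### The Andréief identity for finite sums -/

/-- Every injective tuple is a permutation of a unique increasing one. -/
lemma exists_perm_strictMono {p : ℕ} {α : Type*} [LinearOrder α] {y : Fin p → α}
    (hy : Function.Injective y) : ∃ σ : Equiv.Perm (Fin p), StrictMono (y ∘ σ) :=
  ⟨Tuple.sort y, (Tuple.monotone_sort y).strictMono_of_injective
    (hy.comp (Tuple.sort y).injective)⟩

lemma strictMono_comp_perm_unique {p : ℕ} {α : Type*} [LinearOrder α] {x x' : Fin p → α}
    (hx : StrictMono x) (hx' : StrictMono x') {σ τ : Equiv.Perm (Fin p)} (h : x ∘ σ = x' ∘ τ) :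
    x = x' ∧ σ = τ := by
  have h1 : x = x' := by
    refine (StrictMono.range_inj hx hx').1 ?_
    rw [← σ.surjective.range_comp x, h, τ.surjective.range_comp]
  refine ⟨h1, Equiv.ext fun i => ?_⟩
  have := congrFun h i
  rw [← h1] at this
  exact hx.injective this

lemma slater_comp_perm {p : ℕ} (ψ : Fin p → ℝ → ℝ) (x : Fin p → ℕ) (σ : Equiv.Perm (Fin p)) :
    slater ψ (x ∘ σ) = (Equiv.Perm.sign σ : ℤ) * slater ψ x := by
  unfold slater
  exact Matrix.det_permute σ (Matrix.of fun i j => ψ j (x i))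

/-- The **Andréief identity** for finite sums. -/
lemma sum_slater_mul_slater {p M : ℕ} (f g : Fin p → ℝ → ℝ) (W : ℕ → ℝ) :
    ∑ x ∈ configs p M, slater f x * slater g x * ∏ i, W (x i) =
      (Matrix.of fun a b => ∑ x ∈ Finset.range M, W x * (f a x * g b x)).det := by
  classical
  -- the right-hand side, expanded over all `p`-tuples by multilinearity
  have hR : (Matrix.of fun a b => ∑ x ∈ Finset.range M, W x * (f a x * g b x)).det =
      ∑ y ∈ Fintype.piFinset fun _ : Fin p => Finset.range M,
        (∏ i, W (y i) * f i (y i)) * slater g y := by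
    have h := (Matrix.detRowAlternating (R := ℝ) (n := Fin p)).toMultilinearMap.map_sum_finset
      (fun i (x : ℕ) b => W x * (f i x * g b x)) (fun _ => Finset.range M)
    have e : (Matrix.of fun a b => ∑ x ∈ Finset.range M, W x * (f a x * g b x)).det =
        (Matrix.detRowAlternating (R := ℝ) (n := Fin p)).toMultilinearMap
          (fun i => ∑ x ∈ Finset.range M, fun b => W x * (f i x * g b x)) := by
      change _ = Matrix.det _
      congr 1
      ext i j
      simp
    rw [e, h]
    refine Finset.sum_congr rfl fun y _ => ?_
    change Matrix.det _ = _
    unfold slater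
    rw [← Matrix.det_mul_column]
    congr 1
    ext i j
    simp only [Matrix.of_apply]
    ring
  have hzero : ∀ y : Fin p → ℕ, ¬ Function.Injective y → slater g y = 0 := by
    intro y hy
    unfold Function.Injective at hy
    push Not at hy
    obtain ⟨i, j, hij, hne⟩ := hy
    exact Matrix.det_zero_of_row_eq hne (by funext k; simp only [Matrix.of_apply, hij])
  have hR2 : ∑ y ∈ (Fintype.piFinset fun _ : Fin p => Finset.range M).filter Function.Injective,
      (∏ i, W (y i) * f i (y i)) * slater g y =
      ∑ y ∈ Fintype.piFinset fun _ : Fin p => Finset.range M,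
        (∏ i, W (y i) * f i (y i)) * slater g y :=
    Finset.sum_filter_of_ne fun y _ hy => by_contra fun h => hy (by rw [hzero y h, mul_zero])
  rw [hR, ← hR2]
  have hL : ∀ x ∈ configs p M, slater f x * slater g x * ∏ i, W (x i) =
      ∑ σ : Equiv.Perm (Fin p), (∏ i, W ((x ∘ σ) i) * f i ((x ∘ σ) i)) * slater g (x ∘ σ) := by
    intro x _
    have : slater f x = ∑ σ : Equiv.Perm (Fin p), (Equiv.Perm.sign σ : ℤ) *
        ∏ i, f i (x (σ i)) := by
      unfold slater
      rw [Matrix.det_apply']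
      simp
    rw [this, Finset.sum_mul, Finset.sum_mul]
    refine Finset.sum_congr rfl fun σ _ => ?_
    rw [slater_comp_perm, Finset.prod_mul_distrib, ← Equiv.prod_comp σ fun i => W (x i)]
    simp only [Function.comp]
    ring
  rw [Finset.sum_congr rfl hL, ← Finset.sum_product']
  refine Finset.sum_bij (fun xσ _ => xσ.1 ∘ xσ.2) ?_ ?_ ?_ fun _ _ => rfl
  · rintro ⟨x, σ⟩ h
    obtain ⟨hx1, hx2⟩ := mem_configs.1 (Finset.mem_product.1 h).1
    simp only [Finset.mem_filter, Fintype.mem_piFinset, Finset.mem_range]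
    exact ⟨fun i => hx1 _, hx2.injective.comp σ.injective⟩
  · rintro ⟨x, σ⟩ h ⟨x', σ'⟩ h' he
    obtain ⟨rfl, rfl⟩ := strictMono_comp_perm_unique (mem_configs.1 (Finset.mem_product.1 h).1).2
      (mem_configs.1 (Finset.mem_product.1 h').1).2 he
    rfl
  · intro y hy
    simp only [Finset.mem_filter, Fintype.mem_piFinset, Finset.mem_range] at hy
    obtain ⟨σ, hσ⟩ := exists_perm_strictMono hy.2
    refine ⟨(y ∘ σ, σ⁻¹), ?_, ?_⟩
    · simp only [Finset.mem_product, Finset.mem_univ, and_true, mem_configs]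
      exact ⟨fun i => hy.1 _, hσ⟩
    · funext i; simp

/-! ### Expectations over paths of the chain -/

section Chain

variable {p : ℕ} {z' w' : ℝ} {N : ℕ} {Ω : Type*} [MeasurableSpace Ω] {P : Measure Ω}
  {T : ℕ → Ω → Signature N}

lemma IsUpDownChain.measurableSet_path (hT : IsUpDownChain P (zwMeasure p 0 z' w') N T)
    (k : ℕ) (l : ℕ → Signature N) : MeasurableSet {ω | ∀ j ≤ k, T j ω = l j} := by
  have : {ω | ∀ j ≤ k, T j ω = l j} = ⋂ j, ⋂ (_ : j ≤ k), T j ⁻¹' {l j} := by ext; simp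
  rw [this]
  exact MeasurableSet.iInter fun j => MeasurableSet.iInter fun _ =>
    hT.measurable j (measurableSet_singleton _)

lemma setIntegral_mul_of_eq {S : Type*} [MeasurableSpace S] [MeasurableSingletonClass S]
    {τ : Ω → S} (hτ : Measurable τ) (G : Ω → ℝ) (F : S → ℝ) (l : S) :
    ∫ ω in τ ⁻¹' {l}, G ω * F (τ ω) ∂P = F l * ∫ ω in τ ⁻¹' {l}, G ω ∂P := by
  rw [← integral_const_mul]
  refine setIntegral_congr_fun (hτ (measurableSet_singleton l)) fun ω hω => ?_
  have : τ ω = l := hω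
  simp only [this]; ring

variable [IsProbabilityMeasure P]

lemma IsUpDownChain.ae_isBoxed (hT : IsUpDownChain P (zwMeasure p 0 z' w') N T) :
    ∀ᵐ ω ∂P, ∀ k, IsBoxed p (T k ω) := by
  rw [ae_all_iff]
  intro k
  have hsub : {ω | ¬ IsBoxed p (T k ω)} ⊆
      ⋃ l : {l : Fin (k + 1) → Signature N // ¬ IsBoxed p (l (Fin.last k))},
        {ω | ∀ j ≤ k, T j ω = l.1 (Fin.ofNat (k + 1) j)} := by
    intro ω hω
    refine Set.mem_iUnion.2 ⟨⟨fun j => T j ω, by simpa using hω⟩, fun j hj => ?_⟩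
    simp [Nat.mod_eq_of_lt (show j < k + 1 by omega)]
  refine measure_mono_null hsub (measure_iUnion_null fun l => ?_)
  have h := hT.law k fun j => l.1 (Fin.ofNat (k + 1) j)
  have hl : ¬ IsBoxed p (l.1 (Fin.ofNat (k + 1) k)) := by
    have : Fin.ofNat (k + 1) k = Fin.last k := by ext; simp
    rw [this]; exact l.2
  have h0 : P.real {ω | ∀ j ≤ k, T j ω = l.1 (Fin.ofNat (k + 1) j)} = 0 := by
    rw [h]
    cases k with
    | zero => rw [zwMeasure_eq_zero hl, zero_mul]
    | succ k => rw [Finset.prod_range_succ, pUpDown_eq_zero hl]; simp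
  exact (measureReal_eq_zero_iff).1 h0

/-- The path in `ℕ` that follows `π` and stays at its last state. -/
def extendPath {S : Type*} {k : ℕ} (π : Fin (k + 1) → S) (j : ℕ) : S := π ⟨min j k, by omega⟩

lemma extendPath_of_le {S : Type*} {k : ℕ} (π : Fin (k + 1) → S) {j : ℕ} (hj : j ≤ k) :
    extendPath π j = π ⟨j, by omega⟩ := by
  unfold extendPath; congr 1; ext; simp [hj]

/-- The expectation of a function of the states up to time `k` on an event is a finite sum over
paths. -/
lemma IsUpDownChain.setIntegral_eq_sum (hT : IsUpDownChain P (zwMeasure p 0 z' w') N T) {k : ℕ}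
    {G : (ℕ → Signature N) → ℝ} (hG : ∀ x y, (∀ j ≤ k, x j = y j) → G x = G y) (A : Set Ω) :
    ∫ ω in A, G (fun j => T j ω) ∂P =
      ∑ π ∈ Fintype.piFinset fun _ : Fin (k + 1) => box p N,
        G (extendPath π) * P.real ({ω | ∀ j ≤ k, T j ω = extendPath π j} ∩ A) := by
  classical
  have hae : (fun ω => G (fun j => T j ω)) =ᵐ[P.restrict A] fun ω =>
      ∑ π ∈ Fintype.piFinset fun _ : Fin (k + 1) => box p N,
        {ω | ∀ j ≤ k, T j ω = extendPath π j}.indicator (fun _ => G (extendPath π)) ω := by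
    filter_upwards [ae_restrict_of_ae hT.ae_isBoxed] with ω hω
    set π₀ : Fin (k + 1) → Signature N := fun j => T j ω with hπ
    rw [Finset.sum_eq_single π₀]
    · rw [Set.indicator_of_mem]
      · exact hG _ _ fun j hj => (extendPath_of_le π₀ hj).symm
      · intro j hj
        rw [extendPath_of_le π₀ hj]
    · intro π _ hne
      refine Set.indicator_of_notMem (fun h => hne ?_) _
      funext j
      have := h j (by omega)
      rw [extendPath_of_le π (by omega)] at this
      exact this.symm
    · intro h
      exact absurd (Fintype.mem_piFinset.2 fun j : Fin (k + 1) => mem_box.2 (hω j)) h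
  rw [integral_congr_ae hae, integral_finsetSum]
  · refine Finset.sum_congr rfl fun π _ => ?_
    rw [integral_indicator_const _ (hT.measurableSet_path k _), smul_eq_mul, mul_comm,
      measureReal_restrict_apply (hT.measurableSet_path k _)]
  · intro π _
    exact (integrable_const _).indicator (hT.measurableSet_path k _)

/-- The Markov property of the chain, for functions of the past. -/
lemma IsUpDownChain.setIntegral_succ (hT : IsUpDownChain P (zwMeasure p 0 z' w') N T) {k : ℕ}
    {G : (ℕ → Signature N) → ℝ} (hG : ∀ x y, (∀ j ≤ k, x j = y j) → G x = G y)
    (l : Signature N) :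
    ∫ ω in T (k + 1) ⁻¹' {l}, G (fun j => T j ω) ∂P =
      ∑ l' ∈ box p N, pUpDown (zwMeasure p 0 z' w') l l' *
        ∫ ω in T k ⁻¹' {l'}, G (fun j => T j ω) ∂P := by
  classical
  rw [hT.setIntegral_eq_sum hG]
  have e : ∀ l' ∈ box p N, pUpDown (zwMeasure p 0 z' w') l l' *
        ∫ ω in T k ⁻¹' {l'}, G (fun j => T j ω) ∂P =
      ∑ π ∈ Fintype.piFinset fun _ : Fin (k + 1) => box p N, if extendPath π k = l' then
        pUpDown (zwMeasure p 0 z' w') l l' * (G (extendPath π) *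
          P.real {ω | ∀ j ≤ k, T j ω = extendPath π j}) else 0 := by
    intro l' _
    rw [hT.setIntegral_eq_sum hG, Finset.mul_sum]
    refine Finset.sum_congr rfl fun π _ => ?_
    split_ifs with h
    · congr 3
      ext ω
      simp only [Set.mem_inter_iff, Set.mem_ofPred_eq, Set.mem_preimage, Set.mem_singleton_iff,
        and_iff_left_iff_imp]
      intro hω; rw [hω k le_rfl, h]
    · have : {ω | ∀ j ≤ k, T j ω = extendPath π j} ∩ T k ⁻¹' {l'} = ∅ := by
        ext ω
        simp only [Set.mem_inter_iff, Set.mem_ofPred_eq, Set.mem_preimage, Set.mem_singleton_iff,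
          Set.mem_empty_iff_false, iff_false, not_and]
        intro hω h'; exact h (by rw [← hω k le_rfl, h'])
      rw [this]; simp
  rw [Finset.sum_congr rfl e, Finset.sum_comm]
  refine Finset.sum_congr rfl fun π hπ => ?_
  rw [Finset.sum_ite_eq, if_pos]
  swap
  · exact Fintype.mem_piFinset.1 hπ _
  have h1 := hT.law k (extendPath π)
  have h2 := hT.law (k + 1) fun j => if j ≤ k then extendPath π j else l
  rw [Finset.prod_range_succ] at h2
  have h3 : ∀ j ∈ Finset.range k, pUpDown (zwMeasure p 0 z' w')
      (if j + 1 ≤ k then extendPath π (j + 1) else l) (if j ≤ k then extendPath π j else l) =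
      pUpDown (zwMeasure p 0 z' w') (extendPath π (j + 1)) (extendPath π j) := by
    intro j hj
    have := Finset.mem_range.1 hj
    rw [if_pos (by omega), if_pos (by omega)]
  rw [Finset.prod_congr rfl h3] at h2
  simp only [Nat.zero_le, if_true, le_refl, show ¬ k + 1 ≤ k by omega, if_false] at h2
  have h4 : {ω | ∀ j ≤ k, T j ω = extendPath π j} ∩ T (k + 1) ⁻¹' {l} =
      {ω | ∀ j ≤ k + 1, T j ω = if j ≤ k then extendPath π j else l} := by
    ext ω
    simp only [Set.mem_inter_iff, Set.mem_ofPred_eq, Set.mem_preimage, Set.mem_singleton_iff]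
    constructor
    · rintro ⟨ha, hb⟩ j hj
      split_ifs with hjk
      · exact ha j hjk
      · obtain rfl : j = k + 1 := by omega
        exact hb
    · intro h
      refine ⟨fun j hj => ?_, ?_⟩
      · simpa [hj] using h j (by omega)
      · simpa using h (k + 1) le_rfl
  rw [h4, h2, h1]
  ring

lemma IsUpDownChain.setIntegral_slater_succ (hz : (p : ℝ) - 1 < z') (hw : -1 < w')
    (hp : p = 0 → z' + w' ≠ -1) (hT : IsUpDownChain P (zwMeasure p 0 z' w') N T) {k : ℕ}
    {G : (ℕ → Signature N) → ℝ} (hG : ∀ x y, (∀ j ≤ k, x j = y j) → G x = G y) {c : ℝ}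
    {ψ : Fin p → ℝ → ℝ} (h : ∀ l, IsBoxed p l → ∫ ω in T k ⁻¹' {l}, G (fun j => T j ω) ∂P =
      c * (zwMeasure p 0 z' w' N l * (slater ψ (config p l) / vand (config p l))))
    {l : Signature N} (hl : IsBoxed p l) (g : ℕ) :
    ∫ ω in T (k + g) ⁻¹' {l}, G (fun j => T j ω) ∂P =
      c * ((stepNorm p z' w' N)⁻¹ ^ g * (zwMeasure p 0 z' w' N l *
        (slater (fun j => (stepOp p z' w' N)^[g] (ψ j)) (config p l) / vand (config p l)))) := by
  induction g generalizing l with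
  | zero => simpa using h l hl
  | succ g ih =>
    rw [← add_assoc, hT.setIntegral_succ (k := k + g) fun x y hxy => hG x y fun j hj =>
      hxy j (by omega)]
    rw [Finset.sum_congr rfl fun l' hl' => by rw [ih (mem_box.1 hl')]]
    have := sum_pUpDown_slater hz hw hp hl fun j => (stepOp p z' w' N)^[g] (ψ j)
    have e : ∀ l' ∈ box p N, pUpDown (zwMeasure p 0 z' w') l l' *
        (c * ((stepNorm p z' w' N)⁻¹ ^ g * (zwMeasure p 0 z' w' N l' *
        (slater (fun j => (stepOp p z' w' N)^[g] (ψ j)) (config p l') / vand (config p l'))))) =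
        c * (stepNorm p z' w' N)⁻¹ ^ g * (pUpDown (zwMeasure p 0 z' w') l l' *
          (zwMeasure p 0 z' w' N l' * (slater (fun j => (stepOp p z' w' N)^[g] (ψ j))
            (config p l') / vand (config p l')))) := fun l' _ => by ring
    rw [Finset.sum_congr rfl e, ← Finset.mul_sum, this]
    simp only [Function.iterate_succ_apply']
    ring

lemma IsUpDownChain.measureReal_eq (hz : (p : ℝ) - 1 < z') (hw : -1 < w')
    (hp : p = 0 → z' + w' ≠ -1) (hT : IsUpDownChain P (zwMeasure p 0 z' w') N T) (k : ℕ)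
    {l : Signature N} (hl : IsBoxed p l) :
    P.real (T k ⁻¹' {l}) = zwMeasure p 0 z' w' N l := by
  induction k generalizing l with
  | zero =>
    have := hT.law 0 fun _ => l
    simp only [Finset.range_zero, Finset.prod_empty, mul_one] at this
    rw [← this]
    congr 1
    ext ω; simp
  | succ k ih =>
    have := hT.setIntegral_succ (k := k) (G := fun _ => 1) (fun _ _ _ => rfl) l
    simp only [setIntegral_const, smul_eq_mul, mul_one] at this
    rw [this, Finset.sum_congr rfl fun l' hl' => by rw [ih (mem_box.1 hl')],
      sum_pUpDown_mul_zwMeasure hz hw hp hl]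

/-- The one-particle functions describing the law of the chain at the time `m K`, weighted by the
product of the functions `ξ 0, …, ξ K` of the particles at the times `m 0 ≤ … ≤ m K`. -/
def wave (p : ℕ) (z' w' : ℝ) (N : ℕ) (m : ℕ → ℕ) (ξ : ℕ → ℝ → ℝ) : ℕ → (ℝ → ℝ) → ℝ → ℝ
  | 0, f => fun u => ξ 0 u * f u
  | K + 1, f => fun u => ξ (K + 1) u *
      ((stepOp p z' w' N)^[m (K + 1) - m K] (wave p z' w' N m ξ K f)) u

lemma slater_prod_mul {p : ℕ} (ξ : ℝ → ℝ) (ψ : Fin p → ℝ → ℝ) (x : Fin p → ℕ) :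
    slater (fun j u => ξ u * ψ j u) x = (∏ i, ξ (x i)) * slater ψ x := by
  unfold slater
  exact Matrix.det_mul_column (fun i => ξ (x i)) (Matrix.of fun i j => ψ j (x i))

lemma IsUpDownChain.setIntegral_prod (hz : (p : ℝ) - 1 < z') (hw : -1 < w')
    (hp : p = 0 → z' + w' ≠ -1) (hT : IsUpDownChain P (zwMeasure p 0 z' w') N T)
    {m : ℕ → ℕ} (hm : Monotone m) (ξ : ℕ → ℝ → ℝ) {f : Fin p → ℝ → ℝ} {c : ℝ}
    (hf : ∀ x : Fin p → ℕ, vand x = c * slater f x)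
    (K : ℕ) {l : Signature N} (hl : IsBoxed p l) :
    ∫ ω in T (m K) ⁻¹' {l}, ∏ k ∈ Finset.range (K + 1), ∏ i, ξ k (config p (T (m k) ω) i) ∂P =
      c * ((stepNorm p z' w' N)⁻¹ ^ (m K - m 0) * (zwMeasure p 0 z' w' N l *
        (slater (fun j => wave p z' w' N m ξ K (f j)) (config p l) / vand (config p l)))) := by
  induction K generalizing l with
  | zero =>
    have hV := (vand_pos hl.config_strictMono).ne'
    have h := setIntegral_mul_of_eq (P := P) (hT.measurable (m 0)) (fun _ => 1)
      (fun l => ∏ i, ξ 0 (config p l i)) l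
    simp only [one_mul, setIntegral_const, smul_eq_mul, mul_one,
      hT.measureReal_eq hz hw hp _ hl] at h
    simp only [zero_add, Finset.range_one, Finset.prod_singleton, Nat.sub_self, pow_zero, one_mul,
      wave, slater_prod_mul, h]
    rw [hf] at hV ⊢
    have h1 := left_ne_zero_of_mul hV
    have h2 := right_ne_zero_of_mul hV
    field_simp
  | succ K ih =>
    have hmm : m K ≤ m (K + 1) := hm (Nat.le_succ K)
    have hm0 : m 0 ≤ m K := hm (Nat.zero_le K)
    set G : (ℕ → Signature N) → ℝ := fun x =>
      ∏ k ∈ Finset.range (K + 1), ∏ i, ξ k (config p (x (m k)) i) with hG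
    have hGa : ∀ x y : ℕ → Signature N, (∀ j ≤ m K, x j = y j) → G x = G y := by
      intro x y hxy
      refine Finset.prod_congr rfl fun k hk => ?_
      rw [hxy (m k) (hm (Nat.lt_succ_iff.1 (Finset.mem_range.1 hk)))]
    have h1 := hT.setIntegral_slater_succ hz hw hp hGa
      (c := c * (stepNorm p z' w' N)⁻¹ ^ (m K - m 0))
      (fun l hl => by rw [hG]; simp only; rw [ih hl]; ring) hl (m (K + 1) - m K)
    rw [show m K + (m (K + 1) - m K) = m (K + 1) by omega] at h1
    have h2 := setIntegral_mul_of_eq (P := P) (hT.measurable (m (K + 1)))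
      (fun ω => G fun j => T j ω) (fun l => ∏ i, ξ (K + 1) (config p l i)) l
    simp_rw [Finset.prod_range_succ _ (K + 1)]
    rw [h1] at h2
    simp only [hG] at h2
    rw [h2]
    simp only [wave, slater_prod_mul]
    rw [show m (K + 1) - m 0 = (m K - m 0) + (m (K + 1) - m K) by omega, pow_add]
    ring

lemma IsUpDownChain.integral_eq_sum_setIntegral (hT : IsUpDownChain P (zwMeasure p 0 z' w') N T)
    {G : Ω → ℝ} (hG : Integrable G P) (k : ℕ) :
    ∫ ω, G ω ∂P = ∑ l ∈ box p N, ∫ ω in T k ⁻¹' {l}, G ω ∂P := by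
  have h1 : ∫ ω, G ω ∂P = ∫ ω in ⋃ l ∈ box p N, T k ⁻¹' {l}, G ω ∂P := by
    rw [← setIntegral_univ]
    refine setIntegral_congr_set ?_
    filter_upwards [hT.ae_isBoxed] with ω hω
    apply propext
    change ω ∈ (Set.univ : Set Ω) ↔ ω ∈ ⋃ l ∈ box p N, T k ⁻¹' {l}
    simp [hω k]
  rw [h1, integral_biUnion_finset _ fun l _ => hT.measurable k (measurableSet_singleton l)]
  · intro l _ l' _ hne
    exact Set.disjoint_left.2 fun ω h h' => hne (by rw [← show T k ω = l from h]; exact h')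
  · exact fun _ _ => hG.integrableOn

lemma IsUpDownChain.integrable_prod (hT : IsUpDownChain P (zwMeasure p 0 z' w') N T)
    (m : ℕ → ℕ) (ξ : ℕ → ℝ → ℝ) (K : ℕ) : Integrable (fun ω =>
      ∏ k ∈ Finset.range (K + 1), ∏ i, ξ k (config p (T (m k) ω) i)) P := by
  have hb : ∀ k, ∃ C, ∀ l ∈ box p N, |∏ i, ξ k (config p l i)| ≤ C := fun k =>
    ⟨∑ l ∈ box p N, |∏ i, ξ k (config p l i)|, fun l hl =>
      Finset.single_le_sum (f := fun l => |∏ i, ξ k (config p l i)|) (fun _ _ => abs_nonneg _) hl⟩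
  choose C hC using hb
  refine Integrable.of_bound (C := ∏ k ∈ Finset.range (K + 1), C k) ?_ ?_
  · refine (Finset.measurable_prod _ fun k _ => ?_).aestronglyMeasurable
    exact (measurable_of_countable fun l : Signature N => ∏ i, ξ k (config p l i)).comp
      (hT.measurable (m k))
  · filter_upwards [hT.ae_isBoxed] with ω hω
    rw [Real.norm_eq_abs, Finset.abs_prod]
    exact Finset.prod_le_prod (fun _ _ => abs_nonneg _) fun k _ => hC k _ (mem_box.2 (hω _))

/-- The expectation of a product of multiplicative functions of the configurations at several
times, as a ratio of determinants. -/
theorem IsUpDownChain.integral_prod (hz : (p : ℝ) - 1 < z') (hw : -1 < w')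
    (hp : p = 0 → z' + w' ≠ -1) (hT : IsUpDownChain P (zwMeasure p 0 z' w') N T)
    {m : ℕ → ℕ} (hm : Monotone m) (ξ : ℕ → ℝ → ℝ) {f : Fin p → ℝ → ℝ} {c : ℝ}
    (hf : ∀ x : Fin p → ℕ, vand x = c * slater f x) (K : ℕ) :
    (∫ ω, ∏ k ∈ Finset.range (K + 1), ∏ i, ξ k (config p (T (m k) ω) i) ∂P) *
      (Matrix.of fun a b => ∑ x ∈ Finset.range (N + p),
        hahnWt p z' w' N x * (f a x * f b x)).det =
      (stepNorm p z' w' N)⁻¹ ^ (m K - m 0) * (Matrix.of fun a b => ∑ x ∈ Finset.range (N + p),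
        hahnWt p z' w' N x * (f a x * wave p z' w' N m ξ K (f b) x)).det := by
  have key : ∀ (m : ℕ → ℕ) (_ : Monotone m) (ξ : ℕ → ℝ → ℝ) (K : ℕ),
      ∫ ω, ∏ k ∈ Finset.range (K + 1), ∏ i, ξ k (config p (T (m k) ω) i) ∂P =
      c ^ 2 * holeConst p z' w' N * ((stepNorm p z' w' N)⁻¹ ^ (m K - m 0) *
        (Matrix.of fun a b => ∑ x ∈ Finset.range (N + p),
        hahnWt p z' w' N x * (f a x * wave p z' w' N m ξ K (f b) x)).det) := by
    intro m hm ξ K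
    rw [hT.integral_eq_sum_setIntegral (hT.integrable_prod m ξ K) (m K), ← sum_slater_mul_slater,
      ← sum_box fun x => slater f x * slater (fun b => wave p z' w' N m ξ K (f b)) x *
        ∏ i, hahnWt p z' w' N (x i), Finset.mul_sum, Finset.mul_sum]
    refine Finset.sum_congr rfl fun l hl => ?_
    have hl' := mem_box.1 hl
    have hV := (vand_pos hl'.config_strictMono).ne'
    rw [hT.setIntegral_prod hz hw hp hm ξ hf K hl', zwMeasure_eq hz hw hl']
    rw [hf] at hV ⊢
    have h1 := left_ne_zero_of_mul hV
    have h2 := right_ne_zero_of_mul hV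
    field_simp
  have h1 := key (fun _ => 0) monotone_const (fun _ _ => 1) 0
  simp [wave] at h1
  rw [key m hm ξ K]
  linear_combination (-(stepNorm p z' w' N)⁻¹ ^ (m K - m 0) *
    (Matrix.of fun a b => ∑ x ∈ Finset.range (N + p),
        hahnWt p z' w' N x * (f a x * wave p z' w' N m ξ K (f b) x)).det) * h1

end Chain


/-! ### The Jacobi operator on polynomials and its discretization -/

section JacobiOperator

open Polynomial

/-- The eigenvalues `k (k + α + β + 1)` of the Jacobi operator. -/
def jacobiEig (α β : ℝ) (k : ℕ) : ℝ := k * (k + α + β + 1)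

lemma eigK_eq (p : ℕ) (z' w' : ℝ) (k : ℕ) : eigK p z' w' k = jacobiEig w' (z' - p) k := by
  unfold eigK jacobiEig; ring

/-- The Jacobi operator `-(x (1 - x) q'' + ((α + 1) (1 - x) - (β + 1) x) q')`, which is symmetric
for the weight `x ^ α (1 - x) ^ β`. -/
def jacobiOp (α β : ℝ) : ℝ[X] →ₗ[ℝ] ℝ[X] :=
  -(LinearMap.mulLeft ℝ (X * (1 - X)) ∘ₗ derivative ∘ₗ derivative +
    LinearMap.mulLeft ℝ (C (α + 1) * (1 - X) - C (β + 1) * X) ∘ₗ derivative)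

lemma jacobiOp_apply (α β : ℝ) (q : ℝ[X]) : jacobiOp α β q =
    -(X * (1 - X) * derivative (derivative q) +
      (C (α + 1) * (1 - X) - C (β + 1) * X) * derivative q) := rfl

lemma jacobiOp_X_pow (α β : ℝ) (j : ℕ) : jacobiOp α β (X ^ j) =
    C (jacobiEig α β j) * X ^ j - C (j * (α + j)) * X ^ (j - 1) := by
  rw [jacobiOp_apply]
  rcases j with _ | _ | j
  · simp [jacobiEig]
  · simp [jacobiEig]; ring
  · simp only [derivative_X_pow, derivative_mul, derivative_C, jacobiEig, Nat.add_sub_cancel]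
    push_cast
    simp only [map_add, map_mul, map_natCast, map_one]
    ring

lemma jacobiOp_one_sub_X_pow (α β : ℝ) (j : ℕ) : jacobiOp α β ((1 - X) ^ j) =
    C (jacobiEig α β j) * (1 - X) ^ j - C (j * (β + j)) * (1 - X) ^ (j - 1) := by
  rw [jacobiOp_apply]
  rcases j with _ | _ | j
  · simp [jacobiEig]
  · simp [jacobiEig]; ring
  · simp only [derivative_pow, derivative_mul, derivative_C, derivative_sub, derivative_one,
      derivative_X, jacobiEig, Nat.add_sub_cancel]
    push_cast
    simp only [map_add, map_mul, map_natCast, map_one]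
    rcases j with _ | j
    · simp; ring
    · simp only [Nat.cast_add, Nat.cast_one]
      ring_nf
      simp

lemma natDegree_jacobiOp_le (α β : ℝ) (q : ℝ[X]) : (jacobiOp α β q).natDegree ≤ q.natDegree := by
  conv_lhs => rw [q.as_sum_range_C_mul_X_pow]
  rw [map_sum]
  refine natDegree_sum_le_of_forall_le _ _ fun j hj => ?_
  have hj' := Finset.mem_range.1 hj
  rw [← smul_eq_C_mul, map_smul, jacobiOp_X_pow]
  refine (natDegree_smul_le _ _).trans ((natDegree_sub_le _ _).trans (max_le ?_ ?_))
  · exact (natDegree_C_mul_X_pow_le _ _).trans (by omega)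
  · exact (natDegree_C_mul_X_pow_le _ _).trans (by omega)

/-- Linear maps on polynomials that agree on the monomials of degree at most `d` agree on the
polynomials of degree at most `d`. -/
lemma linearMap_eq_of_X_pow {M : Type*} [AddCommGroup M] [Module ℝ M] {F G : ℝ[X] →ₗ[ℝ] M} {d : ℕ}
    (h : ∀ j ≤ d, F (X ^ j) = G (X ^ j)) {q : ℝ[X]} (hq : q.natDegree ≤ d) : F q = G q := by
  rw [q.as_sum_range_C_mul_X_pow, map_sum, map_sum]
  refine Finset.sum_congr rfl fun j hj => ?_
  have := Finset.mem_range.1 hj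
  rw [← smul_eq_C_mul, map_smul, map_smul, h j (by omega)]

/-- The normalized falling factorials `x (x-1) ⋯ (x-j+1) / (n (n-1) ⋯ (n-j+1))`. -/
def fallingFun (n : ℝ) (j : ℕ) (x : ℝ) : ℝ :=
  (descPochhammer ℝ j).eval x / (descPochhammer ℝ j).eval n

/-- The linear map from polynomials to functions on the lattice which sends `X ^ j` to the
normalized falling factorial. It intertwines the Jacobi operator with its discretization. -/
def fallingMap (n : ℝ) : ℝ[X] →ₗ[ℝ] (ℝ → ℝ) :=
  (basisMonomials ℝ).constr ℝ (fallingFun n)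

lemma fallingMap_X_pow (n : ℝ) (j : ℕ) : fallingMap n (X ^ j) = fallingFun n j := by
  have := (basisMonomials ℝ).constr_basis ℝ (fallingFun n) j
  rwa [coe_basisMonomials, show (fun s => monomial s (1 : ℝ)) j = X ^ j from
    (X_pow_eq_monomial j).symm] at this

lemma descPochhammer_eval_natCast_ne_zero {n j : ℕ} (h : j ≤ n) :
    (descPochhammer ℝ j).eval (n : ℝ) ≠ 0 := by
  rw [descPochhammer_eval_eq_descFactorial]
  exact_mod_cast (Nat.descFactorial_pos.2 h).ne'

lemma fallingFun_succ {n j : ℕ} (h : j + 1 ≤ n) (x : ℝ) :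
    fallingFun n (j + 1) x = fallingFun n j x * ((x - j) / (n - j)) := by
  have h1 := descPochhammer_eval_natCast_ne_zero (show j ≤ n by omega)
  have h2 : (n : ℝ) - j ≠ 0 := by
    have : (j : ℝ) + 1 ≤ n := by exact_mod_cast h
    linarith
  unfold fallingFun
  rw [descPochhammer_succ_eval, descPochhammer_succ_eval]
  field_simp

/-- The operator to which multiplication by `x / n` corresponds, with `h = 1 / n`. -/
def posOp (h : ℝ) : ℝ[X] →ₗ[ℝ] ℝ[X] :=
  LinearMap.mulLeft ℝ X + h • (LinearMap.mulLeft ℝ (X * (1 - X)) ∘ₗ derivative)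

lemma posOp_apply (h : ℝ) (q : ℝ[X]) : posOp h q = X * q + C h * (X * (1 - X) * derivative q) := by
  rw [← smul_eq_C_mul]; rfl

lemma posOp_X_pow (h : ℝ) (j : ℕ) :
    posOp h (X ^ j) = C (1 - h * j) * X ^ (j + 1) + C (h * j) * X ^ j := by
  rw [posOp_apply]
  rcases j with _ | j
  · simp
  · simp only [derivative_X_pow, Nat.add_sub_cancel, map_sub, map_mul, map_natCast, map_one]
    ring

lemma natDegree_posOp_le (h : ℝ) (q : ℝ[X]) : (posOp h q).natDegree ≤ q.natDegree + 1 := by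
  conv_lhs => rw [q.as_sum_range_C_mul_X_pow]
  rw [map_sum]
  refine natDegree_sum_le_of_forall_le _ _ fun j hj => ?_
  have hj' := Finset.mem_range.1 hj
  rw [← smul_eq_C_mul, map_smul, posOp_X_pow]
  refine (natDegree_smul_le _ _).trans ((natDegree_add_le _ _).trans (max_le ?_ ?_))
  · exact (natDegree_C_mul_X_pow_le _ _).trans (by omega)
  · exact (natDegree_C_mul_X_pow_le _ _).trans (by omega)

lemma natDegree_posOp_pow_le (h : ℝ) (i : ℕ) (q : ℝ[X]) :
    ((posOp h ^ i) q).natDegree ≤ q.natDegree + i := by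
  induction i with
  | zero => simp
  | succ i ih =>
    rw [pow_succ', Module.End.mul_apply]
    exact (natDegree_posOp_le h _).trans (by omega)

lemma aeval_posOp_apply (h : ℝ) (f q : ℝ[X]) : aeval (posOp h) f q =
    ∑ i ∈ Finset.range (f.natDegree + 1), f.coeff i • (posOp h ^ i) q := by
  rw [aeval_eq_sum_range, LinearMap.sum_apply]
  rfl

lemma natDegree_aeval_posOp_le (h : ℝ) (f q : ℝ[X]) :
    (aeval (posOp h) f q).natDegree ≤ q.natDegree + f.natDegree := by
  rw [aeval_posOp_apply]
  refine natDegree_sum_le_of_forall_le _ _ fun i hi => ?_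
  have := Finset.mem_range.1 hi
  exact (natDegree_smul_le _ _).trans ((natDegree_posOp_pow_le h i q).trans (by omega))

lemma fallingMap_posOp {n : ℕ} {q : ℝ[X]} (hq : q.natDegree + 1 ≤ n) (x : ℝ) :
    fallingMap n (posOp (1 / n) q) x = x / n * fallingMap n q x := by
  have hn : (n : ℝ) ≠ 0 := by
    have : n ≠ 0 := by omega
    exact_mod_cast this
  have : (LinearMap.proj x ∘ₗ fallingMap (n : ℝ) ∘ₗ posOp (1 / n) : ℝ[X] →ₗ[ℝ] ℝ) q =
      ((x / n) • (LinearMap.proj x ∘ₗ fallingMap (n : ℝ)) : ℝ[X] →ₗ[ℝ] ℝ) q := by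
    refine linearMap_eq_of_X_pow (d := n - 1) (fun j hj => ?_) (by omega)
    have h2 : (n : ℝ) - j ≠ 0 := by
      have : (j : ℝ) + 1 ≤ n := by exact_mod_cast (show j + 1 ≤ n by omega)
      linarith
    simp only [LinearMap.comp_apply, LinearMap.smul_apply, LinearMap.proj_apply, posOp_X_pow,
      map_add, ← smul_eq_C_mul, map_smul, fallingMap_X_pow, smul_eq_mul]
    rw [fallingFun_succ (by omega)]
    field_simp
    ring
  exact this

lemma fallingMap_aeval_posOp {n : ℕ} {f q : ℝ[X]} (hq : q.natDegree + f.natDegree ≤ n) (x : ℝ) :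
    fallingMap n (aeval (posOp (1 / n)) f q) x = f.eval (x / n) * fallingMap n q x := by
  have hpow : ∀ i, q.natDegree + i ≤ n →
      fallingMap n ((posOp (1 / n) ^ i) q) x = (x / n) ^ i * fallingMap n q x := by
    intro i
    induction i with
    | zero => intro _; simp
    | succ i ih =>
      intro hi
      rw [pow_succ', Module.End.mul_apply, fallingMap_posOp, ih (by omega)]
      · ring
      · exact (add_le_add_left (natDegree_posOp_pow_le _ i q) 1).trans (by omega)
  rw [aeval_posOp_apply, map_sum, Finset.sum_apply, eval_eq_sum_range, Finset.sum_mul]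
  refine Finset.sum_congr rfl fun i hi => ?_
  have := Finset.mem_range.1 hi
  rw [map_smul, Pi.smul_apply, hpow i (by omega), smul_eq_mul]
  ring

/-- The constant `C_N` for which the one-particle operator of a step is `C_N` minus the discretized
Jacobi operator. -/
def stepConst (p : ℕ) (z' w' : ℝ) (N : ℕ) : ℝ := (N + p) * (N + 1 + z' + w')

/-- The one-particle operator of a step, as a linear map. -/
def stepLin (p : ℕ) (z' w' : ℝ) (N : ℕ) : (ℝ → ℝ) →ₗ[ℝ] (ℝ → ℝ) where
  toFun := stepOp p z' w' N
  map_add' f g := by funext x; simp only [stepOp, upOp, downOp, Pi.add_apply]; ring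
  map_smul' c f := by
    funext x; simp only [stepOp, upOp, downOp, Pi.smul_apply, smul_eq_mul, RingHom.id_apply]; ring

lemma stepOp_fallingFun {p N j : ℕ} (z' w' : ℝ) (hj : j < N + p) :
    stepOp p z' w' N (fallingFun ((N + p - 1 : ℕ) : ℝ) j) =
      (stepConst p z' w' N - jacobiEig w' (z' - p) j) • fallingFun ((N + p - 1 : ℕ) : ℝ) j +
        (j * (w' + j)) • fallingFun ((N + p - 1 : ℕ) : ℝ) (j - 1) := by
  set n := N + p - 1 with hn
  have hNp : ((N + p : ℕ) : ℝ) = n + 1 := by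
    have : N + p = n + 1 := by omega
    exact_mod_cast this
  have hNp' : (N : ℝ) + p = n + 1 := by rw [← hNp]; push_cast; ring
  have hd := descPochhammer_eval_natCast_ne_zero (show j ≤ n by omega)
  have h1 : stepOp p z' w' N (fun u => (descPochhammer ℝ j).eval u) = fun x =>
      ((n + 1 : ℝ) - j) * ((w' + 1 + (z' + N) + j) * (descPochhammer ℝ j).eval x +
        j * (w' + 1 + j - 1) * (descPochhammer ℝ (j - 1)).eval x) := by
    unfold stepOp
    have : downOp (N + p : ℕ) (fun u => (descPochhammer ℝ j).eval u) =
        ((n + 1 : ℝ) - j) • fun u => (descPochhammer ℝ j).eval u := by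
      funext y
      rw [downOp_descPochhammer, hNp]; rfl
    rw [this]
    funext x
    rw [← upOp_descPochhammer]
    simp only [upOp, Pi.smul_apply, smul_eq_mul]
    ring
  have h2 : fallingFun (n : ℝ) j =
      ((descPochhammer ℝ j).eval (n : ℝ))⁻¹ • fun u => (descPochhammer ℝ j).eval u := by
    funext x; simp [fallingFun, div_eq_inv_mul]
  have h3 : stepOp p z' w' N (fallingFun (n : ℝ) j) = ((descPochhammer ℝ j).eval (n : ℝ))⁻¹ •
      stepOp p z' w' N (fun u => (descPochhammer ℝ j).eval u) := by
    rw [h2]; exact (stepLin p z' w' N).map_smul _ _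
  rw [h3, h1]
  funext x
  simp only [Pi.add_apply, Pi.smul_apply, smul_eq_mul, stepConst, jacobiEig, fallingFun]
  have hN : (N : ℝ) = n + 1 - p := by linarith
  rcases j with _ | j
  · simp [hN]; left; ring
  · have hd' := descPochhammer_eval_natCast_ne_zero (show j ≤ n by omega)
    have hnj : (n : ℝ) - j ≠ 0 := by
      have : (j : ℝ) + 1 ≤ n := by exact_mod_cast (show j + 1 ≤ n by omega)
      linarith
    rw [descPochhammer_succ_eval, descPochhammer_succ_eval, Nat.add_sub_cancel]
    push_cast
    rw [hN]
    field_simp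
    ring

/-- A step of the chain corresponds exactly to `C_N` minus the Jacobi operator. -/
lemma stepOp_fallingMap {p N : ℕ} (z' w' : ℝ) {q : ℝ[X]} (hq : q.natDegree < N + p) :
    stepOp p z' w' N (fallingMap ((N + p - 1 : ℕ) : ℝ) q) = fallingMap ((N + p - 1 : ℕ) : ℝ)
      ((stepConst p z' w' N • LinearMap.id - jacobiOp w' (z' - p) : ℝ[X] →ₗ[ℝ] ℝ[X]) q) := by
  have : (stepLin p z' w' N ∘ₗ fallingMap ((N + p - 1 : ℕ) : ℝ)) q =
      (fallingMap ((N + p - 1 : ℕ) : ℝ) ∘ₗ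
        (stepConst p z' w' N • LinearMap.id - jacobiOp w' (z' - p))) q := by
    refine linearMap_eq_of_X_pow (d := N + p - 1) (fun j hj => ?_) (by omega)
    simp only [LinearMap.comp_apply, LinearMap.sub_apply, LinearMap.smul_apply, LinearMap.id_apply,
      jacobiOp_X_pow, map_sub, ← smul_eq_C_mul, map_smul, fallingMap_X_pow]
    change stepOp p z' w' N _ = _
    rw [stepOp_fallingFun z' w' (by omega), sub_smul]
    abel
  exact this

lemma natDegree_stepPoly_le {p N : ℕ} (z' w' : ℝ) (g : ℕ) (q : ℝ[X]) :
    (((stepConst p z' w' N • LinearMap.id - jacobiOp w' (z' - p) : ℝ[X] →ₗ[ℝ] ℝ[X]) ^ g)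
      q).natDegree ≤ q.natDegree := by
  induction g with
  | zero => simp
  | succ g ih =>
    rw [pow_succ', Module.End.mul_apply]
    refine le_trans ?_ ih
    exact (natDegree_sub_le _ _).trans
      (max_le (natDegree_smul_le _ _) (natDegree_jacobiOp_le _ _ _))

lemma stepOp_iterate_fallingMap {p N : ℕ} (z' w' : ℝ) {q : ℝ[X]} (hq : q.natDegree < N + p)
    (g : ℕ) : (stepOp p z' w' N)^[g] (fallingMap ((N + p - 1 : ℕ) : ℝ) q) =
      fallingMap ((N + p - 1 : ℕ) : ℝ)
      (((stepConst p z' w' N • LinearMap.id - jacobiOp w' (z' - p) : ℝ[X] →ₗ[ℝ] ℝ[X]) ^ g) q) := by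
  induction g with
  | zero => simp
  | succ g ih =>
    rw [Function.iterate_succ_apply', ih, stepOp_fallingMap, pow_succ', Module.End.mul_apply]
    exact (natDegree_stepPoly_le z' w' g q).trans_lt hq

end JacobiOperator


/-! ### Moments of the Jacobi weight and of the Hahn weight -/

section Moments

open Polynomial

lemma betaWeight_nonneg (p : ℕ) (z' w' : ℝ) (x : unitInterval) : 0 ≤ betaWeight p z' w' x :=
  mul_nonneg (Real.rpow_nonneg x.2.1 _) (Real.rpow_nonneg (by linarith [x.2.2]) _)

lemma betaWeight_pos (p : ℕ) (z' w' : ℝ) {x : ℝ} (hx : x ∈ Set.Ioo (0 : ℝ) 1) :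
    0 < betaWeight p z' w' x :=
  mul_pos (Real.rpow_pos_of_pos hx.1 _) (Real.rpow_pos_of_pos (by linarith [hx.2]) _)

lemma integral_unitInterval (f : ℝ → ℝ) :
    ∫ x : unitInterval, f x = ∫ x in (0 : ℝ)..1, f x := by
  rw [intervalIntegral.integral_of_le zero_le_one, ← integral_Icc_eq_integral_Ioc]
  exact integral_subtype_comap measurableSet_Icc f

lemma integrable_unitInterval_iff (f : ℝ → ℝ) :
    Integrable (fun x : unitInterval => f x) ↔ IntegrableOn f (Set.Icc 0 1) := by
  have hm : MeasurableSet (Set.Icc (0 : ℝ) 1) := measurableSet_Icc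
  have := (MeasurableEmbedding.subtype_coe hm).integrableOn_range_iff_comap
    (f := f) (μ := volume)
  rw [Subtype.range_coe] at this
  exact this.symm

lemma integrableOn_rpow_mul_rpow {a b : ℝ} (ha : -1 < a) (hb : -1 < b) :
    IntegrableOn (fun x : ℝ => x ^ a * (1 - x) ^ b) (Set.Icc 0 1) := by
  have h := Complex.betaIntegral_convergent (u := ((a + 1 : ℝ) : ℂ)) (v := ((b + 1 : ℝ) : ℂ))
    (by simpa using by linarith) (by simpa using by linarith)
  rw [intervalIntegrable_iff_integrableOn_Ioc_of_le zero_le_one,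
    ← integrableOn_Icc_iff_integrableOn_Ioc] at h
  refine h.re.congr ?_
  filter_upwards [ae_restrict_mem measurableSet_Icc] with x hx
  have h1 : ((x : ℂ) ^ (((a + 1 : ℝ) : ℂ) - 1) * (1 - (x : ℂ)) ^ (((b + 1 : ℝ) : ℂ) - 1)) =
      ((x ^ a * (1 - x) ^ b : ℝ) : ℂ) := by
    push_cast
    rw [Complex.ofReal_cpow hx.1, Complex.ofReal_cpow (by linarith [hx.2])]
    push_cast
    ring_nf
  rw [h1]; simp

lemma integral_rpow_mul_rpow {a b : ℝ} (ha : -1 < a) (hb : -1 < b) :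
    ∫ x in (0 : ℝ)..1, x ^ a * (1 - x) ^ b =
      Real.Gamma (a + 1) * Real.Gamma (b + 1) / Real.Gamma (a + b + 2) := by
  have h := ProbabilityTheory.beta_eq_betaIntegralReal (a + 1) (b + 1) (by linarith) (by linarith)
  rw [ProbabilityTheory.beta, show a + 1 + (b + 1) = a + b + 2 by ring] at h
  rw [h]
  have : Complex.betaIntegral ((a + 1 : ℝ) : ℂ) ((b + 1 : ℝ) : ℂ) =
      ((∫ x in (0 : ℝ)..1, x ^ a * (1 - x) ^ b : ℝ) : ℂ) := by
    rw [Complex.betaIntegral, ← intervalIntegral.integral_ofReal]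
    refine intervalIntegral.integral_congr fun x hx => ?_
    rw [Set.uIcc_of_le zero_le_one] at hx
    push_cast
    rw [Complex.ofReal_cpow hx.1, Complex.ofReal_cpow (by linarith [hx.2])]
    push_cast
    ring_nf
  rw [this, Complex.ofReal_re]

lemma integrable_betaWeight {p : ℕ} {z' w' : ℝ} (hz : (p : ℝ) - 1 < z') (hw : -1 < w') :
    Integrable (fun x : unitInterval => betaWeight p z' w' x) :=
  (integrable_unitInterval_iff _).2 (integrableOn_rpow_mul_rpow hw (by linarith))

lemma integrable_continuous_mul_betaWeight {p : ℕ} {z' w' : ℝ} (hz : (p : ℝ) - 1 < z')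
    (hw : -1 < w') {f : unitInterval → ℝ} (hf : Continuous f) :
    Integrable (fun x : unitInterval => f x * betaWeight p z' w' x) := by
  obtain ⟨C, hC⟩ := isCompact_univ.exists_bound_of_continuousOn hf.continuousOn
  exact (integrable_betaWeight hz hw).bdd_mul hf.aestronglyMeasurable
    (Eventually.of_forall fun x => hC x (Set.mem_univ x))

lemma continuous_eval_unitInterval (q : ℝ[X]) : Continuous fun x : unitInterval => q.eval (x : ℝ) :=
  q.continuous.comp continuous_subtype_val

lemma integrable_eval_mul_betaWeight {p : ℕ} {z' w' : ℝ} (hz : (p : ℝ) - 1 < z') (hw : -1 < w')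
    (q : ℝ[X]) : Integrable (fun x : unitInterval => q.eval (x : ℝ) * betaWeight p z' w' x) :=
  integrable_continuous_mul_betaWeight hz hw (continuous_eval_unitInterval q)

/-- The integral of a polynomial against the weight `x ^ w' (1 - x) ^ (z' - p)` on `[0, 1]`; it is a
linear functional of the polynomial when the weight is integrable. -/
def moment (p : ℕ) (z' w' : ℝ) (q : ℝ[X]) : ℝ :=
  ∫ x : unitInterval, q.eval (x : ℝ) * betaWeight p z' w' x

section

variable {p : ℕ} {z' w' : ℝ}

lemma moment_add (hz : (p : ℝ) - 1 < z') (hw : -1 < w') (q r : ℝ[X]) :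
    moment p z' w' (q + r) = moment p z' w' q + moment p z' w' r := by
  unfold moment
  simp_rw [eval_add, add_mul]
  exact integral_add (integrable_eval_mul_betaWeight hz hw q)
    (integrable_eval_mul_betaWeight hz hw r)

lemma moment_smul (c : ℝ) (q : ℝ[X]) : moment p z' w' (c • q) = c * moment p z' w' q := by
  unfold moment
  simp_rw [eval_smul, smul_eq_mul, mul_assoc]
  exact integral_const_mul _ _

/-- The moment functional as a linear map. -/
def momentLin (hz : (p : ℝ) - 1 < z') (hw : -1 < w') : ℝ[X] →ₗ[ℝ] ℝ where
  toFun := moment p z' w'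
  map_add' := moment_add hz hw
  map_smul' := moment_smul

lemma moment_X_pow (hz : (p : ℝ) - 1 < z') (hw : -1 < w') (j : ℕ) :
    moment p z' w' (X ^ j) = Real.Gamma (w' + j + 1) * Real.Gamma (z' - p + 1) /
      Real.Gamma (w' + j + (z' - p) + 2) := by
  have hj : (0 : ℝ) ≤ j := Nat.cast_nonneg _
  rw [← integral_rpow_mul_rpow (a := w' + j) (b := z' - p) (by linarith) (by linarith)]
  unfold moment
  rw [integral_unitInterval fun x => (X ^ j : ℝ[X]).eval x * betaWeight p z' w' x]
  rw [intervalIntegral.integral_of_le zero_le_one, intervalIntegral.integral_of_le zero_le_one]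
  refine setIntegral_congr_fun measurableSet_Ioc fun x hx => ?_
  simp only [eval_pow, eval_X, betaWeight]
  rw [Real.rpow_add hx.1, Real.rpow_natCast]
  ring

lemma moment_X_pow_pos (hz : (p : ℝ) - 1 < z') (hw : -1 < w') (j : ℕ) :
    0 < moment p z' w' (X ^ j) := by
  have hj : (0 : ℝ) ≤ j := Nat.cast_nonneg _
  rw [moment_X_pow hz hw]
  refine div_pos (mul_pos ?_ ?_) ?_ <;> apply Real.Gamma_pos_of_pos <;> linarith

/-- The recursion of the moments, which says that the Jacobi operator annihilates the weight. -/
lemma moment_X_pow_succ (hz : (p : ℝ) - 1 < z') (hw : -1 < w') (j : ℕ) :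
    (j + 1 + w' + (z' - p) + 1) * moment p z' w' (X ^ (j + 1)) =
      (w' + j + 1) * moment p z' w' (X ^ j) := by
  have hj : (0 : ℝ) ≤ j := Nat.cast_nonneg _
  rw [moment_X_pow hz hw, moment_X_pow hz hw]
  have h1 : w' + ((j + 1 : ℕ) : ℝ) + 1 = (w' + j + 1) + 1 := by push_cast; ring
  have h2 : w' + ((j + 1 : ℕ) : ℝ) + (z' - p) + 2 = (w' + j + (z' - p) + 2) + 1 := by
    push_cast; ring
  have h3 : 0 < Real.Gamma (w' + j + (z' - p) + 2) := Real.Gamma_pos_of_pos (by linarith)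
  have h4 : w' + j + (z' - p) + 2 ≠ 0 := by linarith
  rw [h1, h2, Real.Gamma_add_one (by linarith), Real.Gamma_add_one h4]
  field_simp
  ring

/-- The Jacobi operator is symmetric for the moment functional. -/
lemma moment_jacobiOp_mul (hz : (p : ℝ) - 1 < z') (hw : -1 < w') (q r : ℝ[X]) :
    moment p z' w' (jacobiOp w' (z' - p) q * r) = moment p z' w' (q * jacobiOp w' (z' - p) r) := by
  set L := jacobiOp w' (z' - p)
  have hmono : ∀ i j : ℕ, momentLin hz hw (L (X ^ i) * X ^ j) =
      momentLin hz hw (X ^ i * L (X ^ j)) := by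
    intro i j
    have key : ∀ k : ℕ, momentLin hz hw (X ^ (k + 1)) * (k + 1 + w' + (z' - p) + 1) =
        (w' + k + 1) * momentLin hz hw (X ^ k) := fun k => by
      have := moment_X_pow_succ hz hw k
      rwa [mul_comm] at this
    simp only [L, jacobiOp_X_pow, sub_mul, mul_sub, mul_assoc, ← smul_eq_C_mul, mul_smul_comm,
      smul_mul_assoc, map_sub, map_smul, smul_eq_mul, ← pow_add, jacobiEig]
    rcases i with _ | i
    · rcases j with _ | j
      · simp
      · have := key j
        simp only [Nat.add_sub_cancel, zero_add, Nat.cast_zero, zero_mul, sub_zero]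
        push_cast
        linear_combination (-(j : ℝ) - 1) * this
    · rcases j with _ | j
      · have := key i
        simp only [Nat.add_sub_cancel, add_zero, Nat.cast_zero, zero_mul, sub_zero]
        push_cast
        linear_combination ((i : ℝ) + 1) * this
      · have := key (i + j + 1)
        rw [show i + 1 + (j + 1) = i + j + 1 + 1 by ring, Nat.add_sub_cancel, Nat.add_sub_cancel,
          show i + (j + 1) = i + j + 1 by ring, show i + 1 + j = i + j + 1 by ring]
        push_cast at this ⊢
        linear_combination ((i : ℝ) - j) * this
  have h2 : ∀ i, momentLin hz hw (L (X ^ i) * r) = momentLin hz hw (X ^ i * L r) := by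
    intro i
    exact linearMap_eq_of_X_pow (F := momentLin hz hw ∘ₗ LinearMap.mulLeft ℝ (L (X ^ i)))
      (G := momentLin hz hw ∘ₗ LinearMap.mulLeft ℝ (X ^ i) ∘ₗ L) (fun j _ => hmono i j) le_rfl
  exact linearMap_eq_of_X_pow (F := momentLin hz hw ∘ₗ LinearMap.mulRight ℝ r ∘ₗ L)
    (G := momentLin hz hw ∘ₗ LinearMap.mulRight ℝ (L r)) (fun j _ => h2 j) le_rfl

/-- The Pearson equation of the Hahn weight. -/
lemma hahnWt_succ (hz : (p : ℝ) - 1 < z') (hw : -1 < w') {N x : ℕ} (hx : x + 1 < N + p) :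
    hahnWt p z' w' N (x + 1) * ((x + 1) * (z' + N - (x + 1))) =
      hahnWt p z' w' N x * ((w' + x + 1) * (N + p - 1 - x)) := by
  have h1 : (x : ℝ) + 1 + 1 ≤ N + p := by exact_mod_cast hx
  have h0 : (0 : ℝ) ≤ x := Nat.cast_nonneg _
  have e1 : w' + ((x + 1 : ℕ) : ℝ) + 1 = (w' + x + 1) + 1 := by push_cast; ring
  have e2 : z' + (N : ℝ) - x = (z' + N - (x + 1 : ℕ)) + 1 := by push_cast; ring
  have e3 : placeWt (N + p) x * (x + 1) = placeWt (N + p) (x + 1) * (N + p - 1 - x) := by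
    unfold placeWt
    rw [show N + p - 1 - x = (N + p - 1 - (x + 1)) + 1 by omega, Nat.factorial_succ,
      Nat.factorial_succ, show N + p - 1 - (x + 1) = N + p - (x + 2) by omega]
    push_cast [Nat.cast_sub (show x + 2 ≤ N + p by omega)]
    ring
  have h2 := (placeWt_pos (N + p) x).ne'
  have h3 := (placeWt_pos (N + p) (x + 1)).ne'
  unfold hahnWt
  have g1 : Real.Gamma (w' + x + 1 + 1) = (w' + x + 1) * Real.Gamma (w' + x + 1) :=
    Real.Gamma_add_one (by linarith)
  have g2 : Real.Gamma (z' + N - (x + 1 : ℕ) + 1) =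
      (z' + N - (x + 1)) * Real.Gamma (z' + N - (x + 1 : ℕ)) := by
    rw [Real.Gamma_add_one (by push_cast; linarith)]
    push_cast
    rfl
  rw [e1, e2, g1, g2]
  generalize Real.Gamma (w' + x + 1) = A
  generalize Real.Gamma (z' + N - (x + 1 : ℕ)) = B
  field_simp
  linear_combination (z' + N - (x + 1)) * A * B * (w' + x + 1) * e3

lemma stepOp_eq (p : ℕ) (z' w' : ℝ) (N : ℕ) (f : ℝ → ℝ) (x : ℝ) :
    stepOp p z' w' N f x = stepConst p z' w' N * f x +
      ((w' + x + 1) * (N + p - 1 - x) * (f (x + 1) - f x) -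
        x * (z' + N - x) * (f x - f (x - 1))) := by
  unfold stepOp upOp downOp stepConst
  push_cast
  rw [show x + 1 - 1 = x by ring]
  ring

lemma sum_hahnWt_stepOp (hz : (p : ℝ) - 1 < z') (hw : -1 < w') (N : ℕ) (f : ℝ → ℝ) :
    ∑ x ∈ Finset.range (N + p), hahnWt p z' w' N x * stepOp p z' w' N f x =
      stepConst p z' w' N * ∑ x ∈ Finset.range (N + p), hahnWt p z' w' N x * f x := by
  rcases Nat.eq_zero_or_pos (N + p) with h0 | hpos
  · simp [h0]
  obtain ⟨n, hn⟩ : ∃ n, N + p = n + 1 := ⟨N + p - 1, by omega⟩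
  have hnR : (N : ℝ) + p - 1 = n := by
    have : (N : ℝ) + p = n + 1 := by exact_mod_cast hn
    linarith
  have key : ∑ x ∈ Finset.range (n + 1),
      hahnWt p z' w' N x * ((w' + x + 1) * (N + p - 1 - x) * (f (x + 1) - f x)) =
      ∑ x ∈ Finset.range (n + 1),
        hahnWt p z' w' N x * (x * (z' + N - x) * (f x - f (x - 1))) := by
    rw [Finset.sum_range_succ, Finset.sum_range_succ']
    simp only [hnR, sub_self, mul_zero, zero_mul, add_zero, Nat.cast_zero]
    refine Finset.sum_congr rfl fun x hx => ?_
    have := hahnWt_succ hz hw (N := N) (x := x) (by have := Finset.mem_range.1 hx; omega)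
    rw [hnR] at this
    push_cast
    rw [show (x : ℝ) + 1 - 1 = x by ring]
    linear_combination (-(f (x + 1) - f x)) * this
  simp_rw [stepOp_eq, mul_add, mul_sub, Finset.sum_add_distrib, Finset.sum_sub_distrib,
    Finset.mul_sum]
  rw [hn]
  simp only [mul_sub] at key
  simp only [Finset.sum_sub_distrib] at key
  have e : ∀ x : ℕ, stepConst p z' w' N * (hahnWt p z' w' N x * f x) =
    hahnWt p z' w' N x * (stepConst p z' w' N * f x) := fun x => by ring
  simp_rw [e]
  linarith

/-- Under the normalized falling factorial map the Hahn weight becomes the Jacobi weight. -/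
lemma sum_hahnWt_fallingMap (hz : (p : ℝ) - 1 < z') (hw : -1 < w') {N : ℕ} {q : ℝ[X]}
    (hq : q.natDegree < N + p) :
    ∑ x ∈ Finset.range (N + p), hahnWt p z' w' N x * fallingMap ((N + p - 1 : ℕ) : ℝ) q x =
      (∑ x ∈ Finset.range (N + p), hahnWt p z' w' N x) / moment p z' w' 1 * moment p z' w' q := by
  set Z := ∑ x ∈ Finset.range (N + p), hahnWt p z' w' N x with hZ
  set n := N + p - 1 with hn
  let F : ℝ[X] →ₗ[ℝ] ℝ := ∑ x ∈ Finset.range (N + p),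
    hahnWt p z' w' N x • (LinearMap.proj (x : ℝ) ∘ₗ fallingMap (n : ℝ))
  have hF : ∀ r, F r = ∑ x ∈ Finset.range (N + p), hahnWt p z' w' N x * fallingMap (n : ℝ) r x := by
    intro r; simp [F]
  have h1 : 0 < moment p z' w' 1 := by simpa using moment_X_pow_pos hz hw 0
  rw [← hF]
  have : F q = ((Z / moment p z' w' 1) • momentLin hz hw : ℝ[X] →ₗ[ℝ] ℝ) q := by
    refine linearMap_eq_of_X_pow (d := n) (fun j => ?_) (by omega)
    change _ → F (X ^ j) = Z / moment p z' w' 1 * moment p z' w' (X ^ j)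
    induction j with
    | zero =>
      intro _
      have e : ∀ x, fallingMap (n : ℝ) (X ^ 0) x = 1 := fun x => by
        rw [fallingMap_X_pow]; simp [fallingFun]
      rw [hF]
      simp only [e, mul_one, ← hZ]
      rw [pow_zero]
      field_simp
    | succ j ih =>
      intro hj
      have hs := sum_hahnWt_stepOp hz hw N (fallingFun (n : ℝ) (j + 1))
      rw [stepOp_fallingFun z' w' (show j + 1 < N + p by omega)] at hs
      simp only [Pi.add_apply, Pi.smul_apply, smul_eq_mul, Nat.add_sub_cancel] at hs
      have ih' := ih (by omega)
      have hm := moment_X_pow_succ hz hw j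
      rw [hF] at ih' ⊢
      simp only [fallingMap_X_pow] at ih' ⊢
      set A := ∑ x ∈ Finset.range (N + p), hahnWt p z' w' N x * fallingFun (n : ℝ) (j + 1) x
      set B := ∑ x ∈ Finset.range (N + p), hahnWt p z' w' N x * fallingFun (n : ℝ) j x
      have hs2 : (stepConst p z' w' N - jacobiEig w' (z' - p) (j + 1)) * A +
          (((j + 1 : ℕ) : ℝ) * (w' + ((j + 1 : ℕ) : ℝ))) * B = stepConst p z' w' N * A := by
        rw [← hs, Finset.mul_sum, Finset.mul_sum, ← Finset.sum_add_distrib]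
        refine Finset.sum_congr rfl fun x _ => by ring
      have hj0 : (0 : ℝ) ≤ j := Nat.cast_nonneg _
      have hK : (0 : ℝ) < j + 1 + w' + (z' - p) + 1 := by linarith
      unfold jacobiEig at hs2
      push_cast at hs2
      have hs3 : (j + 1 + w' + (z' - p) + 1) * A = (w' + j + 1) * B := by
        have hj1 : (j : ℝ) + 1 ≠ 0 := by positivity
        apply mul_left_cancel₀ hj1
        linear_combination -hs2
      apply mul_left_cancel₀ hK.ne'
      rw [hs3, ih']
      linear_combination (-(Z / moment p z' w' 1)) * hm
  exact this

end

end Moments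


/-! ### Jacobi polynomials as eigenvectors of the Jacobi operator -/

section JacobiPolynomials

open Polynomial

/-- The coefficients of the terminating hypergeometric series in the definition of `jacobiPoly`. -/
def hyperCoeff (α β : ℝ) (n k : ℕ) : ℝ :=
  (k ! : ℝ)⁻¹ * (ascPochhammer ℝ k).eval (-(n : ℝ)) * (ascPochhammer ℝ k).eval (n + β + α + 1) *
    ((ascPochhammer ℝ k).eval (β + 1))⁻¹

lemma hyperCoeff_zero (α β : ℝ) (n : ℕ) : hyperCoeff α β n 0 = 1 := by simp [hyperCoeff]

lemma hyperCoeff_succ {β : ℝ} (α : ℝ) (hβ : -1 < β) (n k : ℕ) :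
    hyperCoeff α β n (k + 1) * ((k + 1) * (β + 1 + k)) =
      hyperCoeff α β n k * ((k - n) * (n + β + α + 1 + k)) := by
  have hk : (0 : ℝ) ≤ k := Nat.cast_nonneg _
  have h1 : (0 : ℝ) < β + 1 + k := by linarith
  have h2 := (ascPochhammer_pos k (β + 1) (by linarith)).ne'
  have h3 : ((k ! : ℕ) : ℝ) ≠ 0 := by exact_mod_cast (Nat.factorial_pos k).ne'
  unfold hyperCoeff
  simp only [ascPochhammer_succ_eval, Nat.factorial_succ]
  push_cast
  field_simp
  ring

lemma hyperCoeff_eq_zero (α β : ℝ) {n k : ℕ} (h : n < k) : hyperCoeff α β n k = 0 := by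
  unfold hyperCoeff
  rw [(ascPochhammer_eval_eq_zero_iff k _).2 ⟨n, h, by simp⟩]
  simp

lemma hyperCoeff_self_ne_zero {α β : ℝ} (hα : -1 < α) (hβ : -1 < β) (n : ℕ) :
    hyperCoeff α β n n ≠ 0 := by
  have h3 : ((n ! : ℕ) : ℝ) ≠ 0 := by exact_mod_cast (Nat.factorial_pos n).ne'
  have h2 := (ascPochhammer_pos n (β + 1) (by linarith)).ne'
  have h4 : (ascPochhammer ℝ n).eval (n + β + α + 1) ≠ 0 := by
    rcases n with _ | n
    · simp
    · refine (ascPochhammer_pos _ _ ?_).ne'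
      have : (0 : ℝ) ≤ n := Nat.cast_nonneg _
      push_cast; linarith
  have h5 : (ascPochhammer ℝ n).eval (-(n : ℝ)) ≠ 0 := by
    rw [Ne, ascPochhammer_eval_eq_zero_iff]
    rintro ⟨k, hk, h⟩
    have : (k : ℝ) < n := by exact_mod_cast hk
    linarith
  unfold hyperCoeff
  positivity

/-- The value of the Jacobi polynomial at `1`. -/
def jacobiTop (β : ℝ) (n : ℕ) : ℝ := (ascPochhammer ℝ n).eval (β + 1) / (n ! : ℝ)

lemma jacobiTop_pos {β : ℝ} (hβ : -1 < β) (n : ℕ) : 0 < jacobiTop β n :=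
  div_pos (ascPochhammer_pos n _ (by linarith)) (by exact_mod_cast Nat.factorial_pos n)

/-- `jacobiPoly` as a formal polynomial; `α` is the exponent of `x` and `β` that of `1 - x` in the
weight. -/
def jacobiPolynomial (α β : ℝ) (n : ℕ) : ℝ[X] :=
  C (jacobiTop β n) * ∑ k ∈ Finset.range (n + 1), C (hyperCoeff α β n k) * (1 - X) ^ k

lemma eval_jacobiPolynomial (α β : ℝ) (n : ℕ) (x : ℝ) :
    (jacobiPolynomial α β n).eval x = jacobiPoly n β α x := by
  unfold jacobiPolynomial jacobiPoly
  rw [ordinaryHypergeometric_eq_tsum]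
  simp only [eval_mul, eval_C, eval_finsetSum, eval_pow, eval_sub, eval_one, eval_X, jacobiTop]
  congr 1
  rw [tsum_eq_sum (s := Finset.range (n + 1))]
  · rfl
  · intro k hk
    have hk' : n < k := by simpa using hk
    have := hyperCoeff_eq_zero α β hk'
    unfold hyperCoeff at this
    rw [this, zero_smul]

lemma natDegree_one_sub_X_pow_le (k : ℕ) : ((1 - X : ℝ[X]) ^ k).natDegree ≤ k := by
  refine natDegree_pow_le.trans ?_
  have : (1 - X : ℝ[X]).natDegree ≤ 1 := (natDegree_sub_le _ _).trans (by simp)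
  nlinarith

lemma coeff_one_sub_X_pow_self (k : ℕ) : ((1 - X : ℝ[X]) ^ k).coeff k = (-1) ^ k := by
  have h : (1 - X : ℝ[X]).natDegree ≤ 1 := (natDegree_sub_le _ _).trans (by simp)
  have := coeff_pow_of_natDegree_le (m := k) h
  simpa [coeff_one] using this

lemma natDegree_jacobiPolynomial_le (α β : ℝ) (n : ℕ) : (jacobiPolynomial α β n).natDegree ≤ n := by
  unfold jacobiPolynomial
  refine (natDegree_C_mul_le _ _).trans (natDegree_sum_le_of_forall_le _ _ fun k hk => ?_)
  have := Finset.mem_range.1 hk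
  exact (natDegree_C_mul_le _ _).trans ((natDegree_one_sub_X_pow_le k).trans (by omega))

lemma degree_jacobiPolynomial {α β : ℝ} (hα : -1 < α) (hβ : -1 < β) (n : ℕ) :
    (jacobiPolynomial α β n).degree = n := by
  have hc : (jacobiPolynomial α β n).coeff n ≠ 0 := by
    unfold jacobiPolynomial
    rw [coeff_C_mul, finsetSum_coeff, Finset.sum_range_succ, Finset.sum_eq_zero]
    · rw [coeff_C_mul, coeff_one_sub_X_pow_self, zero_add]
      exact mul_ne_zero (jacobiTop_pos hβ n).ne'
        (mul_ne_zero (hyperCoeff_self_ne_zero hα hβ n) (pow_ne_zero _ (by norm_num)))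
    · intro k hk
      rw [coeff_C_mul, coeff_eq_zero_of_natDegree_lt, mul_zero]
      exact (natDegree_one_sub_X_pow_le k).trans_lt (Finset.mem_range.1 hk)
  exact le_antisymm (degree_le_of_natDegree_le (natDegree_jacobiPolynomial_le α β n))
    (le_degree_of_ne_zero hc)

/-- Jacobi polynomials are eigenvectors of the Jacobi operator. -/
lemma jacobiOp_jacobiPolynomial {β : ℝ} (α : ℝ) (hβ : -1 < β) (n : ℕ) :
    jacobiOp α β (jacobiPolynomial α β n) = jacobiEig α β n • jacobiPolynomial α β n := by
  unfold jacobiPolynomial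
  rw [← smul_eq_C_mul, map_smul, smul_comm]
  congr 1
  rw [map_sum, Finset.smul_sum]
  simp only [← smul_eq_C_mul, map_smul, jacobiOp_one_sub_X_pow, smul_sub, smul_smul]
  rw [Finset.sum_sub_distrib, Finset.sum_range_succ',
    Finset.sum_range_succ' (fun k => (hyperCoeff α β n k * (k * (β + k))) • ((1 - X : ℝ[X]) ^ (k - 1))),
    ← Finset.sum_range_succ' (fun k => (hyperCoeff α β n k * jacobiEig α β k) •
      ((1 - X : ℝ[X]) ^ k))]
  simp only [Nat.cast_zero, zero_mul, mul_zero, zero_smul, add_zero, Nat.add_sub_cancel]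
  have e : ∀ k ∈ Finset.range n, (hyperCoeff α β n (k + 1) * (((k + 1 : ℕ) : ℝ) *
      (β + ((k + 1 : ℕ) : ℝ)))) • ((1 - X : ℝ[X]) ^ k) =
      (hyperCoeff α β n k * (jacobiEig α β k - jacobiEig α β n)) • ((1 - X : ℝ[X]) ^ k) := by
    intro k _
    congr 1
    have := hyperCoeff_succ α hβ n k
    push_cast
    unfold jacobiEig
    linear_combination this
  have e2 : ∑ k ∈ Finset.range n, (hyperCoeff α β n k * (jacobiEig α β k - jacobiEig α β n)) •
      ((1 - X : ℝ[X]) ^ k) = ∑ k ∈ Finset.range (n + 1),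
      (hyperCoeff α β n k * (jacobiEig α β k - jacobiEig α β n)) • ((1 - X : ℝ[X]) ^ k) := by
    rw [Finset.sum_range_succ]; simp
  rw [Finset.sum_congr rfl e, e2, ← Finset.sum_sub_distrib]
  refine Finset.sum_congr rfl fun k _ => ?_
  rw [← sub_smul]
  congr 1
  ring

lemma jacobiEig_strictMono {α β : ℝ} (hα : -1 < α) (hβ : -1 < β) : StrictMono (jacobiEig α β) := by
  refine strictMono_nat_of_lt_succ fun n => ?_
  have : (0 : ℝ) ≤ n := Nat.cast_nonneg _
  unfold jacobiEig
  push_cast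
  nlinarith

/-- The Jacobi polynomials as a sequence with one polynomial in each degree. -/
def jacobiSequence {α β : ℝ} (hα : -1 < α) (hβ : -1 < β) : Polynomial.Sequence ℝ where
  elems' := jacobiPolynomial α β
  degree_eq' := degree_jacobiPolynomial hα hβ

lemma jacobiSequence_isUnit {α β : ℝ} (hα : -1 < α) (hβ : -1 < β) (i : ℕ) :
    IsUnit (jacobiSequence hα hβ i).leadingCoeff :=
  isUnit_iff_ne_zero.2 (leadingCoeff_ne_zero.2 (Sequence.ne_zero _ i))

lemma span_jacobiPolynomial {α β : ℝ} (hα : -1 < α) (hβ : -1 < β) :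
    Submodule.span ℝ (Set.range (jacobiPolynomial α β)) = ⊤ :=
  (jacobiSequence hα hβ).span (jacobiSequence_isUnit hα hβ)

lemma mem_span_jacobiPolynomial {α β : ℝ} (hα : -1 < α) (hβ : -1 < β) {d : ℕ} {q : ℝ[X]}
    (hq : q.natDegree ≤ d) : q ∈ Submodule.span ℝ (jacobiPolynomial α β '' Set.Iic d) := by
  have := (jacobiSequence hα hβ).span_degreeLE (m := d) fun i _ => jacobiSequence_isUnit hα hβ i
  change Submodule.span ℝ (jacobiPolynomial α β '' Set.Iic d) = _ at this
  rw [this, mem_degreeLE]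
  exact degree_le_of_natDegree_le hq

/-- The semigroup generated by minus the Jacobi operator, on polynomials. -/
def jacobiSemigroup {α β : ℝ} (hα : -1 < α) (hβ : -1 < β) (t : ℝ) : ℝ[X] →ₗ[ℝ] ℝ[X] :=
  ((jacobiSequence hα hβ).basis (jacobiSequence_isUnit hα hβ)).constr ℝ
    fun k => Real.exp (-t * jacobiEig α β k) • jacobiPolynomial α β k

lemma jacobiSemigroup_jacobiPolynomial {α β : ℝ} (hα : -1 < α) (hβ : -1 < β) (t : ℝ) (k : ℕ) :
    jacobiSemigroup hα hβ t (jacobiPolynomial α β k) =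
      Real.exp (-t * jacobiEig α β k) • jacobiPolynomial α β k := by
  have : jacobiPolynomial α β k =
    (jacobiSequence hα hβ).basis (jacobiSequence_isUnit hα hβ) k := by
      rw [Sequence.basis_eq_self]; rfl
  conv_lhs => rw [this]
  exact Module.Basis.constr_basis _ _ _ _

lemma jacobiSemigroup_natDegree_coeff {α β : ℝ} (hα : -1 < α) (hβ : -1 < β) (t : ℝ) {d : ℕ}
    {q : ℝ[X]} (hq : q.natDegree ≤ d) : (jacobiSemigroup hα hβ t q).natDegree ≤ d ∧
      (jacobiSemigroup hα hβ t q).coeff d = Real.exp (-t * jacobiEig α β d) * q.coeff d := by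
  refine Submodule.span_induction ?_ ?_ ?_ ?_ (mem_span_jacobiPolynomial hα hβ hq)
  · rintro _ ⟨k, hk, rfl⟩
    rw [jacobiSemigroup_jacobiPolynomial]
    refine ⟨(natDegree_smul_le _ _).trans ((natDegree_jacobiPolynomial_le α β k).trans hk), ?_⟩
    rw [coeff_smul, smul_eq_mul]
    rcases (Set.mem_Iic.1 hk).eq_or_lt with rfl | h
    · rfl
    · rw [coeff_eq_zero_of_natDegree_lt ((natDegree_jacobiPolynomial_le α β k).trans_lt h)]
      simp
  · simp
  · rintro x y _ _ ⟨h1, h2⟩ ⟨h3, h4⟩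
    rw [map_add, coeff_add, coeff_add, h2, h4, mul_add]
    exact ⟨(natDegree_add_le _ _).trans (max_le h1 h3), rfl⟩
  · rintro a x _ ⟨h1, h2⟩
    rw [map_smul, coeff_smul, coeff_smul, h2]
    refine ⟨(natDegree_smul_le _ _).trans h1, ?_⟩
    simp only [smul_eq_mul]; ring

/-- The one-dimensional semigroup multiplies the Vandermonde determinant by a constant. -/
lemma det_eval_jacobiSemigroup {α β : ℝ} (hα : -1 < α) (hβ : -1 < β) (t : ℝ) {p : ℕ}
    (v : Fin p → ℝ) :
    (Matrix.of fun i j : Fin p => (jacobiSemigroup hα hβ t (X ^ (j : ℕ))).eval (v i)).det =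
      Real.exp (-t * ∑ j ∈ Finset.range p, jacobiEig α β j) * (Matrix.vandermonde v).det := by
  have h : ∀ j : Fin p, (jacobiSemigroup hα hβ t (X ^ (j : ℕ))).natDegree ≤ j ∧
      (jacobiSemigroup hα hβ t (X ^ (j : ℕ))).coeff j = Real.exp (-t * jacobiEig α β j) :=
    fun j => by
    have := jacobiSemigroup_natDegree_coeff hα hβ t (natDegree_X_pow_le (R := ℝ) (j : ℕ))
    simpa using this
  rw [det_eval_eq_prod_coeff_mul_vandermonde
    (fun j : Fin p => jacobiSemigroup hα hβ t (X ^ (j : ℕ))) (fun j => (h j).1)]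
  congr 1
  rw [Finset.prod_congr rfl fun j _ => (h j).2, ← Real.exp_sum, ← Finset.mul_sum,
    Finset.sum_range]

section

variable {p : ℕ} {z' w' : ℝ}

lemma neg_one_lt_sub (hz : (p : ℝ) - 1 < z') : -1 < z' - p := by linarith

/-- The squared norm of a Jacobi polynomial. -/
def jacobiNorm (p : ℕ) (z' w' : ℝ) (k : ℕ) : ℝ :=
  moment p z' w' (jacobiPolynomial w' (z' - p) k ^ 2)

lemma jacobiNormSq_eq (k : ℕ) : jacobiNormSq p z' w' k = jacobiNorm p z' w' k := by
  unfold jacobiNormSq jacobiNorm moment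
  rw [integral_unitInterval fun x => (jacobiPolynomial w' (z' - p) k ^ 2).eval x *
    betaWeight p z' w' x]
  simp only [eval_pow, eval_jacobiPolynomial]

lemma moment_jacobiPolynomial_mul (hz : (p : ℝ) - 1 < z') (hw : -1 < w') {j k : ℕ} (h : j ≠ k) :
    moment p z' w' (jacobiPolynomial w' (z' - p) j * jacobiPolynomial w' (z' - p) k) = 0 := by
  have hz' := neg_one_lt_sub hz
  have := moment_jacobiOp_mul hz hw (jacobiPolynomial w' (z' - p) j)
      (jacobiPolynomial w' (z' - p) k)
  rw [jacobiOp_jacobiPolynomial w' hz', jacobiOp_jacobiPolynomial w' hz', smul_mul_assoc,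
    mul_smul_comm, moment_smul, moment_smul] at this
  have hne := (jacobiEig_strictMono hw hz').injective.ne h
  by_contra h0
  exact hne (mul_right_cancel₀ h0 this)

/-- The semigroup is symmetric for the moment functional. -/
lemma moment_jacobiSemigroup_mul (hz : (p : ℝ) - 1 < z') (hw : -1 < w') (t : ℝ) (q r : ℝ[X]) :
    moment p z' w' (jacobiSemigroup hw (neg_one_lt_sub hz) t q * r) =
      moment p z' w' (q * jacobiSemigroup hw (neg_one_lt_sub hz) t r) := by
  have hz' := neg_one_lt_sub hz
  set S := jacobiSemigroup hw hz' t
  have hq : q ∈ Submodule.span ℝ (Set.range (jacobiPolynomial w' (z' - p))) := by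
    rw [span_jacobiPolynomial hw hz']; trivial
  have hr : r ∈ Submodule.span ℝ (Set.range (jacobiPolynomial w' (z' - p))) := by
    rw [span_jacobiPolynomial hw hz']; trivial
  induction hq using Submodule.span_induction with
  | mem q hq =>
    obtain ⟨j, rfl⟩ := hq
    induction hr using Submodule.span_induction with
    | mem r hr =>
      obtain ⟨k, rfl⟩ := hr
      simp only [S, jacobiSemigroup_jacobiPolynomial, smul_mul_assoc, mul_smul_comm, moment_smul]
      rcases eq_or_ne j k with rfl | h
      · rfl
      · rw [moment_jacobiPolynomial_mul hz hw h, mul_zero, mul_zero]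
    | zero => simp
    | add x y _ _ hx hy => simp only [map_add, mul_add, moment_add hz hw, hx, hy]
    | smul a x _ hx => simp only [map_smul, mul_smul_comm, moment_smul, hx]
  | zero => simp
  | add x y _ _ hx hy => simp only [map_add, add_mul, moment_add hz hw, hx, hy]
  | smul a x _ hx => simp only [map_smul, smul_mul_assoc, moment_smul, hx]

end

end JacobiPolynomials


/-! ### The scaling limit of the one-particle evolution -/

section ScalingLimit

open Polynomial

/-- Coefficientwise convergence of polynomials of bounded degree. -/
def PolyTendsto (q : ℕ → ℝ[X]) (r : ℝ[X]) : Prop :=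
  (∃ d, ∀ N, (q N).natDegree ≤ d) ∧ ∀ j, Tendsto (fun N => (q N).coeff j) atTop (𝓝 (r.coeff j))

lemma PolyTendsto.const (r : ℝ[X]) : PolyTendsto (fun _ => r) r :=
  ⟨⟨_, fun _ => le_rfl⟩, fun _ => tendsto_const_nhds⟩

lemma PolyTendsto.add {q r : ℕ → ℝ[X]} {q' r' : ℝ[X]} (hq : PolyTendsto q q')
    (hr : PolyTendsto r r') : PolyTendsto (fun N => q N + r N) (q' + r') := by
  obtain ⟨⟨d, hd⟩, hq⟩ := hq
  obtain ⟨⟨e, he⟩, hr⟩ := hr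
  refine ⟨⟨max d e, fun N => (natDegree_add_le _ _).trans (max_le_max (hd N) (he N))⟩, fun j => ?_⟩
  simp only [coeff_add]
  exact (hq j).add (hr j)

lemma PolyTendsto.smul {c : ℕ → ℝ} {c' : ℝ} {q : ℕ → ℝ[X]} {q' : ℝ[X]}
    (hc : Tendsto c atTop (𝓝 c')) (hq : PolyTendsto q q') :
    PolyTendsto (fun N => c N • q N) (c' • q') := by
  obtain ⟨⟨d, hd⟩, hq⟩ := hq
  refine ⟨⟨d, fun N => (natDegree_smul_le _ _).trans (hd N)⟩, fun j => ?_⟩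
  simp only [coeff_smul, smul_eq_mul]
  exact hc.mul (hq j)

lemma PolyTendsto.sum {ι : Type*} {s : Finset ι} {q : ι → ℕ → ℝ[X]} {q' : ι → ℝ[X]}
    (h : ∀ i ∈ s, PolyTendsto (q i) (q' i)) :
    PolyTendsto (fun N => ∑ i ∈ s, q i N) (∑ i ∈ s, q' i) := by
  classical
  induction s using Finset.induction_on with
  | empty => simpa using PolyTendsto.const 0
  | insert a s ha ih =>
    simp only [Finset.sum_insert ha]
    exact (h a (Finset.mem_insert_self _ _)).add
      (ih fun i hi => h i (Finset.mem_insert_of_mem hi))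

lemma PolyTendsto.limit_eq_sum {q : ℕ → ℝ[X]} {r : ℝ[X]} {d : ℕ} (hd : ∀ N, (q N).natDegree ≤ d)
    (hq : ∀ j, Tendsto (fun N => (q N).coeff j) atTop (𝓝 (r.coeff j))) : r.natDegree ≤ d := by
  rw [natDegree_le_iff_coeff_eq_zero]
  intro j hj
  refine tendsto_nhds_unique (hq j) (tendsto_const_nhds.congr fun N => ?_)
  exact (coeff_eq_zero_of_natDegree_lt ((hd N).trans_lt hj)).symm

lemma PolyTendsto.map {q : ℕ → ℝ[X]} {r : ℝ[X]} (hq : PolyTendsto q r)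
    {F : ℕ → ℝ[X] →ₗ[ℝ] ℝ[X]} {G : ℝ[X] →ₗ[ℝ] ℝ[X]}
    (hF : ∀ j : ℕ, PolyTendsto (fun N => F N (X ^ j)) (G (X ^ j))) :
    PolyTendsto (fun N => F N (q N)) (G r) := by
  obtain ⟨⟨d, hd⟩, hq⟩ := hq
  have hr := PolyTendsto.limit_eq_sum hd hq
  have e : ∀ (H : ℝ[X] →ₗ[ℝ] ℝ[X]) (f : ℝ[X]), f.natDegree ≤ d →
      H f = ∑ j ∈ Finset.range (d + 1), f.coeff j • H (X ^ j) := by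
    intro H f hf
    conv_lhs => rw [f.as_sum_range_C_mul_X_pow' (Nat.lt_succ_of_le hf), map_sum]
    exact Finset.sum_congr rfl fun j _ => by rw [← smul_eq_C_mul, map_smul]
  rw [e G r hr]
  simp_rw [fun N => e (F N) (q N) (hd N)]
  exact PolyTendsto.sum fun j _ => PolyTendsto.smul (hq j) (hF j)

lemma PolyTendsto.linear {q : ℕ → ℝ[X]} {r : ℝ[X]} (hq : PolyTendsto q r) (L : ℝ[X] →ₗ[ℝ] ℝ) :
    Tendsto (fun N => L (q N)) atTop (𝓝 (L r)) := by
  obtain ⟨⟨d, hd⟩, hq⟩ := hq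
  have hr := PolyTendsto.limit_eq_sum hd hq
  have e : ∀ f : ℝ[X], f.natDegree ≤ d →
      L f = ∑ j ∈ Finset.range (d + 1), f.coeff j * L (X ^ j) := by
    intro f hf
    conv_lhs => rw [f.as_sum_range_C_mul_X_pow' (Nat.lt_succ_of_le hf), map_sum]
    exact Finset.sum_congr rfl fun j _ => by rw [← smul_eq_C_mul, map_smul, smul_eq_mul]
  rw [e r hr]
  simp_rw [fun N => e (q N) (hd N)]
  exact tendsto_finsetSum _ fun j _ => (hq j).mul_const _

/-- The discretized multiplication operators converge to multiplication operators. -/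
lemma polyTendsto_aeval_posOp {h : ℕ → ℝ} (hh : Tendsto h atTop (𝓝 0)) (f : ℝ[X]) {q : ℕ → ℝ[X]}
    {r : ℝ[X]} (hq : PolyTendsto q r) :
    PolyTendsto (fun N => aeval (posOp (h N)) f (q N)) (f * r) := by
  have h1 : ∀ {q : ℕ → ℝ[X]} {r : ℝ[X]}, PolyTendsto q r →
      PolyTendsto (fun N => posOp (h N) (q N)) (X * r) := by
    intro q r hq
    refine hq.map (G := LinearMap.mulLeft ℝ X) fun j => ?_
    simp only [posOp_X_pow, LinearMap.mulLeft_apply, ← smul_eq_C_mul]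
    have h2 : Tendsto (fun N => h N * j) atTop (𝓝 0) := by simpa using hh.mul_const (j : ℝ)
    have h3 : Tendsto (fun N => 1 - h N * j) atTop (𝓝 1) := by
      simpa using tendsto_const_nhds (x := (1 : ℝ)).sub h2
    have := (PolyTendsto.smul h3 (PolyTendsto.const (X ^ (j + 1)))).add
      (PolyTendsto.smul h2 (PolyTendsto.const (X ^ j)))
    simpa [pow_succ'] using this
  have h2 : ∀ i : ℕ, PolyTendsto (fun N => (posOp (h N) ^ i) (q N)) (X ^ i * r) := by
    intro i
    induction i with
    | zero => simpa using hq
    | succ i ih =>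
      simp only [pow_succ', Module.End.mul_apply, mul_assoc]
      exact h1 ih
  simp only [aeval_posOp_apply]
  have : f * r = ∑ i ∈ Finset.range (f.natDegree + 1), f.coeff i • (X ^ i * r) := by
    conv_lhs => rw [f.as_sum_range_C_mul_X_pow, Finset.sum_mul]
    exact Finset.sum_congr rfl fun i _ => by rw [smul_eq_C_mul, mul_assoc]
  rw [this]
  exact PolyTendsto.sum fun i _ => PolyTendsto.smul tendsto_const_nhds (h2 i)

lemma tendsto_one_sub_div_pow {g : ℕ → ℕ} {c : ℕ → ℝ} {t : ℝ} (hc : Tendsto c atTop atTop)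
    (hg : Tendsto (fun N => (g N : ℝ) / c N) atTop (𝓝 t)) (κ : ℝ) :
    Tendsto (fun N => (1 - κ / c N) ^ g N) atTop (𝓝 (Real.exp (-t * κ))) := by
  have h1 : Tendsto (fun N => c N * Real.log (1 + -κ / c N)) atTop (𝓝 (-κ)) :=
    (Real.tendsto_mul_log_one_add_div_atTop (-κ)).comp hc
  have h2 := (Real.continuous_exp.tendsto _).comp (hg.mul h1)
  rw [show -t * κ = t * -κ by ring]
  have h3 : Tendsto (fun N => κ / c N) atTop (𝓝 0) := hc.const_div_atTop κ
  refine h2.congr' ?_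
  filter_upwards [hc.eventually_gt_atTop 0, h3.eventually_lt_const zero_lt_one] with N hN hN'
  have h4 : (0 : ℝ) < 1 - κ / c N := by linarith
  rw [Function.comp_apply, show (g N : ℝ) / c N * (c N * Real.log (1 + -κ / c N)) =
    g N * Real.log (1 - κ / c N) by field_simp; ring_nf, Real.exp_nat_mul, Real.exp_log h4]

/-- Powers of `1 - L / c` converge to the semigroup generated by `-L`. -/
lemma polyTendsto_pow_jacobiOp {α β : ℝ} (hα : -1 < α) (hβ : -1 < β) {g : ℕ → ℕ} {c : ℕ → ℝ}
    {t : ℝ} (hc : Tendsto c atTop atTop) (hg : Tendsto (fun N => (g N : ℝ) / c N) atTop (𝓝 t))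
    {q : ℕ → ℝ[X]} {r : ℝ[X]} (hq : PolyTendsto q r) :
    PolyTendsto (fun N => ((LinearMap.id - (c N)⁻¹ • jacobiOp α β : ℝ[X] →ₗ[ℝ] ℝ[X]) ^ g N) (q N))
      (jacobiSemigroup hα hβ t r) := by
  refine hq.map fun j => ?_
  have hX : (X ^ j : ℝ[X]) ∈ Submodule.span ℝ (Set.range (jacobiPolynomial α β)) := by
    rw [span_jacobiPolynomial hα hβ]; trivial
  generalize (X ^ j : ℝ[X]) = f at hX ⊢
  induction hX using Submodule.span_induction with
  | mem f hf =>
    obtain ⟨k, rfl⟩ := hf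
    have e : ∀ N m, ((LinearMap.id - (c N)⁻¹ • jacobiOp α β : ℝ[X] →ₗ[ℝ] ℝ[X]) ^ m)
        (jacobiPolynomial α β k) = (1 - jacobiEig α β k / c N) ^ m • jacobiPolynomial α β k := by
      intro N m
      induction m with
      | zero => simp
      | succ m ih =>
        rw [pow_succ', Module.End.mul_apply, ih, map_smul, LinearMap.sub_apply,
          LinearMap.smul_apply, jacobiOp_jacobiPolynomial α hβ, LinearMap.id_apply, pow_succ,
          mul_smul, smul_smul (c N)⁻¹, sub_smul, one_smul, div_eq_inv_mul]
    simp only [e, jacobiSemigroup_jacobiPolynomial]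
    exact PolyTendsto.smul (tendsto_one_sub_div_pow hc hg _) (PolyTendsto.const _)
  | zero => simpa using PolyTendsto.const 0
  | add x y _ _ hx hy => simpa only [map_add] using hx.add hy
  | smul a x _ hx => simpa only [map_smul] using PolyTendsto.smul tendsto_const_nhds hx

end ScalingLimit


/-! ### The scaling limit of the correlation functions -/

section CorrelationLimit

open Polynomial

variable {p : ℕ} {z' w' : ℝ}

lemma moment_sq_pos (hz : (p : ℝ) - 1 < z') (hw : -1 < w') {q : ℝ[X]} (hq : q ≠ 0) :
    0 < moment p z' w' (q ^ 2) := by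
  have hnn : ∀ x : unitInterval, 0 ≤ (q ^ 2).eval (x : ℝ) * betaWeight p z' w' x := fun x => by
    rw [eval_pow]
    exact mul_nonneg (sq_nonneg _) (betaWeight_nonneg p z' w' x)
  have h0 : 0 ≤ moment p z' w' (q ^ 2) := integral_nonneg hnn
  refine lt_of_le_of_ne h0 fun h => hq ?_
  have hae := (integral_eq_zero_iff_of_nonneg hnn (integrable_eval_mul_betaWeight hz hw _)).1 h.symm
  rw [← integral_eq_zero_iff_of_nonneg hnn (integrable_eval_mul_betaWeight hz hw _)] at hae
  rw [integral_unitInterval fun x => (q ^ 2).eval x * betaWeight p z' w' x,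
    intervalIntegral.integral_of_le zero_le_one, integral_Ioc_eq_integral_Ioo,
    integral_eq_zero_iff_of_nonneg_ae] at hae
  · by_contra hne
    have hfin : (q.roots.toFinset : Set ℝ).Finite := Finset.finite_toSet _
    have h1 : ∀ᵐ x ∂(volume.restrict (Set.Ioo (0 : ℝ) 1)), x ∈ (q.roots.toFinset : Set ℝ) := by
      filter_upwards [hae, ae_restrict_mem measurableSet_Ioo] with x hx hx'
      have h2 := (betaWeight_pos p z' w' hx').ne'
      simp only [Pi.zero_apply, eval_pow] at hx
      have h3 : q.eval x = 0 := by
        rcases mul_eq_zero.1 hx with h | h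
        · exact pow_eq_zero_iff (two_ne_zero) |>.1 h
        · exact absurd h h2
      simpa using ⟨hne, h3⟩
    have h2 : ∀ᵐ x ∂(volume.restrict (Set.Ioo (0 : ℝ) 1)), x ∉ (q.roots.toFinset : Set ℝ) :=
      measure_eq_zero_iff_ae_notMem.1 (hfin.measure_zero _)
    have h3 : ∀ᵐ _x ∂(volume.restrict (Set.Ioo (0 : ℝ) 1)), False := by
      filter_upwards [h1, h2] with x hx hx' using hx' hx
    rw [eventually_false_iff_eq_bot, ae_eq_bot, Measure.restrict_eq_zero] at h3
    simp at h3
  · filter_upwards [ae_restrict_mem measurableSet_Ioo] with x hx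
    exact hnn ⟨x, hx.1.le, hx.2.le⟩
  · have := (integrable_unitInterval_iff fun x => (q ^ 2).eval x * betaWeight p z' w' x).1
      (integrable_eval_mul_betaWeight hz hw _)
    exact this.mono_set Set.Ioo_subset_Icc_self

/-- The Gram determinant of the monomials. -/
def gramDet (p : ℕ) (z' w' : ℝ) : ℝ :=
  (Matrix.of fun a b : Fin p => moment p z' w' (X ^ (a : ℕ) * X ^ (b : ℕ))).det

lemma gramDet_ne_zero (hz : (p : ℝ) - 1 < z') (hw : -1 < w') : gramDet p z' w' ≠ 0 := by
  intro h
  obtain ⟨v, hv, hv0⟩ := Matrix.exists_mulVec_eq_zero_iff.2 h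
  set q : ℝ[X] := ∑ b : Fin p, v b • X ^ (b : ℕ) with hqdef
  have hq : q ≠ 0 := by
    intro h0
    apply hv
    funext b
    have := congrArg (fun f : ℝ[X] => f.coeff b) h0
    simpa [hqdef, finsetSum_coeff, coeff_X_pow, Fin.val_inj] using this
  have h1 : momentLin hz hw (q * q) = 0 := by
    have h2 : ∀ a : Fin p, momentLin hz hw (X ^ (a : ℕ) * q) = 0 := fun a => by
      rw [hqdef, Finset.mul_sum, map_sum]
      simp only [mul_smul_comm, map_smul, smul_eq_mul]
      have := congrFun hv0 a
      simp only [Matrix.mulVec, dotProduct, Matrix.of_apply, Pi.zero_apply] at this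
      rw [← this]
      exact Finset.sum_congr rfl fun b _ => mul_comm _ _
    conv_lhs => rw [hqdef, Finset.sum_mul, map_sum]
    refine Finset.sum_eq_zero fun a _ => ?_
    rw [smul_mul_assoc, map_smul, ← hqdef, h2, smul_zero]
  have h3 := moment_sq_pos hz hw hq
  rw [sq] at h3
  exact h3.ne' h1

/-- The one-particle functions whose determinants give the correlation functions of the limit
process: alternate multiplication by `ξ k` and the Jacobi semigroup between consecutive times. -/
def limitWave (hz : (p : ℝ) - 1 < z') (hw : -1 < w') (τ : ℕ → ℝ≥0) (ξ : ℕ → ℝ[X]) :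
    ℕ → ℝ[X] → ℝ[X]
  | 0, q => ξ 0 * q
  | K + 1, q => ξ (K + 1) * jacobiSemigroup hw (neg_one_lt_sub hz) ((τ (K + 1) : ℝ) - τ K)
      (limitWave hz hw τ ξ K q)

/-- The limit of the expectations of products of multiplicative functions. -/
def limitCorr (hz : (p : ℝ) - 1 < z') (hw : -1 < w') (τ : ℕ → ℝ≥0) (ξ : ℕ → ℝ[X]) (K : ℕ) : ℝ :=
  Real.exp (((τ K : ℝ) - τ 0) * totalK p z' w') * (Matrix.of fun a b : Fin p =>
    moment p z' w' (X ^ (a : ℕ) * limitWave hz hw τ ξ K (X ^ (b : ℕ)))).det / gramDet p z' w'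

/-- The polynomials representing `wave`, up to normalization, in the basis of falling factorials. -/
def scaledWave (p : ℕ) (z' w' : ℝ) (N : ℕ) (m : ℕ → ℕ) (ξ : ℕ → ℝ[X]) : ℕ → ℝ[X] → ℝ[X]
  | 0, q => aeval (posOp (1 / ((N + p - 1 : ℕ) : ℝ))) (ξ 0) q
  | K + 1, q => aeval (posOp (1 / ((N + p - 1 : ℕ) : ℝ))) (ξ (K + 1))
      (((LinearMap.id - (stepConst p z' w' N)⁻¹ • jacobiOp w' (z' - p) : ℝ[X] →ₗ[ℝ] ℝ[X]) ^
        (m (K + 1) - m K)) (scaledWave p z' w' N m ξ K q))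

lemma natDegree_pow_id_sub_le {α β : ℝ} (c : ℝ) (g : ℕ) (q : ℝ[X]) :
    (((LinearMap.id - c • jacobiOp α β : ℝ[X] →ₗ[ℝ] ℝ[X]) ^ g) q).natDegree ≤ q.natDegree := by
  induction g with
  | zero => simp
  | succ g ih =>
    rw [pow_succ', Module.End.mul_apply]
    refine le_trans ?_ ih
    exact (natDegree_sub_le _ _).trans
      (max_le le_rfl ((natDegree_smul_le _ _).trans (natDegree_jacobiOp_le _ _ _)))

lemma natDegree_scaledWave_le (p : ℕ) (z' w' : ℝ) (N : ℕ) (m : ℕ → ℕ) (ξ : ℕ → ℝ[X]) (K : ℕ)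
    (q : ℝ[X]) : (scaledWave p z' w' N m ξ K q).natDegree ≤
      q.natDegree + ∑ k ∈ Finset.range (K + 1), (ξ k).natDegree := by
  induction K with
  | zero =>
    simp only [zero_add, Finset.sum_range_one]
    exact natDegree_aeval_posOp_le _ _ _
  | succ K ih =>
    rw [Finset.sum_range_succ, ← add_assoc]
    refine (natDegree_aeval_posOp_le _ _ _).trans (Nat.add_le_add_right ?_ _)
    exact (natDegree_pow_id_sub_le _ _ _).trans ih

lemma stepConst_pos (hz : (p : ℝ) - 1 < z') (hw : -1 < w') {N : ℕ} (hN : 0 < N) :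
    0 < stepConst p z' w' N := by
  have h1 : (1 : ℝ) ≤ N := by exact_mod_cast hN
  have h2 : (0 : ℝ) ≤ p := Nat.cast_nonneg _
  unfold stepConst
  apply mul_pos <;> linarith

lemma wave_fallingMap (hz : (p : ℝ) - 1 < z') (hw : -1 < w') {N : ℕ} (hN : 0 < N) {m : ℕ → ℕ}
    (hm : Monotone m) (ξ : ℕ → ℝ[X]) (K : ℕ) {q : ℝ[X]}
    (hq : q.natDegree + ∑ k ∈ Finset.range (K + 1), (ξ k).natDegree ≤ N + p - 1) :
    wave p z' w' N m (fun k u => (ξ k).eval (u / ((N + p - 1 : ℕ) : ℝ))) K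
      (fallingMap ((N + p - 1 : ℕ) : ℝ) q) =
      stepConst p z' w' N ^ (m K - m 0) •
        fallingMap ((N + p - 1 : ℕ) : ℝ) (scaledWave p z' w' N m ξ K q) := by
  have hC := (stepConst_pos hz hw hN).ne'
  induction K with
  | zero =>
    funext u
    simp only [wave, scaledWave, Nat.sub_self, pow_zero, one_smul]
    rw [fallingMap_aeval_posOp (by simpa using hq)]
  | succ K ih =>
    have hq' : q.natDegree + ∑ k ∈ Finset.range (K + 1), (ξ k).natDegree ≤ N + p - 1 := by
      rw [Finset.sum_range_succ] at hq; omega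
    have hd := natDegree_scaledWave_le p z' w' N m ξ K q
    have hpow : ∀ g : ℕ, (stepConst p z' w' N • LinearMap.id - jacobiOp w' (z' - p) :
        ℝ[X] →ₗ[ℝ] ℝ[X]) ^ g = stepConst p z' w' N ^ g •
        (LinearMap.id - (stepConst p z' w' N)⁻¹ • jacobiOp w' (z' - p) : ℝ[X] →ₗ[ℝ] ℝ[X]) ^ g := by
      intro g
      rw [← _root_.smul_pow]
      congr 1
      rw [smul_sub, smul_smul, mul_inv_cancel₀ hC, one_smul]
    have hit : ∀ (c : ℝ) (q : ℝ[X]) (g : ℕ), q.natDegree < N + p → (stepOp p z' w' N)^[g]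
        (c • fallingMap ((N + p - 1 : ℕ) : ℝ) q) = (c * stepConst p z' w' N ^ g) •
        fallingMap ((N + p - 1 : ℕ) : ℝ) (((LinearMap.id - (stepConst p z' w' N)⁻¹ •
          jacobiOp w' (z' - p) : ℝ[X] →ₗ[ℝ] ℝ[X]) ^ g) q) := by
      intro c q g hq
      rw [← map_smul, stepOp_iterate_fallingMap z' w' ((natDegree_smul_le _ _).trans_lt hq), hpow,
        LinearMap.smul_apply, map_smul, map_smul, map_smul, smul_smul, mul_comm]
    funext u
    simp only [wave, scaledWave, ih hq', Pi.smul_apply, smul_eq_mul]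
    rw [hit _ _ _ (by omega), fallingMap_aeval_posOp]
    · rw [show m (K + 1) - m 0 = (m K - m 0) + (m (K + 1) - m K) by
        have := hm (Nat.zero_le K); have := hm (Nat.le_add_right K 1); omega, pow_add]
      simp only [Pi.smul_apply, smul_eq_mul]
      ring
    · rw [Finset.sum_range_succ] at hq
      have := natDegree_pow_id_sub_le (α := w') (β := z' - p) (stepConst p z' w' N)⁻¹
        (m (K + 1) - m K) (scaledWave p z' w' N m ξ K q)
      omega

lemma tendsto_stepConst (p : ℕ) (z' w' : ℝ) :
    Tendsto (fun N : ℕ => stepConst p z' w' N) atTop atTop := by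
  have h1 : Tendsto (fun N : ℕ => (N : ℝ) + p) atTop atTop :=
    tendsto_atTop_add_const_right _ _ tendsto_natCast_atTop_atTop
  have h2 : Tendsto (fun N : ℕ => (N : ℝ) + 1 + z' + w') atTop atTop :=
    tendsto_atTop_add_const_right _ _ (tendsto_atTop_add_const_right _ _
      (tendsto_atTop_add_const_right _ _ tendsto_natCast_atTop_atTop))
  exact h1.atTop_mul_atTop₀ h2

lemma tendsto_div_stepConst (p : ℕ) (z' w' : ℝ) {s t : ℝ≥0} (hst : s ≤ t) :
    Tendsto (fun N : ℕ => ((⌊t * (N : ℝ≥0) ^ 2⌋₊ - ⌊s * (N : ℝ≥0) ^ 2⌋₊ : ℕ) : ℝ) /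
      stepConst p z' w' N) atTop (𝓝 ((t : ℝ) - s)) := by
  have hinv : Tendsto (fun N : ℕ => ((N : ℝ))⁻¹) atTop (𝓝 0) :=
    tendsto_inv_atTop_zero.comp tendsto_natCast_atTop_atTop
  have hC : Tendsto (fun N : ℕ => stepConst p z' w' N / (N : ℝ) ^ 2) atTop (𝓝 1) := by
    have h1 : Tendsto (fun N : ℕ => (1 + p * (N : ℝ)⁻¹) * (1 + (1 + z' + w') * (N : ℝ)⁻¹))
        atTop (𝓝 ((1 + p * 0) * (1 + (1 + z' + w') * 0))) :=
      ((hinv.const_mul _).const_add _).mul ((hinv.const_mul _).const_add _)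
    simp only [mul_zero, add_zero, mul_one] at h1
    refine h1.congr' ?_
    filter_upwards [eventually_gt_atTop 0] with N hN
    have : (N : ℝ) ≠ 0 := by exact_mod_cast hN.ne'
    unfold stepConst
    field_simp
    ring
  have hsq : Tendsto (fun N : ℕ => (N : ℝ) ^ 2) atTop atTop :=
    (tendsto_pow_atTop two_ne_zero).comp tendsto_natCast_atTop_atTop
  have hfl : ∀ t : ℝ≥0, Tendsto (fun N : ℕ => ((⌊t * (N : ℝ≥0) ^ 2⌋₊ : ℕ) : ℝ) / (N : ℝ) ^ 2)
      atTop (𝓝 t) := by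
    intro t
    have := (tendsto_nat_floor_mul_div_atTop (R := ℝ) t.2).comp hsq
    refine this.congr fun N => ?_
    simp only [Function.comp_apply]
    congr 2
  have h := ((hfl t).sub (hfl s)).div hC one_ne_zero
  rw [div_one] at h
  refine h.congr' ?_
  filter_upwards [eventually_gt_atTop 0] with N hN
  have hN' : (N : ℝ) ^ 2 ≠ 0 := by positivity
  have hle : ⌊s * (N : ℝ≥0) ^ 2⌋₊ ≤ ⌊t * (N : ℝ≥0) ^ 2⌋₊ := Nat.floor_le_floor (by gcongr)
  rw [Nat.cast_sub hle, Pi.div_apply, ← sub_div, div_div_div_cancel_right₀ hN']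

/-- The discrete time corresponding to the time `t` of the limit process. -/
def discreteTime (N : ℕ) (t : ℝ≥0) : ℕ := ⌊t * (N : ℝ≥0) ^ 2⌋₊

lemma discreteTime_mono (N : ℕ) : Monotone (discreteTime N) := fun s t h =>
  Nat.floor_le_floor (by gcongr)

lemma polyTendsto_scaledWave (hz : (p : ℝ) - 1 < z') (hw : -1 < w') {τ : ℕ → ℝ≥0}
    (hτ : Monotone τ) (ξ : ℕ → ℝ[X]) (K : ℕ) {q : ℕ → ℝ[X]} {r : ℝ[X]} (hq : PolyTendsto q r) :
    PolyTendsto (fun N => scaledWave p z' w' N (fun k => discreteTime N (τ k)) ξ K (q N))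
      (limitWave hz hw τ ξ K r) := by
  have hh : Tendsto (fun N : ℕ => 1 / ((N + p - 1 : ℕ) : ℝ)) atTop (𝓝 0) := by
    refine tendsto_one_div_atTop_nhds_zero_nat.comp ?_
    exact tendsto_atTop_mono (fun N => show N - 1 ≤ N + p - 1 by omega) (tendsto_sub_atTop_nat 1)
  induction K with
  | zero => exact polyTendsto_aeval_posOp hh _ hq
  | succ K ih =>
    exact polyTendsto_aeval_posOp hh _ (polyTendsto_pow_jacobiOp hw (neg_one_lt_sub hz)
      (tendsto_stepConst p z' w') (tendsto_div_stepConst p z' w' (hτ (Nat.le_succ K))) ih)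

lemma stepNorm_eq (p : ℕ) (z' w' : ℝ) (N : ℕ) :
    stepNorm p z' w' N = ∏ j ∈ Finset.range p, (stepConst p z' w' N - eigK p z' w' j) := by
  unfold stepNorm
  rw [Finset.prod_range]
  refine Finset.prod_congr rfl fun j _ => ?_
  unfold stepConst eigK
  push_cast
  ring

lemma tendsto_stepNorm (hz : (p : ℝ) - 1 < z') (hw : -1 < w') {s t : ℝ≥0} (hst : s ≤ t) :
    Tendsto (fun N => (stepNorm p z' w' N)⁻¹ ^ (discreteTime N t - discreteTime N s) *
      (stepConst p z' w' N ^ (discreteTime N t - discreteTime N s)) ^ p) atTop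
      (𝓝 (Real.exp (((t : ℝ) - s) * totalK p z' w'))) := by
  have h1 : Tendsto (fun N => ∏ j ∈ Finset.range p, ((1 - eigK p z' w' j / stepConst p z' w' N) ^
      (discreteTime N t - discreteTime N s))⁻¹) atTop
      (𝓝 (∏ j ∈ Finset.range p, (Real.exp (-((t : ℝ) - s) * eigK p z' w' j))⁻¹)) :=
    tendsto_finsetProd _ fun j _ => (tendsto_one_sub_div_pow (tendsto_stepConst p z' w')
      (tendsto_div_stepConst p z' w' hst) _).inv₀ (Real.exp_pos _).ne'
  have h2 : ∏ j ∈ Finset.range p, (Real.exp (-((t : ℝ) - s) * eigK p z' w' j))⁻¹ =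
      Real.exp (((t : ℝ) - s) * totalK p z' w') := by
    rw [totalK, Finset.mul_sum, Real.exp_sum]
    refine Finset.prod_congr rfl fun j _ => ?_
    rw [← Real.exp_neg]; congr 1; ring
  rw [h2] at h1
  refine h1.congr' ?_
  filter_upwards [eventually_gt_atTop 0] with N hN
  have hC := (stepConst_pos hz hw hN).ne'
  rw [Finset.prod_inv_distrib, Finset.prod_pow, stepNorm_eq, inv_pow, ← pow_mul, mul_comm _ p,
    pow_mul, ← inv_pow, ← inv_pow, ← mul_pow]
  congr 1
  have : ∀ j ∈ Finset.range p, 1 - eigK p z' w' j / stepConst p z' w' N =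
      (stepConst p z' w' N - eigK p z' w' j) / stepConst p z' w' N := fun j _ => by field_simp
  rw [Finset.prod_congr rfl this, Finset.prod_div_distrib, Finset.prod_const, Finset.card_range,
    inv_div, div_eq_inv_mul]

/-- Expectations of products of multiplicative functions converge in the scaling limit. -/
theorem tendsto_integral_rescaledProcess (hz : (p : ℝ) - 1 < z') (hw : -1 < w')
    (hp : p = 0 → z' + w' ≠ -1) {Ω' : ℕ → Type*} [∀ N, MeasurableSpace (Ω' N)]
    (P' : ∀ N, Measure (Ω' N)) [∀ N, IsProbabilityMeasure (P' N)] (T : ∀ N, ℕ → Ω' N → Signature N)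
    (hT : ∀ N, IsUpDownChain (P' N) (zwMeasure p 0 z' w') N (T N))
    {τ : ℕ → ℝ≥0} (hτ : Monotone τ) (ξ : ℕ → ℝ[X]) (K : ℕ) :
    Tendsto (fun N => ∫ ω, ∏ k ∈ Finset.range (K + 1), ∏ i,
      (ξ k).eval (rescaledProcess p N (T N) (τ k) ω i : ℝ) ∂P' N) atTop
      (𝓝 (limitCorr hz hw τ ξ K)) := by
  set L := momentLin hz hw with hL
  set n : ℕ → ℕ := fun N => N + p - 1 with hn
  set A : ℕ → ℕ → ℝ[X] := fun N b => aeval (posOp (1 / (n N : ℝ))) (X ^ b : ℝ[X]) (1 : ℝ[X]) with hA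
  have hh : Tendsto (fun N : ℕ => 1 / (n N : ℝ)) atTop (𝓝 0) := by
    refine tendsto_one_div_atTop_nhds_zero_nat.comp ?_
    exact tendsto_atTop_mono (fun N => show N - 1 ≤ N + p - 1 by omega) (tendsto_sub_atTop_nat 1)
  have hAlim : ∀ b, PolyTendsto (fun N => A N b) (X ^ b) := fun b => by
    have := polyTendsto_aeval_posOp hh (X ^ b) (PolyTendsto.const 1)
    rwa [mul_one] at this
  have hAdeg : ∀ N b : ℕ, (A N b).natDegree ≤ b := fun N b => by
    have := natDegree_aeval_posOp_le (1 / (n N : ℝ)) (X ^ b) (1 : ℝ[X])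
    rwa [natDegree_one, natDegree_X_pow, zero_add] at this
  set m : ℕ → ℕ → ℕ := fun N k => discreteTime N (τ k) with hm
  have hmm : ∀ N, Monotone (m N) := fun N => (discreteTime_mono N).comp hτ
  have hnum : Tendsto (fun N => (Matrix.of fun a b : Fin p => L (aeval (posOp (1 / (n N : ℝ)))
      (X ^ (a : ℕ) : ℝ[X])
          (scaledWave p z' w' N (m N) ξ K (A N b)))).det) atTop
      (𝓝 (Matrix.of fun a b : Fin p =>
        L (X ^ (a : ℕ) * limitWave hz hw τ ξ K (X ^ (b : ℕ)))).det) := by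
    refine ((Continuous.matrix_det continuous_id).tendsto _).comp ?_
    refine tendsto_pi_nhds.2 fun a => tendsto_pi_nhds.2 fun b => ?_
    exact (polyTendsto_aeval_posOp hh _ (polyTendsto_scaledWave hz hw hτ ξ K (hAlim b))).linear L
  have hden : Tendsto (fun N => (Matrix.of fun a b : Fin p => L (aeval (posOp (1 / (n N : ℝ)))
      (X ^ (a : ℕ) : ℝ[X]) (A N b))).det) atTop (𝓝 (gramDet p z' w')) := by
    refine ((Continuous.matrix_det continuous_id).tendsto _).comp ?_
    refine tendsto_pi_nhds.2 fun a => tendsto_pi_nhds.2 fun b => ?_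
    exact (polyTendsto_aeval_posOp hh _ (hAlim b)).linear L
  have hlim := ((tendsto_stepNorm hz hw (hτ (Nat.zero_le K))).mul hnum).div hden
    (gramDet_ne_zero hz hw)
  refine hlim.congr' ?_
  filter_upwards [eventually_gt_atTop (p + p + ∑ k ∈ Finset.range (K + 1), (ξ k).natDegree + 1),
    hden.eventually_ne (gramDet_ne_zero hz hw)] with N hN hd
  have hNpos : 0 < N := by omega
  have hnpos : 0 < n N := by simp only [hn]; omega
  have hn0 : (n N : ℝ) ≠ 0 := by exact_mod_cast hnpos.ne'
  have hnR : (N : ℝ) + p - 1 = (n N : ℝ) := by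
    simp only [hn]
    rw [Nat.cast_sub (by omega)]; push_cast; ring
  have hfall : ∀ b < p, ∀ x, fallingMap (n N : ℝ) (A N b) x = (x / n N) ^ b := fun b hb x => by
    simp only [hA]
    rw [fallingMap_aeval_posOp (by simp only [natDegree_one, natDegree_X_pow, hn]; omega)]
    have : fallingMap (n N : ℝ) (1 : ℝ[X]) x = 1 := by
      have := congrFun (fallingMap_X_pow (n N : ℝ) 0) x
      rw [pow_zero] at this
      rw [this]; simp [fallingFun]
    rw [this]; simp
  set f : Fin p → ℝ → ℝ := fun b => fallingMap (n N : ℝ) (A N b) with hf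
  have hvand : ∀ x : Fin p → ℕ, vand x = (∏ j : Fin p, (n N : ℝ) ^ (j : ℕ)) * slater f x := by
    intro x
    unfold vand slater
    rw [← Matrix.det_mul_row]
    congr 1
    ext i j
    simp only [hf, hfall j j.2, Matrix.vandermonde_apply, Matrix.of_apply, div_pow]
    field_simp
  have hI := (hT N).integral_prod hz hw hp (hmm N) (fun k u => (ξ k).eval (u / (n N : ℝ))) hvand K
  have hint : ∫ ω, ∏ k ∈ Finset.range (K + 1), ∏ i,
      (ξ k).eval (rescaledProcess p N (T N) (τ k) ω i : ℝ) ∂P' N =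
      ∫ ω, ∏ k ∈ Finset.range (K + 1), ∏ i,
        (ξ k).eval (config p (T N (m N k) ω) i / (n N : ℝ)) ∂P' N := by
    simp only [rescaledProcess, scaledConfig, hnR, hm, discreteTime]
  rw [hint]
  set Z := (∑ x ∈ Finset.range (N + p), hahnWt p z' w' N x) / moment p z' w' 1 with hZ
  have hnN : n N = N + p - 1 := rfl
  have hZpos : 0 < Z := by
    refine div_pos (Finset.sum_pos (fun x hx => hahnWt_pos hz hw ?_) ⟨0, ?_⟩) ?_
    · exact Finset.mem_range.1 hx
    · exact Finset.mem_range.2 (by omega)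
    · simpa using moment_X_pow_pos hz hw 0
  have hsum : ∀ (a : Fin p) (q : ℝ[X]), (a : ℕ) + q.natDegree ≤ n N →
      ∑ x ∈ Finset.range (N + p), hahnWt p z' w' N x * (f a x * fallingMap (n N : ℝ) q x) =
      Z * L (aeval (posOp (1 / (n N : ℝ))) (X ^ (a : ℕ) : ℝ[X]) q) := by
    intro a q hq
    have h1 := sum_hahnWt_fallingMap hz hw (N := N)
      (q := aeval (posOp (1 / (n N : ℝ))) (X ^ (a : ℕ) : ℝ[X]) q) (by
        have := natDegree_aeval_posOp_le (1 / (n N : ℝ)) (X ^ (a : ℕ) : ℝ[X]) q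
        rw [natDegree_X_pow] at this
        omega)
    rw [← hZ, ← hnN] at h1
    change _ = Z * moment p z' w' _
    rw [← h1]
    refine Finset.sum_congr rfl fun x _ => ?_
    rw [fallingMap_aeval_posOp (by rw [natDegree_X_pow]; omega)]
    simp only [hf, hfall a a.2, eval_pow, eval_X]
  have hdegA : ∀ b : Fin p, (A N b).natDegree ≤ p := fun b => (hAdeg N b).trans b.2.le
  have e1 : (Matrix.of fun a b => ∑ x ∈ Finset.range (N + p),
      hahnWt p z' w' N x * (f a x * f b x)).det = Z ^ p * (Matrix.of fun a b : Fin p =>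
        L (aeval (posOp (1 / (n N : ℝ))) (X ^ (a : ℕ) : ℝ[X]) (A N b))).det := by
    have := Matrix.det_smul (Matrix.of fun a b : Fin p =>
        L (aeval (posOp (1 / (n N : ℝ))) (X ^ (a : ℕ) : ℝ[X]) (A N b))) Z
    rw [Fintype.card_fin] at this
    rw [← this]
    congr 1
    ext a b
    exact hsum a _ (by have := hdegA b; have := a.2; omega)
  have e2 : (Matrix.of fun a b => ∑ x ∈ Finset.range (N + p), hahnWt p z' w' N x *
      (f a x * wave p z' w' N (m N) (fun k u => (ξ k).eval (u / (n N : ℝ))) K (f b) x)).det =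
      Z ^ p * ((stepConst p z' w' N ^ (m N K - m N 0)) ^ p * (Matrix.of fun a b : Fin p =>
        L (aeval (posOp (1 / (n N : ℝ))) (X ^ (a : ℕ) : ℝ[X])
          (scaledWave p z' w' N (m N) ξ K (A N b)))).det) := by
    have := Matrix.det_smul (Matrix.of fun a b : Fin p =>
        L (aeval (posOp (1 / (n N : ℝ))) (X ^ (a : ℕ) : ℝ[X]) (scaledWave p z' w' N (m N) ξ K (A N b))))
        (Z * stepConst p z' w' N ^ (m N K - m N 0))
    rw [Fintype.card_fin, mul_pow, mul_assoc] at this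
    rw [← this]
    congr 1
    ext a b
    have hdb := hdegA b
    have hdw := natDegree_scaledWave_le p z' w' N (m N) ξ K (A N b)
    have hab := a.2
    have h2 := hsum a (scaledWave p z' w' N (m N) ξ K (A N b)) (by omega)
    simp only [Matrix.of_apply, Matrix.smul_apply, smul_eq_mul]
    rw [mul_right_comm, ← h2, Finset.sum_mul]
    refine Finset.sum_congr rfl fun x _ => ?_
    simp only [hf]
    have h3 := wave_fallingMap hz hw hNpos (hmm N) ξ K (q := A N b) (by omega)
    rw [← hnN] at h3
    rw [h3]
    simp only [Pi.smul_apply, smul_eq_mul]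
    ring
  rw [e1, e2] at hI
  simp only [Pi.div_apply]
  rw [div_eq_iff hd]
  have hZp : Z ^ p ≠ 0 := pow_ne_zero _ hZpos.ne'
  apply mul_left_cancel₀ hZp
  linear_combination -hI

end CorrelationLimit


/-! ### Bounds for Jacobi polynomials -/

section JacobiBounds

open Polynomial

/-- A bound for the growth of the hypergeometric coefficients of the `n`-th Jacobi polynomial. -/
def growth (α β : ℝ) (n : ℕ) : ℝ := (2 * n + |β + α + 1|) / (β + 1)

lemma growth_nonneg {β : ℝ} (α : ℝ) (hβ : -1 < β) (n : ℕ) : 0 ≤ growth α β n :=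
  div_nonneg (by positivity) (by linarith)

lemma abs_hyperCoeff_le {β : ℝ} (α : ℝ) (hβ : -1 < β) {n k : ℕ} (hk : k ≤ n) :
    |hyperCoeff α β n k| ≤ n.choose k * growth α β n ^ k := by
  induction k with
  | zero => simp [hyperCoeff_zero]
  | succ k ih =>
    have ih' := ih (by omega)
    have h := hyperCoeff_succ α hβ n k
    have hk0 : (0 : ℝ) ≤ k := Nat.cast_nonneg _
    have hkn : (k : ℝ) + 1 ≤ n := by exact_mod_cast hk
    have h1 : (0 : ℝ) < (k + 1) * (β + 1 + k) := mul_pos (by linarith) (by linarith)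
    have hch : (n.choose (k + 1) : ℝ) * (k + 1) = n.choose k * (n - k) := by
      have := Nat.choose_succ_right_eq n k
      have h2 : ((n.choose (k + 1) * (k + 1) : ℕ) : ℝ) = ((n.choose k * (n - k) : ℕ) : ℝ) := by
        rw [this]
      rw [Nat.cast_mul, Nat.cast_mul, Nat.cast_sub (by omega)] at h2
      push_cast at h2
      exact h2
    have h2 := congrArg abs h
    rw [abs_mul, abs_of_pos h1, abs_mul, abs_mul,
      abs_of_nonpos (by linarith : (k : ℝ) - n ≤ 0)] at h2
    have h3 : |(n : ℝ) + β + α + 1 + k| ≤ growth α β n * (β + 1 + k) := by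
      have h4 : |(n : ℝ) + β + α + 1 + k| ≤ 2 * n + |β + α + 1| := by
        rw [show (n : ℝ) + β + α + 1 + k = (n + k) + (β + α + 1) by ring]
        refine (abs_add_le _ _).trans ?_
        rw [abs_of_nonneg (by linarith)]
        linarith
      have h5 : growth α β n * (β + 1) = 2 * n + |β + α + 1| := by
        unfold growth
        rw [div_mul_cancel₀]; linarith
      have := mul_nonneg (growth_nonneg α hβ n) hk0
      nlinarith
    have hg := growth_nonneg α hβ n
    refine le_of_mul_le_mul_right ?_ h1
    rw [h2]
    calc |hyperCoeff α β n k| * (-((k : ℝ) - n) * |(n : ℝ) + β + α + 1 + k|)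
        ≤ (n.choose k * growth α β n ^ k) * (-((k : ℝ) - n) * (growth α β n * (β + 1 + k))) := by
          refine mul_le_mul ih' (mul_le_mul_of_nonneg_left h3 (by linarith)) ?_ (by positivity)
          exact mul_nonneg (by linarith) (abs_nonneg _)
      _ = (n.choose k * (n - k)) * growth α β n ^ (k + 1) * (β + 1 + k) := by ring
      _ = _ := by rw [← hch]; ring

lemma sum_abs_hyperCoeff_le {β : ℝ} (α : ℝ) (hβ : -1 < β) (n : ℕ) {v : ℝ} (hv : 0 ≤ v) :
    ∑ k ∈ Finset.range (n + 1), |hyperCoeff α β n k| * v ^ k ≤ (1 + growth α β n * v) ^ n := by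
  rw [add_comm 1, add_pow]
  refine Finset.sum_le_sum fun k hk => ?_
  have := abs_hyperCoeff_le α hβ (n := n) (k := k) (by have := Finset.mem_range.1 hk; omega)
  rw [one_pow, mul_one, mul_pow, mul_comm _ (n.choose k : ℝ), ← mul_assoc]
  exact mul_le_mul_of_nonneg_right this (pow_nonneg hv _)

lemma abs_eval_jacobiPolynomial_le {β : ℝ} (α : ℝ) (hβ : -1 < β) (n : ℕ) (x : unitInterval) :
    |(jacobiPolynomial α β n).eval (x : ℝ)| ≤ jacobiTop β n * (1 + growth α β n) ^ n := by
  unfold jacobiPolynomial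
  simp only [eval_mul, eval_C, eval_finsetSum, eval_pow, eval_sub, eval_one, eval_X]
  rw [abs_mul, abs_of_pos (jacobiTop_pos hβ n)]
  refine mul_le_mul_of_nonneg_left ?_ (jacobiTop_pos hβ n).le
  have h := sum_abs_hyperCoeff_le α hβ n zero_le_one
  simp only [one_pow, mul_one] at h
  refine (Finset.abs_sum_le_sum_abs _ _).trans (le_trans (Finset.sum_le_sum fun k _ => ?_) h)
  rw [abs_mul, abs_pow, abs_of_nonneg (show 0 ≤ 1 - (x : ℝ) by linarith [x.2.2])]
  refine mul_le_of_le_one_right (abs_nonneg _) (pow_le_one₀ ?_ ?_) <;> linarith [x.2.1, x.2.2]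

/-- Near the endpoint `1` the Jacobi polynomial is comparable with its value there. -/
lemma le_eval_jacobiPolynomial {β : ℝ} (α : ℝ) (hβ : -1 < β) (n : ℕ) {x : ℝ} (hx : x ≤ 1)
    (hx' : (1 - x) * (4 * ((n + 1) * (1 + growth α β n))) ≤ 1) :
    jacobiTop β n / 2 ≤ (jacobiPolynomial α β n).eval x := by
  set v := 1 - x with hv
  have hv0 : 0 ≤ v := by linarith
  have hg := growth_nonneg α hβ n
  unfold jacobiPolynomial
  simp only [eval_mul, eval_C, eval_finsetSum, eval_pow, eval_sub, eval_one, eval_X, ← hv]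
  rw [div_eq_mul_inv]
  refine mul_le_mul_of_nonneg_left ?_ (jacobiTop_pos hβ n).le
  have h := sum_abs_hyperCoeff_le α hβ n hv0
  rw [Finset.sum_range_succ'] at h ⊢
  simp only [hyperCoeff_zero, pow_zero, abs_one, mul_one] at h ⊢
  have h1 : -∑ k ∈ Finset.range n, |hyperCoeff α β n (k + 1)| * v ^ (k + 1) ≤
      ∑ k ∈ Finset.range n, hyperCoeff α β n (k + 1) * v ^ (k + 1) := by
    rw [← Finset.sum_neg_distrib]
    refine Finset.sum_le_sum fun k _ => ?_
    rw [← neg_mul]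
    exact mul_le_mul_of_nonneg_right (neg_abs_le _) (pow_nonneg hv0 _)
  have h2 : (1 + growth α β n * v) ^ n ≤ 3 / 2 := by
    have h3 : (1 + growth α β n * v) ^ n ≤ Real.exp (n * (growth α β n * v)) := by
      rw [Real.exp_nat_mul]
      exact pow_le_pow_left₀ (by positivity)
        (by linarith [Real.add_one_le_exp (growth α β n * v)]) n
    have h4 : (n : ℝ) * (growth α β n * v) ≤ 1 / 4 := by
      have : (n : ℝ) * (growth α β n * v) ≤ v * ((n + 1) * (1 + growth α β n)) := by
        have := mul_nonneg (Nat.cast_nonneg (α := ℝ) n) hv0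
        have := mul_nonneg hg hv0
        nlinarith
      linarith
    have h5 : Real.exp (1 / 4) ≤ 3 / 2 := by
      have h6 := Real.add_one_le_exp (-(1 / 4 : ℝ))
      rw [Real.exp_neg] at h6
      have h7 := Real.exp_pos (1 / 4)
      have h8 : (3 / 4 : ℝ) * Real.exp (1 / 4) ≤ 1 := by
        calc (3 / 4 : ℝ) * Real.exp (1 / 4) ≤ (Real.exp (1 / 4))⁻¹ * Real.exp (1 / 4) :=
              mul_le_mul_of_nonneg_right (by linarith) h7.le
          _ = 1 := inv_mul_cancel₀ h7.ne'
      linarith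
    exact h3.trans ((Real.exp_le_exp.2 h4).trans h5)
  linarith

variable {p : ℕ} {z' w' : ℝ}

lemma jacobiNorm_pos (hz : (p : ℝ) - 1 < z') (hw : -1 < w') (k : ℕ) : 0 < jacobiNorm p z' w' k := by
  refine moment_sq_pos hz hw fun h => ?_
  have := degree_jacobiPolynomial hw (neg_one_lt_sub hz) k
  rw [h] at this
  simp at this

/-- A lower bound for the norm, from the neighbourhood of the endpoint `1`. -/
lemma le_jacobiNorm (hz : (p : ℝ) - 1 < z') (hw : -1 < w') (n : ℕ) {δ : ℝ}
    (hδ : δ * (4 * ((n + 1) * (1 + growth w' (z' - p) n))) = 1) (hδ0 : 0 < δ) :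
    (jacobiTop (z' - p) n / 2) ^ 2 * ((1 / 2) ^ |w'| * (δ / 2) ^ |z' - p|) * (δ / 2) ≤
      jacobiNorm p z' w' n := by
  have hβ := neg_one_lt_sub hz
  have hg := growth_nonneg w' hβ n
  have hδ1 : δ ≤ 1 / 4 := by
    have : (1 : ℝ) ≤ (n + 1) * (1 + growth w' (z' - p) n) := by
      have : (0 : ℝ) ≤ n := Nat.cast_nonneg _
      nlinarith
    nlinarith
  set F : ℝ → ℝ := fun x => (jacobiPolynomial w' (z' - p) n ^ 2).eval x * betaWeight p z' w' x
  have hint : IntegrableOn F (Set.Icc 0 1) :=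
    (integrable_unitInterval_iff F).1 (integrable_eval_mul_betaWeight hz hw _)
  have hsub : Set.Icc (1 - δ) (1 - δ / 2) ⊆ Set.Icc (0 : ℝ) 1 :=
    Set.Icc_subset_Icc (by linarith) (by linarith)
  have hF : ∀ x ∈ Set.Icc (0 : ℝ) 1, 0 ≤ F x := fun x hx => by
    simp only [F, eval_pow]
    exact mul_nonneg (sq_nonneg _) (betaWeight_nonneg p z' w' ⟨x, hx⟩)
  have e1 : jacobiNorm p z' w' n = ∫ x in Set.Icc (0 : ℝ) 1, F x := by
    unfold jacobiNorm moment
    rw [integral_unitInterval F, intervalIntegral.integral_of_le zero_le_one,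
      integral_Icc_eq_integral_Ioc]
  rw [e1]
  have h1 : ∫ x in Set.Icc (1 - δ) (1 - δ / 2), F x ≤ ∫ x in Set.Icc (0 : ℝ) 1, F x :=
    setIntegral_mono_set hint ((ae_restrict_mem measurableSet_Icc).mono hF)
      hsub.eventuallyLE
  refine le_trans ?_ h1
  set c := (jacobiTop (z' - p) n / 2) ^ 2 * ((1 / 2) ^ |w'| * (δ / 2) ^ |z' - p|) with hc
  have h2 : ∫ _x in Set.Icc (1 - δ) (1 - δ / 2), c ≤ ∫ x in Set.Icc (1 - δ) (1 - δ / 2), F x := by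
    refine setIntegral_mono_on (integrable_const _) (hint.mono_set hsub) measurableSet_Icc
      fun x hx => ?_
    have hx1 : 1 / 2 ≤ x := by linarith [hx.1]
    have hx2 : x ≤ 1 := by linarith [hx.2]
    have hx3 : δ / 2 ≤ 1 - x := by linarith [hx.2]
    have h3 := le_eval_jacobiPolynomial w' hβ n hx2 (by
      refine le_trans (mul_le_mul_of_nonneg_right (show 1 - x ≤ δ by linarith [hx.1]) ?_) hδ.le
      positivity)
    have ht := (jacobiTop_pos hβ n).le
    simp only [F, eval_pow, betaWeight, hc]
    have hpow : ∀ {y b : ℝ} (e : ℝ), 0 < b → b ≤ y → y ≤ 1 → b ^ |e| ≤ y ^ e := by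
      intro y b e hb hby hy
      refine (Real.rpow_le_rpow hb.le hby (abs_nonneg e)).trans ?_
      exact Real.rpow_le_rpow_of_exponent_ge (hb.trans_le hby) hy (le_abs_self e)
    refine mul_le_mul (pow_le_pow_left₀ (by linarith) h3 2) ?_ (by positivity) (sq_nonneg _)
    exact mul_le_mul (hpow w' (by norm_num) hx1 hx2)
      (hpow (z' - p) (by linarith) hx3 (by linarith)) (by positivity)
      (Real.rpow_nonneg (by linarith) _)
  refine le_trans (le_of_eq ?_) h2
  rw [setIntegral_const, smul_eq_mul, Real.volume_real_Icc_of_le (by linarith)]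
  ring

/-- The uniform norms of the normalized Jacobi polynomials grow subgaussianly. -/
lemma exists_jacobi_bound (hz : (p : ℝ) - 1 < z') (hw : -1 < w') :
    ∃ (C D : ℝ) (m : ℕ), 0 < C ∧ 1 ≤ D ∧ ∀ (n : ℕ) (x y : unitInterval),
      |(jacobiPolynomial w' (z' - p) n).eval (x : ℝ) *
          (jacobiPolynomial w' (z' - p) n).eval (y : ℝ) /
        jacobiNorm p z' w' n| ≤ C * (D * (n + 1)) ^ (2 * (n + m)) := by
  have hβ := neg_one_lt_sub hz
  set b := |z' - p| with hb
  have hb0 : 0 ≤ b := abs_nonneg _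
  obtain ⟨m, hm⟩ := exists_nat_ge (1 + b)
  set a := (2 + |z' - p + w' + 1|) / (z' - p + 1) + 1 with ha
  have hβ1 : 0 < z' - p + 1 := by linarith
  have ha1 : 1 ≤ a := by
    have : 0 ≤ (2 + |z' - p + w' + 1|) / (z' - p + 1) := by positivity
    linarith
  refine ⟨4 * ((1 / 2 : ℝ) ^ |w'|)⁻¹, 8 * a, m, by positivity, by linarith, fun n x y => ?_⟩
  have hn0 : (0 : ℝ) ≤ n := Nat.cast_nonneg _
  set g := 1 + growth w' (z' - p) n with hg
  have hg1 : 1 ≤ g := by have := growth_nonneg w' hβ n; linarith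
  have hga : g ≤ a * (n + 1) := by
    have : growth w' (z' - p) n ≤ (2 + |z' - p + w' + 1|) / (z' - p + 1) * (n + 1) := by
      unfold growth
      rw [div_mul_eq_mul_div]
      refine div_le_div_of_nonneg_right ?_ hβ1.le
      have := mul_nonneg (abs_nonneg (z' - p + w' + 1)) hn0
      nlinarith
    rw [hg, ha]
    nlinarith
  set δ := (4 * ((n + 1) * g))⁻¹ with hδ
  have hG : 0 < 4 * (((n : ℝ) + 1) * g) := by positivity
  have hδ0 : 0 < δ := inv_pos.2 hG
  have hlow := le_jacobiNorm hz hw n (δ := δ) (by rw [hδ]; exact inv_mul_cancel₀ hG.ne') hδ0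
  set t := jacobiTop (z' - p) n with ht
  have ht0 : 0 < t := jacobiTop_pos hβ n
  set c := (1 / 2 : ℝ) ^ |w'| with hc
  have hc0 : 0 < c := by positivity
  have hx := abs_eval_jacobiPolynomial_le w' hβ n x
  have hy := abs_eval_jacobiPolynomial_le w' hβ n y
  rw [← ht, ← hg] at hx hy
  set B := 8 * a * ((n : ℝ) + 1) with hB
  have hB1 : 1 ≤ B := by nlinarith
  have hδB : B⁻¹ ^ 2 ≤ δ / 2 := by
    rw [hδ, inv_pow, div_eq_mul_inv, ← mul_inv]
    apply inv_anti₀ (by positivity)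
    have : g * ((n : ℝ) + 1) ≤ a * (n + 1) * (n + 1) := mul_le_mul_of_nonneg_right hga (by linarith)
    have h1 : a * ((n : ℝ) + 1) * (n + 1) ≤ a * a * ((n : ℝ) + 1) * (n + 1) := by
      have : 0 ≤ a * ((n : ℝ) + 1) * (n + 1) := by positivity
      nlinarith
    have h2 : 0 ≤ a * a * ((n : ℝ) + 1) * (n + 1) := by positivity
    rw [hB]
    nlinarith
  have hδpow : (B⁻¹ ^ 2) ^ m ≤ (δ / 2) ^ b * (δ / 2) := by
    have hδ2 : 0 < δ / 2 := by linarith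
    have hδ3 : δ / 2 ≤ 1 := by
      have h4 : 1 ≤ 4 * (((n : ℝ) + 1) * g) := by nlinarith
      have : δ ≤ 1 := inv_le_one_of_one_le₀ h4
      linarith
    calc (B⁻¹ ^ 2) ^ m ≤ (δ / 2) ^ m := pow_le_pow_left₀ (by positivity) hδB m
      _ = (δ / 2) ^ (m : ℝ) := (Real.rpow_natCast _ _).symm
      _ ≤ (δ / 2) ^ (1 + b) := Real.rpow_le_rpow_of_exponent_ge hδ2 hδ3 hm
      _ = _ := by rw [Real.rpow_add hδ2, Real.rpow_one, mul_comm]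
  have hh : (t / 2) ^ 2 * c * (B⁻¹ ^ 2) ^ m ≤ jacobiNorm p z' w' n := by
    refine le_trans ?_ hlow
    have := mul_le_mul_of_nonneg_left hδpow (show 0 ≤ (t / 2) ^ 2 * c by positivity)
    linarith
  rw [abs_div, abs_mul, abs_of_pos (jacobiNorm_pos hz hw n), div_le_iff₀ (jacobiNorm_pos hz hw n)]
  have hgB : g ≤ B := by nlinarith
  calc |(jacobiPolynomial w' (z' - p) n).eval (x : ℝ)| *
        |(jacobiPolynomial w' (z' - p) n).eval (y : ℝ)|
      ≤ (t * g ^ n) * (t * g ^ n) := mul_le_mul hx hy (abs_nonneg _) (by positivity)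
    _ ≤ (t * B ^ n) * (t * B ^ n) := by
        have := pow_le_pow_left₀ (by linarith) hgB n
        gcongr
    _ = 4 * c⁻¹ * B ^ (2 * (n + m)) * ((t / 2) ^ 2 * c * (B⁻¹ ^ 2) ^ m) := by
        have hBm : B ^ (2 * (n + m)) * (B⁻¹ ^ 2) ^ m = B ^ (2 * n) := by
          rw [← pow_mul, inv_pow, mul_add, pow_add, mul_assoc, mul_inv_cancel₀ (by positivity),
            mul_one]
        calc (t * B ^ n) * (t * B ^ n) = t ^ 2 * B ^ (2 * n) := by ring
          _ = t ^ 2 * (B ^ (2 * (n + m)) * (B⁻¹ ^ 2) ^ m) := by rw [hBm]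
          _ = _ := by field_simp; ring
    _ ≤ _ := mul_le_mul_of_nonneg_left hh (by positivity)

/-- Gaussian decay beats the growth of the Jacobi polynomials. -/
lemma summable_exp_mul_pow {s t D : ℝ} (ht : 0 < t) (hD : 1 ≤ D) (m : ℕ) :
    Summable fun k : ℕ => Real.exp (-t * (k * (k + s))) * (D * (k + 1)) ^ (2 * (k + m)) := by
  refine Summable.of_norm_bounded_eventually_nat (g := fun k : ℕ => Real.exp (-k))
    Real.summable_exp_neg_nat ?_
  have hlog : ∀ᶠ y : ℝ in atTop, Real.log y ≤ t / (16 * D) * y := by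
    have := Real.isLittleO_log_id_atTop.bound (show 0 < t / (16 * D) by positivity)
    filter_upwards [this, eventually_ge_atTop 0] with y hy hy0
    rw [id, Real.norm_of_nonneg hy0] at hy
    exact (le_abs_self _).trans hy
  have hcast : Tendsto (fun k : ℕ => D * ((k : ℝ) + 1)) atTop atTop :=
    Tendsto.const_mul_atTop (by linarith)
      (tendsto_atTop_add_const_right _ _ tendsto_natCast_atTop_atTop)
  have hbig : Tendsto (fun k : ℕ => t / 2 * (k : ℝ) + (t * s - 1)) atTop atTop :=
    tendsto_atTop_add_const_right _ _
      (Tendsto.const_mul_atTop (by linarith) tendsto_natCast_atTop_atTop)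
  filter_upwards [hcast.eventually hlog, eventually_ge_atTop m, eventually_ge_atTop 1,
    hbig.eventually_ge_atTop 0] with k hk hkm hk1 hk2
  have hk1' : (1 : ℝ) ≤ k := by exact_mod_cast hk1
  have hkm' : (m : ℝ) ≤ k := by exact_mod_cast hkm
  have hpos : 0 < D * ((k : ℝ) + 1) := by positivity
  rw [Real.norm_of_nonneg (by positivity), ← Real.exp_log (pow_pos hpos (2 * (k + m))),
    ← Real.exp_add, Real.exp_le_exp, Real.log_pow]
  have h1 : t / (16 * D) * (D * ((k : ℝ) + 1)) = t / 16 * (k + 1) := by field_simp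
  rw [h1] at hk
  push_cast
  have h2 : 2 * ((k : ℝ) + m) * Real.log (D * (k + 1)) ≤ 2 * (k + k) * (t / 16 * (k + k)) := by
    have hl : 0 ≤ Real.log (D * (k + 1)) := Real.log_nonneg (by nlinarith)
    refine mul_le_mul (by linarith) (hk.trans ?_) hl (by positivity)
    exact mul_le_mul_of_nonneg_left (by linarith) (by positivity)
  nlinarith

end JacobiBounds


/-! ### The kernel of the Jacobi semigroup -/

section Kernel

open Polynomial

/-- The terms of the kernel of the Jacobi semigroup with respect to the Jacobi weight. -/
def heatTerm (p : ℕ) (z' w' t : ℝ) (k : ℕ) (x y : ℝ) : ℝ :=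
  Real.exp (-t * eigK p z' w' k) * ((jacobiPolynomial w' (z' - p) k).eval x *
    (jacobiPolynomial w' (z' - p) k).eval y / jacobiNorm p z' w' k)

/-- The kernel of the Jacobi semigroup with respect to the Jacobi weight. -/
def heatKernel (p : ℕ) (z' w' t x y : ℝ) : ℝ := ∑' k, heatTerm p z' w' t k x y

variable {p : ℕ} {z' w' : ℝ}

lemma exists_heatTerm_bound (hz : (p : ℝ) - 1 < z') (hw : -1 < w') {t : ℝ} (ht : 0 < t) :
    ∃ u : ℕ → ℝ, Summable u ∧ ∀ k (x y : unitInterval), |heatTerm p z' w' t k x y| ≤ u k := by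
  obtain ⟨C, D, m, hC, hD, h⟩ := exists_jacobi_bound hz hw
  refine ⟨fun k => C * (Real.exp (-t * (k * (k + (w' + z' + 1 - p)))) *
    (D * (k + 1)) ^ (2 * (k + m))), (summable_exp_mul_pow ht hD m).mul_left C, fun k x y => ?_⟩
  simp only
  unfold heatTerm eigK
  rw [abs_mul, abs_of_pos (Real.exp_pos _), mul_left_comm C,
    show (k : ℝ) * (k + w' + z' + 1 - p) = k * (k + (w' + z' + 1 - p)) by ring]
  exact mul_le_mul_of_nonneg_left (h k x y) (Real.exp_pos _).le

lemma summable_heatTerm (hz : (p : ℝ) - 1 < z') (hw : -1 < w') {t : ℝ} (ht : 0 < t)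
    (x y : unitInterval) : Summable fun k => heatTerm p z' w' t k x y := by
  obtain ⟨u, hu, h⟩ := exists_heatTerm_bound hz hw ht
  exact Summable.of_norm_bounded hu fun k => h k x y

lemma jacobiKernelTerm_eq (t : ℝ) (hz : (p : ℝ) - 1 < z') (hw : -1 < w') (x y : ℝ) (k : ℕ) :
    jacobiKernelTerm p z' w' t x y k =
      √(betaWeight p z' w' x) * √(betaWeight p z' w' y) * heatTerm p z' w' t k x y := by
  unfold jacobiKernelTerm jacobiFun heatTerm
  simp only [eval_jacobiPolynomial, jacobiNormSq_eq]
  have h := Real.mul_self_sqrt (jacobiNorm_pos hz hw k).le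
  have h0 : √(jacobiNorm p z' w' k) ≠ 0 := (Real.sqrt_pos.2 (jacobiNorm_pos hz hw k)).ne'
  rw [← h]
  field_simp
  rw [Real.sqrt_sq (Real.sqrt_nonneg _)]

lemma summable_jacobiKernelTerm (hz : (p : ℝ) - 1 < z') (hw : -1 < w') {t : ℝ} (ht : 0 < t)
    {x y : ℝ} (hx : x ∈ Set.Icc (0 : ℝ) 1) (hy : y ∈ Set.Icc (0 : ℝ) 1) :
    Summable (jacobiKernelTerm p z' w' t x y) := by
  have h := (summable_heatTerm hz hw ht ⟨x, hx⟩ ⟨y, hy⟩).mul_left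
    (√(betaWeight p z' w' x) * √(betaWeight p z' w' y))
  exact h.congr fun k => (jacobiKernelTerm_eq t hz hw x y k).symm

lemma jacobiKernel_eq (t : ℝ) (hz : (p : ℝ) - 1 < z') (hw : -1 < w') (x y : ℝ) :
    jacobiKernel p z' w' t x y =
      √(betaWeight p z' w' x) * √(betaWeight p z' w' y) * heatKernel p z' w' t x y := by
  unfold jacobiKernel heatKernel
  simp_rw [jacobiKernelTerm_eq t hz hw]
  exact tsum_mul_left

lemma continuous_heatTerm (t : ℝ) (k : ℕ) :
    Continuous fun z : unitInterval × unitInterval => heatTerm p z' w' t k z.1 z.2 := by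
  unfold heatTerm
  have h1 := (continuous_eval_unitInterval (jacobiPolynomial w' (z' - p) k)).comp
    (continuous_fst (X := unitInterval) (Y := unitInterval))
  have h2 := (continuous_eval_unitInterval (jacobiPolynomial w' (z' - p) k)).comp
    (continuous_snd (X := unitInterval) (Y := unitInterval))
  exact continuous_const.mul ((h1.mul h2).div_const _)

lemma continuous_heatKernel (hz : (p : ℝ) - 1 < z') (hw : -1 < w') {t : ℝ} (ht : 0 < t) :
    Continuous fun z : unitInterval × unitInterval => heatKernel p z' w' t z.1 z.2 := by
  obtain ⟨u, hu, h⟩ := exists_heatTerm_bound hz hw ht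
  exact continuous_tsum (fun k => continuous_heatTerm t k) hu fun k z => h k z.1 z.2

lemma integrable_heatKernel_mul (hz : (p : ℝ) - 1 < z') (hw : -1 < w') {t : ℝ} (ht : 0 < t)
    (x : unitInterval) (ψ : ℝ[X]) : Integrable fun y : unitInterval =>
      ψ.eval (y : ℝ) * (heatKernel p z' w' t x y * betaWeight p z' w' y) := by
  have h1 : Continuous fun y : unitInterval => heatKernel p z' w' t x y :=
    (continuous_heatKernel hz hw ht).comp (Continuous.prodMk_right x)
  refine (integrable_continuous_mul_betaWeight hz hw
    ((continuous_eval_unitInterval ψ).mul h1)).congr (Eventually.of_forall fun y => ?_)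
  exact mul_assoc _ _ _

lemma integral_heatKernel_mul (hz : (p : ℝ) - 1 < z') (hw : -1 < w') {t : ℝ} (ht : 0 < t)
    (x : unitInterval) (ψ : ℝ[X]) :
    ∫ y : unitInterval, ψ.eval (y : ℝ) * (heatKernel p z' w' t x y * betaWeight p z' w' y) =
      (jacobiSemigroup hw (neg_one_lt_sub hz) t ψ).eval (x : ℝ) := by
  have hβ := neg_one_lt_sub hz
  have hψ : ψ ∈ Submodule.span ℝ (Set.range (jacobiPolynomial w' (z' - p))) := by
    rw [span_jacobiPolynomial hw hβ]; trivial
  induction hψ using Submodule.span_induction with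
  | mem ψ hψ =>
    obtain ⟨j, rfl⟩ := hψ
    set J := jacobiPolynomial w' (z' - p) with hJ
    obtain ⟨u, hu, hb⟩ := exists_heatTerm_bound hz hw ht
    have hcont : ∀ k, Continuous fun y : unitInterval => heatTerm p z' w' t k x y := fun k =>
      (continuous_heatTerm (p := p) (z' := z') (w' := w') t k).comp (Continuous.prodMk_right x)
    have hint : ∀ k, Integrable fun y : unitInterval => heatTerm p z' w' t k x y *
        ((J j).eval (y : ℝ) * betaWeight p z' w' y) := fun k => by
      refine (integrable_continuous_mul_betaWeight hz hw
        ((hcont k).mul (continuous_eval_unitInterval (J j)))).congr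
          (Eventually.of_forall fun y => ?_)
      exact mul_assoc _ _ _
    have hnorm := (integrable_eval_mul_betaWeight hz hw (J j)).norm
    have hsum := hasSum_integral_of_summable_integral_norm (μ := (volume : Measure unitInterval))
      (F := fun k (y : unitInterval) => heatTerm p z' w' t k x y *
        ((J j).eval (y : ℝ) * betaWeight p z' w' y)) hint (by
      refine Summable.of_nonneg_of_le (fun k => integral_nonneg fun y => norm_nonneg _)
        (fun k => ?_)
        (hu.mul_right (∫ y : unitInterval, ‖(J j).eval (y : ℝ) * betaWeight p z' w' y‖))
      rw [← integral_const_mul]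
      refine integral_mono (hint k).norm (hnorm.const_mul _) fun y => ?_
      simp only [norm_mul (heatTerm p z' w' t k x y)]
      exact mul_le_mul_of_nonneg_right (hb k x y) (norm_nonneg _))
    have hterm : ∀ k, ∫ y : unitInterval, heatTerm p z' w' t k x y *
        ((J j).eval (y : ℝ) * betaWeight p z' w' y) =
        if k = j then Real.exp (-t * jacobiEig w' (z' - p) j) * (J j).eval (x : ℝ) else 0 := by
      intro k
      have e : ∀ y : unitInterval, heatTerm p z' w' t k x y *
          ((J j).eval (y : ℝ) * betaWeight p z' w' y) =
          (Real.exp (-t * eigK p z' w' k) * ((J k).eval (x : ℝ) / jacobiNorm p z' w' k)) *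
            ((J k * J j).eval (y : ℝ) * betaWeight p z' w' y) := fun y => by
        rw [eval_mul]; unfold heatTerm; ring
      simp_rw [e]
      rw [integral_const_mul]
      change _ * moment p z' w' (J k * J j) = _
      split_ifs with h
      · subst h
        rw [← sq]
        change _ * jacobiNorm p z' w' k = _
        rw [mul_assoc, div_mul_cancel₀ _ (jacobiNorm_pos hz hw k).ne', eigK_eq]
      · rw [moment_jacobiPolynomial_mul hz hw h, mul_zero]
    simp_rw [hterm] at hsum
    have h2 := hsum.unique (hasSum_ite_eq j _)
    rw [jacobiSemigroup_jacobiPolynomial, eval_smul, smul_eq_mul, ← hJ, ← h2]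
    refine integral_congr_ae (Eventually.of_forall fun y => ?_)
    simp only
    rw [tsum_mul_right]
    unfold heatKernel
    ring
  | zero => simp
  | add f g _ _ hf hg =>
    simp only [map_add, eval_add, add_mul]
    rw [integral_add (integrable_heatKernel_mul hz hw ht x f)
      (integrable_heatKernel_mul hz hw ht x g), hf, hg]
  | smul a f _ hf =>
    simp only [map_smul, eval_smul, smul_eq_mul, mul_assoc]
    rw [integral_const_mul, hf]

end Kernel

/-! ### The Andréief identity -/

section Andreief

lemma measurableSet_strictMono (p : ℕ) :
    MeasurableSet {X : Fin p → unitInterval | StrictMono X} := by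
  have : {X : Fin p → unitInterval | StrictMono X} =
      ⋂ i, ⋂ j, ⋂ (_ : i < j), {X : Fin p → unitInterval | X i < X j} := by
    ext X; simp [StrictMono]
  rw [this]
  exact MeasurableSet.iInter fun i => MeasurableSet.iInter fun j => MeasurableSet.iInter fun _ =>
    measurableSet_lt (measurable_pi_apply i) (measurable_pi_apply j)

/-- The determinant `det f_j(x_i)`. -/
def detFun {p : ℕ} {α : Type*} (f : Fin p → α → ℝ) (X : Fin p → α) : ℝ :=
  (Matrix.of fun i j => f j (X i)).det

lemma detFun_eq_sum {p : ℕ} {α : Type*} (f : Fin p → α → ℝ) (X : Fin p → α) :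
    detFun f X = ∑ σ : Equiv.Perm (Fin p), ((Equiv.Perm.sign σ : ℤ) : ℝ) * ∏ i, f (σ i) (X i) := by
  unfold detFun
  rw [← Matrix.det_transpose, Matrix.det_apply']
  rfl

lemma detFun_comp_perm {p : ℕ} {α : Type*} (f : Fin p → α → ℝ) (X : Fin p → α)
    (σ : Equiv.Perm (Fin p)) : detFun f (X ∘ σ) = ((Equiv.Perm.sign σ : ℤ) : ℝ) * detFun f X := by
  unfold detFun
  exact Matrix.det_permute σ (Matrix.of fun i j => f j (X i))

lemma detFun_eq_zero {p : ℕ} {α : Type*} (f : Fin p → α → ℝ) {X : Fin p → α}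
    (hX : ¬ Function.Injective X) : detFun f X = 0 := by
  unfold Function.Injective at hX
  push Not at hX
  obtain ⟨i, j, hij, hne⟩ := hX
  exact Matrix.det_zero_of_row_eq hne (by ext k; simp [hij])

lemma detFun_mul {p : ℕ} {α : Type*} (w : α → ℝ) (f : Fin p → α → ℝ) (X : Fin p → α) :
    detFun (fun j x => w x * f j x) X = (∏ i, w (X i)) * detFun f X := by
  unfold detFun
  exact Matrix.det_mul_column (fun i => w (X i)) (Matrix.of fun i j => f j (X i))

variable {p : ℕ} {f g : Fin p → unitInterval → ℝ}

lemma integrable_prod_mul_detFun (hfg : ∀ a b, Integrable fun x => f a x * g b x)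
    (σ : Equiv.Perm (Fin p)) :
    Integrable fun X : Fin p → unitInterval => (∏ a, f (σ a) (X a)) * detFun g X := by
  simp_rw [detFun_eq_sum, Finset.mul_sum]
  refine integrable_finsetSum _ fun τ _ => ?_
  have h := Integrable.fintype_prod (μ := fun _ : Fin p => (volume : Measure unitInterval))
    (f := fun i x => f (σ i) x * g (τ i) x) fun i => hfg (σ i) (τ i)
  refine (h.const_mul ((Equiv.Perm.sign τ : ℤ) : ℝ)).congr (Eventually.of_forall fun X => ?_)
  simp only [Finset.prod_mul_distrib]
  ring

lemma integrable_detFun_mul_detFun (hfg : ∀ a b, Integrable fun x => f a x * g b x) :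
    Integrable fun X : Fin p → unitInterval => detFun f X * detFun g X := by
  simp_rw [fun X => detFun_eq_sum f X, Finset.sum_mul]
  refine integrable_finsetSum _ fun σ _ => ?_
  refine ((integrable_prod_mul_detFun hfg σ).const_mul ((Equiv.Perm.sign σ : ℤ) : ℝ)).congr
    (Eventually.of_forall fun X => ?_)
  simp only [mul_assoc]

/-- The integral of a product of two determinants over the chamber is a determinant. -/
theorem setIntegral_detFun_mul_detFun (hfg : ∀ a b, Integrable fun x => f a x * g b x) :
    ∫ X in {X : Fin p → unitInterval | StrictMono X}, detFun f X * detFun g X =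
      (Matrix.of fun a b => ∫ x, f a x * g b x).det := by
  classical
  set S := {X : Fin p → unitInterval | StrictMono X} with hS
  have hSm : MeasurableSet S := measurableSet_strictMono p
  set F : (Fin p → unitInterval) → ℝ := fun X => (∏ a, f a (X a)) * detFun g X with hF
  have h1 : ∫ X, F X = (Matrix.of fun a b => ∫ x, f a x * g b x).det := by
    rw [← Matrix.det_transpose, Matrix.det_apply']
    simp_rw [hF, detFun_eq_sum, Finset.mul_sum]
    rw [integral_finsetSum]
    · refine Finset.sum_congr rfl fun τ _ => ?_
      simp only [Matrix.transpose_apply, Matrix.of_apply]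
      rw [← integral_fintype_prod_volume_eq_prod fun i x => f i x * g (τ i) x, ← integral_const_mul]
      refine integral_congr_ae (Eventually.of_forall fun X => ?_)
      simp only [Finset.prod_mul_distrib]
      ring
    · intro τ _
      have h := Integrable.fintype_prod (μ := fun _ : Fin p => (volume : Measure unitInterval))
        (f := fun i x => f i x * g (τ i) x) fun i => hfg i (τ i)
      refine (h.const_mul ((Equiv.Perm.sign τ : ℤ) : ℝ)).congr (Eventually.of_forall fun X => ?_)
      simp only [Finset.prod_mul_distrib]
      ring
  -- On the configurations with distinct points exactly one permutation sorts the coordinates; on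
  -- the others both sides vanish.
  have h2 : ∀ X, F X = ∑ τ : Equiv.Perm (Fin p), S.indicator (fun Y => F (Y ∘ τ.symm)) (X ∘ τ) := by
    intro X
    by_cases hX : Function.Injective X
    · obtain ⟨τ, hτ⟩ := exists_perm_strictMono hX
      rw [Finset.sum_eq_single τ]
      · rw [Set.indicator_of_mem (show X ∘ τ ∈ S from hτ)]
        congr 1; funext i; simp
      · intro τ' _ hne
        rw [Set.indicator_of_notMem]
        intro h
        apply hne
        have := (strictMono_comp_perm_unique hτ (show StrictMono (X ∘ τ') from h) (σ := τ.symm)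
          (τ := τ'.symm) (by funext i; simp)).2
        rw [← Equiv.symm_symm τ', ← this, Equiv.symm_symm]
      · simp
    · rw [Finset.sum_eq_zero]
      · simp only [hF, detFun_eq_zero g hX, mul_zero]
      · intro τ _
        rw [Set.indicator_of_notMem]
        intro h
        exact hX (by
          have := (show StrictMono (X ∘ τ) from h).injective.comp τ.symm.injective
          rwa [Function.comp_assoc, Equiv.self_comp_symm, Function.comp_id] at this)
  have hperm : ∀ (τ : Equiv.Perm (Fin p)) (X : Fin p → unitInterval),
      MeasurableEquiv.piCongrLeft (fun _ : Fin p => unitInterval) τ.symm X = X ∘ τ := by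
    intro τ X
    funext i
    obtain ⟨j, rfl⟩ := τ.symm.surjective i
    rw [MeasurableEquiv.coe_piCongrLeft, Equiv.piCongrLeft_apply_apply]
    simp
  have hG : ∀ (τ : Equiv.Perm (Fin p)) (Y : Fin p → unitInterval), F (Y ∘ τ.symm) =
      ((Equiv.Perm.sign τ : ℤ) : ℝ) * ((∏ a, f (τ a) (Y a)) * detFun g Y) := by
    intro τ Y
    simp only [hF, detFun_comp_perm, Equiv.Perm.sign_symm]
    have : ∏ a, f a ((Y ∘ τ.symm) a) = ∏ a, f (τ a) (Y a) := by
      rw [← Equiv.prod_comp τ]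
      simp
    rw [this]; ring
  have hint : ∀ τ : Equiv.Perm (Fin p), Integrable (S.indicator fun Y => F (Y ∘ τ.symm)) := by
    intro τ
    refine Integrable.indicator ?_ hSm
    simp_rw [hG τ]
    exact (integrable_prod_mul_detFun hfg τ).const_mul _
  have h4 : ∀ X, F X = ∑ τ : Equiv.Perm (Fin p), S.indicator (fun Y => F (Y ∘ τ.symm))
      (MeasurableEquiv.piCongrLeft (fun _ : Fin p => unitInterval) τ.symm X) := fun X => by
    rw [h2]
    exact Finset.sum_congr rfl fun τ _ => by rw [hperm]
  rw [← h1, integral_congr_ae (Eventually.of_forall h4), integral_finsetSum]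
  · have h5 : ∀ τ : Equiv.Perm (Fin p), ∫ X, S.indicator (fun Y => F (Y ∘ τ.symm))
        (MeasurableEquiv.piCongrLeft (fun _ : Fin p => unitInterval) τ.symm X) =
        ∫ X in S, ((Equiv.Perm.sign τ : ℤ) : ℝ) * ((∏ a, f (τ a) (X a)) * detFun g X) := by
      intro τ
      rw [(volume_measurePreserving_piCongrLeft (fun _ : Fin p => unitInterval)
        τ.symm).integral_comp' (S.indicator fun Y => F (Y ∘ τ.symm)), integral_indicator hSm]
      exact setIntegral_congr_fun hSm fun X _ => hG τ X
    rw [Finset.sum_congr rfl fun τ _ => h5 τ, ← integral_finsetSum]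
    · refine setIntegral_congr_fun hSm fun X _ => ?_
      rw [detFun_eq_sum f, Finset.sum_mul]
      exact Finset.sum_congr rfl fun τ _ => by ring
    · exact fun τ _ => ((integrable_prod_mul_detFun hfg τ).const_mul _).integrableOn
  · intro τ _
    exact (volume_measurePreserving_piCongrLeft (fun _ : Fin p => unitInterval)
      τ.symm).integrable_comp_of_integrable (hint τ)

end Andreief


/-! ### The ensemble and the transition density -/

section TransitionDensity

open Polynomial

/-- Configurations in increasing order. -/
def chamber (p : ℕ) : Set (Fin p → unitInterval) := {X | StrictMono X}

lemma measurableSet_chamber (p : ℕ) : MeasurableSet (chamber p) := measurableSet_strictMono p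

/-- The Vandermonde determinant `∏_{i<j} (x_j - x_i)`. -/
def vanderI {p : ℕ} (X : Fin p → unitInterval) : ℝ :=
  detFun (fun (j : Fin p) (x : unitInterval) => (x : ℝ) ^ (j : ℕ)) X

lemma vanderI_eq {p : ℕ} (X : Fin p → unitInterval) :
    vanderI X = (Matrix.vandermonde fun i => (X i : ℝ)).det := rfl

lemma vanderI_eq_prod {p : ℕ} (X : Fin p → unitInterval) :
    vanderI X = ∏ i : Fin p, ∏ j ∈ Finset.Ioi i, ((X j : ℝ) - X i) := by
  rw [vanderI_eq, Matrix.det_vandermonde]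

lemma vanderI_pos {p : ℕ} {X : Fin p → unitInterval} (hX : StrictMono X) : 0 < vanderI X := by
  rw [vanderI_eq_prod]
  refine Finset.prod_pos fun i _ => Finset.prod_pos fun j hj => sub_pos.2 ?_
  exact_mod_cast hX (Finset.mem_Ioi.1 hj)

lemma continuous_detFun {p : ℕ} {f : Fin p → unitInterval → ℝ} (hf : ∀ j, Continuous (f j)) :
    Continuous fun X : Fin p → unitInterval => detFun f X := by
  unfold detFun
  refine Continuous.matrix_det ?_
  exact continuous_matrix fun i j => (hf j).comp (continuous_apply i)

lemma continuous_vanderI (p : ℕ) : Continuous fun X : Fin p → unitInterval => vanderI X :=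
  continuous_detFun fun _ => continuous_subtype_val.pow _

lemma prod_betaWeight_nonneg (p : ℕ) (z' w' : ℝ) (X : Fin p → unitInterval) :
    0 ≤ ∏ i, betaWeight p z' w' (X i) :=
  Finset.prod_nonneg fun i _ => betaWeight_nonneg p z' w' (X i)

lemma ensembleWeight_eq (p : ℕ) (z' w' : ℝ) (X : Fin p → unitInterval) :
    ensembleWeight p z' w' X = (chamber p).indicator
      (fun X => vanderI X ^ 2 * ∏ i, betaWeight p z' w' (X i)) X := by
  classical
  unfold ensembleWeight
  by_cases hX : StrictMono X
  · rw [if_pos hX, Set.indicator_of_mem (show X ∈ chamber p from hX), vanderI_eq_prod,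
      ← Finset.prod_pow]
    congr 1
    refine Finset.prod_congr rfl fun i _ => ?_
    rw [← Finset.prod_pow]
    exact Finset.prod_congr rfl fun j _ => by ring
  · rw [if_neg hX, Set.indicator_of_notMem (show X ∉ chamber p from hX)]

lemma ensembleWeight_nonneg (p : ℕ) (z' w' : ℝ) (X : Fin p → unitInterval) :
    0 ≤ ensembleWeight p z' w' X := by
  rw [ensembleWeight_eq]
  exact Set.indicator_nonneg (fun X _ => mul_nonneg (sq_nonneg _)
    (prod_betaWeight_nonneg p z' w' X)) X

variable {p : ℕ} {z' w' : ℝ}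

lemma integrable_eval_mul_eval_mul (hz : (p : ℝ) - 1 < z') (hw : -1 < w') (q r : ℝ[X]) :
    Integrable fun x : unitInterval =>
      q.eval (x : ℝ) * (betaWeight p z' w' x * r.eval (x : ℝ)) := by
  refine (integrable_eval_mul_betaWeight hz hw (q * r)).congr (Eventually.of_forall fun x => ?_)
  simp only [eval_mul]; ring

lemma integral_eval_mul_eval_mul (q r : ℝ[X]) :
    ∫ x : unitInterval, q.eval (x : ℝ) * (betaWeight p z' w' x * r.eval (x : ℝ)) =
      moment p z' w' (q * r) := by
  unfold moment
  refine integral_congr_ae (Eventually.of_forall fun x => ?_)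
  simp only [eval_mul]; ring

/-- Integrals over the chamber of products of determinants of polynomials. -/
lemma setIntegral_chamber_eval (hz : (p : ℝ) - 1 < z') (hw : -1 < w') (q r : Fin p → ℝ[X]) :
    Integrable (fun X : Fin p → unitInterval =>
      detFun (fun j (x : unitInterval) => (q j).eval (x : ℝ)) X *
      ((∏ i, betaWeight p z' w' (X i)) *
        detFun (fun j (x : unitInterval) => (r j).eval (x : ℝ)) X)) ∧
    ∫ X in chamber p, detFun (fun j (x : unitInterval) => (q j).eval (x : ℝ)) X *
      ((∏ i, betaWeight p z' w' (X i)) *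
        detFun (fun j (x : unitInterval) => (r j).eval (x : ℝ)) X) =
      (Matrix.of fun a b => moment p z' w' (q a * r b)).det := by
  simp_rw [← fun X : Fin p → unitInterval => detFun_mul
    (fun x : unitInterval => betaWeight p z' w' x)
    (fun j (x : unitInterval) => (r j).eval (x : ℝ)) X]
  constructor
  · exact integrable_detFun_mul_detFun fun a b => integrable_eval_mul_eval_mul hz hw (q a) (r b)
  · have := setIntegral_detFun_mul_detFun
      (f := fun j (x : unitInterval) => (q j).eval (x : ℝ))
      (g := fun j (x : unitInterval) => betaWeight p z' w' x * (r j).eval (x : ℝ))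
      fun a b => integrable_eval_mul_eval_mul hz hw (q a) (r b)
    simp_rw [integral_eval_mul_eval_mul] at this
    exact this

lemma integrable_ensembleWeight (hz : (p : ℝ) - 1 < z') (hw : -1 < w') :
    Integrable (ensembleWeight p z' w') := by
  have h := (setIntegral_chamber_eval hz hw (fun j => X ^ (j : ℕ)) fun j => X ^ (j : ℕ)).1
  simp only [eval_pow, eval_X] at h
  have h2 := h.indicator (measurableSet_chamber p)
  refine h2.congr (Eventually.of_forall fun Y => ?_)
  rw [ensembleWeight_eq]
  congr 1
  funext Y
  change vanderI Y * (_ * vanderI Y) = _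
  ring

lemma integral_ensembleWeight (hz : (p : ℝ) - 1 < z') (hw : -1 < w') :
    ∫ X, ensembleWeight p z' w' X = gramDet p z' w' := by
  have h := (setIntegral_chamber_eval hz hw (fun j => X ^ (j : ℕ)) fun j => X ^ (j : ℕ)).2
  simp only [eval_pow, eval_X] at h
  unfold gramDet
  rw [← h, ← integral_indicator (measurableSet_chamber p)]
  refine integral_congr_ae (Eventually.of_forall fun Y => ?_)
  rw [ensembleWeight_eq]
  congr 1
  funext Y
  change _ = vanderI Y * (_ * vanderI Y)
  ring

lemma gramDet_pos (hz : (p : ℝ) - 1 < z') (hw : -1 < w') : 0 < gramDet p z' w' := by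
  refine lt_of_le_of_ne ?_ (gramDet_ne_zero hz hw).symm
  rw [← integral_ensembleWeight hz hw]
  exact integral_nonneg fun X => ensembleWeight_nonneg p z' w' X

lemma ensembleConst_eq (hz : (p : ℝ) - 1 < z') (hw : -1 < w') :
    ensembleConst p z' w' = (gramDet p z' w')⁻¹ := by
  unfold ensembleConst
  rw [integral_ensembleWeight hz hw]

lemma sqrt_prod_sq_betaWeight (X : Fin p → unitInterval) :
    √(∏ i, betaWeight p z' w' (X i)) = ∏ i, √(betaWeight p z' w' (X i)) := by
  rw [← Real.sqrt_sq (Finset.prod_nonneg fun i (_ : i ∈ Finset.univ) => Real.sqrt_nonneg _),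
    ← Finset.prod_pow]
  congr 1
  exact Finset.prod_congr rfl fun i _ => (Real.sq_sqrt (betaWeight_nonneg p z' w' (X i))).symm

lemma sqrt_ensembleWeight {X : Fin p → unitInterval} (hX : StrictMono X) :
    √(ensembleWeight p z' w' X) = vanderI X * ∏ i, √(betaWeight p z' w' (X i)) := by
  rw [ensembleWeight_eq, Set.indicator_of_mem (show X ∈ chamber p from hX),
    Real.sqrt_mul (sq_nonneg _), Real.sqrt_sq (vanderI_pos hX).le, sqrt_prod_sq_betaWeight]

/-- The transition density without square roots of the weight. -/
lemma transitionDensity_eq (hz : (p : ℝ) - 1 < z') (hw : -1 < w') (t : ℝ)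
    {X : Fin p → unitInterval} (hX : X ∈ openChamber p) (Y : Fin p → unitInterval) :
    transitionDensity p z' w' t X Y = (chamber p).indicator (fun Y =>
      Real.exp (t * totalK p z' w') / vanderI X * (vanderI Y *
        detFun (fun b (y : unitInterval) => heatKernel p z' w' t (X b) y * betaWeight p z' w' y) Y))
      Y := by
  have hB : 0 < ensembleConst p z' w' := by
    rw [ensembleConst_eq hz hw]; exact inv_pos.2 (gramDet_pos hz hw)
  unfold transitionDensity ensembleDensity
  rw [Real.sqrt_mul hB.le, Real.sqrt_mul hB.le, mul_div_mul_left _ _ (Real.sqrt_pos.2 hB).ne']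
  by_cases hY : StrictMono Y
  · rw [Set.indicator_of_mem (show Y ∈ chamber p from hY), sqrt_ensembleWeight hX.1,
      sqrt_ensembleWeight hY]
    have hdet : (Matrix.of fun i j : Fin p => jacobiKernel p z' w' t (X i) (Y j)).det =
        (∏ i, √(betaWeight p z' w' (X i))) * ((∏ i, √(betaWeight p z' w' (Y i))) *
          (Matrix.of fun i j : Fin p => heatKernel p z' w' t (X i) (Y j)).det) := by
      rw [← Matrix.det_mul_row, ← Matrix.det_mul_column]
      congr 1
      ext i j
      simp only [Matrix.of_apply, jacobiKernel_eq t hz hw]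
      ring
    have hdet2 : detFun (fun b (y : unitInterval) => heatKernel p z' w' t (X b) y *
        betaWeight p z' w' y) Y = (∏ i, betaWeight p z' w' (Y i)) *
        (Matrix.of fun i j : Fin p => heatKernel p z' w' t (X i) (Y j)).det := by
      have := detFun_mul (fun y : unitInterval => betaWeight p z' w' y)
        (fun b y => heatKernel p z' w' t (X b) y) Y
      simp_rw [mul_comm (betaWeight p z' w' _)] at this
      rw [this]
      congr 1
      rw [← Matrix.det_transpose]
      rfl
    rw [hdet, hdet2]
    have hsq : ∏ i, betaWeight p z' w' (Y i) = (∏ i, √(betaWeight p z' w' (Y i))) *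
        ∏ i, √(betaWeight p z' w' (Y i)) := by
      rw [← Finset.prod_mul_distrib]
      exact Finset.prod_congr rfl fun i _ =>
        (Real.mul_self_sqrt (betaWeight_nonneg p z' w' (Y i))).symm
    have h1 : ∏ i, √(betaWeight p z' w' (X i)) ≠ 0 :=
      Finset.prod_ne_zero_iff.2 fun i _ => (Real.sqrt_pos.2 (betaWeight_pos p z' w' (hX.2 i))).ne'
    have h2 := (vanderI_pos hX.1).ne'
    rw [hsq]
    field_simp
  · have h0 : ensembleWeight p z' w' Y = 0 := by
      rw [ensembleWeight_eq, Set.indicator_of_notMem (show Y ∉ chamber p from hY)]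
    rw [h0, Set.indicator_of_notMem (show Y ∉ chamber p from hY)]
    simp

/-- The transition density integrates multiplicative functions to a ratio of determinants. -/
lemma integral_transitionDensity_mul (hz : (p : ℝ) - 1 < z') (hw : -1 < w') {t : ℝ} (ht : 0 < t)
    {Y : Fin p → unitInterval} (hY : Y ∈ openChamber p) (γ : ℝ[X]) :
    Integrable (fun Z => transitionDensity p z' w' t Y Z * ∏ i, γ.eval (Z i : ℝ)) ∧
    ∫ Z, transitionDensity p z' w' t Y Z * ∏ i, γ.eval (Z i : ℝ) =
      Real.exp (t * totalK p z' w') * detFun (fun (a : Fin p) (x : unitInterval) =>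
        (jacobiSemigroup hw (neg_one_lt_sub hz) t (γ * X ^ (a : ℕ))).eval (x : ℝ)) Y /
        vanderI Y := by
  have hfun : ∀ Z, transitionDensity p z' w' t Y Z * ∏ i, γ.eval (Z i : ℝ) =
      (chamber p).indicator (fun Z => Real.exp (t * totalK p z' w') / vanderI Y *
        (detFun (fun (a : Fin p) (x : unitInterval) => (γ * X ^ (a : ℕ)).eval (x : ℝ)) Z *
        detFun (fun b (y : unitInterval) => heatKernel p z' w' t (Y b) y *
          betaWeight p z' w' y) Z)) Z := by
    intro Z
    rw [transitionDensity_eq hz hw t hY]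
    by_cases hZ : Z ∈ chamber p
    · rw [Set.indicator_of_mem hZ, Set.indicator_of_mem hZ]
      simp only [eval_mul, eval_pow, eval_X]
      rw [detFun_mul (fun x : unitInterval => γ.eval (x : ℝ))
        (fun (a : Fin p) (x : unitInterval) => (x : ℝ) ^ (a : ℕ))]
      change _ = _ * ((_ * vanderI Z) * _)
      ring
    · rw [Set.indicator_of_notMem hZ, Set.indicator_of_notMem hZ, zero_mul]
  simp_rw [hfun]
  have hint := integrable_detFun_mul_detFun
    (f := fun (a : Fin p) (x : unitInterval) => (γ * X ^ (a : ℕ)).eval (x : ℝ))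
    (g := fun b (y : unitInterval) => heatKernel p z' w' t (Y b) y * betaWeight p z' w' y)
    fun a b => integrable_heatKernel_mul hz hw ht (Y b) _
  refine ⟨(hint.const_mul _).indicator (measurableSet_chamber p), ?_⟩
  rw [integral_indicator (measurableSet_chamber p), integral_const_mul]
  change _ * ∫ Z in {X : Fin p → unitInterval | StrictMono X}, _ = _
  rw [setIntegral_detFun_mul_detFun fun a b => integrable_heatKernel_mul hz hw ht (Y b) _]
  simp_rw [integral_heatKernel_mul hz hw ht]
  rw [← Matrix.det_transpose, div_mul_eq_mul_div]
  rfl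

lemma integrable_transitionDensity (hz : (p : ℝ) - 1 < z') (hw : -1 < w') {t : ℝ} (ht : 0 < t)
    {Y : Fin p → unitInterval} (hY : Y ∈ openChamber p) :
    Integrable (transitionDensity p z' w' t Y) := by
  simpa using (integral_transitionDensity_mul hz hw ht hY 1).1

lemma totalK_eq : totalK p z' w' = ∑ j ∈ Finset.range p, jacobiEig w' (z' - p) j :=
  Finset.sum_congr rfl fun _ _ => eigK_eq ..

lemma integral_transitionDensity (hz : (p : ℝ) - 1 < z') (hw : -1 < w') {t : ℝ} (ht : 0 < t)
    {Y : Fin p → unitInterval} (hY : Y ∈ openChamber p) :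
    ∫ Z, transitionDensity p z' w' t Y Z = 1 := by
  have h := (integral_transitionDensity_mul hz hw ht hY 1).2
  simp only [eval_one, Finset.prod_const_one, mul_one, one_mul] at h
  rw [h]
  have h2 := det_eval_jacobiSemigroup hw (neg_one_lt_sub hz) t fun i => (Y i : ℝ)
  have h3 := (vanderI_pos hY.1).ne'
  unfold detFun
  rw [h2, ← vanderI_eq, ← totalK_eq, ← mul_assoc, ← Real.exp_add, mul_div_assoc, div_self h3]
  simp

end TransitionDensity


/-! ### Multiplicative test functions -/

section TestFunctions

open Polynomial

/-- Configurations of `p` points of `[0, 1]` in nondecreasing order; unlike `chamber p` this is a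
compact space. -/
abbrev Config (p : ℕ) : Type := {X : Fin p → unitInterval // Monotone X}

instance (p : ℕ) : CompactSpace (Config p) := by
  have : IsClosed {X : Fin p → unitInterval | Monotone X} := by
    have : {X : Fin p → unitInterval | Monotone X} = ⋂ i, ⋂ j, ⋂ (_ : i ≤ j), {X | X i ≤ X j} := by
      ext X; simp [Monotone]
    rw [this]
    exact isClosed_iInter fun i => isClosed_iInter fun j => isClosed_iInter fun _ =>
      isClosed_le (continuous_apply i) (continuous_apply j)
  exact isCompact_iff_compactSpace.1 this.isCompact

/-- The product over times `k` and particles `i` of `ξ k` evaluated at the `i`-th particle. -/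
def testFun {n p : ℕ} (ξ : Fin n → ℝ[X]) : C(Fin n → Config p, ℝ) where
  toFun x := ∏ k, ∏ i, (ξ k).eval ((x k).1 i : ℝ)
  continuous_toFun := by
    refine continuous_finsetProd _ fun k _ => continuous_finsetProd _ fun i _ => ?_
    refine (ξ k).continuous.comp (continuous_subtype_val.comp ?_)
    exact (continuous_apply i).comp (continuous_subtype_val.comp (continuous_apply k))

lemma testFun_apply {n p : ℕ} (ξ : Fin n → ℝ[X]) (x : Fin n → Config p) :
    testFun ξ x = ∏ k, ∏ i, (ξ k).eval ((x k).1 i : ℝ) := rfl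

lemma testFun_mul {n p : ℕ} (ξ ζ : Fin n → ℝ[X]) :
    (testFun ξ * testFun ζ : C(Fin n → Config p, ℝ)) = testFun fun k => ξ k * ζ k := by
  ext x
  simp only [ContinuousMap.mul_apply, testFun_apply, eval_mul, Finset.prod_mul_distrib]

lemma testFun_one {n p : ℕ} : (testFun fun _ => 1 : C(Fin n → Config p, ℝ)) = 1 := by
  ext x
  simp [testFun_apply]

/-- A nondecreasing configuration is determined by the polynomial with these roots. -/
lemma config_eq_of_prod_eq {p : ℕ} {x y : Config p}
    (h : ∀ c : ℝ, ∏ i, ((x.1 i : ℝ) - c) = ∏ i, ((y.1 i : ℝ) - c)) : x = y := by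
  have h1 : ∏ i : Fin p, (X - C (x.1 i : ℝ)) = ∏ i : Fin p, (X - C (y.1 i : ℝ)) := by
    refine Polynomial.funext fun c => ?_
    simp only [eval_prod, eval_sub, eval_X, eval_C]
    have e : ∀ z : Config p, ∏ i, (c - (z.1 i : ℝ)) = (-1) ^ p * ∏ i, ((z.1 i : ℝ) - c) := by
      intro z
      rw [← Fin.prod_const, ← Finset.prod_mul_distrib]
      exact Finset.prod_congr rfl fun i _ => by ring
    rw [e x, e y, h c]
  have hr : ∀ z : Config p, (∏ i : Fin p, (X - C (z.1 i : ℝ))).roots =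
      ((List.ofFn fun i => (z.1 i : ℝ) : List ℝ) : Multiset ℝ) := by
    intro z
    have := Polynomial.roots_multiset_prod_X_sub_C
      (((List.ofFn fun i => (z.1 i : ℝ) : List ℝ) : Multiset ℝ))
    rw [← this, ← Fin.univ_val_map, Multiset.map_map]
    rfl
  have h2 : (List.ofFn fun i => (x.1 i : ℝ)).Perm (List.ofFn fun i => (y.1 i : ℝ)) := by
    rw [← Multiset.coe_eq_coe, ← hr, ← hr, h1]
  have h3 := h2.eq_of_pairwise'
    (Monotone.sortedLE_ofFn (f := fun i => (x.1 i : ℝ)) fun i j hij => x.2 hij).pairwise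
    (Monotone.sortedLE_ofFn (f := fun i => (y.1 i : ℝ)) fun i j hij => y.2 hij).pairwise
  have h4 := List.ofFn_injective h3
  exact Subtype.ext (funext fun i => Subtype.ext (congrFun h4 i))

/-- Linear combinations of multiplicative test functions are dense, by Stone-Weierstrass. -/
lemma dense_span_testFun (n p : ℕ) :
    Dense (Submodule.span ℝ (Set.range (testFun (n := n) (p := p))) :
      Set C(Fin n → Config p, ℝ)) := by
  let M : Submonoid C(Fin n → Config p, ℝ) :=
    { carrier := Set.range testFun
      mul_mem' := by
        rintro _ _ ⟨ξ, rfl⟩ ⟨ζ, rfl⟩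
        exact ⟨_, (testFun_mul ξ ζ).symm⟩
      one_mem' := ⟨_, testFun_one⟩ }
  set A := Algebra.adjoin ℝ (M : Set C(Fin n → Config p, ℝ))
  have hA : Subalgebra.toSubmodule A = Submodule.span ℝ (Set.range testFun) := by
    rw [Algebra.adjoin_eq_span, Submonoid.closure_eq]; rfl
  have hsep : A.SeparatesPoints := by
    intro x y hxy
    by_contra hcon
    push Not at hcon
    apply hxy
    funext k
    refine config_eq_of_prod_eq fun c => ?_
    have := hcon _ ⟨testFun fun j => if j = k then X - C c else 1,
      Algebra.subset_adjoin ⟨_, rfl⟩, rfl⟩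
    simp only [testFun_apply] at this
    rw [Finset.prod_eq_single k, Finset.prod_eq_single k] at this
    · simpa using this
    all_goals simp +contextual
  have := ContinuousMap.subalgebra_topologicalClosure_eq_top_of_separatesPoints A hsep
  rw [dense_iff_closure_eq, ← hA]
  have h2 := congrArg (fun B : Subalgebra ℝ C(Fin n → Config p, ℝ) =>
    (B : Set C(Fin n → Config p, ℝ))) this
  simpa using h2

/-- Convergence of uniformly bounded functionals can be checked on a set with dense span. -/
lemma tendsto_of_dense_span {E : Type*} [NormedAddCommGroup E] [NormedSpace ℝ E]
    {Φ : ℕ → E →ₗ[ℝ] ℝ} {Ψ : E →ₗ[ℝ] ℝ} {c : ℝ} (hΦ : ∀ N f, |Φ N f| ≤ c * ‖f‖)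
    (hΨ : ∀ f, |Ψ f| ≤ c * ‖f‖) {S : Set E} (hS : Dense (Submodule.span ℝ S : Set E))
    (h : ∀ f ∈ S, Tendsto (fun N => Φ N f) atTop (𝓝 (Ψ f))) (f : E) :
    Tendsto (fun N => Φ N f) atTop (𝓝 (Ψ f)) := by
  have hspan : ∀ f ∈ Submodule.span ℝ S, Tendsto (fun N => Φ N f) atTop (𝓝 (Ψ f)) := by
    intro f hf
    induction hf using Submodule.span_induction with
    | mem f hf => exact h f hf
    | zero => simp
    | add f g _ _ hf hg => simpa only [map_add] using hf.add hg
    | smul a f _ hf => simpa only [map_smul] using hf.const_smul a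
  have hc : 0 ≤ c ∨ ∀ f : E, ‖f‖ = 0 := by
    by_contra hcon
    push Not at hcon
    obtain ⟨h1, g, hg⟩ := hcon
    have h2 := (abs_nonneg _).trans (hΨ g)
    have h3 : 0 < ‖g‖ := lt_of_le_of_ne (norm_nonneg _) (Ne.symm hg)
    nlinarith
  rw [Metric.tendsto_atTop]
  intro ε hε
  obtain ⟨g, hg, hfg⟩ := Metric.dense_iff.1 hS f (ε / (3 * (|c| + 1))) (by positivity)
  obtain ⟨N₀, hN₀⟩ := Metric.tendsto_atTop.1 (hspan g hfg) (ε / 3) (by positivity)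
  refine ⟨N₀, fun N hN => ?_⟩
  have h1 := hN₀ N hN
  rw [Real.dist_eq] at h1 ⊢
  rw [Metric.mem_ball, dist_eq_norm] at hg
  have h2 : c * ‖g - f‖ < ε / 3 := by
    have h3 : c * ‖g - f‖ ≤ |c| * ‖g - f‖ :=
      mul_le_mul_of_nonneg_right (le_abs_self c) (norm_nonneg _)
    have h4 : ‖g - f‖ * (3 * (|c| + 1)) < ε := (lt_div_iff₀ (by positivity)).1 hg
    have h5 : 0 ≤ ‖g - f‖ := norm_nonneg _
    rcases h5.eq_or_lt with h6 | h6
    · rw [← h6]; simp [hε]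
    · nlinarith
  have h3 := hΦ N (g - f)
  have h4 := hΨ (g - f)
  rw [map_sub] at h3 h4
  rw [abs_lt] at h1 ⊢
  rw [abs_le] at h3 h4
  constructor <;> linarith [h1.1, h1.2, h3.1, h3.2, h4.1, h4.2]

/-- Integration of continuous functions of a random element `ξ` against an integrable weight. -/
def integralFunctional {Ω X : Type*} [TopologicalSpace X] [CompactSpace X] [MeasurableSpace X]
    [OpensMeasurableSpace X] [MeasurableSpace Ω] {μ : Measure Ω} {ξ : Ω → X} (hξ : Measurable ξ)
    {G : Ω → ℝ} (hG : Integrable G μ) : C(X, ℝ) →ₗ[ℝ] ℝ where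
  toFun f := ∫ ω, f (ξ ω) * G ω ∂μ
  map_add' f g := by
    simp only [ContinuousMap.add_apply, add_mul]
    have h : ∀ f : C(X, ℝ), Integrable (fun ω => f (ξ ω) * G ω) μ := fun f =>
      hG.bdd_mul (f.continuous.measurable.comp hξ).aestronglyMeasurable
        (Eventually.of_forall fun ω => f.norm_coe_le_norm (ξ ω))
    exact integral_add (h f) (h g)
  map_smul' a f := by
    simp only [ContinuousMap.smul_apply, smul_eq_mul, mul_assoc, RingHom.id_apply]
    exact integral_const_mul _ _

lemma abs_integralFunctional_le {Ω X : Type*} [TopologicalSpace X] [CompactSpace X]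
    [MeasurableSpace X] [OpensMeasurableSpace X] [MeasurableSpace Ω] {μ : Measure Ω} {ξ : Ω → X}
    (hξ : Measurable ξ) {G : Ω → ℝ} (hG : Integrable G μ) (f : C(X, ℝ)) :
    |integralFunctional hξ hG f| ≤ (∫ ω, |G ω| ∂μ) * ‖f‖ := by
  change |∫ ω, f (ξ ω) * G ω ∂μ| ≤ _
  rw [← Real.norm_eq_abs, mul_comm, ← integral_const_mul]
  refine (norm_integral_le_integral_norm _).trans (integral_mono_of_nonneg
    (Eventually.of_forall fun _ => norm_nonneg _) (hG.abs.const_mul _)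
    (Eventually.of_forall fun ω => ?_))
  simp only [norm_mul, Real.norm_eq_abs]
  exact mul_le_mul_of_nonneg_right (f.norm_coe_le_norm (ξ ω)) (abs_nonneg _)

/-- Two weights with the same integrals against multiplicative test functions have the same
integrals against all continuous functions. -/
lemma integral_mul_eq_of_testFun {Ω Ω' : Type*} [MeasurableSpace Ω] [MeasurableSpace Ω'] {n p : ℕ}
    {μ : Measure Ω} {ν : Measure Ω'} {x : Ω → Fin n → Config p} {y : Ω' → Fin n → Config p}
    (hx : Measurable x) (hy : Measurable y) {G : Ω → ℝ} {H : Ω' → ℝ} (hG : Integrable G μ)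
    (hH : Integrable H ν)
    (h : ∀ ξ : Fin n → ℝ[X], ∫ ω, testFun ξ (x ω) * G ω ∂μ = ∫ ω, testFun ξ (y ω) * H ω ∂ν)
    (f : C(Fin n → Config p, ℝ)) : ∫ ω, f (x ω) * G ω ∂μ = ∫ ω, f (y ω) * H ω ∂ν := by
  have h1 := abs_integralFunctional_le hx hG
  have h2 := abs_integralFunctional_le hy hH
  have := tendsto_of_dense_span (Φ := fun _ => integralFunctional hx hG)
    (Ψ := integralFunctional hy hH) (c := max (∫ ω, |G ω| ∂μ) (∫ ω, |H ω| ∂ν))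
    (fun _ f => (h1 f).trans (mul_le_mul_of_nonneg_right (le_max_left _ _) (norm_nonneg _)))
    (fun f => (h2 f).trans (mul_le_mul_of_nonneg_right (le_max_right _ _) (norm_nonneg _)))
    (dense_span_testFun n p) (by
      rintro _ ⟨ξ, rfl⟩
      refine tendsto_const_nhds.congr fun _ => ?_
      exact (h ξ).symm) f
  exact tendsto_nhds_unique tendsto_const_nhds this

lemma measure_eq_of_testFun {n p : ℕ} {μ ν : Measure (Fin n → Config p)} [IsFiniteMeasure μ]
    [IsFiniteMeasure ν]
    (h : ∀ ξ : Fin n → ℝ[X], ∫ x, testFun ξ x ∂μ = ∫ x, testFun ξ x ∂ν) : μ = ν := by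
  refine ext_of_forall_integral_eq_of_IsFiniteMeasure fun f => ?_
  have := integral_mul_eq_of_testFun measurable_id measurable_id
    (integrable_const (μ := μ) (1 : ℝ)) (integrable_const (μ := ν) (1 : ℝ))
    (by simpa using h) f.toContinuousMap
  simpa using this

end TestFunctions


/-! ### The limit process -/

section LimitProcess

open Polynomial

lemma monotone_scaledConfig {p N : ℕ} {l : Signature N} (h : IsBoxed p l) :
    Monotone (scaledConfig p l) := by
  intro i j hij
  have h1 : (config p l i : ℝ) ≤ config p l j := by
    exact_mod_cast h.config_strictMono.monotone hij
  have h2 := config_lt p l i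
  have h3 : (0 : ℝ) ≤ (N : ℝ) + p - 1 := by
    have : (config p l i : ℝ) + 1 ≤ (N : ℝ) + p := by exact_mod_cast h2
    have : (0 : ℝ) ≤ config p l i := Nat.cast_nonneg _
    linarith
  exact div_le_div_of_nonneg_right h1 h3

open Classical in
/-- The rescaled configuration as a point of the compact space `Config p`; the value at signatures
outside the support of the measures is immaterial. -/
def toConfig (p : ℕ) {N : ℕ} (l : Signature N) : Config p :=
  if h : IsBoxed p l then ⟨scaledConfig p l, monotone_scaledConfig h⟩
  else ⟨fun _ => 0, monotone_const⟩

lemma toConfig_val {p N : ℕ} {l : Signature N} (h : IsBoxed p l) :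
    (toConfig p l).1 = scaledConfig p l := by
  unfold toConfig
  rw [dif_pos h]

/-- The given times in increasing order, continued by their maximum. -/
def sortTime {n : ℕ} (t : Fin n → ℝ≥0) (k : ℕ) : ℝ≥0 :=
  if h : k < n then t (Tuple.sort t ⟨k, h⟩) else Finset.univ.sup t

/-- The test functions in the order of their times, continued by the constant `1`. -/
def sortFactor {n : ℕ} (t : Fin n → ℝ≥0) (ξ : Fin n → ℝ[X]) (k : ℕ) : ℝ[X] :=
  if h : k < n then ξ (Tuple.sort t ⟨k, h⟩) else 1

lemma sortTime_mono {n : ℕ} (t : Fin n → ℝ≥0) : Monotone (sortTime t) := by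
  intro j k hjk
  unfold sortTime
  split_ifs with h1 h2
  · exact Tuple.monotone_sort t (show (⟨j, h1⟩ : Fin n) ≤ ⟨k, h2⟩ from hjk)
  · exact Finset.le_sup (Finset.mem_univ _)
  · omega
  · exact le_rfl

lemma prod_sort {n : ℕ} (t : Fin n → ℝ≥0) (ξ : Fin n → ℝ[X]) (F : ℝ≥0 → ℝ[X] → ℝ)
    (hF : ∀ s, F s 1 = 1) :
    ∏ k ∈ Finset.range (n + 1), F (sortTime t k) (sortFactor t ξ k) = ∏ k, F (t k) (ξ k) := by
  rw [Finset.prod_range_succ, Finset.prod_range,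
    ← Equiv.prod_comp (Tuple.sort t) (fun k => F (t k) (ξ k))]
  have h : F (sortTime t n) (sortFactor t ξ n) = 1 := by
    unfold sortFactor
    rw [dif_neg (lt_irrefl n), hF]
  rw [h, mul_one]
  refine Finset.prod_congr rfl fun k _ => ?_
  simp [sortTime, sortFactor]

variable {p : ℕ} {z' w' : ℝ}

/-- The expectation of a multiplicative test function of the limit process at the times `t`. -/
def fddCorr (hz : (p : ℝ) - 1 < z') (hw : -1 < w') {n : ℕ} (t : Fin n → ℝ≥0) (ξ : Fin n → ℝ[X]) :
    ℝ := limitCorr hz hw (sortTime t) (sortFactor t ξ) n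

lemma tendsto_integral_testFun (hz : (p : ℝ) - 1 < z') (hw : -1 < w')
    (hp : p = 0 → z' + w' ≠ -1) {Ω' : ℕ → Type*} [∀ N, MeasurableSpace (Ω' N)]
    (P' : ∀ N, Measure (Ω' N)) [∀ N, IsProbabilityMeasure (P' N)] (T : ∀ N, ℕ → Ω' N → Signature N)
    (hT : ∀ N, IsUpDownChain (P' N) (zwMeasure p 0 z' w') N (T N)) {n : ℕ} (t : Fin n → ℝ≥0)
    (ξ : Fin n → ℝ[X]) :
    Tendsto (fun N => ∫ ω, testFun ξ (fun k => toConfig p (T N (discreteTime N (t k)) ω)) ∂P' N)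
      atTop (𝓝 (fddCorr hz hw t ξ)) := by
  refine (tendsto_integral_rescaledProcess hz hw hp P' T hT (sortTime_mono t)
    (sortFactor t ξ) n).congr fun N => ?_
  refine integral_congr_ae ?_
  filter_upwards [(hT N).ae_isBoxed] with ω hω
  rw [testFun_apply, prod_sort t ξ
    (fun s ζ => ∏ i, ζ.eval (rescaledProcess p N (T N) s ω i : ℝ)) (by simp)]
  refine Finset.prod_congr rfl fun k _ => Finset.prod_congr rfl fun i _ => ?_
  rw [toConfig_val (hω _)]
  rfl

/-- The space of all paths in the compact space `Config p`, a compact Hausdorff space. -/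
def PathSpace (p : ℕ) : Type := ℝ≥0 → Config p

instance : TopologicalSpace (PathSpace p) := inferInstanceAs (TopologicalSpace (ℝ≥0 → Config p))

instance : CompactSpace (PathSpace p) := inferInstanceAs (CompactSpace (ℝ≥0 → Config p))

instance : T2Space (PathSpace p) := inferInstanceAs (T2Space (ℝ≥0 → Config p))

/-- Path space carries the Borel σ-algebra of its topology, which is larger than the product
σ-algebra. -/
instance : MeasurableSpace (PathSpace p) := borel _

instance : BorelSpace (PathSpace p) := ⟨rfl⟩

instance (N : ℕ) : TopologicalSpace (Signature N) := ⊥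

instance (N : ℕ) : DiscreteTopology (Signature N) := ⟨rfl⟩

instance (N : ℕ) : BorelSpace (Signature N) := ⟨borel_eq_top_of_discrete.symm⟩

/-- The rescaled path of a trajectory of the discrete chain. -/
def toPath (p N : ℕ) (σ : ℕ → Signature N) : PathSpace p :=
  fun t => toConfig p (σ (discreteTime N t))

lemma measurable_toPath (p N : ℕ) : Measurable (toPath p N) := by
  have : Continuous (toPath p N) := continuous_pi fun t =>
    continuous_of_discreteTopology.comp (continuous_apply (discreteTime N t))
  exact this.measurable

lemma continuous_eval_pathSpace {n : ℕ} (t : Fin n → ℝ≥0) :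
    Continuous fun (x : PathSpace p) (k : Fin n) => x (t k) :=
  continuous_pi fun k => continuous_apply (t k)

/-- A law on path space whose finite-dimensional distributions have the limiting correlation
functions, as a limit point of the laws of the discrete chains. -/
theorem exists_limit_law (hz : (p : ℝ) - 1 < z') (hw : -1 < w') (hp : p = 0 → z' + w' ≠ -1) :
    ∃ Q : Measure (PathSpace p), IsProbabilityMeasure Q ∧ ∀ (n : ℕ) (t : Fin n → ℝ≥0)
      (ξ : Fin n → ℝ[X]), ∫ x, testFun ξ (fun k => x (t k)) ∂Q = fddCorr hz hw t ξ := by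
  choose Ω hΩ P hP T hT using exists_isUpDownChain hz hw hp
  have hmeas : ∀ N, Measurable fun ω => toPath p N fun k => T N k ω := fun N =>
    (measurable_toPath p N).comp (measurable_pi_lambda _ fun k => (hT N).measurable k)
  let Q : ℕ → ProbabilityMeasure (PathSpace p) := fun N =>
    ⟨(P N).map fun ω => toPath p N fun k => T N k ω,
      Measure.isProbabilityMeasure_map (hmeas N).aemeasurable⟩
  let U : Ultrafilter (ProbabilityMeasure (PathSpace p)) := (Ultrafilter.of atTop).map Q
  obtain ⟨Q', -, hQ'⟩ := isCompact_univ.ultrafilter_le_nhds U (by simp)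
  refine ⟨Q', inferInstance, fun n t ξ => ?_⟩
  have hlim : Tendsto Q (Ultrafilter.of atTop : Ultrafilter ℕ) (𝓝 Q') := hQ'
  rw [ProbabilityMeasure.tendsto_iff_forall_integral_tendsto] at hlim
  let F : BoundedContinuousFunction (PathSpace p) ℝ := BoundedContinuousFunction.mkOfCompact
    ⟨fun x => testFun ξ (fun k => x (t k)),
      (testFun ξ).continuous.comp (continuous_eval_pathSpace t)⟩
  have h1 := hlim F
  have h2 := (tendsto_integral_testFun hz hw hp P T hT t ξ).mono_left
    (Ultrafilter.of_le (atTop : Filter ℕ))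
  refine tendsto_nhds_unique h1 (h2.congr fun N => ?_)
  change _ = ∫ x, F x ∂((P N).map fun ω => toPath p N fun k => T N k ω)
  rw [integral_map (hmeas N).aemeasurable F.continuous.aestronglyMeasurable]
  rfl

variable {Q : Measure (PathSpace p)} [IsProbabilityMeasure Q]

lemma measurable_eval_pathSpace {n : ℕ} (t : Fin n → ℝ≥0) :
    Measurable fun (x : PathSpace p) (k : Fin n) => x (t k) :=
  (continuous_eval_pathSpace t).measurable

lemma measurable_apply_pathSpace (t : ℝ≥0) : Measurable fun x : PathSpace p => x t := by
  have : Continuous fun x : PathSpace p => x t := continuous_apply (A := fun _ : ℝ≥0 => Config p) t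
  exact this.measurable

/-- The correlation functions depend on time differences only. -/
lemma limitCorr_add (hz : (p : ℝ) - 1 < z') (hw : -1 < w') (τ : ℕ → ℝ≥0) (h : ℝ≥0)
    (ξ : ℕ → ℝ[X]) (K : ℕ) :
    limitCorr hz hw (fun k => τ k + h) ξ K = limitCorr hz hw τ ξ K := by
  have hwave : ∀ K q, limitWave hz hw (fun k => τ k + h) ξ K q = limitWave hz hw τ ξ K q := by
    intro K q
    induction K with
    | zero => rfl
    | succ K ih =>
      simp only [limitWave, ih]
      congr 3
      push_cast; ring
  unfold limitCorr
  simp only [hwave]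
  congr 4
  push_cast; ring

/-- The correlation functions can be computed from any enumeration of the times in increasing
order, possibly with additional times. -/
lemma fddCorr_eq_limitCorr (hz : (p : ℝ) - 1 < z') (hw : -1 < w') (hp : p = 0 → z' + w' ≠ -1)
    {n : ℕ} (t : Fin n → ℝ≥0) (ξ : Fin n → ℝ[X]) {τ : ℕ → ℝ≥0} (hτ : Monotone τ) (ζ : ℕ → ℝ[X])
    (K : ℕ) (h : ∀ F : ℝ≥0 → ℝ[X] → ℝ, (∀ s, F s 1 = 1) →
      ∏ k ∈ Finset.range (K + 1), F (τ k) (ζ k) = ∏ k, F (t k) (ξ k)) :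
    fddCorr hz hw t ξ = limitCorr hz hw τ ζ K := by
  choose Ω hΩ P hP T hT using exists_isUpDownChain hz hw hp
  refine tendsto_nhds_unique (tendsto_integral_rescaledProcess hz hw hp P T hT (sortTime_mono t)
    (sortFactor t ξ) n) ((tendsto_integral_rescaledProcess hz hw hp P T hT hτ ζ K).congr
      fun N => ?_)
  refine integral_congr_ae (Eventually.of_forall fun ω => ?_)
  have hF : ∀ s, ∏ i : Fin p, (1 : ℝ[X]).eval (rescaledProcess p N (T N) s ω i : ℝ) = 1 := by simp
  simp only
  rw [h (fun s ζ => ∏ i, ζ.eval (rescaledProcess p N (T N) s ω i : ℝ)) hF,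
    prod_sort t ξ (fun s ζ => ∏ i, ζ.eval (rescaledProcess p N (T N) s ω i : ℝ)) hF]

lemma fddCorr_add (hz : (p : ℝ) - 1 < z') (hw : -1 < w') (hp : p = 0 → z' + w' ≠ -1)
    {n : ℕ} (t : Fin n → ℝ≥0) (h : ℝ≥0) (ξ : Fin n → ℝ[X]) :
    fddCorr hz hw (fun k => t k + h) ξ = fddCorr hz hw t ξ := by
  rw [fddCorr_eq_limitCorr hz hw hp (fun k => t k + h) ξ (τ := fun k => sortTime t k + h)
    (fun j k hjk => add_le_add (sortTime_mono t hjk) le_rfl) (sortFactor t ξ) n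
    fun F hF => prod_sort t ξ (fun s ζ => F (s + h) ζ) fun s => hF (s + h), limitCorr_add]
  rfl

/-- The finite-dimensional distributions of a law with the limiting correlation functions are
stationary. -/
lemma map_eval_add (hz : (p : ℝ) - 1 < z') (hw : -1 < w') (hp : p = 0 → z' + w' ≠ -1)
    (hQ : ∀ (n : ℕ) (t : Fin n → ℝ≥0) (ξ : Fin n → ℝ[X]),
      ∫ x, testFun ξ (fun k => x (t k)) ∂Q = fddCorr hz hw t ξ)
    {n : ℕ} (t : Fin n → ℝ≥0) (h : ℝ≥0) :
    Q.map (fun x k => x (t k + h)) = Q.map fun x k => x (t k) := by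
  have hm : ∀ t : Fin n → ℝ≥0, Measurable fun (x : PathSpace p) k => x (t k) :=
    measurable_eval_pathSpace
  have : ∀ t : Fin n → ℝ≥0, IsProbabilityMeasure (Q.map fun (x : PathSpace p) k => x (t k)) :=
    fun t => Measure.isProbabilityMeasure_map (hm t).aemeasurable
  have := this fun k => t k + h
  refine measure_eq_of_testFun fun ξ => ?_
  rw [integral_map (hm _).aemeasurable (testFun ξ).continuous.aestronglyMeasurable,
    integral_map (hm _).aemeasurable (testFun ξ).continuous.aestronglyMeasurable, hQ n t ξ]
  exact (hQ n (fun k => t k + h) ξ).trans (fddCorr_add hz hw hp t h ξ)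

/-- Convergence of the finite-dimensional distributions, for continuous functions on the compact
space of ordered configurations. -/
lemma tendsto_integral_continuous (hz : (p : ℝ) - 1 < z') (hw : -1 < w')
    (hp : p = 0 → z' + w' ≠ -1)
    (hQ : ∀ (n : ℕ) (t : Fin n → ℝ≥0) (ξ : Fin n → ℝ[X]),
      ∫ x, testFun ξ (fun k => x (t k)) ∂Q = fddCorr hz hw t ξ)
    {Ω' : ℕ → Type*} [∀ N, MeasurableSpace (Ω' N)]
    (P' : ∀ N, Measure (Ω' N)) [∀ N, IsProbabilityMeasure (P' N)] (T : ∀ N, ℕ → Ω' N → Signature N)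
    (hT : ∀ N, IsUpDownChain (P' N) (zwMeasure p 0 z' w') N (T N)) {n : ℕ} (t : Fin n → ℝ≥0)
    (f : C(Fin n → Config p, ℝ)) :
    Tendsto (fun N => ∫ ω, f (fun k => toConfig p (T N (discreteTime N (t k)) ω)) ∂P' N)
      atTop (𝓝 (∫ x, f (fun k => x (t k)) ∂Q)) := by
  have hm : ∀ N, Measurable fun ω (k : Fin n) => toConfig p (T N (discreteTime N (t k)) ω) :=
    fun N => measurable_pi_lambda _ fun k =>
      (measurable_of_countable (toConfig p)).comp ((hT N).measurable _)
  have h1 : ∀ N (f : C(Fin n → Config p, ℝ)), |integralFunctional (hm N)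
      (integrable_const (μ := P' N) (1 : ℝ)) f| ≤ 1 * ‖f‖ := fun N f => by
    simpa using abs_integralFunctional_le (hm N) (integrable_const (μ := P' N) (1 : ℝ)) f
  have h2 : ∀ f : C(Fin n → Config p, ℝ), |integralFunctional (measurable_eval_pathSpace t)
      (integrable_const (μ := Q) (1 : ℝ)) f| ≤ 1 * ‖f‖ := fun f => by
    simpa using abs_integralFunctional_le (measurable_eval_pathSpace t)
      (integrable_const (μ := Q) (1 : ℝ)) f
  have := tendsto_of_dense_span h1 h2 (dense_span_testFun n p) (by
      rintro _ ⟨ξ, rfl⟩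
      simp only [integralFunctional, LinearMap.coe_mk, AddHom.coe_mk, mul_one, hQ n t ξ]
      exact tendsto_integral_testFun hz hw hp P' T hT t ξ) f
  simpa only [integralFunctional, LinearMap.coe_mk, AddHom.coe_mk, mul_one] using this

end LimitProcess


/-! ### One-dimensional distributions of the limit process -/

section Marginals

open Polynomial

open Classical in
/-- A configuration as a point of `Config p`; the value at unordered configurations is
immaterial. -/
def toOrdered {p : ℕ} (X : Fin p → unitInterval) : Config p :=
  if h : X ∈ {X : Fin p → unitInterval | Monotone X} then ⟨X, h⟩ else ⟨fun _ => 0, monotone_const⟩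

lemma toOrdered_val {p : ℕ} {X : Fin p → unitInterval} (h : X ∈ chamber p) :
    (toOrdered X).1 = X := by
  unfold toOrdered
  rw [dif_pos (show X ∈ {X : Fin p → unitInterval | Monotone X} from StrictMono.monotone h)]

lemma measurable_toOrdered (p : ℕ) : Measurable (toOrdered (p := p)) := by
  classical
  have hs : MeasurableSet {X : Fin p → unitInterval | Monotone X} := by
    have : {X : Fin p → unitInterval | Monotone X} = ⋂ i, ⋂ j, ⋂ (_ : i ≤ j), {X | X i ≤ X j} := by
      ext X; simp [Monotone]
    rw [this]
    exact MeasurableSet.iInter fun i => MeasurableSet.iInter fun j => MeasurableSet.iInter fun _ =>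
      measurableSet_le (measurable_pi_apply i) (measurable_pi_apply j)
  exact Measurable.dite (f := fun X : {X : Fin p → unitInterval | Monotone X} => (X : Config p))
    measurable_id measurable_const hs

variable {p : ℕ} {z' w' : ℝ}

lemma limitWave_congr (hz : (p : ℝ) - 1 < z') (hw : -1 < w') (τ : ℕ → ℝ≥0) {ξ ζ : ℕ → ℝ[X]}
    {K : ℕ} (h : ∀ k ≤ K, ξ k = ζ k) (q : ℝ[X]) :
    limitWave hz hw τ ξ K q = limitWave hz hw τ ζ K q := by
  induction K with
  | zero => simp only [limitWave, h 0 le_rfl]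
  | succ K ih =>
    simp only [limitWave, h (K + 1) le_rfl, ih fun k hk => h k (by omega)]

lemma limitWave_update (hz : (p : ℝ) - 1 < z') (hw : -1 < w') (τ : ℕ → ℝ≥0) (ξ : ℕ → ℝ[X])
    (K : ℕ) (γ q : ℝ[X]) :
    limitWave hz hw τ (Function.update ξ K (γ * ξ K)) K q = γ * limitWave hz hw τ ξ K q := by
  rcases K with _ | K
  · simp [limitWave, mul_assoc]
  · simp only [limitWave, Function.update_self, mul_assoc]
    rw [limitWave_congr hz hw τ (ζ := ξ)]
    intro k hk
    rw [Function.update_of_ne (by omega)]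

/-- The unnormalized density of the configuration at time `τ K`, weighted by multiplicative
functions of the configurations at the times `τ 0, …, τ K`. -/
def waveDensity (hz : (p : ℝ) - 1 < z') (hw : -1 < w') (τ : ℕ → ℝ≥0) (ξ : ℕ → ℝ[X]) (K : ℕ)
    (X : Fin p → unitInterval) : ℝ :=
  (∏ i, betaWeight p z' w' (X i)) * detFun (fun (b : Fin p) (x : unitInterval) =>
    (limitWave hz hw τ ξ K (Polynomial.X ^ (b : ℕ))).eval (x : ℝ)) X

lemma integrable_prod_betaWeight (hz : (p : ℝ) - 1 < z') (hw : -1 < w') :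
    Integrable fun X : Fin p → unitInterval => ∏ i, betaWeight p z' w' (X i) :=
  Integrable.fintype_prod (μ := fun _ : Fin p => (volume : Measure unitInterval))
    (f := fun _ (x : unitInterval) => betaWeight p z' w' x) fun _ => integrable_betaWeight hz hw

lemma integrable_continuous_mul_prod_betaWeight (hz : (p : ℝ) - 1 < z') (hw : -1 < w')
    {f : (Fin p → unitInterval) → ℝ} (hf : Continuous f) :
    Integrable fun X : Fin p → unitInterval => f X * ∏ i, betaWeight p z' w' (X i) := by
  obtain ⟨C, hC⟩ := isCompact_univ.exists_bound_of_continuousOn hf.continuousOn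
  exact (integrable_prod_betaWeight hz hw).bdd_mul hf.aestronglyMeasurable
    (Eventually.of_forall fun x => hC x (Set.mem_univ x))

lemma continuous_detFun_eval (q : Fin p → ℝ[X]) : Continuous fun X : Fin p → unitInterval =>
    detFun (fun b (x : unitInterval) => (q b).eval (x : ℝ)) X :=
  continuous_detFun fun b => continuous_eval_unitInterval (q b)

lemma integrable_mul_waveDensity (hz : (p : ℝ) - 1 < z') (hw : -1 < w') (τ : ℕ → ℝ≥0)
    (ξ : ℕ → ℝ[X]) (K : ℕ) {f : (Fin p → unitInterval) → ℝ} (hf : Continuous f) :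
    Integrable fun X => f X * waveDensity hz hw τ ξ K X := by
  refine (integrable_continuous_mul_prod_betaWeight hz hw (hf.mul (continuous_detFun_eval
    fun b : Fin p => limitWave hz hw τ ξ K (X ^ (b : ℕ))))).congr (Eventually.of_forall fun X => ?_)
  simp only [waveDensity, Pi.mul_apply]
  ring

variable {Q : Measure (PathSpace p)}

/-- A law on path space has the limiting correlation functions. -/
def IsLimitLaw (hz : (p : ℝ) - 1 < z') (hw : -1 < w') (Q : Measure (PathSpace p)) : Prop :=
  ∀ (n : ℕ) (t : Fin n → ℝ≥0) (ξ : Fin n → ℝ[X]),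
    ∫ x, testFun ξ (fun k => x (t k)) ∂Q = fddCorr hz hw t ξ

/-- The product of multiplicative functions of the configurations at several times. -/
def pathProd (τ : ℕ → ℝ≥0) (ξ : ℕ → ℝ[X]) (K : ℕ) (x : PathSpace p) : ℝ :=
  ∏ k ∈ Finset.range (K + 1), ∏ i, (ξ k).eval ((x (τ k)).1 i : ℝ)

lemma continuous_pathProd (τ : ℕ → ℝ≥0) (ξ : ℕ → ℝ[X]) (K : ℕ) :
    Continuous (pathProd (p := p) τ ξ K) := by
  have h : ∀ t : ℝ≥0, Continuous fun x : PathSpace p => x t := fun t =>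
    continuous_apply (A := fun _ : ℝ≥0 => Config p) t
  refine continuous_finsetProd _ fun k _ => continuous_finsetProd _ fun i _ => ?_
  exact (ξ k).continuous.comp (continuous_subtype_val.comp
    ((continuous_apply i).comp (continuous_subtype_val.comp (h (τ k)))))

lemma integrable_of_continuous [IsFiniteMeasure Q] {f : PathSpace p → ℝ} (hf : Continuous f) :
    Integrable f Q := by
  obtain ⟨C, hC⟩ := isCompact_univ.exists_bound_of_continuousOn hf.continuousOn
  exact Integrable.of_bound hf.aestronglyMeasurable C
    (Eventually.of_forall fun x => hC x (Set.mem_univ x))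

lemma IsLimitLaw.integral_pathProd {hz : (p : ℝ) - 1 < z'} {hw : -1 < w'}
    (hQ : IsLimitLaw hz hw Q) (hp : p = 0 → z' + w' ≠ -1) {τ : ℕ → ℝ≥0} (hτ : Monotone τ)
    (ξ : ℕ → ℝ[X]) (K : ℕ) : ∫ x, pathProd τ ξ K x ∂Q = limitCorr hz hw τ ξ K := by
  rw [← fddCorr_eq_limitCorr hz hw hp (fun k : Fin (K + 1) => τ k) (fun k => ξ k) hτ ξ K
    fun F _ => Finset.prod_range _, ← hQ]
  simp only [testFun_apply, pathProd, Finset.prod_range]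

lemma limitCorr_eq_setIntegral (hz : (p : ℝ) - 1 < z') (hw : -1 < w') (τ : ℕ → ℝ≥0) (ξ : ℕ → ℝ[X])
    (K : ℕ) : limitCorr hz hw τ ξ K =
      Real.exp (((τ K : ℝ) - τ 0) * totalK p z' w') / gramDet p z' w' *
        ∫ X in chamber p, vanderI X * waveDensity hz hw τ ξ K X := by
  have h := (setIntegral_chamber_eval hz hw (fun a : Fin p => X ^ (a : ℕ))
    fun b : Fin p => limitWave hz hw τ ξ K (X ^ (b : ℕ))).2
  unfold limitCorr
  rw [← h]
  simp only [eval_pow, eval_X]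
  rw [mul_div_right_comm]
  rfl

variable [IsProbabilityMeasure Q]

/-- Expectations of a continuous function of the last configuration times multiplicative functions
of the earlier ones. -/
lemma IsLimitLaw.integral_mul_pathProd {hz : (p : ℝ) - 1 < z'} {hw : -1 < w'}
    (hQ : IsLimitLaw hz hw Q) (hp : p = 0 → z' + w' ≠ -1) {τ : ℕ → ℝ≥0} (hτ : Monotone τ)
    (ξ : ℕ → ℝ[X]) (K : ℕ) {f : (Fin p → unitInterval) → ℝ} (hf : Continuous f) :
    ∫ x, f (x (τ K)).1 * pathProd τ ξ K x ∂Q =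
      Real.exp (((τ K : ℝ) - τ 0) * totalK p z' w') / gramDet p z' w' *
        ∫ X in chamber p, f X * (vanderI X * waveDensity hz hw τ ξ K X) := by
  set c := Real.exp (((τ K : ℝ) - τ 0) * totalK p z' w') / gramDet p z' w' with hc
  have hH : Integrable (fun X => c * (vanderI X * waveDensity hz hw τ ξ K X))
      (volume.restrict (chamber p)) :=
    ((integrable_mul_waveDensity hz hw τ ξ K (continuous_vanderI p)).const_mul c).integrableOn
  have hx : Measurable fun (x : PathSpace p) (_ : Fin 1) => x (τ K) :=
    measurable_pi_lambda _ fun _ => measurable_apply_pathSpace _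
  have hy : Measurable fun (X : Fin p → unitInterval) (_ : Fin 1) => toOrdered X :=
    measurable_pi_lambda _ fun _ => measurable_toOrdered p
  have key := integral_mul_eq_of_testFun hx hy
    (integrable_of_continuous (Q := Q) (continuous_pathProd τ ξ K)) hH (by
      intro ζ
      have h1 : ∀ x : PathSpace p, testFun ζ (fun _ => x (τ K)) * pathProd τ ξ K x =
          pathProd τ (Function.update ξ K (ζ 0 * ξ K)) K x := by
        intro x
        rw [testFun_apply, Fin.prod_univ_one]
        simp only [pathProd]
        rw [Finset.prod_range_succ, Finset.prod_range_succ (n := K), Function.update_self]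
        simp only [eval_mul, Finset.prod_mul_distrib]
        have : ∀ k ∈ Finset.range K, ∏ i, (Function.update ξ K (ζ 0 * ξ K) k).eval
            ((x (τ k)).1 i : ℝ) = ∏ i, (ξ k).eval ((x (τ k)).1 i : ℝ) := by
          intro k hk
          rw [Function.update_of_ne (Finset.mem_range.1 hk).ne]
        rw [Finset.prod_congr rfl this]
        ring
      simp_rw [h1]
      rw [hQ.integral_pathProd hp hτ, limitCorr_eq_setIntegral, ← hc, ← integral_const_mul]
      refine setIntegral_congr_fun (measurableSet_chamber p) fun X hX => ?_
      simp only [waveDensity, limitWave_update, testFun_apply, Fin.prod_univ_one,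
        toOrdered_val hX, eval_mul]
      rw [detFun_mul (fun x : unitInterval => (ζ 0).eval (x : ℝ))]
      ring) ⟨fun y => f (y 0).1, hf.comp (continuous_subtype_val.comp (continuous_apply 0))⟩
  simp only [ContinuousMap.coe_mk] at key
  rw [key, ← integral_const_mul]
  refine setIntegral_congr_fun (measurableSet_chamber p) fun X hX => ?_
  simp only [toOrdered_val hX]
  ring

lemma measurable_betaWeight (p : ℕ) (z' w' : ℝ) :
    Measurable fun x : unitInterval => betaWeight p z' w' x := by
  unfold betaWeight
  exact (measurable_subtype_coe.pow_const _).mul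
    ((measurable_const.sub measurable_subtype_coe).pow_const _)

/-- The law of the limit process at a fixed time is the Jacobi ensemble. -/
lemma IsLimitLaw.map_eval {hz : (p : ℝ) - 1 < z'} {hw : -1 < w'} (hQ : IsLimitLaw hz hw Q)
    (hp : p = 0 → z' + w' ≠ -1) (t : ℝ≥0) : Q.map (fun x => (x t).1) =
      volume.withDensity fun X => ENNReal.ofReal (ensembleDensity p z' w' X) := by
  have hm : Measurable fun x : PathSpace p => (x t).1 :=
    measurable_subtype_coe.comp (measurable_apply_pathSpace t)
  have hint : Integrable (ensembleDensity p z' w') :=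
    (integrable_ensembleWeight hz hw).const_mul _
  have hnn : ∀ X, 0 ≤ ensembleDensity p z' w' X := fun X => by
    unfold ensembleDensity
    rw [ensembleConst_eq hz hw]
    exact mul_nonneg (inv_nonneg.2 (gramDet_pos hz hw).le) (ensembleWeight_nonneg p z' w' X)
  have := Measure.isProbabilityMeasure_map (μ := Q) hm.aemeasurable
  have := isFiniteMeasure_withDensity_ofReal hint.2
  refine ext_of_forall_integral_eq_of_IsFiniteMeasure fun f => ?_
  rw [integral_map hm.aemeasurable f.continuous.aestronglyMeasurable]
  have h := hQ.integral_mul_pathProd hp (τ := fun _ => t) monotone_const (fun _ => 1) 0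
    f.continuous
  have h1 : ∀ x : PathSpace p, pathProd (fun _ => t) (fun _ => 1) 0 x = 1 := fun x => by
    simp [pathProd]
  simp only [h1, mul_one, sub_self, zero_mul, Real.exp_zero] at h
  rw [h, integral_withDensity_eq_integral_toReal_smul₀ hint.1.aemeasurable.ennreal_ofReal
    (Eventually.of_forall fun _ => ENNReal.ofReal_lt_top), ← integral_const_mul,
    ← integral_indicator (measurableSet_chamber p)]
  refine integral_congr_ae (Eventually.of_forall fun X => ?_)
  dsimp only
  rw [ENNReal.toReal_ofReal (hnn X)]
  simp only [ensembleDensity, ensembleConst_eq hz hw, ensembleWeight_eq, smul_eq_mul]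
  by_cases hX : X ∈ chamber p
  · rw [Set.indicator_of_mem hX, Set.indicator_of_mem hX]
    simp only [waveDensity, limitWave, one_mul, eval_pow, eval_X]
    change 1 / _ * (f X * (vanderI X * (_ * vanderI X))) = _
    rw [one_div]
    ring
  · rw [Set.indicator_of_notMem hX, Set.indicator_of_notMem hX]
    simp

lemma measurableSet_openChamber (p : ℕ) : MeasurableSet (openChamber p) := by
  have : openChamber p = chamber p ∩ ⋂ i, {X | (X i : ℝ) ∈ Set.Ioo (0 : ℝ) 1} := by
    ext X; simp [openChamber, chamber]
  rw [this]
  exact (measurableSet_chamber p).inter (MeasurableSet.iInter fun i =>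
    (measurable_subtype_coe.comp (measurable_pi_apply i)) measurableSet_Ioo)

lemma ae_mem_openChamber_of_mem_chamber (p : ℕ) :
    ∀ᵐ X : Fin p → unitInterval, X ∈ chamber p → X ∈ openChamber p := by
  have h0 : ∀ (i : Fin p) (c : unitInterval), ∀ᵐ X : Fin p → unitInterval, X i ≠ c := by
    intro i c
    have h : (volume : Measure (Fin p → unitInterval)) {X | X i = c} = 0 :=
      Measure.pi_hyperplane (fun _ : Fin p => (volume : Measure unitInterval)) i c
    exact measure_eq_zero_iff_ae_notMem.1 h
  have h1 := ae_all_iff.2 fun i => h0 i 0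
  have h2 := ae_all_iff.2 fun i => h0 i 1
  filter_upwards [h1, h2] with X hX0 hX1 hX
  refine ⟨hX, fun i => ⟨?_, ?_⟩⟩
  · exact unitInterval.pos_iff_ne_zero.2 (hX0 i)
  · exact unitInterval.lt_one_iff_ne_one.2 (hX1 i)

lemma IsLimitLaw.ae_mem_openChamber {hz : (p : ℝ) - 1 < z'} {hw : -1 < w'}
    (hQ : IsLimitLaw hz hw Q) (hp : p = 0 → z' + w' ≠ -1) (t : ℝ≥0) :
    ∀ᵐ x ∂Q, (x t).1 ∈ openChamber p := by
  have hm : Measurable fun x : PathSpace p => (x t).1 :=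
    measurable_subtype_coe.comp (measurable_apply_pathSpace t)
  refine ae_of_ae_map (p := fun X => X ∈ openChamber p) hm.aemeasurable ?_
  rw [hQ.map_eval hp t, ae_withDensity_iff']
  · filter_upwards [ae_mem_openChamber_of_mem_chamber p] with X hX hne
    refine hX ?_
    by_contra hcon
    apply hne
    rw [ensembleDensity, ensembleWeight_eq, Set.indicator_of_notMem hcon]
    simp
  · exact ((integrable_ensembleWeight hz hw).const_mul _).1.aemeasurable.ennreal_ofReal

end Marginals


/-! ### Nonnegativity of the transition density -/

section Positivity

open Polynomial

instance : Measure.IsOpenPosMeasure (volume : Measure unitInterval) where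
  open_pos U hU hne := by
    obtain ⟨V, hV, rfl⟩ := isOpen_induced_iff.1 hU
    obtain ⟨x, hx⟩ := hne
    have hx2 : (x : ℝ) ∈ closure (Set.Ioo (0 : ℝ) 1) := by
      rw [closure_Ioo zero_ne_one]; exact x.2
    have h1 : (V ∩ Set.Ioo (0 : ℝ) 1).Nonempty := mem_closure_iff.1 hx2 V hV hx
    have h2 := ((hV.inter isOpen_Ioo).measure_pos (volume : Measure ℝ) h1).ne'
    rw [Measure.Subtype.volume_def,
      comap_subtype_coe_apply (show MeasurableSet unitInterval from measurableSet_Icc)]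
    refine fun h0 => h2 (measure_mono_null ?_ h0)
    rintro y ⟨hy, hy2⟩
    exact ⟨⟨y, Set.Ioo_subset_Icc_self hy2⟩, hy, rfl⟩

instance (p : ℕ) : Measure.IsOpenPosMeasure (volume : Measure (Fin p → unitInterval)) :=
  inferInstanceAs (Measure.IsOpenPosMeasure
    (Measure.pi fun _ : Fin p => (volume : Measure unitInterval)))

lemma isOpen_openChamber (p : ℕ) : IsOpen (openChamber p) := by
  have : openChamber p = (⋂ i, ⋂ j, ⋂ (_ : i < j), {X : Fin p → unitInterval | X i < X j}) ∩
      ⋂ i, {X | (X i : ℝ) ∈ Set.Ioo (0 : ℝ) 1} := by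
    ext X; simp [openChamber, StrictMono]
  rw [this]
  refine IsOpen.inter (isOpen_iInter_of_finite fun i => isOpen_iInter_of_finite fun j =>
    isOpen_iInter_of_finite fun _ => isOpen_lt (continuous_apply i) (continuous_apply j))
    (isOpen_iInter_of_finite fun i => isOpen_Ioo.preimage
      (continuous_subtype_val.comp (continuous_apply i)))

/-- The determinant of heat kernels between two configurations. -/
def kernelDet (p : ℕ) (z' w' t : ℝ) (Y X : Fin p → unitInterval) : ℝ :=
  detFun (fun b (x : unitInterval) => heatKernel p z' w' t (Y b) x) X

variable {p : ℕ} {z' w' : ℝ}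

lemma continuous_kernelDet (hz : (p : ℝ) - 1 < z') (hw : -1 < w') {t : ℝ} (ht : 0 < t) :
    Continuous fun Z : (Fin p → unitInterval) × (Fin p → unitInterval) =>
      kernelDet p z' w' t Z.1 Z.2 := by
  unfold kernelDet detFun
  refine Continuous.matrix_det (continuous_matrix fun i j => ?_)
  have h : Continuous fun Z : (Fin p → unitInterval) × (Fin p → unitInterval) =>
      (Z.1 j, Z.2 i) := by fun_prop
  exact (continuous_heatKernel hz hw ht).comp h

lemma detFun_heatKernel_mul (t : ℝ) (Y X : Fin p → unitInterval) :
    detFun (fun b (x : unitInterval) => heatKernel p z' w' t (Y b) x * betaWeight p z' w' x) X =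
      (∏ i, betaWeight p z' w' (X i)) * kernelDet p z' w' t Y X := by
  have := detFun_mul (fun y : unitInterval => betaWeight p z' w' y)
    (fun b y => heatKernel p z' w' t (Y b) y) X
  simp_rw [mul_comm (betaWeight p z' w' _)] at this
  exact this

/-- The determinantal form of the action of the semigroup on alternating polynomials. -/
lemma setIntegral_kernelDet (hz : (p : ℝ) - 1 < z') (hw : -1 < w') {t : ℝ} (ht : 0 < t)
    (Y : Fin p → unitInterval) (ψ : Fin p → ℝ[X]) :
    ∫ X in chamber p, detFun (fun a (x : unitInterval) => (ψ a).eval (x : ℝ)) X *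
      ((∏ i, betaWeight p z' w' (X i)) * kernelDet p z' w' t Y X) =
      detFun (fun a (y : unitInterval) =>
        (jacobiSemigroup hw (neg_one_lt_sub hz) t (ψ a)).eval (y : ℝ)) Y := by
  simp_rw [← detFun_heatKernel_mul]
  change ∫ Z in {X : Fin p → unitInterval | StrictMono X}, _ = _
  rw [setIntegral_detFun_mul_detFun fun a b => integrable_heatKernel_mul hz hw ht (Y b) _]
  simp_rw [integral_heatKernel_mul hz hw ht]
  rw [← Matrix.det_transpose]
  rfl

/-- The joint density of the configurations at two times, up to normalization. -/
def pairWeight (p : ℕ) (z' w' t : ℝ) (Z : (Fin p → unitInterval) × (Fin p → unitInterval)) : ℝ :=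
  (vanderI Z.1 * ∏ i, betaWeight p z' w' (Z.1 i)) *
    ((vanderI Z.2 * ∏ i, betaWeight p z' w' (Z.2 i)) * kernelDet p z' w' t Z.1 Z.2)

lemma integrable_pairWeight (hz : (p : ℝ) - 1 < z') (hw : -1 < w') {t : ℝ} (ht : 0 < t) :
    Integrable (pairWeight p z' w' t) := by
  have h := (integrable_prod_betaWeight hz hw).mul_prod (integrable_prod_betaWeight hz hw)
  have hc : Continuous fun Z : (Fin p → unitInterval) × (Fin p → unitInterval) =>
      vanderI Z.1 * vanderI Z.2 * kernelDet p z' w' t Z.1 Z.2 :=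
    (((continuous_vanderI p).comp continuous_fst).mul
      ((continuous_vanderI p).comp continuous_snd)).mul (continuous_kernelDet hz hw ht)
  obtain ⟨C, hC⟩ := isCompact_univ.exists_bound_of_continuousOn hc.continuousOn
  refine (h.bdd_mul hc.aestronglyMeasurable
    (Eventually.of_forall fun x => hC x (Set.mem_univ x))).congr (Eventually.of_forall fun Z => ?_)
  simp only [pairWeight]
  ring

lemma IsLimitLaw.integral_pair {Q : Measure (PathSpace p)} [IsProbabilityMeasure Q]
    {hz : (p : ℝ) - 1 < z'} {hw : -1 < w'} (hQ : IsLimitLaw hz hw Q)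
    (hp : p = 0 → z' + w' ≠ -1) {t : ℝ≥0} (ht : 0 < t) (f : C(Fin 2 → Config p, ℝ)) :
    ∫ x, f ![x 0, x t] ∂Q = ∫ Z, f ![toOrdered Z.2, toOrdered Z.1] *
      (Real.exp (t * totalK p z' w') / gramDet p z' w' * pairWeight p z' w' t Z)
      ∂((volume.restrict (chamber p)).prod (volume.restrict (chamber p))) := by
  have ht' : (0 : ℝ) < t := ht
  set c := Real.exp (t * totalK p z' w') / gramDet p z' w' with hc
  have hH : Integrable (fun Z => c * pairWeight p z' w' t Z)
      ((volume.restrict (chamber p)).prod (volume.restrict (chamber p))) := by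
    rw [Measure.prod_restrict]
    exact ((integrable_pairWeight hz hw ht').const_mul c).integrableOn
  have hx : Measurable fun (x : PathSpace p) => ![x 0, x t] := by
    refine measurable_pi_lambda _ fun i => ?_
    fin_cases i
    · exact measurable_apply_pathSpace _
    · exact measurable_apply_pathSpace _
  have hy : Measurable fun (Z : (Fin p → unitInterval) × (Fin p → unitInterval)) =>
      ![toOrdered Z.2, toOrdered Z.1] := by
    refine measurable_pi_lambda _ fun i => ?_
    fin_cases i
    · exact (measurable_toOrdered p).comp measurable_snd
    · exact (measurable_toOrdered p).comp measurable_fst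
  have key := integral_mul_eq_of_testFun hx hy (integrable_const (μ := Q) (1 : ℝ)) hH (by
    intro ξ
    set τ : ℕ → ℝ≥0 := fun k => if k = 0 then 0 else t with hτdef
    have hτ : Monotone τ := by
      intro a b hab
      simp only [hτdef]
      split_ifs with h1 h2
      · exact le_rfl
      · exact zero_le
      · omega
      · exact le_rfl
    set ζ : ℕ → ℝ[X] := fun k => if k = 0 then ξ 0 else ξ 1 with hζ
    have h1 : ∀ x : PathSpace p, testFun ξ ![x 0, x t] * 1 = pathProd τ ζ 1 x := by
      intro x
      simp [testFun_apply, pathProd, Finset.prod_range_succ, Fin.prod_univ_two, hτdef, hζ]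
    simp_rw [h1]
    rw [hQ.integral_pathProd hp hτ, limitCorr_eq_setIntegral]
    have h2 : Integrable (fun Z => testFun ξ ![toOrdered Z.2, toOrdered Z.1] *
        (c * pairWeight p z' w' t Z))
        ((volume.restrict (chamber p)).prod (volume.restrict (chamber p))) := by
      obtain ⟨C, hC⟩ := isCompact_univ.exists_bound_of_continuousOn
        (testFun ξ).continuous.continuousOn
      exact hH.bdd_mul ((testFun ξ).continuous.measurable.comp hy).aestronglyMeasurable
        (Eventually.of_forall fun x => hC _ (Set.mem_univ _))
    rw [integral_prod _ h2]
    have h3 : ((τ 1 : ℝ) - τ 0) = t := by simp [hτdef]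
    rw [h3, ← hc, ← integral_const_mul]
    refine setIntegral_congr_fun (measurableSet_chamber p) fun Y hY => ?_
    have h4 := setIntegral_kernelDet hz hw ht' Y fun a : Fin p => ξ 0 * X ^ (a : ℕ)
    have h5 : waveDensity hz hw τ ζ 1 Y = (∏ i, betaWeight p z' w' (Y i)) *
        ((∏ i, (ξ 1).eval (Y i : ℝ)) * detFun (fun (a : Fin p) (y : unitInterval) =>
        (jacobiSemigroup hw (neg_one_lt_sub hz) t (ξ 0 * X ^ (a : ℕ))).eval (y : ℝ)) Y) := by
      unfold waveDensity
      rw [← detFun_mul (fun x : unitInterval => (ξ 1).eval (x : ℝ))]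
      simp [limitWave, hτdef, hζ]
    simp only
    rw [h5, ← h4, ← integral_const_mul, ← integral_const_mul, ← integral_const_mul,
      ← integral_const_mul]
    refine setIntegral_congr_fun (measurableSet_chamber p) fun Z hZ => ?_
    simp only [testFun_apply, Fin.prod_univ_two, Matrix.cons_val_zero, Matrix.cons_val_one,
      toOrdered_val hY, toOrdered_val hZ, pairWeight, eval_mul, eval_pow, eval_X]
    rw [detFun_mul (fun x : unitInterval => (ξ 0).eval (x : ℝ))
        (fun (a : Fin p) (x : unitInterval) => (x : ℝ) ^ (a : ℕ))]
    change _ * (_ * (_ * (_ * (_ * vanderI Z * _)))) = _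
    ring) f
  simpa using key

/-- Integrating the negative part of the determinant against the joint law of two configurations
shows that it vanishes. -/
lemma kernelDet_nonneg (hz : (p : ℝ) - 1 < z') (hw : -1 < w') (hp : p = 0 → z' + w' ≠ -1)
    {t : ℝ} (ht : 0 < t) {X Y : Fin p → unitInterval} (hX : X ∈ openChamber p)
    (hY : Y ∈ openChamber p) : 0 ≤ kernelDet p z' w' t X Y := by
  obtain ⟨Q, hQ1, hQ⟩ := exists_limit_law hz hw hp
  have hQ : IsLimitLaw hz hw Q := hQ
  lift t to ℝ≥0 using ht.le
  have hD := continuous_kernelDet hz hw ht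
  set c := Real.exp (t * totalK p z' w') / gramDet p z' w' with hc
  have hcpos : 0 < c := div_pos (Real.exp_pos _) (gramDet_pos hz hw)
  set g : (Fin p → unitInterval) × (Fin p → unitInterval) → ℝ :=
    fun Z => max 0 (-kernelDet p z' w' t Z.1 Z.2) with hg
  have hgc : Continuous g := continuous_const.max hD.neg
  have key := hQ.integral_pair hp (t := t) (by exact_mod_cast ht)
    ⟨fun y => g ((y 1).1, (y 0).1), hgc.comp
      ((continuous_subtype_val.comp (continuous_apply 1)).prodMk
        (continuous_subtype_val.comp (continuous_apply 0)))⟩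
  simp only [ContinuousMap.coe_mk, Matrix.cons_val_zero, Matrix.cons_val_one] at key
  rw [← hc, Measure.prod_restrict] at key
  have hm := (measurableSet_chamber p).prod (measurableSet_chamber p)
  set W : (Fin p → unitInterval) × (Fin p → unitInterval) → ℝ := fun Z =>
    (vanderI Z.1 * ∏ i, betaWeight p z' w' (Z.1 i)) *
      (vanderI Z.2 * ∏ i, betaWeight p z' w' (Z.2 i)) with hW
  have hneg : ∀ d : ℝ, max 0 (-d) * d = -(max 0 (-d)) ^ 2 := by
    intro d
    rcases le_total 0 d with h | h
    · rw [max_eq_left (by linarith)]; simp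
    · rw [max_eq_right (by linarith)]; ring
  have hcongr : ∫ Z in chamber p ×ˢ chamber p, g ((toOrdered Z.1).1, (toOrdered Z.2).1) *
      (c * pairWeight p z' w' t Z) ∂(volume.prod volume) =
      -(c * ∫ Z in chamber p ×ˢ chamber p, g Z ^ 2 * W Z ∂(volume.prod volume)) := by
    rw [← integral_const_mul, ← integral_neg]
    refine setIntegral_congr_fun hm fun Z hZ => ?_
    simp only [toOrdered_val hZ.1, toOrdered_val hZ.2, Prod.mk.eta, pairWeight, hW]
    have := hneg (kernelDet p z' w' t Z.1 Z.2)
    simp only [hg]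
    linear_combination (c * (vanderI Z.1 * ∏ i, betaWeight p z' w' (Z.1 i)) *
      (vanderI Z.2 * ∏ i, betaWeight p z' w' (Z.2 i))) * this
  rw [hcongr] at key
  have h0 : 0 ≤ ∫ x : PathSpace p, g ((x t).1, (x 0).1) ∂Q :=
    integral_nonneg fun x => le_max_left _ _
  have hWnn : ∀ Z ∈ chamber p ×ˢ chamber p, 0 ≤ g Z ^ 2 * W Z := fun Z hZ =>
    mul_nonneg (sq_nonneg _) (mul_nonneg
      (mul_nonneg (vanderI_pos hZ.1).le (prod_betaWeight_nonneg p z' w' _))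
      (mul_nonneg (vanderI_pos hZ.2).le (prod_betaWeight_nonneg p z' w' _)))
  have h1 : ∫ Z in chamber p ×ˢ chamber p, g Z ^ 2 * W Z ∂(volume.prod volume) = 0 := by
    refine le_antisymm ?_ (setIntegral_nonneg hm hWnn)
    by_contra! hlt
    have := mul_pos hcpos hlt
    linarith
  have hint : IntegrableOn (fun Z => g Z ^ 2 * W Z) (chamber p ×ˢ chamber p)
      (volume.prod volume) := by
    refine Integrable.integrableOn ?_
    have h := (integrable_prod_betaWeight hz hw).mul_prod (integrable_prod_betaWeight hz hw)
    have hc : Continuous fun Z : (Fin p → unitInterval) × (Fin p → unitInterval) =>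
        g Z ^ 2 * (vanderI Z.1 * vanderI Z.2) :=
      (hgc.pow 2).mul (((continuous_vanderI p).comp continuous_fst).mul
        ((continuous_vanderI p).comp continuous_snd))
    obtain ⟨C, hC⟩ := isCompact_univ.exists_bound_of_continuousOn hc.continuousOn
    refine (h.bdd_mul hc.aestronglyMeasurable (Eventually.of_forall fun x =>
      hC x (Set.mem_univ x))).congr (Eventually.of_forall fun Z => ?_)
    simp only [hW]
    ring
  rw [setIntegral_eq_zero_iff_of_nonneg_ae ((ae_restrict_iff' hm).2 (Eventually.of_forall hWnn))
    hint] at h1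
  have hsub : openChamber p ×ˢ openChamber p ⊆ chamber p ×ˢ chamber p :=
    Set.prod_mono (fun Z hZ => hZ.1) fun Z hZ => hZ.1
  have h2 : g =ᵐ[(volume.prod volume).restrict (openChamber p ×ˢ openChamber p)] fun _ => 0 := by
    filter_upwards [ae_restrict_of_ae_restrict_of_subset hsub h1, ae_restrict_mem
      ((measurableSet_openChamber p).prod (measurableSet_openChamber p))] with Z hZ hmem
    have hpos : 0 < W Z := mul_pos
      (mul_pos (vanderI_pos hmem.1.1) (Finset.prod_pos fun i _ =>
        betaWeight_pos p z' w' (hmem.1.2 i)))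
      (mul_pos (vanderI_pos hmem.2.1) (Finset.prod_pos fun i _ =>
        betaWeight_pos p z' w' (hmem.2.2 i)))
    have : g Z ^ 2 = 0 := (mul_eq_zero.1 hZ).resolve_right hpos.ne'
    exact pow_eq_zero_iff two_ne_zero |>.1 this
  have h3 := Measure.eqOn_open_of_ae_eq h2
    ((isOpen_openChamber p).prod (isOpen_openChamber p)) hgc.continuousOn continuousOn_const
    (Set.mk_mem_prod hX hY)
  have h4 : -kernelDet p z' w' t X Y ≤ 0 := by
    exact (le_max_right _ _).trans h3.le
  linarith

lemma transitionDensity_eq_kernelDet (hz : (p : ℝ) - 1 < z') (hw : -1 < w') (t : ℝ)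
    {X : Fin p → unitInterval} (hX : X ∈ openChamber p) (Y : Fin p → unitInterval) :
    transitionDensity p z' w' t X Y = (chamber p).indicator (fun Y =>
      Real.exp (t * totalK p z' w') / vanderI X * (vanderI Y *
        ((∏ i, betaWeight p z' w' (Y i)) * kernelDet p z' w' t X Y))) Y := by
  simp_rw [transitionDensity_eq hz hw t hX, detFun_heatKernel_mul]

lemma transitionDensity_nonneg (hz : (p : ℝ) - 1 < z') (hw : -1 < w')
    (hp : p = 0 → z' + w' ≠ -1) {t : ℝ} (ht : 0 < t) {X Y : Fin p → unitInterval}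
    (hX : X ∈ openChamber p) (hY : Y ∈ openChamber p) : 0 ≤ transitionDensity p z' w' t X Y := by
  rw [transitionDensity_eq_kernelDet hz hw t hX,
    Set.indicator_of_mem (show Y ∈ chamber p from hY.1)]
  exact mul_nonneg (div_nonneg (Real.exp_pos _).le (vanderI_pos hX.1).le)
    (mul_nonneg (vanderI_pos hY.1).le (mul_nonneg (prod_betaWeight_nonneg p z' w' Y)
      (kernelDet_nonneg hz hw hp ht hX hY)))

lemma ae_transitionDensity_nonneg (hz : (p : ℝ) - 1 < z') (hw : -1 < w')
    (hp : p = 0 → z' + w' ≠ -1) {t : ℝ} (ht : 0 < t) {X : Fin p → unitInterval}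
    (hX : X ∈ openChamber p) : ∀ᵐ Y, 0 ≤ transitionDensity p z' w' t X Y := by
  filter_upwards [ae_mem_openChamber_of_mem_chamber p] with Y hY
  by_cases h : Y ∈ chamber p
  · exact transitionDensity_nonneg hz hw hp ht hX (hY h)
  · rw [transitionDensity_eq_kernelDet hz hw t hX, Set.indicator_of_notMem h]

end Positivity


/-! ### The Markov identity for multiplicative functions -/

section MarkovIdentity

open Polynomial

variable {p : ℕ} {z' w' : ℝ}

/-- By the symmetry of the semigroup, the last step can be moved to the other side of the
pairing. -/
lemma limitCorr_succ_eq (hz : (p : ℝ) - 1 < z') (hw : -1 < w') (τ : ℕ → ℝ≥0) (ξ : ℕ → ℝ[X])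
    (K : ℕ) : limitCorr hz hw τ ξ (K + 1) =
      Real.exp (((τ (K + 1) : ℝ) - τ 0) * totalK p z' w') / gramDet p z' w' *
        ∫ Y in chamber p, detFun (fun (a : Fin p) (x : unitInterval) =>
          (jacobiSemigroup hw (neg_one_lt_sub hz) ((τ (K + 1) : ℝ) - τ K)
            (ξ (K + 1) * X ^ (a : ℕ))).eval (x : ℝ)) Y * waveDensity hz hw τ ξ K Y := by
  have h := (setIntegral_chamber_eval hz hw (fun a : Fin p =>
    jacobiSemigroup hw (neg_one_lt_sub hz) ((τ (K + 1) : ℝ) - τ K) (ξ (K + 1) * X ^ (a : ℕ)))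
    fun b : Fin p => limitWave hz hw τ ξ K (X ^ (b : ℕ))).2
  have h2 : (Matrix.of fun a b : Fin p =>
      moment p z' w' (X ^ (a : ℕ) * limitWave hz hw τ ξ (K + 1) (X ^ (b : ℕ)))) =
      Matrix.of fun a b : Fin p => moment p z' w' (jacobiSemigroup hw (neg_one_lt_sub hz)
        ((τ (K + 1) : ℝ) - τ K) (ξ (K + 1) * X ^ (a : ℕ)) *
          limitWave hz hw τ ξ K (X ^ (b : ℕ))) := by
    ext a b
    simp only [Matrix.of_apply, limitWave]
    rw [moment_jacobiSemigroup_mul hz hw]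
    congr 1
    ring
  unfold limitCorr
  rw [h2, ← h, mul_div_right_comm]
  rfl

lemma abs_integral_transitionDensity_mul_le (hz : (p : ℝ) - 1 < z') (hw : -1 < w')
    (hp : p = 0 → z' + w' ≠ -1) {t : ℝ} (ht : 0 < t) {Y : Fin p → unitInterval}
    (hY : Y ∈ openChamber p) {f : (Fin p → unitInterval) → ℝ} {C : ℝ} (hC : ∀ Z, |f Z| ≤ C) :
    |∫ Z, transitionDensity p z' w' t Y Z * f Z| ≤ C := by
  have h1 : ∀ᵐ Z, ‖transitionDensity p z' w' t Y Z * f Z‖ ≤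
      C * transitionDensity p z' w' t Y Z := by
    filter_upwards [ae_transitionDensity_nonneg hz hw hp ht hY] with Z hZ
    rw [Real.norm_eq_abs, abs_mul, abs_of_nonneg hZ, mul_comm]
    exact mul_le_mul_of_nonneg_right (hC Z) hZ
  have h2 := norm_integral_le_of_norm_le ((integrable_transitionDensity hz hw ht hY).const_mul C) h1
  rwa [integral_const_mul, integral_transitionDensity hz hw ht hY, mul_one] at h2

variable {Q : Measure (PathSpace p)} [IsProbabilityMeasure Q]

/-- Given the past, the conditional expectation of a multiplicative function of a later
configuration is its integral against the transition density. Since the ratio of determinants that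
gives this integral is singular on the walls of the chamber, it is approximated by continuous
functions. -/
theorem IsLimitLaw.integral_pathProd_succ {hz : (p : ℝ) - 1 < z'} {hw : -1 < w'}
    (hQ : IsLimitLaw hz hw Q) (hp : p = 0 → z' + w' ≠ -1) {τ : ℕ → ℝ≥0} (hτ : Monotone τ)
    (ξ : ℕ → ℝ[X]) (K : ℕ) (hlt : τ K < τ (K + 1)) :
    ∫ x, pathProd τ ξ (K + 1) x ∂Q = ∫ x, (∫ Z, transitionDensity p z' w' ((τ (K + 1) : ℝ) - τ K)
      (x (τ K)).1 Z * ∏ i, (ξ (K + 1)).eval (Z i : ℝ)) * pathProd τ ξ K x ∂Q := by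
  set d : ℝ := (τ (K + 1) : ℝ) - τ K with hd
  have hd0 : 0 < d := sub_pos.2 (by exact_mod_cast hlt)
  set A : (Fin p → unitInterval) → ℝ := fun Y => Real.exp (d * totalK p z' w') *
    detFun (fun (a : Fin p) (x : unitInterval) => (jacobiSemigroup hw (neg_one_lt_sub hz) d
      (ξ (K + 1) * X ^ (a : ℕ))).eval (x : ℝ)) Y with hA
  have hAc : Continuous A := continuous_const.mul (continuous_detFun_eval _)
  set P : (Fin p → unitInterval) → ℝ := fun Y => ∫ Z, transitionDensity p z' w' d Y Z *
    ∏ i, (ξ (K + 1)).eval (Z i : ℝ) with hP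
  have hPeq : ∀ Y ∈ openChamber p, P Y = A Y / vanderI Y := fun Y hY =>
    (integral_transitionDensity_mul hz hw hd0 hY _).2
  obtain ⟨C, hC⟩ : ∃ C, ∀ Z : Fin p → unitInterval, |∏ i, (ξ (K + 1)).eval (Z i : ℝ)| ≤ C := by
    have hc : Continuous fun Z : Fin p → unitInterval => ∏ i, (ξ (K + 1)).eval (Z i : ℝ) :=
      continuous_finsetProd _ fun i _ => (ξ (K + 1)).continuous.comp
        (continuous_subtype_val.comp (continuous_apply i))
    obtain ⟨C, hC⟩ := isCompact_univ.exists_bound_of_continuousOn hc.continuousOn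
    exact ⟨C, fun Z => hC Z (Set.mem_univ Z)⟩
  have hPC : ∀ Y ∈ openChamber p, |P Y| ≤ C := fun Y hY =>
    abs_integral_transitionDensity_mul_le hz hw hp hd0 hY hC
  -- the continuous approximations of `A / vanderI`
  set ε : ℕ → ℝ := fun n => 1 / ((n : ℝ) + 1) with hε
  have hε0 : ∀ n, 0 < ε n := fun n => Nat.one_div_pos_of_nat
  have hεt : Tendsto ε atTop (𝓝 0) := tendsto_one_div_add_atTop_nhds_zero_nat
  set h : ℕ → (Fin p → unitInterval) → ℝ := fun n Y =>
    A Y * vanderI Y / max (vanderI Y ^ 2) (ε n) with hh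
  have hmax : ∀ n Y, 0 < max (vanderI (p := p) Y ^ 2) (ε n) := fun n Y => lt_max_of_lt_right (hε0 n)
  have hhc : ∀ n, Continuous (h n) := fun n =>
    (hAc.mul (continuous_vanderI p)).div
      (((continuous_vanderI p).pow 2).max continuous_const) fun Y => (hmax n Y).ne'
  have hratio : ∀ n (Y : Fin p → unitInterval), |h n Y * vanderI Y| ≤ |A Y| := by
    intro n Y
    have h1 : h n Y * vanderI Y = A Y * (vanderI Y ^ 2 / max (vanderI Y ^ 2) (ε n)) := by
      simp only [hh]; ring
    rw [h1, abs_mul, abs_of_nonneg (div_nonneg (sq_nonneg _) (hmax n Y).le)]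
    exact mul_le_of_le_one_right (abs_nonneg _) (div_le_one_of_le₀ (le_max_left _ _) (hmax n Y).le)
  have hlim : ∀ Y ∈ chamber p, Tendsto (fun n => h n Y) atTop (𝓝 (A Y / vanderI Y)) := by
    intro Y hY
    have hV := vanderI_pos hY
    refine tendsto_const_nhds.congr' ?_
    filter_upwards [hεt.eventually (gt_mem_nhds (pow_pos hV 2))] with n hn
    simp only [hh]
    rw [max_eq_left hn.le]
    field_simp
  have key : ∀ n, ∫ x, h n (x (τ K)).1 * pathProd τ ξ K x ∂Q =
      Real.exp (((τ K : ℝ) - τ 0) * totalK p z' w') / gramDet p z' w' *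
        ∫ X in chamber p, h n X * (vanderI X * waveDensity hz hw τ ξ K X) :=
    fun n => hQ.integral_mul_pathProd hp hτ ξ K (hhc n)
  have hmeas : Measurable fun x : PathSpace p => (x (τ K)).1 :=
    measurable_subtype_coe.comp (measurable_apply_pathSpace _)
  obtain ⟨C', hC'⟩ := isCompact_univ.exists_bound_of_continuousOn
    (continuous_pathProd (p := p) τ ξ K).continuousOn
  have hleft : Tendsto (fun n => ∫ x, h n (x (τ K)).1 * pathProd τ ξ K x ∂Q) atTop
      (𝓝 (∫ x, P (x (τ K)).1 * pathProd τ ξ K x ∂Q)) := by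
    refine tendsto_integral_of_dominated_convergence (fun _ => C * C') ?_
      (integrable_const _) ?_ ?_
    · exact fun n => (((hhc n).measurable.comp hmeas).mul
        (continuous_pathProd τ ξ K).measurable).aestronglyMeasurable
    · intro n
      filter_upwards [hQ.ae_mem_openChamber hp (τ K)] with x hx
      have hV := vanderI_pos hx.1
      rw [norm_mul]
      refine mul_le_mul ?_ (hC' x (Set.mem_univ x)) (norm_nonneg _)
        ((abs_nonneg _).trans (hPC _ hx))
      refine le_trans ?_ (hPC _ hx)
      rw [hPeq _ hx, abs_div, abs_of_pos hV, le_div_iff₀ hV, Real.norm_eq_abs]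
      refine le_trans (le_of_eq ?_) (hratio n _)
      rw [abs_mul, abs_of_pos hV]
    · filter_upwards [hQ.ae_mem_openChamber hp (τ K)] with x hx
      rw [hPeq _ hx]
      exact (hlim _ hx.1).mul_const _
  have hright : Tendsto (fun n => ∫ X in chamber p, h n X * (vanderI X * waveDensity hz hw τ ξ K X))
      atTop (𝓝 (∫ X in chamber p, A X * waveDensity hz hw τ ξ K X)) := by
    have hint := integrable_mul_waveDensity hz hw τ ξ K hAc
    refine tendsto_integral_of_dominated_convergence (fun X => ‖A X * waveDensity hz hw τ ξ K X‖) ?_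
      hint.norm.integrableOn ?_ ?_
    · intro n
      refine ((integrable_mul_waveDensity hz hw τ ξ K
        ((hhc n).mul (continuous_vanderI p))).aestronglyMeasurable.congr
        (Eventually.of_forall fun X => ?_)).restrict
      simp only [Pi.mul_apply]
      ring
    · intro n
      refine Eventually.of_forall fun X => ?_
      rw [← mul_assoc, norm_mul, norm_mul (A X)]
      exact mul_le_mul_of_nonneg_right (hratio n X) (norm_nonneg _)
    · filter_upwards [ae_restrict_mem (measurableSet_chamber p)] with X hX
      have := (hlim X hX).mul_const (vanderI X * waveDensity hz hw τ ξ K X)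
      rwa [← mul_assoc, div_mul_cancel₀ _ (vanderI_pos hX).ne'] at this
  have hfin := tendsto_nhds_unique hleft
    ((hright.const_mul _).congr fun n => (key n).symm)
  have hexp : Real.exp (((τ (K + 1) : ℝ) - τ 0) * totalK p z' w') =
      Real.exp (((τ K : ℝ) - τ 0) * totalK p z' w') * Real.exp (d * totalK p z' w') := by
    rw [← Real.exp_add, hd]
    congr 1
    ring
  rw [hfin, hQ.integral_pathProd hp hτ, limitCorr_succ_eq, ← hd, hexp]
  simp only [hA, mul_assoc]
  rw [integral_const_mul]
  ring

end MarkovIdentity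


/-! ### The Markov property -/

section MarkovProperty

open Polynomial

variable {p : ℕ} {z' w' : ℝ}

lemma transitionDensity_eq_zero (t : ℝ) (X : Fin p → unitInterval) {Y : Fin p → unitInterval}
    (hY : Y ∉ chamber p) : transitionDensity p z' w' t X Y = 0 := by
  rw [transitionDensity, ensembleDensity, ensembleWeight_eq, Set.indicator_of_notMem hY]
  simp

lemma measurable_transitionDensity (hz : (p : ℝ) - 1 < z') (hw : -1 < w') {t : ℝ} (ht : 0 < t) :
    Measurable fun Z : (Fin p → unitInterval) × (Fin p → unitInterval) =>
      transitionDensity p z' w' t Z.1 Z.2 := by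
  have hβ : ∀ i, Measurable fun X : Fin p → unitInterval => betaWeight p z' w' (X i) := fun i =>
    (measurable_betaWeight p z' w').comp (measurable_pi_apply i)
  have hρ : Measurable (ensembleDensity p z' w') := by
    refine Measurable.const_mul ?_ _
    rw [funext (ensembleWeight_eq p z' w')]
    exact (((continuous_vanderI p).measurable.pow_const 2).mul
      (Finset.measurable_prod _ fun i _ => hβ i)).indicator (measurableSet_chamber p)
  have hJ : ∀ i j, Measurable fun Z : (Fin p → unitInterval) × (Fin p → unitInterval) =>
      jacobiKernel p z' w' t (Z.1 i) (Z.2 j) := by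
    intro i j
    have h : Continuous fun Z : (Fin p → unitInterval) × (Fin p → unitInterval) =>
        (Z.1 i, Z.2 j) := by fun_prop
    simp_rw [jacobiKernel_eq t hz hw]
    exact (((hβ i).comp measurable_fst).sqrt.mul ((hβ j).comp measurable_snd).sqrt).mul
      ((continuous_heatKernel hz hw ht).comp h).measurable
  unfold transitionDensity
  refine (((hρ.comp measurable_snd).sqrt.div (hρ.comp measurable_fst).sqrt).mul_const _).mul ?_
  simp_rw [Matrix.det_apply', Matrix.of_apply]
  exact Finset.measurable_sum _ fun σ _ => (Finset.measurable_prod _ fun i _ => hJ _ _).const_mul _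

variable {Q : Measure (PathSpace p)} [IsProbabilityMeasure Q]

lemma measurable_transitionDensity_apply (hz : (p : ℝ) - 1 < z') (hw : -1 < w') (s : ℝ≥0) {d : ℝ}
    (hd : 0 < d) : Measurable fun xZ : PathSpace p × (Fin p → unitInterval) =>
      transitionDensity p z' w' d (xZ.1 s).1 xZ.2 :=
  (measurable_transitionDensity hz hw hd).comp ((measurable_subtype_coe.comp
    ((measurable_apply_pathSpace s).comp measurable_fst)).prodMk measurable_snd)

lemma IsLimitLaw.integrable_transitionDensity {hz : (p : ℝ) - 1 < z'} {hw : -1 < w'}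
    (hQ : IsLimitLaw hz hw Q) (hp : p = 0 → z' + w' ≠ -1) (s : ℝ≥0) {d : ℝ} (hd : 0 < d) :
    Integrable (fun xZ : PathSpace p × (Fin p → unitInterval) =>
      transitionDensity p z' w' d (xZ.1 s).1 xZ.2) (Q.prod volume) := by
  have hm := measurable_transitionDensity_apply hz hw s hd
  rw [integrable_prod_iff hm.aestronglyMeasurable]
  constructor
  · filter_upwards [hQ.ae_mem_openChamber hp s] with x hx
    exact GelfandTsetlin.integrable_transitionDensity hz hw hd hx
  · refine (integrable_const (1 : ℝ)).congr ?_
    filter_upwards [hQ.ae_mem_openChamber hp s] with x hx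
    rw [← integral_transitionDensity hz hw hd hx]
    refine integral_congr_ae ?_
    filter_upwards [ae_transitionDensity_nonneg hz hw hp hd hx] with Z hZ
    rw [Real.norm_of_nonneg hZ]

lemma measurable_snoc {Ω : Type*} [MeasurableSpace Ω] {n : ℕ} {f : Ω → Fin n → Config p}
    {g : Ω → Config p} (hf : Measurable f) (hg : Measurable g) :
    Measurable fun ω => (Fin.snoc (f ω) (g ω) : Fin (n + 1) → Config p) := by
  refine measurable_pi_lambda _ fun k => ?_
  refine Fin.lastCases ?_ (fun k => ?_) k
  · simpa only [Fin.snoc_last] using hg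
  · simp only [Fin.snoc_castSucc]
    exact (measurable_pi_apply k).comp hf

/-- The Markov identity for multiplicative functions at arbitrary times up to `s`. -/
lemma IsLimitLaw.integral_testFun_snoc {hz : (p : ℝ) - 1 < z'} {hw : -1 < w'}
    (hQ : IsLimitLaw hz hw Q) (hp : p = 0 → z' + w' ≠ -1) {n : ℕ} {t : Fin n → ℝ≥0} {s u : ℝ≥0}
    (hs : ∃ k, t k = s) (hts : ∀ k, t k ≤ s) (hu : s < u) (ζ : Fin (n + 1) → ℝ[X]) :
    ∫ x, testFun ζ (Fin.snoc (fun k => x (t k)) (x u)) ∂Q =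
      ∫ x, testFun (fun k : Fin n => ζ k.castSucc) (fun k => x (t k)) *
        (∫ Z, transitionDensity p z' w' ((u : ℝ) - s) (x s).1 Z *
          ∏ i, (ζ (Fin.last n)).eval (Z i : ℝ)) ∂Q := by
  set τ : ℕ → ℝ≥0 := fun k => if k ≤ n then sortTime t k else u with hτdef
  have hsn : sortTime t n = s := by
    simp only [sortTime, lt_irrefl, dite_false]
    obtain ⟨k, rfl⟩ := hs
    exact le_antisymm (Finset.sup_le fun j _ => hts j) (Finset.le_sup (Finset.mem_univ k))
  have hτ : Monotone τ := by
    intro j k hjk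
    simp only [hτdef]
    split_ifs with h1 h2 h2
    · exact sortTime_mono t hjk
    · exact ((sortTime_mono t h1).trans hsn.le).trans hu.le
    · omega
    · exact le_rfl
  set ξ : ℕ → ℝ[X] := fun k =>
    if k ≤ n then sortFactor t (fun k : Fin n => ζ k.castSucc) k else ζ (Fin.last n) with hξ
  have hτn : τ n = s := by simp only [hτdef, le_refl, if_true, hsn]
  have hτn1 : τ (n + 1) = u := by simp [hτdef]
  have hξn1 : ξ (n + 1) = ζ (Fin.last n) := by simp [hξ]
  have h1 : ∀ x : PathSpace p, pathProd τ ξ n x =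
      testFun (fun k : Fin n => ζ k.castSucc) (fun k => x (t k)) := by
    intro x
    rw [testFun_apply, ← prod_sort t (fun k : Fin n => ζ k.castSucc)
      (fun r q => ∏ i, q.eval ((x r).1 i : ℝ)) (by simp), pathProd]
    refine Finset.prod_congr rfl fun k hk => ?_
    have hk' : k ≤ n := Nat.lt_succ_iff.1 (Finset.mem_range.1 hk)
    simp only [hτdef, hξ, hk', if_true]
  have h2 : ∀ x : PathSpace p, pathProd τ ξ (n + 1) x =
      testFun ζ (Fin.snoc (fun k => x (t k)) (x u)) := by
    intro x
    have : pathProd τ ξ (n + 1) x =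
        pathProd τ ξ n x * ∏ i, (ξ (n + 1)).eval ((x (τ (n + 1))).1 i : ℝ) :=
      Finset.prod_range_succ _ _
    rw [this, h1, hξn1, hτn1, testFun_apply, testFun_apply, Fin.prod_univ_castSucc]
    simp only [Fin.snoc_castSucc, Fin.snoc_last]
  have key := hQ.integral_pathProd_succ hp hτ ξ n (by rw [hτn, hτn1]; exact hu)
  simp_rw [h1, h2, hτn, hτn1, hξn1] at key
  rw [key]
  exact integral_congr_ae (Eventually.of_forall fun x => mul_comm _ _)

/-- The law of the configurations at the times `t`, followed by a step of length `d` with the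
transition density from the configuration at time `s`. -/
def stepLaw (z' w' : ℝ) (Q : Measure (PathSpace p)) {n : ℕ} (t : Fin n → ℝ≥0) (s : ℝ≥0) (d : ℝ) :
    Measure (Fin (n + 1) → Config p) :=
  ((Q.prod volume).withDensity fun xZ => ENNReal.ofReal
    (transitionDensity p z' w' d (xZ.1 s).1 xZ.2)).map
      fun xZ => Fin.snoc (fun k => xZ.1 (t k)) (toOrdered xZ.2)

lemma measurable_snoc_toOrdered {n : ℕ} (t : Fin n → ℝ≥0) :
    Measurable fun xZ : PathSpace p × (Fin p → unitInterval) =>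
      (Fin.snoc (fun k => xZ.1 (t k)) (toOrdered xZ.2) : Fin (n + 1) → Config p) :=
  measurable_snoc ((measurable_eval_pathSpace t).comp measurable_fst)
    ((measurable_toOrdered p).comp measurable_snd)

lemma measurable_castSucc_mul_last {n : ℕ} {η : (Fin n → Config p) → ℝ}
    {ψ : (Fin p → unitInterval) → ℝ} (hη : Measurable η) (hψ : Measurable ψ) :
    Measurable fun y : Fin (n + 1) → Config p =>
      η (fun k => y k.castSucc) * ψ (y (Fin.last n)).1 := by
  have h1 : Measurable fun (y : Fin (n + 1) → Config p) (k : Fin n) => y k.castSucc :=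
    measurable_pi_lambda _ fun k => measurable_pi_apply _
  have h2 : Measurable fun y : Fin (n + 1) → Config p => (y (Fin.last n)).1 :=
    measurable_subtype_coe.comp (measurable_pi_apply _)
  exact (hη.comp h1).mul (hψ.comp h2)

lemma IsLimitLaw.integral_stepLaw {hz : (p : ℝ) - 1 < z'} {hw : -1 < w'} (hQ : IsLimitLaw hz hw Q)
    (hp : p = 0 → z' + w' ≠ -1) {n : ℕ} (t : Fin n → ℝ≥0) (s : ℝ≥0) {d : ℝ} (hd : 0 < d)
    {η : (Fin n → Config p) → ℝ} {ψ : (Fin p → unitInterval) → ℝ} (hη : Measurable η)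
    (hψ : Measurable ψ) {C : ℝ} (hC : ∀ a b, |η a * ψ b| ≤ C) :
    ∫ y, η (fun k => y k.castSucc) * ψ (y (Fin.last n)).1 ∂stepLaw z' w' Q t s d =
      ∫ x, η (fun k => x (t k)) * (∫ Z, transitionDensity p z' w' d (x s).1 Z * ψ Z) ∂Q := by
  have hint := hQ.integrable_transitionDensity hp s hd
  have hF : Measurable fun y : Fin (n + 1) → Config p =>
      η (fun k => y k.castSucc) * ψ (y (Fin.last n)).1 :=
    measurable_castSucc_mul_last hη hψ
  have hy := measurable_snoc_toOrdered (p := p) t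
  have hprod : Integrable (fun xZ : PathSpace p × (Fin p → unitInterval) =>
      η (fun k => xZ.1 (t k)) * ψ (toOrdered xZ.2).1 *
        transitionDensity p z' w' d (xZ.1 s).1 xZ.2) (Q.prod volume) := by
    refine (hint.bdd_mul (hF.comp hy).aestronglyMeasurable
      (Eventually.of_forall fun xZ => hC _ _)).congr (Eventually.of_forall fun xZ => ?_)
    simp only [Function.comp_apply, Fin.snoc_castSucc, Fin.snoc_last]
  rw [stepLaw, integral_map hy.aemeasurable hF.aestronglyMeasurable,
    integral_withDensity_eq_integral_toReal_smul₀ hint.1.aemeasurable.ennreal_ofReal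
      (Eventually.of_forall fun _ => ENNReal.ofReal_lt_top)]
  simp only [Fin.snoc_castSucc, Fin.snoc_last]
  have h1 : ∀ᵐ xZ ∂(Q.prod (volume : Measure (Fin p → unitInterval))),
      (ENNReal.ofReal (transitionDensity p z' w' d (xZ.1 s).1 xZ.2)).toReal •
        (η (fun k => xZ.1 (t k)) * ψ (toOrdered xZ.2).1) =
      η (fun k => xZ.1 (t k)) * ψ (toOrdered xZ.2).1 *
        transitionDensity p z' w' d (xZ.1 s).1 xZ.2 := by
    have hnn : ∀ᵐ xZ ∂(Q.prod (volume : Measure (Fin p → unitInterval))),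
        0 ≤ transitionDensity p z' w' d (xZ.1 s).1 xZ.2 := by
      rw [Measure.ae_prod_iff_ae_ae (measurableSet_le measurable_const
        (measurable_transitionDensity_apply hz hw s hd))]
      filter_upwards [hQ.ae_mem_openChamber hp s] with x hx
      exact ae_transitionDensity_nonneg hz hw hp hd hx
    filter_upwards [hnn] with xZ hxZ
    rw [ENNReal.toReal_ofReal hxZ, smul_eq_mul, mul_comm]
  rw [integral_congr_ae h1, integral_prod _ hprod]
  refine integral_congr_ae (Eventually.of_forall fun x => ?_)
  simp only
  rw [← integral_const_mul]
  refine integral_congr_ae (Eventually.of_forall fun Z => ?_)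
  by_cases hZ : Z ∈ chamber p
  · simp only [toOrdered_val hZ]
    ring
  · simp only [transitionDensity_eq_zero _ _ hZ]
    ring

/-- The joint law of the configurations at finitely many times up to `s`, among them `s`, and of
the configuration at a later time. -/
lemma IsLimitLaw.map_snoc {hz : (p : ℝ) - 1 < z'} {hw : -1 < w'}
    (hQ : IsLimitLaw hz hw Q) (hp : p = 0 → z' + w' ≠ -1) {n : ℕ} {t : Fin n → ℝ≥0} {s u : ℝ≥0}
    (hs : ∃ k, t k = s) (hts : ∀ k, t k ≤ s) (hu : s < u) :
    Q.map (fun x => (Fin.snoc (fun k => x (t k)) (x u) : Fin (n + 1) → Config p)) =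
      stepLaw z' w' Q t s ((u : ℝ) - s) := by
  have hd : 0 < (u : ℝ) - s := sub_pos.2 (by exact_mod_cast hu)
  have hint := hQ.integrable_transitionDensity hp s hd
  have hx : Measurable fun x : PathSpace p =>
      (Fin.snoc (fun k => x (t k)) (x u) : Fin (n + 1) → Config p) :=
    measurable_snoc (measurable_eval_pathSpace t) (measurable_apply_pathSpace u)
  have := isFiniteMeasure_withDensity_ofReal hint.2
  have : IsFiniteMeasure (stepLaw z' w' Q t s ((u : ℝ) - s)) :=
    Measure.isFiniteMeasure_map _ _
  refine measure_eq_of_testFun fun ζ => ?_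
  rw [integral_map hx.aemeasurable (testFun ζ).continuous.aestronglyMeasurable,
    hQ.integral_testFun_snoc hp hs hts hu]
  have hψ : Continuous fun Z : Fin p → unitInterval => ∏ i, (ζ (Fin.last n)).eval (Z i : ℝ) :=
    continuous_finsetProd _ fun i _ => (ζ (Fin.last n)).continuous.comp
      (continuous_subtype_val.comp (continuous_apply i))
  have hη := (testFun (p := p) fun k : Fin n => ζ k.castSucc).continuous
  have hc := (hη.comp continuous_fst).mul (hψ.comp continuous_snd)
  obtain ⟨C, hC⟩ := isCompact_univ.exists_bound_of_continuousOn hc.continuousOn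
  rw [← hQ.integral_stepLaw hp t s hd hη.measurable hψ.measurable
    fun a b => hC (a, b) (Set.mem_univ _)]
  refine integral_congr_ae (Eventually.of_forall fun y => ?_)
  simp only [testFun_apply, Fin.prod_univ_castSucc]

lemma IsLimitLaw.integral_mul_eq {hz : (p : ℝ) - 1 < z'} {hw : -1 < w'}
    (hQ : IsLimitLaw hz hw Q) (hp : p = 0 → z' + w' ≠ -1) {n : ℕ} {t : Fin n → ℝ≥0} {s u : ℝ≥0}
    (hs : ∃ k, t k = s) (hts : ∀ k, t k ≤ s) (hu : s < u)
    {η : (Fin n → Config p) → ℝ} {ψ : (Fin p → unitInterval) → ℝ} (hη : Measurable η)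
    (hψ : Measurable ψ) {C : ℝ} (hC : ∀ a b, |η a * ψ b| ≤ C) :
    ∫ x, η (fun k => x (t k)) * ψ (x u).1 ∂Q = ∫ x, η (fun k => x (t k)) *
      (∫ Z, transitionDensity p z' w' ((u : ℝ) - s) (x s).1 Z * ψ Z) ∂Q := by
  have hx : Measurable fun x : PathSpace p =>
      (Fin.snoc (fun k => x (t k)) (x u) : Fin (n + 1) → Config p) :=
    measurable_snoc (measurable_eval_pathSpace t) (measurable_apply_pathSpace u)
  have hF : Measurable fun y : Fin (n + 1) → Config p =>
      η (fun k => y k.castSucc) * ψ (y (Fin.last n)).1 :=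
    measurable_castSucc_mul_last hη hψ
  rw [← hQ.integral_stepLaw hp t s (sub_pos.2 (by exact_mod_cast hu)) hη hψ hC,
    ← hQ.map_snoc hp hs hts hu, integral_map hx.aemeasurable hF.aestronglyMeasurable]
  simp only [Fin.snoc_castSucc, Fin.snoc_last]

/-- The natural filtration of the coordinate process. -/
abbrev pastAlgebra (p : ℕ) (s : ℝ≥0) : MeasurableSpace (PathSpace p) :=
  ⨆ u ∈ Set.Iic s, MeasurableSpace.comap (fun x : PathSpace p => (x u).1) inferInstance

lemma measurable_val_apply (t : ℝ≥0) : Measurable fun x : PathSpace p => (x t).1 :=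
  measurable_subtype_coe.comp (measurable_apply_pathSpace t)

lemma pastAlgebra_le (s : ℝ≥0) :
    pastAlgebra p s ≤ (inferInstance : MeasurableSpace (PathSpace p)) :=
  iSup₂_le fun u _ => (measurable_val_apply u).comap_le

lemma measurable_pastAlgebra (s : ℝ≥0) :
    Measurable[pastAlgebra p s] fun x : PathSpace p => (x s).1 :=
  (comap_measurable _).mono (le_iSup₂_of_le s (Set.mem_Iic.2 le_rfl) le_rfl) le_rfl

theorem IsLimitLaw.isMarkovWithDensity {hz : (p : ℝ) - 1 < z'} {hw : -1 < w'}
    (hQ : IsLimitLaw hz hw Q) (hp : p = 0 → z' + w' ≠ -1) :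
    IsMarkovWithDensity Q (fun t x => (x t).1) (transitionDensity p z' w') := by
  intro s u hu A hA
  have hd : 0 < (u : ℝ) - s := sub_pos.2 (by exact_mod_cast hu)
  set f : PathSpace p → ℝ := ((fun x : PathSpace p => (x u).1) ⁻¹' A).indicator fun _ => 1 with hf
  set g : PathSpace p → ℝ :=
    fun x => ∫ Z in A, transitionDensity p z' w' ((u : ℝ) - s) (x s).1 Z with hg
  have hfi : Integrable f Q := (integrable_const 1).indicator (measurable_val_apply u hA)
  have hgi : Integrable g Q := by
    have h := (hQ.integrable_transitionDensity hp s hd).integrableOn (s := Set.univ ×ˢ A)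
    rw [IntegrableOn, ← Measure.prod_restrict, Measure.restrict_univ] at h
    exact h.integral_prod_left
  have hgm : StronglyMeasurable[pastAlgebra p s] g := by
    have h : StronglyMeasurable fun X : Fin p → unitInterval =>
        ∫ Z in A, transitionDensity p z' w' ((u : ℝ) - s) X Z :=
      (measurable_transitionDensity hz hw hd).stronglyMeasurable.integral_prod_right'
    exact h.comp_measurable (measurable_pastAlgebra s)
  have key : ∀ C, MeasurableSet[pastAlgebra p s] C → ∫ x in C, g x ∂Q = ∫ x in C, f x ∂Q := by
    -- cylinder sets
    have hcyl : ∀ (T : Finset ℝ≥0) (B : ℝ≥0 → Set (Fin p → unitInterval)), (∀ r ∈ T, r ≤ s) →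
        (∀ r ∈ T, MeasurableSet (B r)) →
        ∫ x in {x : PathSpace p | ∀ r ∈ T, (x r).1 ∈ B r}, g x ∂Q =
          ∫ x in {x : PathSpace p | ∀ r ∈ T, (x r).1 ∈ B r}, f x ∂Q := by
      intro T B hT hB
      classical
      set S := insert s T with hS
      set t : Fin S.card → ℝ≥0 := fun k => S.equivFin.symm k with ht
      set D : Set (Fin S.card → Config p) := {y | ∀ k, t k ∈ T → (y k).1 ∈ B (t k)} with hD
      have hDm : MeasurableSet D := by
        have : D = ⋂ k, ⋂ (_ : t k ∈ T), {y | (y k).1 ∈ B (t k)} := by ext y; simp [hD]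
        rw [this]
        exact MeasurableSet.iInter fun k => MeasurableSet.iInter fun hk =>
          (measurable_subtype_coe.comp (measurable_pi_apply k)) (hB _ hk)
      have hsurj : ∀ r ∈ S, ∃ k, t k = r := fun r hr => ⟨S.equivFin ⟨r, hr⟩, by simp [ht]⟩
      have hC : {x : PathSpace p | ∀ r ∈ T, (x r).1 ∈ B r} = (fun x k => x (t k)) ⁻¹' D := by
        ext x
        simp only [hD, Set.mem_ofPred_eq, Set.mem_preimage]
        refine ⟨fun h k hk => h _ hk, fun h r hr => ?_⟩
        obtain ⟨k, rfl⟩ := hsurj r (Finset.mem_insert_of_mem hr)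
        exact h k hr
      have hCm := measurable_eval_pathSpace (p := p) t hDm
      have h := hQ.integral_mul_eq hp (t := t) (hsurj s (Finset.mem_insert_self _ _)) (fun k => by
        rcases Finset.mem_insert.1 (S.equivFin.symm k).2 with h | h
        · exact h.le
        · exact hT _ h) hu (η := D.indicator fun _ => 1) (ψ := A.indicator fun _ => 1)
        (measurable_const.indicator hDm) (measurable_const.indicator hA) (C := 1) (by
          intro a b
          by_cases h1 : a ∈ D <;> by_cases h2 : b ∈ A <;> simp [h1, h2])
      rw [hC, ← integral_indicator hCm, ← integral_indicator hCm]
      refine Eq.trans ?_ (h.symm.trans ?_)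
      · refine integral_congr_ae (Eventually.of_forall fun x => ?_)
        have : ∫ Z, transitionDensity p z' w' ((u : ℝ) - s) (x s).1 Z *
            A.indicator (fun _ => (1 : ℝ)) Z = g x := by
          change _ = ∫ Z in A, _
          rw [← integral_indicator hA]
          refine integral_congr_ae (Eventually.of_forall fun Z => ?_)
          by_cases hZ : Z ∈ A <;> simp [hZ]
        simp only [this]
        by_cases hx : (fun k => x (t k)) ∈ D <;> simp [Set.indicator, hx]
      · refine integral_congr_ae (Eventually.of_forall fun x => ?_)
        by_cases hx : (fun k => x (t k)) ∈ D <;> simp [Set.indicator, hx, hf]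
    have hle := pastAlgebra_le (p := p) s
    have hgen : pastAlgebra p s = MeasurableSpace.generateFrom (piiUnionInter (fun r : ℝ≥0 =>
        {C | MeasurableSet[MeasurableSpace.comap (fun x : PathSpace p => (x r).1) inferInstance] C})
        (Set.Iic s)) := (generateFrom_piiUnionInter_measurableSet _ _).symm
    have hcyl' : ∀ C ∈ piiUnionInter (fun r : ℝ≥0 => {C | MeasurableSet[MeasurableSpace.comap
        (fun x : PathSpace p => (x r).1) inferInstance] C}) (Set.Iic s),
        ∫ x in C, g x ∂Q = ∫ x in C, f x ∂Q := by
      rintro C ⟨T, hT, F, hF, rfl⟩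
      choose! B hB hB2 using hF
      have : (⋂ r ∈ T, F r) = {x : PathSpace p | ∀ r ∈ T, (x r).1 ∈ B r} := by
        ext x
        simp only [Set.mem_iInter, Set.mem_ofPred_eq]
        refine forall₂_congr fun r hr => ?_
        rw [← hB2 r hr]; rfl
      rw [this]
      exact hcyl T B (fun r hr => hT hr) hB
    have huniv : ∫ x, g x ∂Q = ∫ x, f x ∂Q := by
      simpa using hcyl ∅ (fun _ => Set.univ) (by simp) (by simp)
    intro C hC
    induction C, hC using MeasurableSpace.induction_on_inter hgen
      (isPiSystem_piiUnionInter _ (fun r => @MeasurableSpace.isPiSystem_measurableSet _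
        (MeasurableSpace.comap (fun x : PathSpace p => (x r).1) inferInstance)) _) with
    | empty => simp
    | basic C hC => exact hcyl' C hC
    | compl C hC ih =>
      have h1 := integral_add_compl (hle _ hC) hgi
      have h2 := integral_add_compl (hle _ hC) hfi
      linarith
    | iUnion C hdisj hC ih =>
      rw [integral_iUnion (fun k => hle _ (hC k)) hdisj hgi.integrableOn,
        integral_iUnion (fun k => hle _ (hC k)) hdisj hfi.integrableOn]
      exact tsum_congr ih
  exact (ae_eq_condExp_of_forall_setIntegral_eq (pastAlgebra_le s) hfi
    (fun _ _ _ => hgi.integrableOn) (fun C hC _ => key C hC) hgm.aestronglyMeasurable).symm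

end MarkovProperty


/-! ### Convergence to the limit process -/

section Convergence

variable {p : ℕ} {z' w' : ℝ} {Q : Measure (PathSpace p)} [IsProbabilityMeasure Q]

lemma measurable_coordinates {n : ℕ} (t : Fin n → ℝ≥0) :
    Measurable fun (x : PathSpace p) (k : Fin n) => (x (t k)).1 :=
  measurable_pi_lambda _ fun k => measurable_val_apply (t k)

lemma measurable_rescaledProcess {Ω : Type*} [MeasurableSpace Ω] {P : Measure Ω}
    {M : (N : ℕ) → Signature N → ℝ} {N : ℕ} {T : ℕ → Ω → Signature N} (hT : IsUpDownChain P M N T)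
    {n : ℕ} (t : Fin n → ℝ≥0) :
    Measurable fun ω (k : Fin n) => rescaledProcess p N T (t k) ω := by
  refine measurable_pi_lambda _ fun k => ?_
  unfold rescaledProcess
  exact (measurable_of_countable (scaledConfig p)).comp (hT.measurable _)

lemma IsLimitLaw.isStationaryProcess {hz : (p : ℝ) - 1 < z'} {hw : -1 < w'}
    (hQ : IsLimitLaw hz hw Q) (hp : p = 0 → z' + w' ≠ -1) :
    IsStationaryProcess Q fun t (x : PathSpace p) => (x t).1 := by
  intro n t h
  have hm : Measurable fun (y : Fin n → Config p) (k : Fin n) => (y k).1 :=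
    measurable_pi_lambda _ fun k => measurable_subtype_coe.comp (measurable_pi_apply k)
  have h1 := congrArg (Measure.map fun (y : Fin n → Config p) (k : Fin n) => (y k).1)
    (map_eval_add hz hw hp hQ t h)
  rw [Measure.map_map hm (measurable_eval_pathSpace _),
    Measure.map_map hm (measurable_eval_pathSpace _)] at h1
  exact h1

lemma IsLimitLaw.tendstoInDistribution {hz : (p : ℝ) - 1 < z'} {hw : -1 < w'}
    (hQ : IsLimitLaw hz hw Q) (hp : p = 0 → z' + w' ≠ -1) {Ω' : ℕ → Type*}
    [∀ N, MeasurableSpace (Ω' N)] (P' : ∀ N, Measure (Ω' N)) [∀ N, IsProbabilityMeasure (P' N)]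
    (T : ∀ N, ℕ → Ω' N → Signature N)
    (hT : ∀ N, IsUpDownChain (P' N) (zwMeasure p 0 z' w') N (T N)) {n : ℕ} (t : Fin n → ℝ≥0) :
    TendstoInDistribution (fun N ω (k : Fin n) => rescaledProcess p N (T N) (t k) ω) atTop
      (fun (x : PathSpace p) (k : Fin n) => (x (t k)).1) P' Q where
  forall_aemeasurable N := (measurable_rescaledProcess (hT N) t).aemeasurable
  aemeasurable_limit := (measurable_coordinates t).aemeasurable
  tendsto := by
    refine ProbabilityMeasure.tendsto_iff_forall_integral_tendsto.2 fun f => ?_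
    have key := tendsto_integral_continuous hz hw hp hQ P' T hT t
      ⟨fun y => f fun k => (y k).1, f.continuous.comp (continuous_pi fun k =>
        continuous_subtype_val.comp (continuous_apply k))⟩
    simp only [ContinuousMap.coe_mk] at key
    simp only [ProbabilityMeasure.coe_mk]
    rw [integral_map (measurable_coordinates t).aemeasurable f.continuous.aestronglyMeasurable]
    refine key.congr fun N => ?_
    rw [integral_map (measurable_rescaledProcess (hT N) t).aemeasurable
      f.continuous.aestronglyMeasurable]
    refine integral_congr_ae ?_
    filter_upwards [(hT N).ae_isBoxed] with ω hω
    congr 1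
    funext k
    exact toConfig_val (hω _)

end Convergence

end GelfandTsetlin

end

theorem mainTheorem1 (p : ℕ) (z' w' : ℝ) (hz : (p : ℝ) - 1 < z') (hw : -1 < w')
    (hp : p = 0 → z' + w' ≠ -1) :
    -- the measures form a coherent system, and its up-down chains exist on every level
    IsCoherentSystem (zwMeasure p 0 z' w') ∧
    (∀ N : ℕ, ∃ (Ω : Type) (_ : MeasurableSpace Ω) (P : Measure Ω) (_ : IsProbabilityMeasure P)
      (T : ℕ → Ω → Signature N), IsUpDownChain P (zwMeasure p 0 z' w') N T) ∧
    -- the kernel series converges, and the transition density is a probability density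
    (∀ t : ℝ, 0 < t → ∀ x ∈ Set.Ioo (0 : ℝ) 1, ∀ y ∈ Set.Ioo (0 : ℝ) 1,
      Summable (jacobiKernelTerm p z' w' t x y)) ∧
    (∀ t : ℝ, 0 < t → ∀ X ∈ openChamber p,
      (∀ Y ∈ openChamber p, 0 ≤ transitionDensity p z' w' t X Y) ∧
      Integrable (transitionDensity p z' w' t X) ∧
      ∫ Y, transitionDensity p z' w' t X Y = 1) ∧
    -- the limit process
    ∃ (Ω : Type) (_ : MeasurableSpace Ω) (P : Measure Ω) (_ : IsProbabilityMeasure P)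
      (J : ℝ≥0 → Ω → Fin p → unitInterval),
      (∀ t, Measurable (J t)) ∧
      IsStationaryProcess P J ∧
      P.map (J 0) = volume.withDensity (fun X => ENNReal.ofReal (ensembleDensity p z' w' X)) ∧
      IsMarkovWithDensity P J (transitionDensity p z' w') ∧
      -- convergence of finite-dimensional distributions
      ∀ (Ω' : ℕ → Type*) [∀ N, MeasurableSpace (Ω' N)] (P' : ∀ N, Measure (Ω' N))
        [∀ N, IsProbabilityMeasure (P' N)] (T : ∀ N, ℕ → Ω' N → Signature N),
        (∀ N, IsUpDownChain (P' N) (zwMeasure p 0 z' w') N (T N)) →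
        ∀ (n : ℕ) (t : Fin n → ℝ≥0),
          TendstoInDistribution
            (fun N ω (k : Fin n) => rescaledProcess p N (T N) (t k) ω) atTop
            (fun ω (k : Fin n) => J (t k) ω) P' P := by
  obtain ⟨Q, hQ1, hQ⟩ := exists_limit_law hz hw hp
  replace hQ : IsLimitLaw hz hw Q := hQ
  refine ⟨isCoherentSystem_zwMeasure hz hw hp, exists_isUpDownChain hz hw hp,
    fun t ht x hx y hy => summable_jacobiKernelTerm hz hw ht (Set.Ioo_subset_Icc_self hx)
      (Set.Ioo_subset_Icc_self hy),
    fun t ht X hX => ⟨fun Y hY => transitionDensity_nonneg hz hw hp ht hX hY,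
      integrable_transitionDensity hz hw ht hX, integral_transitionDensity hz hw ht hX⟩,
    PathSpace p, inferInstance, Q, hQ1, fun t x => (x t).1, measurable_val_apply,
    hQ.isStationaryProcess hp, hQ.map_eval hp 0, hQ.isMarkovWithDensity hp, ?_⟩
  intro Ω' _ P' _ T hT n t
  exact hQ.tendstoInDistribution hp P' T hT t
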